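/- **Setting.** Let $n\geq 0$ and let $m=2d$ be even, let $\Theta=-\Theta^{T}\in\mathbb R^{n\times n}$ be nonsingular, $K=K^{T}\in\mathbb R^{n\times n}$, $M\in\mathbb R^{m\times n}$, $J=\begin{bmatrix}0&I_{d}\\-I_{d}&0\end{bmatrix}$, and put $A=2\Theta(K+M^{T}JM)$, $B=2\Theta M^{T}$. An open quantum harmonic oscillator (OQHO) has the space $\mathfrak H=\mathfrak H_0\otimes\mathfrak F$, where $\mathfrak F$ is the symmetric Fock space over $L^2(\mathbb R_+)\otimes\mathbb C^{d}$ which carries $m$ quantum Wiener processes $W=(W_1,\dots,W_m)^T$ with $dW\,dW^{T}=(I_m+iJ)\,dt$ in the vacuum state, and $\mathfrak H_0$ is a Hilbert space with self-adjoint initial variables $X_1(0),\dots,X_n(0)$ satisfying the Weyl form of the CCRs $[X(0),X(0)^{T}]=2i\Theta$ (with a strongly continuous Weyl representation). The system variables solve $dX=AX\,dt+B\,dW$, that is, $X(t)=e^{tA}X(0)+\int_0^te^{(t-s)A}B\,dW(s)$, and they satisfy $[X(s),X(t)^{T}]=2i\Lambda(s-t)$, with $\Lambda(\tau)=e^{\tau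 A}\Theta$ for $\tau\geq0$ and $\Lambda(\tau)=\Theta e^{-\tau A^{T}}$ for $\tau<0$. Let $\Pi\succcurlyeq0$ be a real symmetric matrix of order $n$, $\theta\geq0$, $\psi(t)=X(t)^{T}\Pi X(t)$, and let $\varphi(t)=\int_0^t\psi(s)\,ds\succcurlyeq 0$ be the self-adjoint operator associated with the closed quadratic form $v\mapsto\int_0^t\|\sqrt\Pi X(s)v\|^2ds$. Put $S_\theta(t)=e^{\frac\theta2\varphi(t)}$ and $$\Psi_\theta(t)=\psi(t)+\frac\theta2\Big(\mathrm{Re}\Big(X(t)^{T}\int_0^t\alpha_{\theta,t}(\sigma)X(\sigma)\,d\sigma\Big)+\int_{[0,t]^2}X(\sigma)^{T}\beta_{\theta,t}(\sigma,\tau)X(\tau)\,d\sigma\, d\tau\Big),\qquad \mathrm{Re}\,\xi=\tfrac12(\xi+\xi^\dagger),$$ where, with $L_1(s,\sigma)=\Lambda(s-\sigma)\Pi$ and $L_{k+1}(s,\sigma)=\int_0^tL_1(s,r)L_k(r,\sigma)\,dr$, $$\alpha_{\theta,t}(\sigma)=8\sum_{k\geq1}\frac{(-1)^k(2\theta)^{2k-1}}{(2k+1)!}\,\Pi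 L_{2k}(t,\sigma),\qquad \beta_{\theta,t}(\sigma,\tau)=4\sum_{k\geq1}\frac{(-1)^k(2\theta)^{2k-1}}{(2k+1)!}\sum_{j=1}^{2k-1}\binom{2k}{j}L_j(t,\sigma)^{T}\Pi L_{2k-j}(t,\tau)$$ (so that $\Psi_\theta(t)=\sum_{k\geq0}\frac{(\theta/2)^{2k}}{(2k+1)!}\,\mathrm{ad}_{\varphi(t)}^{2k}\psi(t)$). Let $R_\theta$ be the time-ordered exponential of a process $C$, that is, the fundamental solution of $\dot R_\theta(t)=\frac\theta2C(t)R_\theta(t)$, $R_\theta(0)=I$. For unbounded operators this means: the operators $R_\theta(t)$, $t\geq0$, are densely defined with bounded everywhere defined inverses, and the equation holds in the form $\frac{d}{dt}\big(R_\theta(t)^{-\dagger}x\big)=-\frac\theta2C(t)R_\theta(t)^{-\dagger}x$ for all $x$ in the dense set of the vectors with finitely many nonzero components in the occupation number representation of $\mathfrak F$ (with respect to an orthonormal basis of $L^2(\mathbb R_+)$), each of them a smooth vector of the Weyl representation on $\mathfrak H_0$. **Theorem.** Put $V_\theta(t)=R_\theta(t)S_\theta(t)^{-1}$, and suppose that,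 for all $t\geq0$, $V_\theta(t)$ is densely defined (so that $V_\theta(t)^\dagger$ exists) and $$C(t)=V_\theta(t)\Psi_\theta(t)V_\theta(t)^{\dagger}.$$ Then, for every density operator $\rho$ on $\mathfrak H$ (in particular, for $\rho=\rho_0\otimes\upsilon$ with an initial system state $\rho_0$ and the vacuum field state $\upsilon$), with $\mathbf E\,\xi=\mathrm{Tr}(\rho\,\xi)\in[0,+\infty]$ for positive semi-definite self-adjoint $\xi$, the original quantum risk-sensitive cost and the quadratic-exponential functional coincide: $$E_\theta(t):=\mathbf E\big(R_\theta(t)^\dagger R_\theta(t)\big)=\Xi_\theta(t):=\mathbf E\,e^{\theta\varphi(t)}\qquad\text{for all }t\geq0,$$ and the operator $V_\theta(t)$ is unitary for all $t\geq0$. -/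

import Mathlib

open MeasureTheory Filter Topology
open scoped ENNReal InnerProductSpace ContDiff

noncomputable section

/-! ### Unbounded operators on a Hilbert space -/

section Operators

variable {H : Type*} [NormedAddCommGroup H] [InnerProductSpace ℂ H]

/-- The value of a partially defined operator, extended by `0` outside of its domain. -/
def opApply (A : H →ₗ.[ℂ] H) (v : H) : H :=
  open Classical in if h : v ∈ A.domain then A ⟨v, h⟩ else 0

theorem opApply_of_mem (A : H →ₗ.[ℂ] H) {v : H} (h : v ∈ A.domain) :
    opApply A v = A ⟨v, h⟩ := by
  unfold opApply
  rw [dif_pos h]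

theorem opApply_add (A : H →ₗ.[ℂ] H) {v w : H} (hv : v ∈ A.domain) (hw : w ∈ A.domain) :
    opApply A (v + w) = opApply A v + opApply A w := by
  rw [opApply_of_mem A hv, opApply_of_mem A hw, opApply_of_mem A (A.domain.add_mem hv hw),
    ← A.map_add]
  rfl

theorem opApply_smul (A : H →ₗ.[ℂ] H) (c : ℂ) {v : H} (hv : v ∈ A.domain) :
    opApply A (c • v) = c • opApply A v := by
  rw [opApply_of_mem A hv, opApply_of_mem A (A.domain.smul_mem c hv), ← A.map_smul]
  rfl

theorem opApply_zero (A : H →ₗ.[ℂ] H) : opApply A 0 = 0 := by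
  rw [opApply_of_mem A A.domain.zero_mem]
  exact A.map_zero

/-- The product `A B` of unbounded operators on its natural domain
`{v ∈ dom B | B v ∈ dom A}`. -/
def opMul (A B : H →ₗ.[ℂ] H) : H →ₗ.[ℂ] H where
  domain :=
    { carrier := {v | v ∈ B.domain ∧ opApply B v ∈ A.domain}
      zero_mem' := ⟨B.domain.zero_mem, by rw [opApply_zero]; exact A.domain.zero_mem⟩
      add_mem' := fun {v w} hv hw => ⟨B.domain.add_mem hv.1 hw.1, by
        rw [opApply_add B hv.1 hw.1]; exact A.domain.add_mem hv.2 hw.2⟩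
      smul_mem' := fun c v hv => ⟨B.domain.smul_mem c hv.1, by
        rw [opApply_smul B c hv.1]; exact A.domain.smul_mem c hv.2⟩ }
  toFun :=
    { toFun := fun v => opApply A (opApply B v)
      map_add' := fun v w => by
        rw [Submodule.coe_add, opApply_add B v.2.1 w.2.1, opApply_add A v.2.2 w.2.2]
      map_smul' := fun c v => by
        rw [Submodule.coe_smul, opApply_smul B c v.2.1, opApply_smul A c v.2.2]
        rfl }

/-- A bounded everywhere defined operator, viewed as a partially defined one. -/
def opBdd (T : H →L[ℂ] H) : H →ₗ.[ℂ] H := T.toLinearMap.toPMap ⊤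

/-- `A` has the bounded everywhere defined operator `Q` as its inverse. -/
def IsBddInverse (A : H →ₗ.[ℂ] H) (Q : H →L[ℂ] H) : Prop :=
  (∀ x : H, ∃ h : Q x ∈ A.domain, A ⟨Q x, h⟩ = x) ∧ ∀ u : A.domain, Q (A u) = u

/-- An operator is unitary: everywhere defined, and given by a unitary element of `B(H)`. -/
def IsUnitaryOp [CompleteSpace H] (A : H →ₗ.[ℂ] H) : Prop :=
  ∃ U ∈ unitary (H →L[ℂ] H), A = opBdd U

/-- The trace, in `[0, ∞]`, of a positive semi-definite bounded operator: the supremum of the sums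
of diagonal elements over finite orthonormal families. -/
def opTrace (T : H →L[ℂ] H) : ℝ≥0∞ :=
  ⨆ (s : Finset H) (_ : Orthonormal ℂ (fun e : s => (e : H))),
    ∑ e ∈ s, ENNReal.ofReal (⟪e, T e⟫_ℂ).re

/-- Density operators: positive semi-definite, with unit trace. -/
def IsDensityOp [CompleteSpace H] (ρ : H →L[ℂ] H) : Prop :=
  ρ.IsPositive ∧ opTrace ρ = 1

/-- The closed quadratic form `u ↦ ‖√A u‖² ∈ [0, ∞]` of an (unbounded) positive semi-definite
self-adjoint operator `A`, as the lower semicontinuous envelope of `u ↦ ⟪u, A u⟫` on `dom A`. -/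
def opForm (A : H →ₗ.[ℂ] H) (u : H) : ℝ≥0∞ :=
  liminf (fun v : A.domain => ENNReal.ofReal (⟪(v : H), A v⟫_ℂ).re)
    (comap (fun v : A.domain => (v : H)) (𝓝 u))

/-- The quantum expectation `Tr (ρ A) = Tr (√ρ A √ρ) ∈ [0, ∞]` of an (unbounded) positive
semi-definite self-adjoint operator `A` over a density operator `ρ`. -/
def expectation [CompleteSpace H] (ρ : H →L[ℂ] H) (A : H →ₗ.[ℂ] H) : ℝ≥0∞ :=
  ⨆ (s : Finset H) (_ : Orthonormal ℂ (fun e : s => (e : H))),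
    ∑ e ∈ s, opForm A (cfc Real.sqrt ρ e)

/-- For a densely defined closed operator `Z` from `H` to a Hilbert space `E` with the graph `Γ`,
this is the resolvent `(I + Z†Z)⁻¹` of the positive semi-definite self-adjoint operator `Z†Z`:
the vector `(I + Z†Z)⁻¹ w` is the first component of the orthogonal projection of `(w, 0)`
on `Γ`. -/
def graphResolvent {E : Type*} [NormedAddCommGroup E] [InnerProductSpace ℂ E]
    (Γ : Submodule ℂ (WithLp 2 (H × E))) [Γ.HasOrthogonalProjection] : H →L[ℂ] H :=
  ((WithLp.fstL 2 ℂ H E) ∘L Γ.starProjection) ∘L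
    ((WithLp.prodContinuousLinearEquiv 2 ℂ H E).symm.toContinuousLinearMap ∘L
      ContinuousLinearMap.inl ℂ H E)

/-- The bounded operator `e^{-cA}`, `c ≥ 0`, for a positive semi-definite self-adjoint operator
`A` with the resolvent `G = (I + A)⁻¹`: since `A = G⁻¹ - I`, it is `f(G)` with
`f(x) = exp (-c (1/x - 1))` for `x > 0`, and `f(0) = 0` if `c > 0`. -/
def expNegOfResolvent [CompleteSpace H] (c : ℝ) (G : H →L[ℂ] H) : H →L[ℂ] H :=
  cfc (fun x : ℝ => if c = 0 then 1 else if x ≤ 0 then 0 else Real.exp (-c * (1 / x - 1))) G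

/-- `R` is the fundamental solution (the leftward time-ordered exponential) of
`dR/dt = (θ/2) C R`, `R(0) = I`, for a time-dependent, in general unbounded, operator `C`.
The operators `R(t)` are densely defined with bounded inverses `Q(t)`, and the equation is imposed
in the equivalent form `d(R⁻†)/dt = -(θ/2) C R⁻†` for the bounded operators `R(t)⁻† = Q(t)†`,
strongly on a given set `D` of vectors (in general, the domains of the unbounded operators `R(t)`
have no common nonzero vector). -/
structure IsTimeOrderedExp [CompleteSpace H] (D : Set H) (θ : ℝ) (C R : ℝ → (H →ₗ.[ℂ] H)) :
    Prop where
  initial : R 0 = opBdd (ContinuousLinearMap.id ℂ H)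
  dense_domain : ∀ t : ℝ, 0 ≤ t → Dense ((R t).domain : Set H)
  evolution : ∃ Q : ℝ → (H →L[ℂ] H), (∀ t : ℝ, 0 ≤ t → IsBddInverse (R t) (Q t)) ∧
    ∀ x ∈ D, ∀ t : ℝ, 0 ≤ t → ∃ h : ContinuousLinearMap.adjoint (Q t) x ∈ (C t).domain,
      HasDerivWithinAt (fun s : ℝ => ContinuousLinearMap.adjoint (Q s) x)
        (-((θ / 2 : ℝ) : ℂ) • (C t) ⟨ContinuousLinearMap.adjoint (Q t) x, h⟩) (Set.Ici 0) t

end Operators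

/-! ### Open quantum harmonic oscillators -/

/-- The real Hilbert space `L²(ℝ₊)`. -/
abbrev HalfLineL2 : Type := Lp ℝ 2 (volume.restrict (Set.Ici (0 : ℝ)))

/-- The matrix `J` of order `m = 2 d`. -/
def matJ (d : ℕ) : Matrix (Fin d ⊕ Fin d) (Fin d ⊕ Fin d) ℝ :=
  Matrix.fromBlocks 0 1 (-1) 0

/-- An open quantum harmonic oscillator with `n` system variables and `m = 2 d` quantum Wiener
processes: the CCR matrix `Θ`, the energy matrix `K`, the system-field coupling matrix `M`, a
strongly continuous Weyl representation `u ↦ exp (i uᵀ X(0))` of the CCRs `[X, Xᵀ] = 2iΘ` on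
the initial system space `H₀`, and an orthonormal basis of `L²(ℝ₊)` used for representing
the symmetric Fock space over `L²(ℝ₊) ⊗ ℂ^d` by occupation numbers. -/
structure OQHO (n d : ℕ) (ι : Type*) (H₀ : Type*) [NormedAddCommGroup H₀]
    [InnerProductSpace ℂ H₀] where
  Θ : Matrix (Fin n) (Fin n) ℝ
  K : Matrix (Fin n) (Fin n) ℝ
  M : Matrix (Fin d ⊕ Fin d) (Fin n) ℝ
  antisymm : Θ.transpose = -Θ
  nonsing : IsUnit Θ.det
  symm : K.IsSymm
  weyl : (Fin n → ℝ) → (H₀ ≃ₗᵢ[ℂ] H₀)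
  weyl_rel : ∀ (u v : Fin n → ℝ) (x : H₀),
    weyl u (weyl v x) = Complex.exp (-(Complex.I * ((u ⬝ᵥ Θ.mulVec v : ℝ) : ℂ))) • weyl (u + v) x
  weyl_cont : ∀ x : H₀, Continuous fun u : Fin n → ℝ => weyl u x
  basis : HilbertBasis ι ℝ HalfLineL2

/-- The modes of the field: channel and basis function. -/
abbrev FieldMode (d : ℕ) (ι : Type*) : Type _ := Fin d × ι

/-- The system-field space `H₀ ⊗ F`, where `F = ℓ²(occupation numbers)` is the symmetric Fock
space, realised as the space of square summable `H₀`-valued functions of the occupation numbers. -/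
abbrev SystemField (d : ℕ) (ι : Type*) (H₀ : Type*) [NormedAddCommGroup H₀] : Type _ :=
  lp (fun _ : FieldMode d ι →₀ ℕ => H₀) 2

namespace OQHO

variable {n d : ℕ} {ι : Type*} {H₀ : Type*} [NormedAddCommGroup H₀] [InnerProductSpace ℂ H₀]
variable (O : OQHO n d ι H₀)

/-- The drift matrix `A = 2Θ(K + MᵀJM)` of the QSDE `dX = A X dt + B dW`. -/
def A : Matrix (Fin n) (Fin n) ℝ := (2 : ℝ) • (O.Θ * (O.K + O.M.transpose * matJ d * O.M))

/-- The matrix `B = 2ΘMᵀ` of the QSDE `dX = A X dt + B dW`. -/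
def B : Matrix (Fin n) (Fin d ⊕ Fin d) ℝ := (2 : ℝ) • (O.Θ * O.M.transpose)

/-- The two-point CCR matrix: `[X(s), X(t)ᵀ] = 2i Λ(s - t)`. -/
def Lam (τ : ℝ) : Matrix (Fin n) (Fin n) ℝ :=
  if 0 ≤ τ then NormedSpace.exp (τ • O.A) * O.Θ
  else O.Θ * NormedSpace.exp ((-τ) • O.A.transpose)

/-- The graph of the self-adjoint operator `uᵀX(0) ⊗ I + I ⊗ (a(c) + a†(c))` on `H₀ ⊗ F`.
Here `uᵀX(0)` is the Stone generator of `τ ↦ exp (i τ uᵀ X(0))`, and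
`a(c) = ∑ κ, conj (c κ) a_κ`, `a†(c) = ∑ κ, c κ a_κ†` in terms of the annihilation and creation
operators `(a_κ v)(N) = √(N κ + 1) v(N + e_κ)`, `(a_κ† v)(N) = √(N κ) v(N - e_κ)`. -/
def fieldGraph (u : Fin n → ℝ) (c : FieldMode d ι → ℂ) :
    Submodule ℂ (SystemField d ι H₀ × SystemField d ι H₀) where
  carrier := {p | ∀ N : FieldMode d ι →₀ ℕ, ∃ x y : H₀,
    HasDerivAt (fun τ : ℝ => O.weyl (τ • u) (p.1 N)) (Complex.I • x) 0 ∧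
    HasSum (fun κ => (starRingEnd ℂ (c κ) * ((√((N κ : ℝ) + 1) : ℝ) : ℂ)) •
      p.1 (N + Finsupp.single κ 1)) y ∧
    p.2 N = x + y + ∑ κ ∈ N.support,
      (c κ * ((√(N κ : ℝ) : ℝ) : ℂ)) • p.1 (N - Finsupp.single κ 1)}
  zero_mem' := fun N => ⟨0, 0, by simpa using hasDerivAt_const (0 : ℝ) (0 : H₀), by
    simp, by simp⟩
  add_mem' := fun {p q} hp hq N => by
    obtain ⟨x, y, h1, h2, h3⟩ := hp N
    obtain ⟨x', y', h1', h2', h3'⟩ := hq N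
    refine ⟨x + x', y + y', ?_, ?_, ?_⟩
    · rw [smul_add]
      exact (h1.add h1').congr_of_eventuallyEq (Eventually.of_forall fun τ => by simp)
    · simpa [smul_add] using h2.add h2'
    · simp only [Prod.fst_add, Prod.snd_add, lp.coeFn_add, Pi.add_apply, h3, h3', smul_add,
        Finset.sum_add_distrib]
      abel
  smul_mem' := fun a p hp N => by
    obtain ⟨x, y, h1, h2, h3⟩ := hp N
    refine ⟨a • x, a • y, ?_, ?_, ?_⟩
    · rw [smul_comm Complex.I a]
      exact (h1.const_smul a).congr_of_eventuallyEq (Eventually.of_forall fun τ => by simp)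
    · simpa [smul_comm a] using h2.const_smul a
    · simp only [Prod.smul_fst, Prod.smul_snd, lp.coeFn_smul, Pi.smul_apply, h3, smul_add,
        Finset.smul_sum, smul_comm a]

theorem fieldGraph_functional (u : Fin n → ℝ) (c : FieldMode d ι → ℂ) :
    ∀ p ∈ O.fieldGraph u c, p.1 = 0 → p.2 = 0 := by
  rintro ⟨v, w⟩ hp (rfl : v = 0)
  ext N
  obtain ⟨x, y, h1, h2, h3⟩ := hp N
  have hx : Complex.I • x = 0 := h1.unique (by simpa using hasDerivAt_const (0 : ℝ) (0 : H₀))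
  have hy : y = 0 := h2.unique (by simp)
  have hx' : x = 0 := by simpa using hx
  simpa [hx', hy] using h3

/-- The self-adjoint operator `uᵀX(0) ⊗ I + I ⊗ (a(c) + a†(c))`. -/
def field (u : Fin n → ℝ) (c : FieldMode d ι → ℂ) :
    SystemField d ι H₀ →ₗ.[ℂ] SystemField d ι H₀ :=
  (O.fieldGraph u c).toLinearPMap

/-- The coefficients `c` with `∑ j, ∫₀ᵗ f_j(s) dW_j(s) = a(c) + a†(c)`, where the quantum Wiener
processes of channel `j` are `W_j = a_j + a_j†` and `W_{j+d} = (a_j - a_j†)/i`,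
so that `dW dWᵀ = (I + iJ) dt` in the vacuum state. -/
def fieldCoeff (t : ℝ) (f : ℝ → Fin d ⊕ Fin d → ℝ) (κ : FieldMode d ι) : ℂ :=
  ((∫ s in (0 : ℝ)..t, f s (Sum.inl κ.1) * O.basis κ.2 s : ℝ) : ℂ) +
    Complex.I * ((∫ s in (0 : ℝ)..t, f s (Sum.inr κ.1) * O.basis κ.2 s : ℝ) : ℂ)

/-- The system variables `X_k(t)`: the solution
`X(t) = e^{tA} X(0) + ∫₀ᵗ e^{(t-s)A} B dW(s)` of the QSDE `dX = A X dt + B dW`. -/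
def X (k : Fin n) (t : ℝ) : SystemField d ι H₀ →ₗ.[ℂ] SystemField d ι H₀ :=
  O.field (NormedSpace.exp (t • O.A) k)
    (O.fieldCoeff t fun s => (NormedSpace.exp ((t - s) • O.A) * O.B) k)

/-- The domain of nice vectors: finitely many occupation numbers are present, and the values are
smooth vectors of the Weyl representation on `H₀`. -/
def core : Set (SystemField d ι H₀) :=
  {v | (Function.support fun N => v N).Finite ∧
    ∀ N, ContDiff ℝ ∞ fun u : Fin n → ℝ => O.weyl u (v N)}

/-- The graph of the operator `v ↦ ζ(·) v`, `ζ = √Π X`, from the core to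
`L²([0, t]; (H₀ ⊗ F)ⁿ)`. -/
def zetaGraph (P : Matrix (Fin n) (Fin n) ℝ) (t : ℝ) :
    Submodule ℂ (WithLp 2 (SystemField d ι H₀ ×
      Lp (PiLp 2 fun _ : Fin n => SystemField d ι H₀) 2 (volume.restrict (Set.Icc 0 t)))) :=
  Submodule.span ℂ {p | p.fst ∈ O.core ∧
    ∀ k, ∀ᵐ s ∂(volume.restrict (Set.Icc 0 t)),
      (p.snd s) k = ∑ l, ((cfc Real.sqrt P k l : ℝ) : ℂ) • opApply (O.X l s) p.fst}

/-- The iterated kernels of the commutator with `φ(t)`: with `ad ξ = [φ(t), ξ]`,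
`adᵏ X(s) = (-4i)ᵏ ∫₀ᵗ L_k(s, σ) X(σ) dσ`, `k ≥ 1`, where `L_1(s, σ) = Λ(s - σ) Π` and
`L_{k+1}(s, σ) = ∫₀ᵗ L_1(s, r) L_k(r, σ) dr`. The value at index `k` below is `L_{k+1}`. -/
def adKernel (P : Matrix (Fin n) (Fin n) ℝ) (t : ℝ) : ℕ → ℝ → ℝ → Matrix (Fin n) (Fin n) ℝ
  | 0 => fun s σ => O.Lam (s - σ) * P
  | k + 1 => fun s σ => Matrix.of fun a b =>
      ∫ r in (0 : ℝ)..t, ((O.Lam (s - r) * P) * adKernel P t k r σ) a b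

/-- The function `α_{θ,t}`, from the terms of
`Ψ_θ(t) = sinhc ((θ/2) ad) ψ(t) = ∑ k, (θ/2)^{2k} / (2k+1)! ad^{2k} ψ(t)` where all the
commutators fall on one factor of `ψ(t) = X(t)ᵀ Π X(t)`. -/
def alpha (P : Matrix (Fin n) (Fin n) ℝ) (θ t σ : ℝ) : Matrix (Fin n) (Fin n) ℝ :=
  (8 : ℝ) • ∑' k : ℕ, ((-1) ^ (k + 1) * (2 * θ) ^ (2 * k + 1) / (Nat.factorial (2 * k + 3)) : ℝ) •
    (P * O.adKernel P t (2 * k + 1) t σ)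

/-- The function `β_{θ,t}`, from the terms of `sinhc ((θ/2) ad) ψ(t)` where the commutators fall
on both factors of `ψ(t) = X(t)ᵀ Π X(t)`. -/
def beta (P : Matrix (Fin n) (Fin n) ℝ) (θ t σ τ : ℝ) : Matrix (Fin n) (Fin n) ℝ :=
  (4 : ℝ) • ∑' k : ℕ, ((-1) ^ (k + 1) * (2 * θ) ^ (2 * k + 1) / (Nat.factorial (2 * k + 3)) : ℝ) •
    ∑ j ∈ Finset.range (2 * k + 1), (Nat.choose (2 * k + 2) (j + 1) : ℝ) •
      ((O.adKernel P t j t σ).transpose * P * O.adKernel P t (2 * k - j) t τ)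

/-- The product `X_j(σ) X_k(τ)`. -/
def XX (j k : Fin n) (σ τ : ℝ) : SystemField d ι H₀ →ₗ.[ℂ] SystemField d ι H₀ :=
  opMul (O.X j σ) (O.X k τ)

/-- The integrand of `Re (X(t)ᵀ ∫₀ᵗ α(σ) X(σ) dσ)`, with `Re ξ = (ξ + ξ†)/2`. -/
def alphaTerm (P : Matrix (Fin n) (Fin n) ℝ) (θ t : ℝ) (j k : Fin n) (v : SystemField d ι H₀)
    (σ : ℝ) : SystemField d ι H₀ :=
  ((O.alpha P θ t σ j k / 2 : ℝ) : ℂ) •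
    (opApply (O.XX j k t σ) v + opApply (O.XX k j σ t) v)

/-- The integrand of `∫∫ X(σ)ᵀ β(σ, τ) X(τ) dσ dτ`. -/
def betaTerm (P : Matrix (Fin n) (Fin n) ℝ) (θ t : ℝ) (j k : Fin n) (v : SystemField d ι H₀)
    (p : ℝ × ℝ) : SystemField d ι H₀ :=
  ((O.beta P θ t p.1 p.2 j k : ℝ) : ℂ) • opApply (O.XX j k p.1 p.2) v

/-- The vectors to which all the products `X_j(σ) X_k(τ)`, `σ, τ ∈ [0, t]`, are applicable. -/
def quadDomain (t : ℝ) : Submodule ℂ (SystemField d ι H₀) :=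
  ⨅ (j : Fin n) (k : Fin n) (σ : Set.uIcc (0 : ℝ) t) (τ : Set.uIcc (0 : ℝ) t),
    (O.XX j k σ τ).domain

theorem mem_quadDomain {t : ℝ} {v : SystemField d ι H₀} (hv : v ∈ O.quadDomain t) (j k : Fin n)
    {σ τ : ℝ} (hσ : σ ∈ Set.uIcc 0 t) (hτ : τ ∈ Set.uIcc 0 t) : v ∈ (O.XX j k σ τ).domain := by
  simp only [quadDomain, Submodule.mem_iInf] at hv
  exact hv j k ⟨σ, hσ⟩ ⟨τ, hτ⟩

theorem alphaTerm_add (P : Matrix (Fin n) (Fin n) ℝ) (θ : ℝ) {t : ℝ} (j k : Fin n)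
    {v w : SystemField d ι H₀} (hv : v ∈ O.quadDomain t) (hw : w ∈ O.quadDomain t) {σ : ℝ}
    (hσ : σ ∈ Set.Icc 0 t) :
    O.alphaTerm P θ t j k (v + w) σ = O.alphaTerm P θ t j k v σ + O.alphaTerm P θ t j k w σ := by
  have h : t ∈ Set.uIcc 0 t := Set.right_mem_uIcc
  replace hσ := Set.Icc_subset_uIcc hσ
  unfold alphaTerm
  rw [opApply_add _ (O.mem_quadDomain hv j k h hσ) (O.mem_quadDomain hw j k h hσ),
    opApply_add _ (O.mem_quadDomain hv k j hσ h) (O.mem_quadDomain hw k j hσ h)]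
  module

theorem alphaTerm_smul (P : Matrix (Fin n) (Fin n) ℝ) (θ : ℝ) {t : ℝ} (j k : Fin n)
    (c : ℂ) {v : SystemField d ι H₀} (hv : v ∈ O.quadDomain t) {σ : ℝ} (hσ : σ ∈ Set.Icc 0 t) :
    O.alphaTerm P θ t j k (c • v) σ = c • O.alphaTerm P θ t j k v σ := by
  have h : t ∈ Set.uIcc 0 t := Set.right_mem_uIcc
  replace hσ := Set.Icc_subset_uIcc hσ
  unfold alphaTerm
  rw [opApply_smul _ c (O.mem_quadDomain hv j k h hσ),
    opApply_smul _ c (O.mem_quadDomain hv k j hσ h)]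
  module

theorem betaTerm_add (P : Matrix (Fin n) (Fin n) ℝ) (θ : ℝ) {t : ℝ} (j k : Fin n)
    {v w : SystemField d ι H₀} (hv : v ∈ O.quadDomain t) (hw : w ∈ O.quadDomain t) {p : ℝ × ℝ}
    (hp : p ∈ Set.Icc 0 t ×ˢ Set.Icc 0 t) :
    O.betaTerm P θ t j k (v + w) p = O.betaTerm P θ t j k v p + O.betaTerm P θ t j k w p := by
  unfold betaTerm
  rw [opApply_add _ (O.mem_quadDomain hv j k (Set.Icc_subset_uIcc hp.1)
    (Set.Icc_subset_uIcc hp.2)) (O.mem_quadDomain hw j k (Set.Icc_subset_uIcc hp.1)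
    (Set.Icc_subset_uIcc hp.2))]
  module

theorem betaTerm_smul (P : Matrix (Fin n) (Fin n) ℝ) (θ : ℝ) {t : ℝ} (j k : Fin n)
    (c : ℂ) {v : SystemField d ι H₀} (hv : v ∈ O.quadDomain t) {p : ℝ × ℝ}
    (hp : p ∈ Set.Icc 0 t ×ˢ Set.Icc 0 t) :
    O.betaTerm P θ t j k (c • v) p = c • O.betaTerm P θ t j k v p := by
  unfold betaTerm
  rw [opApply_smul _ c (O.mem_quadDomain hv j k (Set.Icc_subset_uIcc hp.1)
    (Set.Icc_subset_uIcc hp.2))]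
  module

/-- The graph of `Ψ_θ(t)`, with the integrals understood in the strong (Bochner) sense, on
the domain of the vectors for which they make sense. -/
def PsiGraph (P : Matrix (Fin n) (Fin n) ℝ) (θ t : ℝ) :
    Submodule ℂ (SystemField d ι H₀ × SystemField d ι H₀) where
  carrier := {p | p.1 ∈ O.quadDomain t ∧
    (∀ j k, IntegrableOn (O.alphaTerm P θ t j k p.1) (Set.Icc 0 t)) ∧
    (∀ j k, IntegrableOn (O.betaTerm P θ t j k p.1) (Set.Icc 0 t ×ˢ Set.Icc 0 t)) ∧
    p.2 = (∑ j, ∑ k, ((P j k : ℝ) : ℂ) • opApply (O.XX j k t t) p.1) +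
      ((θ / 2 : ℝ) : ℂ) • ((∑ j, ∑ k, (∫ σ in Set.Icc 0 t, O.alphaTerm P θ t j k p.1 σ)) +
        ∑ j, ∑ k, (∫ q in Set.Icc 0 t ×ˢ Set.Icc 0 t, O.betaTerm P θ t j k p.1 q))}
  zero_mem' := by
    have ha : ∀ j k, O.alphaTerm P θ t j k 0 = 0 := fun j k => by
      funext σ; simp [alphaTerm, opApply_zero]
    have hb : ∀ j k, O.betaTerm P θ t j k 0 = 0 := fun j k => by
      funext σ; simp [betaTerm, opApply_zero]
    refine ⟨Submodule.zero_mem _, fun j k => ?_, fun j k => ?_, ?_⟩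
    · rw [Prod.fst_zero, ha]; exact integrableOn_zero
    · rw [Prod.fst_zero, hb]; exact integrableOn_zero
    · simp [ha, hb, opApply_zero]
  add_mem' := fun {p q} ⟨hp, hpa, hpb, hpe⟩ ⟨hq, hqa, hqb, hqe⟩ => by
    have ht : t ∈ Set.uIcc 0 t := Set.right_mem_uIcc
    have hm : MeasurableSet (Set.Icc 0 t ×ˢ Set.Icc 0 t) := measurableSet_Icc.prod measurableSet_Icc
    have ha : ∀ j k, Set.EqOn (O.alphaTerm P θ t j k (p.1 + q.1))
        (O.alphaTerm P θ t j k p.1 + O.alphaTerm P θ t j k q.1) (Set.Icc 0 t) :=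
      fun j k σ hσ => O.alphaTerm_add P θ j k hp hq hσ
    have hb : ∀ j k, Set.EqOn (O.betaTerm P θ t j k (p.1 + q.1))
        (O.betaTerm P θ t j k p.1 + O.betaTerm P θ t j k q.1) (Set.Icc 0 t ×ˢ Set.Icc 0 t) :=
      fun j k r hr => O.betaTerm_add P θ j k hp hq hr
    refine ⟨Submodule.add_mem _ hp hq, fun j k => ?_, fun j k => ?_, ?_⟩
    · exact (integrableOn_congr_fun (ha j k) measurableSet_Icc).2 ((hpa j k).add (hqa j k))
    · exact (integrableOn_congr_fun (hb j k) hm).2 ((hpb j k).add (hqb j k))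
    · have h1 : ∀ j k, opApply (O.XX j k t t) (p.1 + q.1) =
          opApply (O.XX j k t t) p.1 + opApply (O.XX j k t t) q.1 := fun j k =>
        opApply_add _ (O.mem_quadDomain hp j k ht ht) (O.mem_quadDomain hq j k ht ht)
      have h2 : ∀ j k, (∫ σ in Set.Icc 0 t, O.alphaTerm P θ t j k (p.1 + q.1) σ) =
          (∫ σ in Set.Icc 0 t, O.alphaTerm P θ t j k p.1 σ) +
          (∫ σ in Set.Icc 0 t, O.alphaTerm P θ t j k q.1 σ) := fun j k => by
        rw [setIntegral_congr_fun measurableSet_Icc (ha j k)]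
        exact integral_add (hpa j k) (hqa j k)
      have h3 : ∀ j k, (∫ r in Set.Icc 0 t ×ˢ Set.Icc 0 t, O.betaTerm P θ t j k (p.1 + q.1) r) =
          (∫ r in Set.Icc 0 t ×ˢ Set.Icc 0 t, O.betaTerm P θ t j k p.1 r) +
          (∫ r in Set.Icc 0 t ×ˢ Set.Icc 0 t, O.betaTerm P θ t j k q.1 r) := fun j k => by
        rw [setIntegral_congr_fun hm (hb j k)]
        exact integral_add (hpb j k) (hqb j k)
      simp only [Prod.fst_add, Prod.snd_add, hpe, hqe, h1, h2, h3, smul_add,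
        Finset.sum_add_distrib]
      abel
  smul_mem' := fun c p ⟨hp, hpa, hpb, hpe⟩ => by
    have ht : t ∈ Set.uIcc 0 t := Set.right_mem_uIcc
    have hm : MeasurableSet (Set.Icc 0 t ×ˢ Set.Icc 0 t) := measurableSet_Icc.prod measurableSet_Icc
    have ha : ∀ j k, Set.EqOn (O.alphaTerm P θ t j k (c • p.1))
        (c • O.alphaTerm P θ t j k p.1) (Set.Icc 0 t) :=
      fun j k σ hσ => O.alphaTerm_smul P θ j k c hp hσ
    have hb : ∀ j k, Set.EqOn (O.betaTerm P θ t j k (c • p.1))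
        (c • O.betaTerm P θ t j k p.1) (Set.Icc 0 t ×ˢ Set.Icc 0 t) :=
      fun j k r hr => O.betaTerm_smul P θ j k c hp hr
    refine ⟨Submodule.smul_mem _ c hp, fun j k => ?_, fun j k => ?_, ?_⟩
    · exact (integrableOn_congr_fun (ha j k) measurableSet_Icc).2 ((hpa j k).smul c)
    · exact (integrableOn_congr_fun (hb j k) hm).2 ((hpb j k).smul c)
    · have h1 : ∀ j k, opApply (O.XX j k t t) (c • p.1) = c • opApply (O.XX j k t t) p.1 :=
        fun j k => opApply_smul _ c (O.mem_quadDomain hp j k ht ht)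
      have h2 : ∀ j k, (∫ σ in Set.Icc 0 t, O.alphaTerm P θ t j k (c • p.1) σ) =
          c • (∫ σ in Set.Icc 0 t, O.alphaTerm P θ t j k p.1 σ) := fun j k => by
        rw [setIntegral_congr_fun measurableSet_Icc (ha j k)]
        exact integral_smul c _
      have h3 : ∀ j k, (∫ r in Set.Icc 0 t ×ˢ Set.Icc 0 t, O.betaTerm P θ t j k (c • p.1) r) =
          c • (∫ r in Set.Icc 0 t ×ˢ Set.Icc 0 t, O.betaTerm P θ t j k p.1 r) := fun j k => by
        rw [setIntegral_congr_fun hm (hb j k)]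
        exact integral_smul c _
      simp only [Prod.smul_fst, Prod.smul_snd, hpe, h1, h2, h3, smul_add,
        Finset.smul_sum, smul_comm c]

/-- The operator `Ψ_θ(t) = ψ(t) + (θ/2) (Re (X(t)ᵀ ∫₀ᵗ α(σ) X(σ) dσ) +
∫∫ X(σ)ᵀ β(σ, τ) X(τ) dσ dτ)`. -/
def Psi (P : Matrix (Fin n) (Fin n) ℝ) (θ t : ℝ) :
    SystemField d ι H₀ →ₗ.[ℂ] SystemField d ι H₀ :=
  (O.PsiGraph P θ t).toLinearPMap

variable [CompleteSpace H₀]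

/-- The resolvent `(I + φ(t))⁻¹` of the positive semi-definite self-adjoint operator
`φ(t) = ∫₀ᵗ ψ(s) ds`, `ψ = XᵀΠX = ζᵀζ`. It is defined through its closed quadratic form
`⟪v, φ(t) v⟫ = ∫₀ᵗ ‖ζ(s) v‖² ds`, that is, `φ(t) = Z†Z` for the closed operator `Z v = ζ(·) v`. -/
def phiResolvent (P : Matrix (Fin n) (Fin n) ℝ) (t : ℝ) :
    SystemField d ι H₀ →L[ℂ] SystemField d ι H₀ :=
  graphResolvent (O.zetaGraph P t).topologicalClosure

/-- The bounded operator `e^{-cφ(t)}`, `c ≥ 0`. -/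
def expNegPhi (P : Matrix (Fin n) (Fin n) ℝ) (c t : ℝ) :
    SystemField d ι H₀ →L[ℂ] SystemField d ι H₀ :=
  expNegOfResolvent c (O.phiResolvent P t)

/-- The (unbounded) positive definite self-adjoint operator `e^{cφ(t)} = (e^{-cφ(t)})⁻¹`,
`c ≥ 0`. -/
def expPhi (P : Matrix (Fin n) (Fin n) ℝ) (c t : ℝ) :
    SystemField d ι H₀ →ₗ.[ℂ] SystemField d ι H₀ :=
  (opBdd (O.expNegPhi P c t)).inverse

/-- The operator `S_θ(t) = e^{(θ/2)φ(t)}`. -/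
def S (P : Matrix (Fin n) (Fin n) ℝ) (θ t : ℝ) :
    SystemField d ι H₀ →ₗ.[ℂ] SystemField d ι H₀ :=
  O.expPhi P (θ / 2) t

/-- The operator `V_θ(t) = R_θ(t) S_θ(t)⁻¹`. -/
def V (P : Matrix (Fin n) (Fin n) ℝ) (θ : ℝ)
    (R : ℝ → (SystemField d ι H₀ →ₗ.[ℂ] SystemField d ι H₀)) (t : ℝ) :
    SystemField d ι H₀ →ₗ.[ℂ] SystemField d ι H₀ :=
  opMul (R t) (O.S P θ t).inverse

/-- The quadratic-exponential functional `Ξ_θ(t) = E e^{θφ(t)}`. -/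
def QEF (ρ : SystemField d ι H₀ →L[ℂ] SystemField d ι H₀) (P : Matrix (Fin n) (Fin n) ℝ)
    (θ t : ℝ) : ℝ≥0∞ :=
  expectation ρ (O.expPhi P θ t)

end OQHO

end

/-!
The cost and the exponential functional coincide, and `V` is unitary, because `R†R = e^{θφ}` as
unbounded operators. With the bounded inverse `Q = R⁻¹` this is the identity `Q Q† = e^{-θφ}`
(`OQHO.inverse_mul_adjoint`), from which `R†R = e^{θφ}` follows for the graphs
(`IsBddInverse.opMul_adjoint_self`), while `V = R e^{-θφ/2}` is the unitary factor of a polar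
decomposition (`IsBddInverse.isUnitaryOp`).

The identity holds at `t = 0`, and both sides have the same derivative between vectors `x`, `y` of
the core. Let `T = e^{-θφ/2}`. Since `V = R T`, we have `V†Q† = T` and `C Q† = R T Ψ T`, so that the
evolution equation gives
`d/dt ⟪Q†x, Q†y⟫ = -θ/2 (⟪T Ψ T x, y⟫ + ⟪x, T Ψ T y⟫) = -θ ⟪T x, Ψ T y⟫`.
On the other side, Duhamel's formula (`FieldSystem.hasDerivWithinAt_inner_semigroup`) gives
`d/dt ⟪x, e^{-θφ} y⟫ = -∫₀^θ ⟪x, e^{-(θ-c)φ} ψ e^{-cφ} y⟫ dc`,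
and this is `-θ ⟪T x, Ψ T y⟫` as well, because the series `∑ k, (θ/2)^{2k} / (2k+1)! ad_φ^{2k} ψ` is the average of `e^{sφ} ψ e^{-sφ}` over
`s ∈ [-θ/2, θ/2]` (`OQHO.integral_exp_eq_psiValue`, `OQHO.hasDerivWithinAt_inner_semigroup_psi`).

What makes the commutators with the unbounded `φ` tractable is that `φ` and `ψ` are quadratic in
fields `Φ(g)` which are linear in a vector `g` of a one-particle space and have scalar
commutators. Hence `[φ, Φ(g)] = Φ(D g)` with a bounded operator `D` (`FieldSystem.adOp`), and
`Φ(g) e^{-cφ} = e^{-cφ} Φ(e^{cD} g)` on a suitable domain (`FieldSystem.reg_semigroup`). The last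
relation first appears in an integrated form, through bounded operators which approximate the
fields and have bounded commutators with them (`FieldSystem.inner_field_semigroup`). The
difference of its two sides then solves a homogeneous Volterra equation, and vanishes. All the
series in commutators thereby become power series of the bounded operator `D`.

`FieldSystem` lists the properties of the fields that are used, and `OQHO.fieldSystem` verifies
them for the oscillator: Gårding's theorem for the Weyl representation on the initial space,
truncations of the particle number, weighted shifts as bounded approximations of creation and
annihilation operators, and `sin (ε uᵀX) / ε` as bounded approximations of `uᵀX`. The two-point
commutators `2iΛ` of the system variables, which determine `D` on the one-particle curves, come from
the relation `A Θ + Θ Aᵀ + B J Bᵀ = 0` (`OQHO.drift_relation`, `OQHO.hasLamComm_sysCurve`). Finally,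
`OQHO.expNegPhi_eq` and `OQHO.FieldReg.Psi` identify `e^{-cφ}` and `Ψ` of the oscillator with the
expressions in the fields.
-/

noncomputable section

/-! ### The semigroup of a positive self-adjoint operator given by the graph of its square root -/

section Semigroup

variable {H E : Type*} [NormedAddCommGroup H] [InnerProductSpace ℂ H]
  [NormedAddCommGroup E] [InnerProductSpace ℂ E]

section Graph

variable (Γ : Submodule ℂ (WithLp 2 (H × E))) [Γ.HasOrthogonalProjection]

/-- With `Γ` the graph of `Z` and `G = (I + Z†Z)⁻¹`, this is the bounded operator `Z G`. -/
def graphSnd : H →L[ℂ] E :=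
  ((WithLp.sndL 2 ℂ H E) ∘L Γ.starProjection) ∘L
    ((WithLp.prodContinuousLinearEquiv 2 ℂ H E).symm.toContinuousLinearMap ∘L
      ContinuousLinearMap.inl ℂ H E)

theorem graphResolvent_mem (u : H) :
    WithLp.toLp 2 (graphResolvent Γ u, graphSnd Γ u) ∈ Γ := by
  have h : WithLp.toLp 2 (graphResolvent Γ u, graphSnd Γ u) =
      Γ.starProjection (WithLp.toLp 2 (u, 0)) := rfl
  rw [h]
  exact Submodule.starProjection_apply_mem _ _

/-- The variational equation of `G = (I + Z†Z)⁻¹`: `⟪(I - G) u, p⟫ = ⟪Z G u, Z p⟫`. -/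
theorem inner_sub_graphResolvent (u : H) {p : WithLp 2 (H × E)} (hp : p ∈ Γ) :
    ⟪u - graphResolvent Γ u, p.fst⟫_ℂ = ⟪graphSnd Γ u, p.snd⟫_ℂ := by
  have h := Submodule.starProjection_inner_eq_zero (K := Γ) (WithLp.toLp 2 (u, 0)) p hp
  rw [WithLp.prod_inner_apply] at h
  have h' : ⟪u - graphResolvent Γ u, p.fst⟫_ℂ + ⟪(0 : E) - graphSnd Γ u, p.snd⟫_ℂ = 0 := h
  rw [zero_sub, inner_neg_left] at h'
  linear_combination h'

theorem graphResolvent_unique {u v : H} {q : E} (hv : WithLp.toLp 2 (v, q) ∈ Γ)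
    (h : ∀ p ∈ Γ, ⟪u - v, p.fst⟫_ℂ = ⟪q, p.snd⟫_ℂ) :
    graphResolvent Γ u = v ∧ graphSnd Γ u = q := by
  have h1 : Γ.starProjection (WithLp.toLp 2 (u, 0)) = WithLp.toLp 2 (v, q) := by
    refine Submodule.eq_starProjection_of_mem_of_inner_eq_zero hv fun p hp => ?_
    rw [WithLp.prod_inner_apply]
    have := h p hp
    have h' : ⟪u - v, p.fst⟫_ℂ + ⟪(0 : E) - q, p.snd⟫_ℂ = 0 := by
      rw [zero_sub, inner_neg_left, this]; ring
    exact h'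
  exact ⟨congrArg WithLp.fst h1, congrArg WithLp.snd h1⟩

theorem inner_graphResolvent_symm (u v : H) :
    ⟪graphResolvent Γ u, v⟫_ℂ = ⟪u, graphResolvent Γ v⟫_ℂ := by
  have h1 := inner_sub_graphResolvent Γ u (graphResolvent_mem Γ v)
  have h2 := inner_sub_graphResolvent Γ v (graphResolvent_mem Γ u)
  have h3 := congrArg (starRingEnd ℂ) h2
  simp only [inner_conj_symm, WithLp.toLp_fst, WithLp.toLp_snd] at h1 h3
  rw [← h3, inner_sub_left, inner_sub_right] at h1
  linear_combination -h1

theorem re_inner_graphResolvent (u : H) :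
    (⟪u, graphResolvent Γ u⟫_ℂ).re = ‖graphResolvent Γ u‖ ^ 2 + ‖graphSnd Γ u‖ ^ 2 := by
  have h1 := inner_sub_graphResolvent Γ u (graphResolvent_mem Γ u)
  simp only [WithLp.toLp_fst, WithLp.toLp_snd, inner_sub_left,
    inner_self_eq_norm_sq_to_K] at h1
  have := congrArg Complex.re h1
  simp only [Complex.sub_re] at this
  norm_cast at this
  have e : ∀ r : ℝ, ((RCLike.ofReal r : ℂ)).re = r := fun r => Complex.ofReal_re r
  simp only [e] at this
  linarith

theorem graphResolvent_injective (hd : ∀ v : H, (∀ p ∈ Γ, ⟪v, p.fst⟫_ℂ = 0) → v = 0) {u : H}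
    (hu : graphResolvent Γ u = 0) : u = 0 := by
  have h1 := re_inner_graphResolvent Γ u
  rw [hu] at h1
  simp only [inner_zero_right, Complex.zero_re, norm_zero] at h1
  have h2 : graphSnd Γ u = 0 := by
    rw [← norm_eq_zero]; nlinarith [sq_nonneg ‖graphSnd Γ u‖]
  refine hd u fun p hp => ?_
  have := inner_sub_graphResolvent Γ u hp
  rwa [hu, h2, sub_zero, inner_zero_left] at this

theorem graphResolvent_isPositive : (graphResolvent Γ).IsPositive := by
  rw [ContinuousLinearMap.isPositive_iff_complex]
  intro u
  have h1 := re_inner_graphResolvent Γ u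
  have h2 : ⟪graphResolvent Γ u, u⟫_ℂ = ⟪u, graphResolvent Γ u⟫_ℂ :=
    inner_graphResolvent_symm Γ u u
  have h3 := inner_conj_symm (𝕜 := ℂ) u (graphResolvent Γ u)
  rw [h2] at h3
  have e1 : (RCLike.re ⟪graphResolvent Γ u, u⟫_ℂ) = (⟪u, graphResolvent Γ u⟫_ℂ).re := by
    rw [h2]; rfl
  rw [e1]
  refine ⟨?_, ?_⟩
  · rw [h2]; exact Complex.conj_eq_iff_re.1 h3
  · rw [h1]; positivity

theorem graphResolvent_norm_le : ‖graphResolvent Γ‖ ≤ 1 := by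
  refine ContinuousLinearMap.opNorm_le_bound _ zero_le_one fun u => ?_
  have h1 := re_inner_graphResolvent Γ u
  have h2 := (Complex.re_le_norm _).trans (norm_inner_le_norm (𝕜 := ℂ) u (graphResolvent Γ u))
  by_contra! h
  nlinarith [norm_nonneg u, norm_nonneg (graphResolvent Γ u), sq_nonneg ‖graphSnd Γ u‖]

end Graph

/-! ### Semigroup generated through the functional calculus -/

variable [CompleteSpace H]

/-- The symbol of `e^{-cA}` as a function of the resolvent `(I + A)⁻¹`. -/
def expNegSymbol (c x : ℝ) : ℝ :=
  if c = 0 then 1 else if x ≤ 0 then 0 else Real.exp (-c * (1 / x - 1))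

theorem expNegSymbol_of_pos (c : ℝ) {x : ℝ} (hx : 0 < x) :
    expNegSymbol c x = Real.exp (-c * (1 / x - 1)) := by
  unfold expNegSymbol
  split_ifs with h h'
  · simp [h]
  · exact absurd hx (not_lt.2 h')
  · rfl

theorem expNegSymbol_at_zero {c : ℝ} (hc : c ≠ 0) : expNegSymbol c 0 = 0 := by
  simp [expNegSymbol, hc]

theorem expNegSymbol_nonneg (c x : ℝ) : 0 ≤ expNegSymbol c x := by
  unfold expNegSymbol
  split_ifs <;> positivity

theorem expNegSymbol_le_one {c x : ℝ} (hc : 0 ≤ c) (hx : x ∈ Set.Icc (0 : ℝ) 1) :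
    expNegSymbol c x ≤ 1 := by
  unfold expNegSymbol
  split_ifs with h h'
  · rfl
  · exact zero_le_one
  · rw [Real.exp_le_one_iff]
    have : 1 ≤ 1 / x := by rw [le_div_iff₀ (not_le.1 h')]; linarith [hx.2]
    nlinarith

theorem expNegSymbol_add {c c' x : ℝ} (hc : 0 ≤ c) (hc' : 0 ≤ c') (hx : 0 ≤ x) :
    expNegSymbol (c + c') x = expNegSymbol c x * expNegSymbol c' x := by
  rcases hx.eq_or_lt with rfl | hx
  · rcases hc.eq_or_lt with rfl | hc
    · simp [expNegSymbol]
    · rw [expNegSymbol_at_zero hc.ne', expNegSymbol_at_zero (by positivity), zero_mul]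
  · rw [expNegSymbol_of_pos _ hx, expNegSymbol_of_pos _ hx, expNegSymbol_of_pos _ hx,
      ← Real.exp_add]
    congr 1; ring

theorem continuousOn_expNegSymbol {c : ℝ} (hc : 0 ≤ c) :
    ContinuousOn (expNegSymbol c) (Set.Icc 0 1) := by
  rcases hc.eq_or_lt with rfl | hc
  · have : expNegSymbol 0 = fun _ => 1 := by funext x; simp [expNegSymbol]
    rw [this]; exact continuousOn_const
  intro x hx
  rcases hx.1.eq_or_lt with rfl | hx0
  · refine ContinuousWithinAt.mono ?_ Set.Icc_subset_Ici_self
    rw [← continuousWithinAt_Ioi_iff_Ici]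
    unfold ContinuousWithinAt
    rw [expNegSymbol_at_zero hc.ne']
    have h1 : Tendsto (fun x : ℝ => Real.exp (-c * (1 / x - 1))) (𝓝[>] 0) (𝓝 0) := by
      refine Real.tendsto_exp_atBot.comp ?_
      simp_rw [neg_mul]
      refine tendsto_neg_atTop_atBot.comp (Tendsto.const_mul_atTop hc ?_)
      refine tendsto_atTop_add_const_right _ _ ?_
      exact tendsto_inv_nhdsGT_zero.congr fun y => (one_div y).symm
    refine h1.congr' ?_
    filter_upwards [self_mem_nhdsWithin] with y hy
    rw [expNegSymbol_of_pos c hy]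
  · refine ContinuousAt.continuousWithinAt ?_
    have h1 : ContinuousAt (fun x : ℝ => Real.exp (-c * (1 / x - 1))) x := by
      have := hx0.ne'
      fun_prop (disch := assumption)
    refine h1.congr ?_
    filter_upwards [lt_mem_nhds hx0] with y hy
    rw [expNegSymbol_of_pos c hy]

/-- The bound behind the generator property: `x²(h_{c+ε} - h_c) + ε (1 - x) x h_c` is of order
`ε²` uniformly in the spectral parameter. -/
theorem abs_expNegSymbol_taylor {c ε x : ℝ} (hc : 0 ≤ c) (hε : 0 ≤ ε)
    (hx : x ∈ Set.Icc (0 : ℝ) 1) :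
    |(expNegSymbol (c + ε) x - expNegSymbol c x) * x ^ 2 +
      ε * (expNegSymbol c x * ((1 - x) * x))| ≤ ε ^ 2 := by
  rcases hx.1.eq_or_lt with rfl | hx0
  · simp; positivity
  have h1 := expNegSymbol_le_one hc hx
  have h0 := expNegSymbol_nonneg c x
  rw [expNegSymbol_add hc hε hx.1, expNegSymbol_of_pos ε hx0]
  set y := ε * (1 / x - 1) with hy
  have hxy : x * y = ε * (1 - x) := by rw [hy]; field_simp
  have hy0 : 0 ≤ y := by
    have : 1 ≤ 1 / x := by rw [le_div_iff₀ hx0]; linarith [hx.2]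
    exact mul_nonneg hε (by linarith)
  have e1 : Real.exp (-ε * (1 / x - 1)) = Real.exp (-y) := by rw [hy]; congr 1; ring
  rw [e1]
  have e2 : (expNegSymbol c x * Real.exp (-y) - expNegSymbol c x) * x ^ 2 +
      ε * (expNegSymbol c x * ((1 - x) * x)) =
      expNegSymbol c x * (x ^ 2 * (Real.exp (-y) - 1 + y)) := by
    linear_combination (-(expNegSymbol c x * x)) * hxy
  rw [e2]
  have l1 : 0 ≤ Real.exp (-y) - 1 + y := by linarith [Real.add_one_le_exp (-y)]
  have l2 : Real.exp (-y) - 1 + y ≤ y ^ 2 := by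
    have h3 : Real.exp (-y) * (1 + y) ≤ 1 := by
      have := mul_le_mul_of_nonneg_left (Real.add_one_le_exp y) (Real.exp_pos (-y)).le
      rw [← Real.exp_add] at this
      simpa [add_comm] using this
    nlinarith [Real.exp_pos (-y)]
  rw [abs_of_nonneg (by positivity)]
  have l3 : x ^ 2 * (Real.exp (-y) - 1 + y) ≤ ε ^ 2 := by
    calc x ^ 2 * (Real.exp (-y) - 1 + y) ≤ x ^ 2 * y ^ 2 := by gcongr
      _ = ε ^ 2 * (1 - x) ^ 2 := by rw [← mul_pow, hxy, mul_pow]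
      _ ≤ ε ^ 2 * 1 := by
        gcongr
        nlinarith [hx.1, hx.2]
      _ = ε ^ 2 := mul_one _
  calc _ ≤ 1 * (x ^ 2 * (Real.exp (-y) - 1 + y)) := by gcongr
    _ ≤ ε ^ 2 := by rwa [one_mul]

theorem spectrum_subset_unitInterval {G : H →L[ℂ] H} (hG : G.IsPositive) (hG1 : ‖G‖ ≤ 1) :
    spectrum ℝ G ⊆ Set.Icc 0 1 := by
  intro x hx
  refine ⟨spectrum_nonneg_of_nonneg ((ContinuousLinearMap.nonneg_iff_isPositive G).2 hG) hx, ?_⟩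
  rcases subsingleton_or_nontrivial H with h | h
  · have := spectrum.of_subsingleton (R := ℝ) G
    rw [this] at hx; exact hx.elim
  · exact (le_abs_self x).trans ((spectrum.norm_le_norm_of_mem hx).trans hG1)

/-- The semigroup `c ↦ e^{-cA}` of the operator `A` with the resolvent `G = (I + A)⁻¹`, extended
by the identity to `c < 0`, so that its orbits are continuous on the whole line. -/
def contractionSemigroup (G : H →L[ℂ] H) (c : ℝ) : H →L[ℂ] H :=
  expNegOfResolvent (max c 0) G

theorem contractionSemigroup_of_nonneg (G : H →L[ℂ] H) {c : ℝ} (hc : 0 ≤ c) :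
    contractionSemigroup G c = cfc (expNegSymbol c) G := by
  unfold contractionSemigroup expNegOfResolvent
  rw [max_eq_left hc]
  rfl

theorem contractionSemigroup_of_nonpos {G : H →L[ℂ] H} (hG : G.IsPositive) {c : ℝ} (hc : c ≤ 0) :
    contractionSemigroup G c = 1 := by
  have : contractionSemigroup G c = contractionSemigroup G 0 := by
    simp [contractionSemigroup, hc]
  rw [this, contractionSemigroup_of_nonneg G le_rfl]
  have h : expNegSymbol 0 = fun _ => 1 := by funext x; simp [expNegSymbol]
  rw [h, cfc_const_one ℝ G (ha := hG.isSelfAdjoint)]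

section Calculus

variable {G : H →L[ℂ] H}

theorem contractionSemigroup_add (hG : G.IsPositive) (hG1 : ‖G‖ ≤ 1) {c c' : ℝ} (hc : 0 ≤ c)
    (hc' : 0 ≤ c') (u : H) : contractionSemigroup G c (contractionSemigroup G c' u) =
      contractionSemigroup G (c + c') u := by
  have hs := spectrum_subset_unitInterval hG hG1
  rw [contractionSemigroup_of_nonneg G hc, contractionSemigroup_of_nonneg G hc',
    contractionSemigroup_of_nonneg G (add_nonneg hc hc')]
  have h := cfc_mul (expNegSymbol c) (expNegSymbol c') G
    ((continuousOn_expNegSymbol hc).mono hs) ((continuousOn_expNegSymbol hc').mono hs)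
  rw [← ContinuousLinearMap.comp_apply]
  have h' : (cfc (expNegSymbol c) G) ∘L (cfc (expNegSymbol c') G) = cfc (expNegSymbol (c + c')) G := by
    refine h.symm.trans (cfc_congr fun x hx => (expNegSymbol_add hc hc' (hs hx).1).symm)
  rw [h']

theorem contractionSemigroup_isSelfAdjoint (G : H →L[ℂ] H) (c : ℝ) :
    IsSelfAdjoint (contractionSemigroup G c) := cfc_predicate _ G

theorem inner_contractionSemigroup (G : H →L[ℂ] H) (c : ℝ) (u v : H) :
    ⟪contractionSemigroup G c u, v⟫_ℂ = ⟪u, contractionSemigroup G c v⟫_ℂ := by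
  have h := (contractionSemigroup_isSelfAdjoint G c).adjoint_eq
  conv_rhs => rw [← h]
  rw [ContinuousLinearMap.adjoint_inner_right]

theorem norm_contractionSemigroup_le (hG : G.IsPositive) (hG1 : ‖G‖ ≤ 1) (c : ℝ) :
    ‖contractionSemigroup G c‖ ≤ 1 := by
  rcases le_total c 0 with hc | hc
  · rw [contractionSemigroup_of_nonpos hG hc]; exact ContinuousLinearMap.norm_id_le
  rw [contractionSemigroup_of_nonneg G hc]
  refine norm_cfc_le zero_le_one fun x hx => ?_
  rw [Real.norm_of_nonneg (expNegSymbol_nonneg c x)]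
  exact expNegSymbol_le_one hc (spectrum_subset_unitInterval hG hG1 hx)

theorem norm_contractionSemigroup_apply_le (hG : G.IsPositive) (hG1 : ‖G‖ ≤ 1) (c : ℝ) (u : H) :
    ‖contractionSemigroup G c u‖ ≤ ‖u‖ := by
  simpa using (contractionSemigroup G c).le_of_opNorm_le
    (norm_contractionSemigroup_le hG hG1 c) u

theorem contractionSemigroup_comm (hG : G.IsPositive) (c : ℝ) (u : H) :
    contractionSemigroup G c (G u) = G (contractionSemigroup G c u) := by
  have h : Commute (contractionSemigroup G c) (cfc (id : ℝ → ℝ) G) := cfc_commute_cfc _ _ G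
  rw [cfc_id ℝ G (ha := hG.isSelfAdjoint)] at h
  exact congrArg (fun T : H →L[ℂ] H => T u) h

/-- On the range of `G`, the domain of the generator, the semigroup is Lipschitz in time. -/
theorem norm_contractionSemigroup_sub_le (hG : G.IsPositive) (hG1 : ‖G‖ ≤ 1) {c c' : ℝ}
    (hc : 0 ≤ c) (h : c ≤ c') (u : H) :
    ‖contractionSemigroup G c' (G u) - contractionSemigroup G c (G u)‖ ≤ (c' - c) * ‖u‖ := by
  have hs := spectrum_subset_unitInterval hG hG1
  have k1 := (continuousOn_expNegSymbol hc).mono hs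
  have k2 := (continuousOn_expNegSymbol (hc.trans h)).mono hs
  have e : cfc (fun x => (expNegSymbol c' x - expNegSymbol c x) * x) G =
      (contractionSemigroup G c' - contractionSemigroup G c) * G := by
    rw [cfc_mul (fun x => expNegSymbol c' x - expNegSymbol c x) (fun x => x) G (k2.sub k1),
      cfc_sub _ _ G k2 k1, cfc_id' ℝ G (ha := hG.isSelfAdjoint),
      contractionSemigroup_of_nonneg G hc, contractionSemigroup_of_nonneg G (hc.trans h)]
  have hn : ‖(contractionSemigroup G c' - contractionSemigroup G c) * G‖ ≤ c' - c := by
    rw [← e]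
    refine norm_cfc_le (sub_nonneg.2 h) fun x hx => ?_
    have hx := hs hx
    rcases hx.1.eq_or_lt with rfl | hx0
    · simpa using h
    obtain ⟨ε, hε, rfl⟩ : ∃ ε, 0 ≤ ε ∧ c' = c + ε := ⟨c' - c, sub_nonneg.2 h, by ring⟩
    rw [expNegSymbol_add hc hε hx.1]
    have h1 := expNegSymbol_le_one hc hx
    have h0 := expNegSymbol_nonneg c x
    have h2 := expNegSymbol_le_one hε hx
    have h3 : (1 - expNegSymbol ε x) * x ≤ ε := by
      rw [expNegSymbol_of_pos ε hx0]
      have := Real.add_one_le_exp (-ε * (1 / x - 1))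
      have e3 : (-ε * (1 / x - 1)) * x = -ε * (1 - x) := by field_simp
      nlinarith [mul_le_mul_of_nonneg_right this hx0.le]
    rw [Real.norm_eq_abs, abs_le]
    constructor <;> nlinarith [mul_nonneg (sub_nonneg.2 h2) hx0.le]
  exact ((contractionSemigroup G c' - contractionSemigroup G c) * G).le_of_opNorm_le hn u

theorem continuous_contractionSemigroup (hG : G.IsPositive) (hG1 : ‖G‖ ≤ 1) (hd : DenseRange G)
    (u : H) : Continuous fun c => contractionSemigroup G c u := by
  refine continuous_of_uniform_approx_of_continuous fun U hU => ?_
  obtain ⟨ε, hε, hU⟩ := Metric.mem_uniformity_dist.1 hU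
  obtain ⟨v, hv⟩ := hd.exists_dist_lt u hε
  refine ⟨fun c => contractionSemigroup G c (G v), ?_, fun c => hU ?_⟩
  · refine (LipschitzWith.of_dist_le_mul (K := ‖v‖₊) fun c c' => ?_).continuous
    have key : ∀ a b : ℝ, a ≤ b →
        ‖contractionSemigroup G b (G v) - contractionSemigroup G a (G v)‖ ≤ ‖v‖ * |b - a| := by
      intro a b hab
      have e : ∀ a : ℝ, contractionSemigroup G a = contractionSemigroup G (max a 0) := fun a => by
        simp [contractionSemigroup]
      rw [e a, e b]
      refine (norm_contractionSemigroup_sub_le hG hG1 (le_max_right a 0)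
        (max_le_max_right 0 hab) v).trans ?_
      rw [mul_comm]
      refine mul_le_mul_of_nonneg_left ?_ (norm_nonneg v)
      exact (le_abs_self _).trans (abs_max_sub_max_le_abs b a 0)
    rw [coe_nnnorm]
    rcases le_total c c' with h | h
    · rw [dist_comm, dist_eq_norm, dist_comm, Real.dist_eq]; exact key _ _ h
    · rw [dist_eq_norm, Real.dist_eq]; exact key _ _ h
  · rw [dist_eq_norm, ← map_sub]
    refine (norm_contractionSemigroup_apply_le hG hG1 c _).trans_lt ?_
    rwa [← dist_eq_norm]

/-- Although `e^{-cA}` may be far from invertible, it has no kernel when `A` is densely defined. -/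
theorem contractionSemigroup_injective (hG : G.IsPositive) (hG1 : ‖G‖ ≤ 1) (hd : DenseRange G)
    {c : ℝ} {u : H} (h : contractionSemigroup G c u = 0) : u = 0 := by
  rcases le_or_gt c 0 with hc | hc
  · rw [contractionSemigroup_of_nonpos hG hc] at h; exact h
  -- the square root of an injective positive operator is injective: halve `c` repeatedly
  have step : ∀ k : ℕ, contractionSemigroup G (c / 2 ^ k) u = 0 := by
    intro k
    induction k with
    | zero => simpa using h
    | succ k ih =>
      have hp : 0 ≤ c / 2 ^ (k + 1) := by positivity
      rw [← inner_self_eq_zero (𝕜 := ℂ), inner_contractionSemigroup,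
        contractionSemigroup_add hG hG1 hp hp]
      have : c / 2 ^ (k + 1) + c / 2 ^ (k + 1) = c / 2 ^ k := by rw [pow_succ]; ring
      rw [this, ih, inner_zero_right]
  have lim : Tendsto (fun k : ℕ => c / 2 ^ k) atTop (𝓝 0) :=
    tendsto_const_nhds.div_atTop (tendsto_pow_atTop_atTop_of_one_lt one_lt_two)
  have h1 := ((continuous_contractionSemigroup hG hG1 hd u).tendsto 0).comp lim
  rw [contractionSemigroup_of_nonpos hG le_rfl] at h1
  refine tendsto_nhds_unique h1 ?_
  simp only [Function.comp_def, step]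
  exact tendsto_const_nhds

/-- The generator property on the range of `G²`, where the Taylor remainder of the symbol is
bounded by `ε²` uniformly on the spectrum. -/
theorem hasDerivWithinAt_contractionSemigroup_sq (hG : G.IsPositive) (hG1 : ‖G‖ ≤ 1) {c : ℝ}
    (hc : 0 ≤ c) (u : H) :
    HasDerivWithinAt (fun r => contractionSemigroup G r (G (G u)))
      (-contractionSemigroup G c (G u - G (G u))) (Set.Ici c) c := by
  have hs := spectrum_subset_unitInterval hG hG1
  rw [hasDerivWithinAt_iff_isLittleO]
  have hO : (fun r => contractionSemigroup G r (G (G u)) - contractionSemigroup G c (G (G u)) -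
      (r - c) • -contractionSemigroup G c (G u - G (G u))) =O[𝓝[Set.Ici c] c]
      fun r => (r - c) ^ 2 := by
    refine Asymptotics.IsBigO.of_bound ‖u‖ ?_
    filter_upwards [self_mem_nhdsWithin] with r hr
    obtain ⟨ε, hε, rfl⟩ : ∃ ε, 0 ≤ ε ∧ r = c + ε := ⟨r - c, sub_nonneg.2 hr, by ring⟩
    have k1 := (continuousOn_expNegSymbol hc).mono hs
    have k2 := (continuousOn_expNegSymbol (add_nonneg hc hε)).mono hs
    have e : cfc (fun x => (expNegSymbol (c + ε) x - expNegSymbol c x) * x ^ 2 +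
        ε * (expNegSymbol c x * ((1 - x) * x))) G =
        (contractionSemigroup G (c + ε) - contractionSemigroup G c) * G ^ 2 +
          ε • (contractionSemigroup G c * ((1 - G) * G)) := by
      have k3 : ContinuousOn (fun x : ℝ => (1 - x) * x) (spectrum ℝ G) := by fun_prop
      have k4 : ContinuousOn (fun x : ℝ => x ^ 2) (spectrum ℝ G) := by fun_prop
      rw [cfc_add G (fun x => (expNegSymbol (c + ε) x - expNegSymbol c x) * x ^ 2)
          (fun x => ε * (expNegSymbol c x * ((1 - x) * x))) ((k2.sub k1).mul k4)
          (continuousOn_const.mul (k1.mul k3)),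
        cfc_mul (fun x => expNegSymbol (c + ε) x - expNegSymbol c x) (fun x => x ^ 2) G (k2.sub k1)
          k4,
        cfc_sub _ _ G k2 k1,
        cfc_const_mul ε (fun x => expNegSymbol c x * ((1 - x) * x)) G (k1.mul k3),
        cfc_mul (expNegSymbol c) (fun x => (1 - x) * x) G k1 k3,
        cfc_mul (fun x : ℝ => 1 - x) (fun x => x) G (by fun_prop) (by fun_prop),
        cfc_sub (fun _ => (1 : ℝ)) (fun x => x) G (by fun_prop) (by fun_prop),
        cfc_const_one ℝ G (ha := hG.isSelfAdjoint), cfc_id' ℝ G (ha := hG.isSelfAdjoint),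
        cfc_pow_id G 2 (ha := hG.isSelfAdjoint), contractionSemigroup_of_nonneg G hc,
        contractionSemigroup_of_nonneg G (add_nonneg hc hε)]
    have hn : ‖(contractionSemigroup G (c + ε) - contractionSemigroup G c) * G ^ 2 +
          ε • (contractionSemigroup G c * ((1 - G) * G))‖ ≤ ε ^ 2 := by
      rw [← e]
      refine norm_cfc_le (by positivity) fun x hx => ?_
      exact abs_expNegSymbol_taylor hc hε (hs hx)
    have := ((contractionSemigroup G (c + ε) - contractionSemigroup G c) * G ^ 2 +
          ε • (contractionSemigroup G c * ((1 - G) * G))).le_of_opNorm_le hn u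
    rw [add_sub_cancel_left, Real.norm_of_nonneg (by positivity : (0:ℝ) ≤ ε ^ 2), mul_comm]
    refine le_trans (le_of_eq ?_) this
    congr 1
    rw [smul_neg, sub_neg_eq_add]
    rfl
  refine hO.trans_isLittleO ?_
  have h1 : (fun r : ℝ => (r - c) ^ 2) =o[𝓝 c] fun r => (r - c) := by
    have := (Asymptotics.isLittleO_pow_id (𝕜 := ℝ) one_lt_two)
    have h2 : Tendsto (fun r : ℝ => r - c) (𝓝 c) (𝓝 0) := by
      have h3 : Continuous fun r : ℝ => r - c := by fun_prop
      simpa using h3.tendsto c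
    exact this.comp_tendsto h2
  exact h1.mono nhdsWithin_le_nhds

/-- The integrated generator property on the range of `G`. It is a closed condition, and thus
follows from the case of the range of `G²`. -/
theorem contractionSemigroup_sub_eq_integral (hG : G.IsPositive) (hG1 : ‖G‖ ≤ 1)
    (hd : DenseRange G) {c : ℝ} (hc : 0 ≤ c) (u : H) :
    contractionSemigroup G c (G u) - G u =
      -∫ r in (0 : ℝ)..c, contractionSemigroup G r (u - G u) := by
  have hcont := continuous_contractionSemigroup hG hG1 hd
  have main : ∀ v, contractionSemigroup G c (G (G v)) - G (G v) =
      -∫ r in (0 : ℝ)..c, contractionSemigroup G r (G v - G (G v)) := by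
    intro v
    have := intervalIntegral.integral_eq_sub_of_hasDeriv_right (a := 0) (b := c)
      (hcont (G (G v))).continuousOn
      (f' := fun r => -contractionSemigroup G r (G v - G (G v)))
      (fun r hr => ((hasDerivWithinAt_contractionSemigroup_sq hG hG1
        (by rw [min_eq_left hc] at hr; exact hr.1.le) v).mono Set.Ioi_subset_Ici_self))
      ((hcont _).neg.intervalIntegrable _ _)
    rw [intervalIntegral.integral_neg, contractionSemigroup_of_nonpos hG le_rfl] at this
    exact this.symm
  have hcl : IsClosed {u : H | contractionSemigroup G c (G u) - G u =
      -∫ r in (0 : ℝ)..c, contractionSemigroup G r (u - G u)} := by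
    refine isClosed_eq (by fun_prop) (Continuous.neg ?_)
    have hl : ∀ u v, ‖(∫ r in (0 : ℝ)..c, contractionSemigroup G r u) -
        ∫ r in (0 : ℝ)..c, contractionSemigroup G r v‖ ≤ c * ‖u - v‖ := by
      intro u v
      rw [← intervalIntegral.integral_sub ((hcont _).intervalIntegrable _ _)
        ((hcont _).intervalIntegrable _ _)]
      have := intervalIntegral.norm_integral_le_of_norm_le_const (a := 0) (b := c)
        (C := ‖u - v‖) (f := fun r => contractionSemigroup G r u - contractionSemigroup G r v)
        (fun r _ => by
          rw [← map_sub]; exact norm_contractionSemigroup_apply_le hG hG1 r _)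
      rwa [sub_zero, abs_of_nonneg hc, mul_comm] at this
    have hL : Continuous fun u : H => ∫ r in (0 : ℝ)..c, contractionSemigroup G r u := by
      refine (LipschitzWith.of_dist_le_mul (K := c.toNNReal) fun u v => ?_).continuous
      rw [dist_eq_norm, dist_eq_norm, Real.coe_toNNReal c hc]
      exact hl u v
    exact hL.comp (by fun_prop : Continuous fun u : H => u - G u)
  have := hd.closure_range ▸ hcl.closure_subset_iff.2 (Set.range_subset_iff.2 main)
  exact this (Set.mem_univ u)

/-- The generator property: `d/dc e^{-cA} G u = -e^{-cA} A G u`, where `A G = I - G`. -/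
theorem hasDerivAt_contractionSemigroup (hG : G.IsPositive) (hG1 : ‖G‖ ≤ 1)
    (hd : DenseRange G) {c : ℝ} (hc : 0 < c) (u : H) :
    HasDerivAt (fun r => contractionSemigroup G r (G u))
      (-contractionSemigroup G c (u - G u)) c := by
  have hcont := continuous_contractionSemigroup hG hG1 hd (u - G u)
  have h1 := ((hcont.integral_hasStrictDerivAt 0 c).hasDerivAt.neg).add_const (G u)
  refine h1.congr_of_eventuallyEq ?_
  filter_upwards [lt_mem_nhds hc] with r hr
  simp only [Pi.neg_apply]
  rw [← contractionSemigroup_sub_eq_integral hG hG1 hd hr.le u, sub_add_cancel]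

end Calculus

section Commutator

variable (Γ : Submodule ℂ (WithLp 2 (H × E))) [Γ.HasOrthogonalProjection]

theorem denseRange_graphResolvent (hd : ∀ v : H, (∀ p ∈ Γ, ⟪v, p.fst⟫_ℂ = 0) → v = 0) :
    DenseRange (graphResolvent Γ) := by
  have h : (LinearMap.range (graphResolvent Γ).toLinearMap)ᗮ = ⊥ := by
    rw [Submodule.eq_bot_iff]
    intro v hv
    rw [Submodule.mem_orthogonal'] at hv
    refine graphResolvent_injective Γ hd ?_
    rw [← inner_self_eq_zero (𝕜 := ℂ), inner_graphResolvent_symm]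
    exact hv _ ⟨graphResolvent Γ v, rfl⟩
  have h2 := (Submodule.topologicalClosure_eq_top_iff (K :=
    LinearMap.range (graphResolvent Γ).toLinearMap)).2 h
  intro x
  have : x ∈ (LinearMap.range (graphResolvent Γ).toLinearMap).topologicalClosure := by
    rw [h2]; trivial
  exact this

/-- Duhamel's formula for the commutator of the semigroup `e^{-cA}`, `A = Z†Z`, with a bounded
operator `B`. The adjoint pair `B`, `B'` is lifted to an adjoint pair on the range space of `Z`, up
to the bounded commutators `K = [Z, B]` and `K' = [Z, B']`. -/
theorem inner_contractionSemigroup_commutator (hd : DenseRange (graphResolvent Γ))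
    {B B' : H →L[ℂ] H} {Bh Bh' : E →L[ℂ] E} {K K' : H →L[ℂ] E}
    (hB : ∀ x y, ⟪B' x, y⟫_ℂ = ⟪x, B y⟫_ℂ) (hBh : ∀ x y, ⟪Bh' x, y⟫_ℂ = ⟪x, Bh y⟫_ℂ)
    (hΓ : ∀ p ∈ Γ, WithLp.toLp 2 (B p.fst, Bh p.snd + K p.fst) ∈ Γ)
    (hΓ' : ∀ p ∈ Γ, WithLp.toLp 2 (B' p.fst, Bh' p.snd + K' p.fst) ∈ Γ)
    {c : ℝ} (hc : 0 ≤ c) (μ ν : H) :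
    ⟪graphResolvent Γ μ, B (contractionSemigroup (graphResolvent Γ) c (graphResolvent Γ ν))⟫_ℂ -
      ⟪contractionSemigroup (graphResolvent Γ) c (graphResolvent Γ μ), B (graphResolvent Γ ν)⟫_ℂ =
    ∫ r in (0 : ℝ)..c,
      (⟪graphSnd Γ (contractionSemigroup (graphResolvent Γ) (c - r) μ),
        K (contractionSemigroup (graphResolvent Γ) r (graphResolvent Γ ν))⟫_ℂ -
      ⟪K' (contractionSemigroup (graphResolvent Γ) (c - r) (graphResolvent Γ μ)),
        graphSnd Γ (contractionSemigroup (graphResolvent Γ) r ν)⟫_ℂ) := by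
  have hG := graphResolvent_isPositive Γ
  have hG1 := graphResolvent_norm_le Γ
  set G := graphResolvent Γ with hGdef
  set T := contractionSemigroup G with hT
  have hcont : ∀ u, Continuous fun r => T r u := continuous_contractionSemigroup hG hG1 hd
  have hcont' : ∀ u, Continuous fun r => T (c - r) u := fun u =>
    (hcont u).comp (by fun_prop : Continuous fun r : ℝ => c - r)
  -- the derivative of `r ↦ ⟪e^{-(c-r)A} G μ, B e^{-rA} G ν⟫` is the commutator with the form of
  -- `A`
  have hder : ∀ r ∈ Set.Ioo (0 : ℝ) c, HasDerivAt (fun r => ⟪T (c - r) (G μ), B (T r (G ν))⟫_ℂ)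
      (⟪graphSnd Γ (T (c - r) μ), K (T r (G ν))⟫_ℂ -
        ⟪K' (T (c - r) (G μ)), graphSnd Γ (T r ν)⟫_ℂ) r := by
    intro r hr
    have h1 : HasDerivAt (fun r => T r (G ν)) (-T r (ν - G ν)) r :=
      hasDerivAt_contractionSemigroup hG hG1 hd hr.1 ν
    have h2 : HasDerivAt (fun r => T (c - r) (G μ)) (T (c - r) (μ - G μ)) r := by
      have := (hasDerivAt_contractionSemigroup hG hG1 hd (sub_pos.2 hr.2) μ).scomp r
        ((hasDerivAt_id r).const_sub c)
      refine this.congr_deriv ?_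
      simp [hT]
    have h3 : HasDerivAt (fun r => B (T r (G ν))) (B (-T r (ν - G ν))) r :=
      (B.restrictScalars ℝ).hasFDerivAt.comp_hasDerivAt r h1
    refine (h2.inner ℂ h3).congr_deriv ?_
    symm
    have e1 : T (c - r) (μ - G μ) = T (c - r) μ - G (T (c - r) μ) := by
      rw [map_sub, hT, contractionSemigroup_comm hG]
    have e2 : T r (ν - G ν) = T r ν - G (T r ν) := by
      rw [map_sub, hT, contractionSemigroup_comm hG]
    have e3 : T r (G ν) = G (T r ν) := contractionSemigroup_comm hG r ν
    have e4 : T (c - r) (G μ) = G (T (c - r) μ) := contractionSemigroup_comm hG _ μ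
    rw [e1, e2, e3, e4, map_neg, inner_neg_right, ← hB]
    have f1 := inner_sub_graphResolvent Γ (T (c - r) μ)
      (hΓ _ (graphResolvent_mem Γ (T r ν)))
    have f2 := inner_sub_graphResolvent Γ (T r ν)
      (hΓ' _ (graphResolvent_mem Γ (T (c - r) μ)))
    have f3 := congrArg (starRingEnd ℂ) f2
    simp only [inner_conj_symm, WithLp.toLp_fst, WithLp.toLp_snd] at f1 f3
    rw [← hGdef] at f1 f3
    rw [f1, f3, inner_add_left, inner_add_right, hBh]
    ring
  have hi : IntervalIntegrable (fun r => (⟪graphSnd Γ (T (c - r) μ), K (T r (G ν))⟫_ℂ -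
        ⟪K' (T (c - r) (G μ)), graphSnd Γ (T r ν)⟫_ℂ)) volume 0 c := by
    refine Continuous.intervalIntegrable ?_ _ _
    exact (((graphSnd Γ).continuous.comp (hcont' μ)).inner (K.continuous.comp (hcont (G ν)))).sub
      ((K'.continuous.comp (hcont' (G μ))).inner ((graphSnd Γ).continuous.comp (hcont ν)))
  rw [intervalIntegral.integral_eq_sub_of_hasDerivAt_of_le hc
    ((hcont' (G μ)).inner (B.continuous.comp (hcont (G ν)))).continuousOn hder hi]
  have h0 : T 0 = 1 := contractionSemigroup_of_nonpos hG le_rfl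
  simp only [sub_self, sub_zero, h0]
  rfl

end Commutator
end Semigroup

/-! ### Square integrable curves -/

theorem inner_intervalIntegral {H : Type*} [NormedAddCommGroup H] [InnerProductSpace ℂ H]
    [CompleteSpace H] (w : H) {f : ℝ → H} {a b : ℝ} (hf : IntervalIntegrable f volume a b) :
    ⟪w, ∫ s in a..b, f s⟫_ℂ = ∫ s in a..b, ⟪w, f s⟫_ℂ :=
  ((innerSL ℂ w).intervalIntegral_comp_comm hf).symm

theorem intervalIntegral_inner {H : Type*} [NormedAddCommGroup H] [InnerProductSpace ℂ H]
    [CompleteSpace H] (w : H) {f : ℝ → H} {a b : ℝ} (hf : IntervalIntegrable f volume a b) :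
    ⟪∫ s in a..b, f s, w⟫_ℂ = ∫ s in a..b, ⟪f s, w⟫_ℂ := by
  rw [← inner_conj_symm, inner_intervalIntegral w hf, intervalIntegral, map_sub, ← integral_conj,
    ← integral_conj]
  simp only [inner_conj_symm]
  rfl

section Curves

variable {n : ℕ} {H 𝒦 : Type*} [NormedAddCommGroup H] [InnerProductSpace ℂ H]
  [NormedAddCommGroup 𝒦] [NormedSpace ℂ 𝒦]

/-- The space `L²([0, t]; Hⁿ)`. -/
abbrev CurveL2 (n : ℕ) (H : Type*) [NormedAddCommGroup H] [InnerProductSpace ℂ H] (t : ℝ) :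
    Type _ :=
  Lp (PiLp 2 fun _ : Fin n => H) 2 (volume.restrict (Set.Icc 0 t))

theorem continuous_curve (ζ : Fin n → C(ℝ, 𝒦)) (L : 𝒦 →L[ℂ] H) :
    Continuous fun s => WithLp.toLp 2 fun j => L (ζ j s) := by
  refine (PiLp.continuous_toLp 2 _).comp ?_
  fun_prop

theorem memLp_curve (ζ : Fin n → C(ℝ, 𝒦)) (t : ℝ) (L : 𝒦 →L[ℂ] H) :
    MemLp (fun s => WithLp.toLp 2 fun j => L (ζ j s)) 2 (volume.restrict (Set.Icc 0 t)) := by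
  have hc := continuous_curve ζ L
  obtain ⟨C, hC⟩ := isCompact_Icc.exists_bound_of_continuousOn (hc.continuousOn (s := Set.Icc 0 t))
  refine MemLp.of_bound ?_ C ?_
  · exact hc.continuousOn.aestronglyMeasurable_of_isCompact isCompact_Icc measurableSet_Icc
  · exact (ae_restrict_iff' measurableSet_Icc).2 (Eventually.of_forall hC)

/-- The linear map which sends a field `L` to its values `s ↦ (L (ζ_j(s)))_j` along the curves
`ζ_j`. -/
def curveMap (ζ : Fin n → C(ℝ, 𝒦)) (t : ℝ) : (𝒦 →L[ℂ] H) →L[ℂ] CurveL2 n H t :=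
  LinearMap.mkContinuousOfExistsBound
    { toFun := fun L => (memLp_curve ζ t L).toLp _
      map_add' := fun L L' => by
        rw [← MemLp.toLp_add]; rfl
      map_smul' := fun c L => by
        rw [RingHom.id_apply, ← MemLp.toLp_const_smul]; rfl }
    (by
      have hb : ∀ j, ∃ C, ∀ s ∈ Set.Icc (0 : ℝ) t, ‖ζ j s‖ ≤ C := fun j =>
        isCompact_Icc.exists_bound_of_continuousOn (ζ j).continuous.continuousOn
      choose C hC using hb
      refine ⟨↑(measureUnivNNReal (volume.restrict (Set.Icc 0 t))) ^ (2 : ℝ≥0∞).toReal⁻¹ *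
        √(∑ j, (|C j|) ^ 2), fun L => ?_⟩
      refine (Lp.norm_le_of_ae_bound (C := √(∑ j, (|C j|) ^ 2) * ‖L‖) (by positivity) ?_).trans
        (le_of_eq (mul_assoc _ _ _).symm)
      refine (MemLp.coeFn_toLp (memLp_curve ζ t L)).mp ?_
      refine (ae_restrict_iff' measurableSet_Icc).2 (Eventually.of_forall fun s hs heq => ?_)
      dsimp only [LinearMap.coe_mk, AddHom.coe_mk]
      rw [heq, PiLp.norm_eq_of_L2, ← Real.sqrt_sq (norm_nonneg L), ← Real.sqrt_mul (by positivity)]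
      refine Real.sqrt_le_sqrt ?_
      rw [Finset.sum_mul]
      refine Finset.sum_le_sum fun j _ => ?_
      rw [← mul_pow]
      refine pow_le_pow_left₀ (norm_nonneg _) ?_ 2
      rw [mul_comm]
      refine (L.le_opNorm _).trans ?_
      exact mul_le_mul_of_nonneg_left ((hC j s hs).trans (le_abs_self _)) (norm_nonneg L))

theorem curveMap_coeFn (ζ : Fin n → C(ℝ, 𝒦)) (t : ℝ) (L : 𝒦 →L[ℂ] H) :
    curveMap ζ t L =ᵐ[volume.restrict (Set.Icc 0 t)] fun s => WithLp.toLp 2 fun j => L (ζ j s) :=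
  MemLp.coeFn_toLp (memLp_curve ζ t L)

theorem inner_curveMap (ζ : Fin n → C(ℝ, 𝒦)) {t : ℝ} (ht : 0 ≤ t) (L L' : 𝒦 →L[ℂ] H) :
    ⟪curveMap ζ t L, curveMap ζ t L'⟫_ℂ = ∫ s in (0 : ℝ)..t, ∑ j, ⟪L (ζ j s), L' (ζ j s)⟫_ℂ := by
  rw [L2.inner_def, intervalIntegral.integral_of_le ht, ← integral_Icc_eq_integral_Ioc]
  refine integral_congr_ae ?_
  filter_upwards [curveMap_coeFn ζ t L, curveMap_coeFn ζ t L'] with s h1 h2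
  rw [h1, h2, PiLp.inner_apply]

/-- The pointwise action of a bounded operator on curves. -/
def curveLift (n : ℕ) (t : ℝ) (B : H →L[ℂ] H) : CurveL2 n H t →L[ℂ] CurveL2 n H t :=
  ContinuousLinearMap.compLpL 2 (volume.restrict (Set.Icc 0 t))
    ((PiLp.continuousLinearEquiv 2 ℂ fun _ : Fin n => H).symm.toContinuousLinearMap ∘L
      ((ContinuousLinearMap.piMap fun _ => B) ∘L
        (PiLp.continuousLinearEquiv 2 ℂ fun _ : Fin n => H).toContinuousLinearMap))

theorem curveLift_coeFn (n : ℕ) (t : ℝ) (B : H →L[ℂ] H) (q : CurveL2 n H t) :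
    ∀ᵐ s ∂(volume.restrict (Set.Icc 0 t)), ∀ j, curveLift n t B q s j = B (q s j) := by
  have h := ContinuousLinearMap.coeFn_compLpL (p := 2)
    (μ := volume.restrict (Set.Icc 0 t)) (𝕜 := ℂ)
    ((PiLp.continuousLinearEquiv 2 ℂ fun _ : Fin n => H).symm.toContinuousLinearMap ∘L
      ((ContinuousLinearMap.piMap fun _ => B) ∘L
        (PiLp.continuousLinearEquiv 2 ℂ fun _ : Fin n => H).toContinuousLinearMap)) q
  filter_upwards [h] with s hs j
  unfold curveLift
  rw [hs]
  rfl

theorem curveLift_curveMap (ζ : Fin n → C(ℝ, 𝒦)) (t : ℝ) (B : H →L[ℂ] H) (L : 𝒦 →L[ℂ] H) :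
    curveLift n t B (curveMap ζ t L) = curveMap ζ t (B ∘L L) := by
  refine Lp.ext ?_
  filter_upwards [curveLift_coeFn n t B (curveMap ζ t L), curveMap_coeFn ζ t L,
    curveMap_coeFn ζ t (B ∘L L)] with s h1 h2 h3
  rw [h3]
  ext j
  rw [h1, h2]
  rfl

theorem inner_curveLift (t : ℝ) {B B' : H →L[ℂ] H} (hB : ∀ x y, ⟪B' x, y⟫_ℂ = ⟪x, B y⟫_ℂ)
    (p q : CurveL2 n H t) : ⟪curveLift n t B' p, q⟫_ℂ = ⟪p, curveLift n t B q⟫_ℂ := by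
  rw [L2.inner_def, L2.inner_def]
  refine integral_congr_ae ?_
  filter_upwards [curveLift_coeFn n t B q, curveLift_coeFn n t B' p] with s h1 h2
  simp only [PiLp.inner_apply, h1, h2, hB]

end Curves

/-! ### Systems of fields linear in a one-particle vector -/

section Fields

/-- A bounded approximation of the field `Φ(g)`: operators `B m` which preserve the core, converge
strongly to `Φ(g)`, and whose commutators `K m p f = [Φ(f), B m] p` with the
fields are uniformly bounded and converge strongly to the commutator `[Φ(f), Φ(g)]`. -/
structure IsFieldApprox {H 𝒦 : Type*} [NormedAddCommGroup H] [InnerProductSpace ℂ H]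
    [NormedAddCommGroup 𝒦] [NormedSpace ℂ 𝒦] (Reg : H → (𝒦 →L[ℂ] H) → Prop)
    (core : Submodule ℂ H) (comm : 𝒦 →L[ℂ] 𝒦 →L[ℂ] ℂ) (g : 𝒦) (B : ℕ → H →L[ℂ] H)
    (K : ℕ → H →L[ℂ] 𝒦 →L[ℂ] H) : Prop where
  map_core : ∀ m, ∀ p ∈ core, B m p ∈ core
  map_reg : ∀ m p L, Reg p L → Reg (B m p) (B m ∘L L + K m p)
  bound : ∃ C, ∀ m, ‖K m‖ ≤ C
  tendsto_comm : ∀ p, Tendsto (fun m => K m p) atTop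
    (𝓝 (ContinuousLinearMap.smulRight (comm.flip g) p))
  tendsto_field : ∀ v L, Reg v L → Tendsto (fun m => B m v) atTop (𝓝 (L g))

/-- Unbounded field operators `Φ(g)` on a Hilbert space `H`, linear in a vector `g` of the
one-particle space `𝒦`, with scalar commutators `[Φ(f), Φ(g)] = comm f g` and adjoints
`Φ(g)† ⊇ Φ(conj g)`. A vector `v` in the domain of all the fields is recorded by
`Reg v L`, where `L` is the bounded linear map `g ↦ Φ(g) v`.

The dense subspace `core` is the one on which quadratic forms of the fields are defined. The larger
subspace `nice` is invariant under the fields, so that products of fields are applicable to its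
vectors, and every vector of it is approximated from `core` together with its images under the
fields (`nice_approx`). The fields are as large as possible: a vector is in their domain as soon as
it has images in the sense of the adjoints on `core` (`reg_of_weak`). By `approx`, the vectors `g`
for which `Φ(g)` has bounded approximations, whose adjoints approximate `Φ(conj g)`, span a dense
subspace of `𝒦`. -/
structure FieldSystem (H 𝒦 : Type*) [NormedAddCommGroup H] [InnerProductSpace ℂ H]
    [NormedAddCommGroup 𝒦] [NormedSpace ℂ 𝒦] where
  conj : 𝒦 →SL[starRingEnd ℂ] 𝒦
  comm : 𝒦 →L[ℂ] 𝒦 →L[ℂ] ℂ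
  Reg : H → (𝒦 →L[ℂ] H) → Prop
  core : Submodule ℂ H
  nice : Submodule ℂ H
  comm_conj : ∀ f g, comm (conj f) (conj g) = -starRingEnd ℂ (comm f g)
  core_dense : Dense (core : Set H)
  core_le : core ≤ nice
  nice_reg : ∀ v ∈ nice, ∃ L : 𝒦 →L[ℂ] H, ∃ M : 𝒦 →L[ℂ] 𝒦 →L[ℂ] H,
    Reg v L ∧ ∀ h, L h ∈ nice ∧ Reg (L h) (M h)
  nice_approx : ∀ v ∈ nice, ∀ L, Reg v L →
    (v, L) ∈ closure {p : H × (𝒦 →L[ℂ] H) | p.1 ∈ core ∧ Reg p.1 p.2}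
  reg_inner : ∀ v L w L', Reg v L → Reg w L' → ∀ g, ⟪L' (conj g), v⟫_ℂ = ⟪w, L g⟫_ℂ
  reg_of_weak : ∀ v L, (∀ w ∈ core, ∀ L', Reg w L' → ∀ g, ⟪L' (conj g), v⟫_ℂ = ⟪w, L g⟫_ℂ) →
    Reg v L
  approx : ∀ U : Submodule ℂ 𝒦, IsClosed (U : Set 𝒦) →
    (∀ g B B' K K', IsFieldApprox Reg core comm g B K →
      IsFieldApprox Reg core comm (conj g) B' K' →
      (∀ m x y, ⟪B' m x, y⟫_ℂ = ⟪x, B m y⟫_ℂ) → g ∈ U) → U = ⊤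

namespace FieldSystem

variable {n : ℕ} {H 𝒦 : Type*} [NormedAddCommGroup H] [InnerProductSpace ℂ H]
  [NormedAddCommGroup 𝒦] [NormedSpace ℂ 𝒦] (S : FieldSystem H 𝒦)

theorem core_reg {v : H} (hv : v ∈ S.core) : ∃ L, S.Reg v L := by
  obtain ⟨L, _, h, _⟩ := S.nice_reg v (S.core_le hv)
  exact ⟨L, h⟩

theorem eq_of_core_inner {x y : H} (h : ∀ w ∈ S.core, ⟪w, x⟫_ℂ = ⟪w, y⟫_ℂ) : x = y :=
  S.core_dense.eq_of_inner_right (𝕜 := ℂ) h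

theorem reg_unique {v : H} {L L' : 𝒦 →L[ℂ] H} (h : S.Reg v L) (h' : S.Reg v L') : L = L' := by
  ext g
  refine S.eq_of_core_inner fun w hw => ?_
  obtain ⟨Lw, hLw⟩ := S.core_reg hw
  rw [← S.reg_inner v L w Lw h hLw, ← S.reg_inner v L' w Lw h' hLw]

/-- Vectors of the core together with the curves of their images under the fields `Φ(ζ_j(s))`. -/
def preGraph (ζ : Fin n → C(ℝ, 𝒦)) (t : ℝ) : Submodule ℂ (WithLp 2 (H × CurveL2 n H t)) :=
  Submodule.span ℂ {p | p.fst ∈ S.core ∧ ∃ L, S.Reg p.fst L ∧ p.snd = curveMap ζ t L}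

/-- The graph of the closed operator `v ↦ (Φ(ζ_j(s)) v)_j`, `0 ≤ s ≤ t`. -/
abbrev graph (ζ : Fin n → C(ℝ, 𝒦)) (t : ℝ) : Submodule ℂ (WithLp 2 (H × CurveL2 n H t)) :=
  (S.preGraph ζ t).topologicalClosure

variable (ζ : Fin n → C(ℝ, 𝒦)) {t : ℝ}

theorem mem_graph_of_core {w : H} (hw : w ∈ S.core) {L : 𝒦 →L[ℂ] H} (hL : S.Reg w L) :
    WithLp.toLp 2 (w, curveMap ζ t L) ∈ S.graph ζ t :=
  Submodule.le_topologicalClosure _ (Submodule.subset_span ⟨hw, L, hL, rfl⟩)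

/-- A closed subspace which contains the images of the core contains the graph. -/
theorem graph_le {U : Submodule ℂ (WithLp 2 (H × CurveL2 n H t))}
    (hU : IsClosed (U : Set (WithLp 2 (H × CurveL2 n H t))))
    (h : ∀ w ∈ S.core, ∀ L, S.Reg w L → WithLp.toLp 2 (w, curveMap ζ t L) ∈ U) :
    S.graph ζ t ≤ U := by
  refine Submodule.topologicalClosure_minimal _ (Submodule.span_le.2 ?_) hU
  rintro p ⟨hp, L, hL, hq⟩
  have : p = WithLp.toLp 2 (p.fst, curveMap ζ t L) := by rw [← hq]; rfl
  rw [this]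
  exact h _ hp L hL

/-- An adjoint relation on the core extends to the graph. -/
theorem graph_inner {x : H} {y : CurveL2 n H t}
    (h : ∀ w ∈ S.core, ∀ L, S.Reg w L → ⟪x, w⟫_ℂ = ⟪y, curveMap ζ t L⟫_ℂ)
    {p : WithLp 2 (H × CurveL2 n H t)} (hp : p ∈ S.graph ζ t) :
    ⟪x, p.fst⟫_ℂ = ⟪y, p.snd⟫_ℂ := by
  have := S.graph_le ζ (U := LinearMap.ker
    ((innerSL ℂ x ∘L WithLp.fstL 2 ℂ H (CurveL2 n H t)) -
      (innerSL ℂ y ∘L WithLp.sndL 2 ℂ H (CurveL2 n H t))).toLinearMap)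
    (ContinuousLinearMap.isClosed_ker _) (fun w hw L hL => ?_) hp
  · have h2 : ⟪x, p.fst⟫_ℂ - ⟪y, p.snd⟫_ℂ = 0 := this
    exact sub_eq_zero.1 h2
  · have h2 : ⟪x, w⟫_ℂ - ⟪y, curveMap ζ t L⟫_ℂ = 0 := sub_eq_zero.2 (h w hw L hL)
    exact h2

theorem graph_total (v : H) (h : ∀ p ∈ S.graph ζ t, ⟪v, p.fst⟫_ℂ = 0) : v = 0 := by
  refine S.core_dense.eq_zero_of_inner_left (𝕜 := ℂ) fun w hw => ?_
  obtain ⟨L, hL⟩ := S.core_reg hw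
  exact h _ (S.mem_graph_of_core ζ hw hL)

/-- Since the nice vectors are approximated by the core together with their fields, they lie in
the domain of the closed operator. -/
theorem mem_graph_of_nice {v : H} (hv : v ∈ S.nice) {L : 𝒦 →L[ℂ] H} (hL : S.Reg v L) :
    WithLp.toLp 2 (v, curveMap ζ t L) ∈ S.graph ζ t := by
  have hc : Continuous fun p : H × (𝒦 →L[ℂ] H) =>
      (WithLp.toLp 2 (p.1, curveMap ζ t p.2) : WithLp 2 (H × CurveL2 n H t)) :=
    (WithLp.prod_continuous_toLp 2 _ _).comp (by fun_prop)
  have h := map_mem_closure (t := (S.preGraph ζ t : Set (WithLp 2 (H × CurveL2 n H t)))) hc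
    (S.nice_approx v hv L hL) fun p hp => Submodule.subset_span ⟨hp.1, p.2, hp.2, rfl⟩
  exact h

/-- The operator `g ↦ [φ, Φ(g)]` on the one-particle space, where
`φ = ∫₀ᵗ ∑ j, Φ(ζ_j(s))² ds`. -/
def adOp (t : ℝ) : 𝒦 →L[ℂ] 𝒦 :=
  ∫ s in (0 : ℝ)..t, ∑ j, (2 : ℂ) • (S.comm (ζ j s)).smulRight (ζ j s)

theorem continuous_adOp_integrand :
    Continuous fun s => ∑ j, (2 : ℂ) • (S.comm (ζ j s)).smulRight (ζ j s) := by
  refine continuous_finsetSum _ fun j _ => ?_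
  have : ∀ s, (S.comm (ζ j s)).smulRight (ζ j s) =
      ContinuousLinearMap.smulRightL ℂ 𝒦 𝒦 (S.comm (ζ j s)) (ζ j s) := fun s => rfl
  simp_rw [this]
  fun_prop

theorem adOp_apply [CompleteSpace 𝒦] (t : ℝ) (g : 𝒦) :
    S.adOp ζ t g = ∫ s in (0 : ℝ)..t, ∑ j, (2 * S.comm (ζ j s) g) • ζ j s := by
  unfold adOp
  have := ContinuousLinearMap.intervalIntegral_apply
    ((S.continuous_adOp_integrand ζ).intervalIntegrable (μ := volume) 0 t) g
  rw [this]
  refine intervalIntegral.integral_congr fun s _ => ?_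
  simp [smul_smul]

theorem map_adOp [CompleteSpace 𝒦] [CompleteSpace H] (t : ℝ) (g : 𝒦) (L : 𝒦 →L[ℂ] H) :
    L (S.adOp ζ t g) = ∫ s in (0 : ℝ)..t, ∑ j, (2 * S.comm (ζ j s) g) • L (ζ j s) := by
  rw [adOp_apply, ← ContinuousLinearMap.intervalIntegral_comp_comm]
  · simp only [map_sum, map_smul]
  · refine Continuous.intervalIntegrable ?_ _ _
    fun_prop

/-- The map `v ↦ ([Φ(ζ_j(s)), Φ(g)] v)_j` from vectors to curves. -/
def commCurve (t : ℝ) (g : 𝒦) : H →L[ℂ] CurveL2 n H t :=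
  curveMap ζ t ∘L ContinuousLinearMap.smulRightL ℂ 𝒦 H (S.comm.flip g)

theorem commCurve_apply (g : 𝒦) (v : H) :
    S.commCurve ζ t g v = curveMap ζ t ((S.comm.flip g).smulRight v) := rfl

theorem commCurve_add (f g : 𝒦) :
    S.commCurve ζ t (f + g) = S.commCurve (H := H) ζ t f + S.commCurve ζ t g := by
  ext1 v; simp [commCurve]

theorem commCurve_smul (c : ℂ) (g : 𝒦) :
    S.commCurve ζ t (c • g) = c • S.commCurve (H := H) ζ t g := by
  ext1 v; simp [commCurve]

theorem norm_commCurve_le (t : ℝ) : ∃ C, 0 ≤ C ∧ ∀ g v,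
    ‖S.commCurve (H := H) ζ t g v‖ ≤ C * ‖g‖ * ‖v‖ := by
  obtain ⟨C, hC, h⟩ := (curveMap ζ t : (𝒦 →L[ℂ] H) →L[ℂ] CurveL2 n H t).bound
  refine ⟨C * ‖S.comm.flip‖, by positivity, fun g v => ?_⟩
  rw [commCurve_apply]
  refine (h _).trans ?_
  rw [ContinuousLinearMap.norm_smulRight_apply, mul_assoc C, mul_assoc C]
  gcongr
  exact S.comm.flip.le_opNorm g

theorem comm_conj_right {ζ : Fin n → C(ℝ, 𝒦)} (hζ : ∀ j s, S.conj (ζ j s) = ζ j s)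
    (j : Fin n) (s : ℝ) (g : 𝒦) :
    S.comm (ζ j s) (S.conj g) = -starRingEnd ℂ (S.comm (ζ j s) g) := by
  rw [← S.comm_conj, hζ]

variable [CompleteSpace H]

/-- The map `(q_j)_j ↦ 2 ∫₀ᵗ ∑ j, [Φ(ζ_j(s)), Φ(g)] q_j(s) ds` from curves to vectors; it maps
the curves of a vector `v` to `Φ(adOp g) v`. -/
def smear (t : ℝ) (g : 𝒦) : CurveL2 n H t →L[ℂ] H :=
  (-2 : ℂ) • ContinuousLinearMap.adjoint (S.commCurve ζ t (S.conj g))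

theorem inner_smear (g : 𝒦) (w : H) (q : CurveL2 n H t) :
    ⟪w, S.smear ζ t g q⟫_ℂ = -2 * ⟪S.commCurve ζ t (S.conj g) w, q⟫_ℂ := by
  unfold smear
  rw [_root_.smul_apply, inner_smul_right, ContinuousLinearMap.adjoint_inner_right]

theorem smear_add (f g : 𝒦) :
    S.smear ζ t (f + g) = S.smear (H := H) ζ t f + S.smear ζ t g := by
  simp [smear, commCurve_add]

theorem smear_smul (c : ℂ) (g : 𝒦) :
    S.smear ζ t (c • g) = c • S.smear (H := H) ζ t g := by
  refine ContinuousLinearMap.ext fun q => ext_inner_left ℂ fun w => ?_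
  rw [_root_.smul_apply, inner_smul_right, inner_smear, inner_smear, map_smulₛₗ, commCurve_smul,
    _root_.smul_apply, inner_smul_left, Complex.conj_conj]
  ring

theorem norm_smear_le (t : ℝ) : ∃ C, 0 ≤ C ∧ ∀ g q, ‖S.smear (H := H) ζ t g q‖ ≤
    C * ‖g‖ * ‖q‖ := by
  obtain ⟨C, hC, h⟩ := S.norm_commCurve_le (H := H) ζ t
  obtain ⟨C', hC', h'⟩ := S.conj.bound
  refine ⟨2 * (C * C'), by positivity, fun g q => ?_⟩
  by_contra! hlt
  have h1 := inner_self_eq_norm_sq_to_K (𝕜 := ℂ) (S.smear ζ t g q)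
  rw [inner_smear] at h1
  have h2 := congrArg norm h1
  rw [norm_mul, norm_pow] at h2
  have h3 : ‖(-2 : ℂ)‖ = 2 := by simp
  have h4 : ‖((‖S.smear ζ t g q‖ : ℝ) : ℂ)‖ = ‖S.smear ζ t g q‖ := by simp
  have h5 := norm_inner_le_norm (𝕜 := ℂ) (S.commCurve ζ t (S.conj g) (S.smear ζ t g q)) q
  have h6 := h (S.conj g) (S.smear ζ t g q)
  have h7 : ‖S.smear ζ t g q‖ ^ 2 ≤ 2 * ((C * (C' * ‖g‖) * ‖S.smear ζ t g q‖) * ‖q‖) := by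
    calc ‖S.smear ζ t g q‖ ^ 2 = 2 * ‖⟪S.commCurve ζ t (S.conj g) (S.smear ζ t g q), q⟫_ℂ‖ := by
          rw [← h3, h2]; congr 1; exact h4.symm
      _ ≤ 2 * ((C * (C' * ‖g‖) * ‖S.smear ζ t g q‖) * ‖q‖) := by
          gcongr
          refine h5.trans (mul_le_mul_of_nonneg_right (h6.trans ?_) (norm_nonneg _))
          gcongr
          exact h' g
  have hpos : 0 < ‖S.smear ζ t g q‖ := lt_of_le_of_lt (by positivity) hlt
  nlinarith [mul_lt_mul_of_pos_left hlt hpos]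

variable {ζ}

/-- Symmetry of the form `(p, p') ↦ ∫₀ᵗ ∑ j, [Φ(ζ_j(s)), Φ(g)] ⟪Φ(ζ_j(s)) p, p'⟫ ds`. -/
theorem inner_commCurve_symm (hζ : ∀ j s, S.conj (ζ j s) = ζ j s) (ht : 0 ≤ t) (g : 𝒦)
    {p p' : WithLp 2 (H × CurveL2 n H t)} (hp : p ∈ S.graph ζ t) (hp' : p' ∈ S.graph ζ t) :
    ⟪p.snd, S.commCurve ζ t g p'.fst⟫_ℂ = -⟪S.commCurve ζ t (S.conj g) p.fst, p'.snd⟫_ℂ := by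
  have base : ∀ w ∈ S.core, ∀ L, S.Reg w L → ∀ w' ∈ S.core, ∀ L', S.Reg w' L' →
      ⟪curveMap ζ t L, S.commCurve ζ t g w'⟫_ℂ =
        -⟪S.commCurve ζ t (S.conj g) w, curveMap ζ t L'⟫_ℂ := by
    intro w _ L hL w' _ L' hL'
    rw [commCurve_apply, commCurve_apply, inner_curveMap ζ ht, inner_curveMap ζ ht,
      ← intervalIntegral.integral_neg]
    refine intervalIntegral.integral_congr fun s _ => ?_
    simp only [← Finset.sum_neg_distrib, ContinuousLinearMap.smulRight_apply, inner_smul_left,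
      inner_smul_right, ContinuousLinearMap.flip_apply]
    refine Finset.sum_congr rfl fun j _ => ?_
    rw [S.comm_conj_right hζ, map_neg, Complex.conj_conj, neg_mul, neg_neg,
      ← S.reg_inner w' L' w L hL' hL, hζ]
  have step : ∀ w' ∈ S.core, ∀ L', S.Reg w' L' →
      ⟪p.snd, S.commCurve ζ t g w'⟫_ℂ =
        -⟪S.commCurve ζ t (S.conj g) p.fst, curveMap ζ t L'⟫_ℂ := by
    intro w' hw' L' hL'
    have h := S.graph_inner ζ (x := -ContinuousLinearMap.adjoint (S.commCurve ζ t (S.conj g))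
      (curveMap ζ t L')) (y := S.commCurve ζ t g w') (fun w hw L hL => ?_) hp
    · have h2 := congrArg (starRingEnd ℂ) h
      rw [inner_conj_symm, inner_conj_symm, inner_neg_right,
        ContinuousLinearMap.adjoint_inner_right] at h2
      exact h2.symm
    · have h2 := congrArg (starRingEnd ℂ) (base w hw L hL w' hw' L' hL')
      rw [map_neg, inner_conj_symm, inner_conj_symm] at h2
      rw [inner_neg_left, ContinuousLinearMap.adjoint_inner_left, h2]
  have h := S.graph_inner ζ (x := ContinuousLinearMap.adjoint (S.commCurve ζ t g) p.snd)
    (y := -S.commCurve ζ t (S.conj g) p.fst) (fun w hw L hL => ?_) hp'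
  · rwa [ContinuousLinearMap.adjoint_inner_left, inner_neg_left] at h
  · rw [ContinuousLinearMap.adjoint_inner_left, inner_neg_left]
    exact step w hw L hL

/-- The value of `φ = ∫₀ᵗ ∑ j, Φ(ζ_j(s))² ds` on a vector whose images under the products
`Φ(g) Φ(h)` are `M h g`. -/
def phiVec (ζ : Fin n → C(ℝ, 𝒦)) (t : ℝ) (M : 𝒦 →L[ℂ] 𝒦 →L[ℂ] H) : H :=
  ∫ s in (0 : ℝ)..t, ∑ j, M (ζ j s) (ζ j s)

/-- A nice vector `v` belongs to the domain of `φ`, with the value `phiVec` there: it is the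
resolvent of `v + φ v`. -/
theorem graphResolvent_nice (hζ : ∀ j s, S.conj (ζ j s) = ζ j s) (ht : 0 ≤ t) {v : H}
    (hv : v ∈ S.nice) {L : 𝒦 →L[ℂ] H} (hL : S.Reg v L) {M : 𝒦 →L[ℂ] 𝒦 →L[ℂ] H}
    (hM : ∀ h, S.Reg (L h) (M h)) :
    graphResolvent (S.graph ζ t) (v + phiVec ζ t M) = v ∧
      graphSnd (S.graph ζ t) (v + phiVec ζ t M) = curveMap ζ t L := by
  refine graphResolvent_unique _ (S.mem_graph_of_nice ζ hv hL) fun p hp => ?_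
  refine S.graph_inner ζ (fun w _ Lw hLw => ?_) hp
  rw [add_sub_cancel_left, phiVec, intervalIntegral_inner, inner_curveMap ζ ht]
  · refine intervalIntegral.integral_congr fun s _ => ?_
    simp only [sum_inner]
    refine Finset.sum_congr rfl fun j _ => ?_
    have := S.reg_inner w Lw _ _ hLw (hM (ζ j s)) (ζ j s)
    rwa [hζ] at this
  · refine Continuous.intervalIntegrable ?_ _ _
    fun_prop

variable [CompleteSpace 𝒦]

/-- On the curve `s ↦ Φ(ζ_j(s)) v` the map `smear` returns the commutator `[φ, Φ(g)] v = Φ(D g)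
v`. -/
theorem smear_curveMap (hζ : ∀ j s, S.conj (ζ j s) = ζ j s) (ht : 0 ≤ t) (g : 𝒦)
    (L : 𝒦 →L[ℂ] H) : S.smear ζ t g (curveMap ζ t L) = L (S.adOp ζ t g) := by
  refine ext_inner_left ℂ fun w => ?_
  rw [inner_smear, commCurve_apply, inner_curveMap ζ ht, map_adOp, inner_intervalIntegral,
    ← intervalIntegral.integral_const_mul]
  · refine intervalIntegral.integral_congr fun s _ => ?_
    simp only [inner_sum, Finset.mul_sum, ContinuousLinearMap.smulRight_apply, inner_smul_left,
      inner_smul_right, ContinuousLinearMap.flip_apply]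
    refine Finset.sum_congr rfl fun j _ => ?_
    rw [S.comm_conj_right hζ, map_neg, Complex.conj_conj]
    ring
  · refine Continuous.intervalIntegrable ?_ _ _
    fun_prop

/-- The commutator `[φ, Φ(g)] = Φ(D g)`, in the weak sense, on the whole domain of the form of
`φ`. -/
theorem inner_smear_graph (hζ : ∀ j s, S.conj (ζ j s) = ζ j s) (ht : 0 ≤ t) (g : 𝒦) {w : H}
    {L : 𝒦 →L[ℂ] H} (hL : S.Reg w L) {p : WithLp 2 (H × CurveL2 n H t)}
    (hp : p ∈ S.graph ζ t) :
    ⟪w, S.smear ζ t g p.snd⟫_ℂ = ⟪L (S.conj (S.adOp ζ t g)), p.fst⟫_ℂ := by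
  have h := S.graph_inner ζ (x := L (S.conj (S.adOp ζ t g)))
    (y := ContinuousLinearMap.adjoint (S.smear ζ t g) w) (fun v _ Lv hv => ?_) hp
  · rw [h, ContinuousLinearMap.adjoint_inner_left]
  · rw [ContinuousLinearMap.adjoint_inner_left, S.smear_curveMap hζ ht]
    exact S.reg_inner v Lv w L hv hL _

end FieldSystem
end Fields

/-! ### Fields and the semigroup of a quadratic form of the fields -/

namespace FieldSystem

variable {n : ℕ} {H 𝒦 : Type*} [NormedAddCommGroup H] [InnerProductSpace ℂ H]
  [NormedAddCommGroup 𝒦] [NormedSpace ℂ 𝒦] (S : FieldSystem H 𝒦)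
  {ζ : Fin n → C(ℝ, 𝒦)} {t : ℝ}

/-- A bounded approximation of a field preserves the graph, up to its bounded commutators with
the fields `Φ(ζ_j(s))`. -/
theorem approx_mem_graph {core : Submodule ℂ H} (hcore : core = S.core) {g : 𝒦}
    {B : ℕ → H →L[ℂ] H} {K : ℕ → H →L[ℂ] 𝒦 →L[ℂ] H}
    (hB : IsFieldApprox S.Reg core S.comm g B K) (m : ℕ)
    {p : WithLp 2 (H × CurveL2 n H t)} (hp : p ∈ S.graph ζ t) :
    WithLp.toLp 2 (B m p.fst, curveLift n t (B m) p.snd + (curveMap ζ t ∘L K m) p.fst) ∈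
      S.graph ζ t := by
  let A : WithLp 2 (H × CurveL2 n H t) →L[ℂ] WithLp 2 (H × CurveL2 n H t) :=
    (WithLp.prodContinuousLinearEquiv 2 ℂ H (CurveL2 n H t)).symm.toContinuousLinearMap ∘L
      ((B m ∘L WithLp.fstL 2 ℂ H (CurveL2 n H t)).prod
        (curveLift n t (B m) ∘L WithLp.sndL 2 ℂ H (CurveL2 n H t) +
          (curveMap ζ t ∘L K m) ∘L WithLp.fstL 2 ℂ H (CurveL2 n H t)))
  have h := S.graph_le ζ (U := (S.graph ζ t).comap A.toLinearMap)
    ((Submodule.isClosed_topologicalClosure _).preimage A.continuous) (fun w hw L hL => ?_) hp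
  · exact h
  · change WithLp.toLp 2 (B m w, curveLift n t (B m) (curveMap ζ t L) +
      curveMap ζ t (K m w)) ∈ S.graph ζ t
    rw [curveLift_curveMap, ← map_add]
    subst hcore
    exact S.mem_graph_of_core ζ (hB.map_core m w hw) (hB.map_reg m w L hL)

variable [CompleteSpace H]

/-- The semigroup `c ↦ e^{-cφ}`, `φ = ∫₀ᵗ ∑ j, Φ(ζ_j(s))² ds`. -/
def semigroup (ζ : Fin n → C(ℝ, 𝒦)) (t c : ℝ) : H →L[ℂ] H :=
  contractionSemigroup (graphResolvent (S.graph ζ t)) c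

theorem denseRange_resolvent (ζ : Fin n → C(ℝ, 𝒦)) (t : ℝ) :
    DenseRange (graphResolvent (S.graph ζ t)) :=
  denseRange_graphResolvent _ (S.graph_total ζ)

theorem continuous_semigroup (ζ : Fin n → C(ℝ, 𝒦)) (t : ℝ) (u : H) :
    Continuous fun c => S.semigroup ζ t c u :=
  continuous_contractionSemigroup (graphResolvent_isPositive _) (graphResolvent_norm_le _)
    (S.denseRange_resolvent ζ t) u

theorem norm_semigroup_le (ζ : Fin n → C(ℝ, 𝒦)) (t c : ℝ) (u : H) :
    ‖S.semigroup ζ t c u‖ ≤ ‖u‖ :=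
  norm_contractionSemigroup_apply_le (graphResolvent_isPositive _) (graphResolvent_norm_le _) c u

theorem semigroup_zero (ζ : Fin n → C(ℝ, 𝒦)) (t : ℝ) : S.semigroup ζ t 0 = 1 :=
  contractionSemigroup_of_nonpos (graphResolvent_isPositive _) le_rfl

theorem semigroup_add (ζ : Fin n → C(ℝ, 𝒦)) (t : ℝ) {c c' : ℝ} (hc : 0 ≤ c) (hc' : 0 ≤ c')
    (u : H) : S.semigroup ζ t c (S.semigroup ζ t c' u) = S.semigroup ζ t (c + c') u :=
  contractionSemigroup_add (graphResolvent_isPositive _) (graphResolvent_norm_le _) hc hc' u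

theorem inner_semigroup (ζ : Fin n → C(ℝ, 𝒦)) (t c : ℝ) (u v : H) :
    ⟪S.semigroup ζ t c u, v⟫_ℂ = ⟪u, S.semigroup ζ t c v⟫_ℂ :=
  inner_contractionSemigroup _ c u v

theorem semigroup_mem_graph (ζ : Fin n → C(ℝ, 𝒦)) (t c : ℝ) (u : H) :
    WithLp.toLp 2 (S.semigroup ζ t c (graphResolvent (S.graph ζ t) u),
      graphSnd (S.graph ζ t) (S.semigroup ζ t c u)) ∈ S.graph ζ t := by
  rw [semigroup, contractionSemigroup_comm (graphResolvent_isPositive _)]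
  exact graphResolvent_mem _ _

set_option maxHeartbeats 800000 in
/-- First order commutation of the semigroup with a field, in the weak sense. -/
theorem inner_field_semigroup (hζ : ∀ j s, S.conj (ζ j s) = ζ j s) (ht : 0 ≤ t) {c : ℝ}
    (hc : 0 ≤ c) {μ ν : H} {Lw Lv : 𝒦 →L[ℂ] H}
    (hw : S.Reg (graphResolvent (S.graph ζ t) μ) Lw)
    (hv : S.Reg (graphResolvent (S.graph ζ t) ν) Lv) (g : 𝒦) :
    ⟪Lw (S.conj g), S.semigroup ζ t c (graphResolvent (S.graph ζ t) ν)⟫_ℂ -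
      ⟪S.semigroup ζ t c (graphResolvent (S.graph ζ t) μ), Lv g⟫_ℂ =
    ∫ r in (0 : ℝ)..c, ⟪S.semigroup ζ t (c - r) (graphResolvent (S.graph ζ t) μ),
      S.smear ζ t g (graphSnd (S.graph ζ t) (S.semigroup ζ t r ν))⟫_ℂ := by
  set G := graphResolvent (S.graph ζ t) with hGdef
  set Y := graphSnd (S.graph ζ t) with hYdef
  have hcont := S.continuous_semigroup ζ t
  have hcont' : ∀ u, Continuous fun r => S.semigroup ζ t (c - r) u := fun u =>
    (hcont u).comp (by fun_prop : Continuous fun r : ℝ => c - r)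
  obtain ⟨C, hC, hsm⟩ := S.norm_smear_le (H := H) ζ t
  have hint : ∀ g, IntervalIntegrable (fun r => ⟪S.semigroup ζ t (c - r) (G μ),
      S.smear ζ t g (Y (S.semigroup ζ t r ν))⟫_ℂ) volume 0 c := fun g =>
    Continuous.intervalIntegrable ((hcont' _).inner
      ((S.smear ζ t g).continuous.comp (Y.continuous.comp (hcont ν)))) _ _
  -- the defect of the relation is a continuous linear functional of `g`, so that it suffices to
  -- consider those `g` for which `Φ(g)` has bounded approximations
  let F : 𝒦 →ₗ[ℂ] ℂ :=
    { toFun := fun g => ⟪Lw (S.conj g), S.semigroup ζ t c (G ν)⟫_ℂ -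
        ⟪S.semigroup ζ t c (G μ), Lv g⟫_ℂ -
        ∫ r in (0 : ℝ)..c, ⟪S.semigroup ζ t (c - r) (G μ),
          S.smear ζ t g (Y (S.semigroup ζ t r ν))⟫_ℂ
      map_add' := fun f g => by
        simp only [map_add, inner_add_left, inner_add_right, smear_add, _root_.add_apply]
        rw [intervalIntegral.integral_add (hint f) (hint g)]
        ring
      map_smul' := fun a g => by
        simp only [map_smulₛₗ, inner_smul_left, inner_smul_right, smear_smul, _root_.smul_apply,
          RingHom.id_apply, Complex.conj_conj, smul_eq_mul]
        rw [intervalIntegral.integral_const_mul]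
        ring }
  have hFc : Continuous F := by
    refine AddMonoidHomClass.continuous_of_bound F
      (‖Lw‖ * ‖S.conj‖ * ‖G ν‖ + ‖G μ‖ * ‖Lv‖ + c * (‖G μ‖ * (C * (‖Y‖ * ‖ν‖)))) fun g => ?_
    have b1 : ‖⟪Lw (S.conj g), S.semigroup ζ t c (G ν)⟫_ℂ‖ ≤ ‖Lw‖ * ‖S.conj‖ * ‖G ν‖ * ‖g‖ := by
      refine (norm_inner_le_norm _ _).trans ?_
      calc _ ≤ (‖Lw‖ * (‖S.conj‖ * ‖g‖)) * ‖G ν‖ := by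
            gcongr
            · exact Lw.le_opNorm_of_le (S.conj.le_opNorm g)
            · exact S.norm_semigroup_le ζ t c _
        _ = _ := by ring
    have b2 : ‖⟪S.semigroup ζ t c (G μ), Lv g⟫_ℂ‖ ≤ ‖G μ‖ * ‖Lv‖ * ‖g‖ := by
      refine (norm_inner_le_norm _ _).trans ?_
      calc _ ≤ ‖G μ‖ * (‖Lv‖ * ‖g‖) := by
            gcongr
            · exact S.norm_semigroup_le ζ t c _
            · exact Lv.le_opNorm g
        _ = _ := by ring
    have b3 : ‖∫ r in (0 : ℝ)..c, ⟪S.semigroup ζ t (c - r) (G μ),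
          S.smear ζ t g (Y (S.semigroup ζ t r ν))⟫_ℂ‖ ≤
          c * (‖G μ‖ * (C * (‖Y‖ * ‖ν‖))) * ‖g‖ := by
      refine (intervalIntegral.norm_integral_le_of_norm_le_const
        (C := ‖G μ‖ * (C * ‖g‖ * (‖Y‖ * ‖ν‖))) fun r _ => ?_).trans (le_of_eq ?_)
      · refine (norm_inner_le_norm _ _).trans ?_
        gcongr
        · exact S.norm_semigroup_le ζ t _ _
        · refine (hsm g _).trans ?_
          gcongr
          exact Y.le_opNorm_of_le (S.norm_semigroup_le ζ t r ν)
      · rw [sub_zero, abs_of_nonneg hc]; ring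
    calc ‖F g‖ ≤ _ := (norm_sub_le _ _).trans (add_le_add (norm_sub_le _ _) le_rfl)
      _ ≤ _ := add_le_add (add_le_add b1 b2) b3
      _ = _ := by ring
  have hker : LinearMap.ker F = ⊤ := by
    refine S.approx _ (isClosed_singleton.preimage hFc) fun g B B' K K' hB hB' hadj => ?_
    change ⟪Lw (S.conj g), S.semigroup ζ t c (G ν)⟫_ℂ - ⟪S.semigroup ζ t c (G μ), Lv g⟫_ℂ -
        ∫ r in (0 : ℝ)..c, ⟪S.semigroup ζ t (c - r) (G μ),
          S.smear ζ t g (Y (S.semigroup ζ t r ν))⟫_ℂ = 0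
    rw [sub_eq_zero]
    -- for the bounded approximations the relation is Duhamel's formula
    have e : ∀ m, ⟪B' m (G μ), S.semigroup ζ t c (G ν)⟫_ℂ -
        ⟪S.semigroup ζ t c (G μ), B m (G ν)⟫_ℂ =
        ∫ r in (0 : ℝ)..c, (⟪Y (S.semigroup ζ t (c - r) μ),
            curveMap ζ t (K m (S.semigroup ζ t r (G ν)))⟫_ℂ -
          ⟪curveMap ζ t (K' m (S.semigroup ζ t (c - r) (G μ))), Y (S.semigroup ζ t r ν)⟫_ℂ) := by
      intro m
      rw [hadj m]
      exact inner_contractionSemigroup_commutator (S.graph ζ t) (S.denseRange_resolvent ζ t)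
        (hadj m) (inner_curveLift t (hadj m)) (fun p hp => S.approx_mem_graph rfl hB m hp)
        (fun p hp => S.approx_mem_graph rfl hB' m hp) hc μ ν
    have l1 := ((hB'.tendsto_field _ _ hw).inner (𝕜 := ℂ) (tendsto_const_nhds (x :=
      S.semigroup ζ t c (G ν)))).sub
      ((tendsto_const_nhds (x := S.semigroup ζ t c (G μ))).inner (𝕜 := ℂ) (hB.tendsto_field _ _ hv))
    -- pass to the limit under the integral, by dominated convergence
    refine tendsto_nhds_unique l1 ?_
    rw [tendsto_congr e]
    obtain ⟨b, hb⟩ := hB.bound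
    obtain ⟨b', hb'⟩ := hB'.bound
    obtain ⟨Z, hZ0, hZ⟩ := (curveMap ζ t : (𝒦 →L[ℂ] H) →L[ℂ] CurveL2 n H t).bound
    refine intervalIntegral.tendsto_integral_filter_of_dominated_convergence
      (fun _ => ‖Y‖ * ‖μ‖ * (Z * (b * ‖G ν‖)) + Z * (b' * ‖G μ‖) * (‖Y‖ * ‖ν‖)) ?_ ?_ ?_ ?_
    · refine Eventually.of_forall fun m => Continuous.aestronglyMeasurable ?_
      exact ((Y.continuous.comp (hcont' μ)).inner ((curveMap ζ t ∘L K m).continuous.comp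
        (hcont (G ν)))).sub (((curveMap ζ t ∘L K' m).continuous.comp (hcont' (G μ))).inner
          (Y.continuous.comp (hcont ν)))
    · refine Eventually.of_forall fun m => Eventually.of_forall fun r _ => ?_
      refine (norm_sub_le _ _).trans (add_le_add ((norm_inner_le_norm _ _).trans ?_)
        ((norm_inner_le_norm _ _).trans ?_))
      · refine mul_le_mul (Y.le_opNorm_of_le (S.norm_semigroup_le ζ t _ μ)) ((hZ _).trans ?_)
          (norm_nonneg _) (by positivity)
        exact mul_le_mul_of_nonneg_left
          ((K m).le_of_opNorm_le_of_le (hb m) (S.norm_semigroup_le ζ t r _)) hZ0.le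
      · have hb0 : 0 ≤ b' := (norm_nonneg (K' m)).trans (hb' m)
        refine mul_le_mul ((hZ _).trans ?_) (Y.le_opNorm_of_le (S.norm_semigroup_le ζ t _ ν))
          (norm_nonneg _) (by positivity)
        exact mul_le_mul_of_nonneg_left
          ((K' m).le_of_opNorm_le_of_le (hb' m) (S.norm_semigroup_le ζ t _ _)) hZ0.le
    · exact intervalIntegrable_const
    · refine Eventually.of_forall fun r _ => ?_
      have h1 := ((curveMap ζ t : (𝒦 →L[ℂ] H) →L[ℂ] CurveL2 n H t).continuous.tendsto _).comp
        (hB.tendsto_comm (S.semigroup ζ t r (G ν)))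
      have h2 := ((curveMap ζ t : (𝒦 →L[ℂ] H) →L[ℂ] CurveL2 n H t).continuous.tendsto _).comp
        (hB'.tendsto_comm (S.semigroup ζ t (c - r) (G μ)))
      have h3 := ((tendsto_const_nhds (x := Y (S.semigroup ζ t (c - r) μ))).inner (𝕜 := ℂ) h1).sub
        (h2.inner (𝕜 := ℂ) (tendsto_const_nhds (x := Y (S.semigroup ζ t r ν))))
      have h4 := S.inner_commCurve_symm hζ ht g (S.semigroup_mem_graph ζ t (c - r) μ)
        (S.semigroup_mem_graph ζ t r ν)
      simp only [WithLp.toLp_fst, WithLp.toLp_snd] at h4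
      -- by symmetry, the two terms of the limit add up to `smear`, which has the factor `2` of
      -- `[Φ(ζ)², Φ(g)] = 2 [Φ(ζ), Φ(g)] Φ(ζ)`
      have e2 : ⟪S.semigroup ζ t (c - r) (G μ), S.smear ζ t g (Y (S.semigroup ζ t r ν))⟫_ℂ =
          ⟪Y (S.semigroup ζ t (c - r) μ), S.commCurve ζ t g (S.semigroup ζ t r (G ν))⟫_ℂ -
          ⟪S.commCurve ζ t (S.conj g) (S.semigroup ζ t (c - r) (G μ)),
            Y (S.semigroup ζ t r ν)⟫_ℂ := by
        rw [h4, inner_smear]; ring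
      rw [e2]
      exact h3
  have : g ∈ LinearMap.ker F := by rw [hker]; trivial
  exact sub_eq_zero.1 this

theorem continuous_semigroup_comp (ζ : Fin n → C(ℝ, 𝒦)) (t : ℝ) {X : Type*} [TopologicalSpace X]
    {f : X → ℝ} {u : X → H} (hf : Continuous f) (hu : Continuous u) :
    Continuous fun x => S.semigroup ζ t (f x) (u x) := by
  rw [continuous_iff_continuousAt]
  intro x
  have h1 : Tendsto (fun y => S.semigroup ζ t (f y) (u y - u x)) (𝓝 x) (𝓝 0) := by
    refine squeeze_zero_norm (fun y => S.norm_semigroup_le ζ t _ _) ?_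
    have : Continuous fun y => ‖u y - u x‖ := by fun_prop
    simpa using this.tendsto x
  have h2 := ((S.continuous_semigroup ζ t (u x)).comp hf).tendsto x
  have h3 := h1.add h2
  simp only [Function.comp_apply, zero_add] at h3
  refine h3.congr fun y => ?_
  rw [map_sub, sub_add_cancel]

variable [CompleteSpace 𝒦]

theorem continuous_exp_smul (D : 𝒦 →L[ℂ] 𝒦) : Continuous fun r : ℝ => NormedSpace.exp (r • D) :=
  continuous_iff_continuousAt.2 fun r =>
    (hasDerivAt_exp_smul_const (𝕂 := ℝ) D r).continuousAt

theorem integral_exp_smul_apply (D : 𝒦 →L[ℂ] 𝒦) (c : ℝ) (g : 𝒦) :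
    ∫ r in (0 : ℝ)..c, NormedSpace.exp (r • D) (D g) = NormedSpace.exp (c • D) g - g := by
  have hd : ∀ r : ℝ, HasDerivAt (fun r : ℝ => NormedSpace.exp (r • D) g)
      (NormedSpace.exp (r • D) (D g)) r := by
    intro r
    have h := hasDerivAt_exp_smul_const (𝕂 := ℝ) D r
    have h2 := ((ContinuousLinearMap.apply ℂ 𝒦 g).restrictScalars ℝ).hasFDerivAt.comp_hasDerivAt r h
    exact h2
  have hc : Continuous fun r : ℝ => NormedSpace.exp (r • D) (D g) := by
    have := continuous_exp_smul D
    fun_prop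
  rw [intervalIntegral.integral_eq_sub_of_hasDerivAt (fun r _ => hd r)
    (hc.intervalIntegrable _ _)]
  simp

set_option maxHeartbeats 800000 in
/-- The semigroup intertwines the fields: `Φ(g) e^{-cφ} v = e^{-cφ} Φ(e^{cD} g) v`,
where `Φ(D g) = [φ, Φ(g)]`. -/
theorem reg_semigroup (hζ : ∀ j s, S.conj (ζ j s) = ζ j s) (ht : 0 ≤ t) {c : ℝ} (hc : 0 ≤ c)
    {v : H} (hv : v ∈ S.nice) {L : 𝒦 →L[ℂ] H} (hL : S.Reg v L) :
    S.Reg (S.semigroup ζ t c v)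
      (S.semigroup ζ t c ∘L (L ∘L NormedSpace.exp (c • S.adOp ζ t))) := by
  set D := S.adOp ζ t with hD
  obtain ⟨L₀, M, hL₀, hM⟩ := S.nice_reg v hv
  obtain rfl := S.reg_unique hL hL₀
  obtain ⟨ν, hν⟩ : ∃ ν, graphResolvent (S.graph ζ t) ν = v :=
    ⟨_, (S.graphResolvent_nice hζ ht hv hL fun h => (hM h).2).1⟩
  set N : ℝ → CurveL2 n H t := fun r => graphSnd (S.graph ζ t) (S.semigroup ζ t r ν) with hN
  have hNc : Continuous N := (graphSnd (S.graph ζ t)).continuous.comp (S.continuous_semigroup ζ t ν)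
  obtain ⟨C, hC, hsm⟩ := S.norm_smear_le (H := H) ζ t
  have hcs : ∀ (c : ℝ) (g : 𝒦), Continuous fun r =>
      S.semigroup ζ t (c - r) (S.smear ζ t g (N r)) := fun c g =>
    S.continuous_semigroup_comp ζ t (by fun_prop) ((S.smear ζ t g).continuous.comp hNc)
  have hexp := continuous_exp_smul D
  -- the first order commutation relation, for all `c`
  have key1 : ∀ c, 0 ≤ c → ∀ w ∈ S.core, ∀ Lw, S.Reg w Lw → ∀ g,
      ⟪Lw (S.conj g), S.semigroup ζ t c v⟫_ℂ = ⟪w, S.semigroup ζ t c (L g) +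
        ∫ r in (0 : ℝ)..c, S.semigroup ζ t (c - r) (S.smear ζ t g (N r))⟫_ℂ := by
    intro c hc w hw Lw hLw g
    obtain ⟨L₁, M₁, hL₁, hM₁⟩ := S.nice_reg w (S.core_le hw)
    obtain ⟨μ, hμ⟩ : ∃ μ, graphResolvent (S.graph ζ t) μ = w :=
      ⟨_, (S.graphResolvent_nice hζ ht (S.core_le hw) hL₁ fun h => (hM₁ h).2).1⟩
    have h := S.inner_field_semigroup hζ ht hc (μ := μ) (ν := ν) (Lw := Lw) (Lv := L)
      (by rwa [hμ]) (by rwa [hν]) g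
    rw [hμ, hν, sub_eq_iff_eq_add'] at h
    rw [h, inner_add_right, inner_semigroup, inner_intervalIntegral _ ((hcs c g).intervalIntegrable _ _)]
    simp only [inner_semigroup, hN]
  -- the pairing with the graph shows that `smear h (N c)` is a weak form of `Φ(D h) e^{-cφ} v`, to
  -- which the first order relation applies
  have key2 : ∀ c, 0 ≤ c → ∀ h, S.smear ζ t h (N c) = S.semigroup ζ t c (L (D h)) +
        ∫ r in (0 : ℝ)..c, S.semigroup ζ t (c - r) (S.smear ζ t (D h) (N r)) := by
    intro c hc h
    refine S.eq_of_core_inner fun w hw => ?_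
    obtain ⟨Lw, hLw⟩ := S.core_reg hw
    rw [← key1 c hc w hw Lw hLw]
    have := S.inner_smear_graph hζ ht h hLw (S.semigroup_mem_graph ζ t c ν)
    rw [hν] at this
    exact this
  -- the defect of the expected value `e^{-rφ} Φ(e^{rD} D h) v`
  set η : ℝ → 𝒦 → H := fun r h => S.smear ζ t h (N r) -
    S.semigroup ζ t r (L (NormedSpace.exp (r • D) (D h))) with hη
  have hηc : ∀ h, Continuous fun r => η r h := fun h =>
    ((S.smear ζ t h).continuous.comp hNc).sub
      (S.continuous_semigroup_comp ζ t continuous_id (by fun_prop))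
  have expint : ∀ c, 0 ≤ c → ∀ g, ∫ r in (0 : ℝ)..c, S.semigroup ζ t (c - r)
      (S.semigroup ζ t r (L (NormedSpace.exp (r • D) (D g)))) =
      S.semigroup ζ t c (L (NormedSpace.exp (c • D) g)) - S.semigroup ζ t c (L g) := by
    intro c hc g
    have e : ∫ r in (0 : ℝ)..c, S.semigroup ζ t (c - r)
        (S.semigroup ζ t r (L (NormedSpace.exp (r • D) (D g)))) =
        ∫ r in (0 : ℝ)..c, (S.semigroup ζ t c ∘L L) (NormedSpace.exp (r • D) (D g)) := by
      refine intervalIntegral.integral_congr fun r hr => ?_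
      rw [Set.uIcc_of_le hc] at hr
      simp only [S.semigroup_add ζ t (sub_nonneg.2 hr.2) hr.1, sub_add_cancel,
        ContinuousLinearMap.comp_apply]
    rw [e, ContinuousLinearMap.intervalIntegral_comp_comm _
      (Continuous.intervalIntegrable (by fun_prop) _ _), integral_exp_smul_apply, map_sub]
    rfl
  -- the defect solves a homogeneous Volterra equation
  have key3 : ∀ c, 0 ≤ c → ∀ h, η c h = ∫ r in (0 : ℝ)..c, S.semigroup ζ t (c - r) (η r (D h)) := by
    intro c hc h
    have e1 : ∀ r, S.semigroup ζ t (c - r) (η r (D h)) =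
        S.semigroup ζ t (c - r) (S.smear ζ t (D h) (N r)) - S.semigroup ζ t (c - r)
          (S.semigroup ζ t r (L (NormedSpace.exp (r • D) (D (D h))))) := fun r => map_sub _ _ _
    simp only [e1]
    rw [intervalIntegral.integral_sub ((hcs c _).intervalIntegrable _ _), expint c hc]
    · simp only [hη]
      rw [key2 c hc h]
      abel
    · refine Continuous.intervalIntegrable ?_ _ _
      exact S.continuous_semigroup_comp ζ t (by fun_prop)
        (S.continuous_semigroup_comp ζ t continuous_id (by fun_prop))
  have bd : ∃ A, 0 ≤ A ∧ ∀ r ∈ Set.Icc (0 : ℝ) c, ∀ h, ‖η r h‖ ≤ A * ‖h‖ := by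
    obtain ⟨E, hE⟩ := isCompact_Icc.exists_bound_of_continuousOn
      (hexp.continuousOn (s := Set.Icc 0 c))
    have hE0 : 0 ≤ E := (norm_nonneg _).trans (hE 0 ⟨le_rfl, hc⟩)
    refine ⟨C * (‖graphSnd (S.graph ζ t)‖ * ‖ν‖) + ‖L‖ * (E * ‖D‖), by positivity,
      fun r hr h => ?_⟩
    refine (norm_sub_le _ _).trans ?_
    have b1 : ‖S.smear ζ t h (N r)‖ ≤ C * ‖h‖ * (‖graphSnd (S.graph ζ t)‖ * ‖ν‖) := by
      refine (hsm h _).trans (mul_le_mul_of_nonneg_left ?_ (by positivity))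
      exact (graphSnd (S.graph ζ t)).le_opNorm_of_le (S.norm_semigroup_le ζ t r ν)
    have b2 : ‖S.semigroup ζ t r (L (NormedSpace.exp (r • D) (D h)))‖ ≤
        ‖L‖ * (E * (‖D‖ * ‖h‖)) := by
      refine (S.norm_semigroup_le ζ t r _).trans (L.le_opNorm_of_le ?_)
      exact (NormedSpace.exp (r • D)).le_of_opNorm_le_of_le (hE r hr) (D.le_opNorm h)
    calc _ ≤ _ := add_le_add b1 b2
      _ = _ := by ring
  obtain ⟨A, hA, hηA⟩ := bd
  -- iterations of the equation give a factorial decay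
  have iter : ∀ k : ℕ, ∀ r ∈ Set.Icc (0 : ℝ) c, ∀ h,
      ‖η r h‖ ≤ A * (‖D‖ ^ k * r ^ k / k.factorial) * ‖h‖ := by
    intro k
    induction k with
    | zero => intro r hr h; simpa using hηA r hr h
    | succ k ih =>
      intro r hr h
      rw [key3 r hr.1 h]
      have hb : ∀ s ∈ Set.Ioc (0 : ℝ) r, ‖S.semigroup ζ t (r - s) (η s (D h))‖ ≤
          A * (‖D‖ ^ k / k.factorial) * (‖D‖ * ‖h‖) * s ^ k := by
        intro s hs
        refine (S.norm_semigroup_le ζ t _ _).trans ((ih s ⟨hs.1.le, hs.2.trans hr.2⟩ _).trans ?_)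
        have hs0 : 0 ≤ s := hs.1.le
        calc A * (‖D‖ ^ k * s ^ k / k.factorial) * ‖D h‖ ≤
            A * (‖D‖ ^ k * s ^ k / k.factorial) * (‖D‖ * ‖h‖) := by
              gcongr
              exact D.le_opNorm h
          _ = _ := by ring
      refine (intervalIntegral.norm_integral_le_of_norm_le hr.1
        (Eventually.of_forall fun s hs => hb s hs)
        (Continuous.intervalIntegrable (by fun_prop) _ _)).trans (le_of_eq ?_)
      rw [intervalIntegral.integral_const_mul, integral_pow, Nat.factorial_succ]
      push_cast
      field_simp
      simp only [pow_succ]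
      ring
  have hη0 : ∀ r ∈ Set.Icc (0 : ℝ) c, ∀ h, η r h = 0 := by
    intro r hr h
    have lim : Tendsto (fun k : ℕ => A * (‖D‖ ^ k * r ^ k / k.factorial) * ‖h‖) atTop (𝓝 0) := by
      have := ((FloorSemiring.tendsto_pow_div_factorial_atTop (‖D‖ * r)).const_mul A).mul_const ‖h‖
      simpa [mul_pow] using this
    exact norm_le_zero_iff.1 (ge_of_tendsto' lim fun k => iter k r hr h)
  refine S.reg_of_weak _ _ fun w hw Lw hLw g => ?_
  rw [key1 c hc w hw Lw hLw g]
  congr 1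
  have e : ∫ r in (0 : ℝ)..c, S.semigroup ζ t (c - r) (S.smear ζ t g (N r)) =
      ∫ r in (0 : ℝ)..c, S.semigroup ζ t (c - r)
        (S.semigroup ζ t r (L (NormedSpace.exp (r • D) (D g)))) := by
    refine intervalIntegral.integral_congr fun r hr => ?_
    rw [Set.uIcc_of_le hc] at hr
    exact congrArg _ (sub_eq_zero.1 (hη0 r hr g))
  rw [e, expint c hc]
  simp

end FieldSystem

/-! ### Differentiation of the semigroup with respect to the length of the interval -/

namespace FieldSystem

variable {n : ℕ} {H 𝒦 : Type*} [NormedAddCommGroup H] [InnerProductSpace ℂ H]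
  [NormedAddCommGroup 𝒦] [NormedSpace ℂ 𝒦] (S : FieldSystem H 𝒦)
  {ζ : Fin n → C(ℝ, 𝒦)} {t : ℝ}

/-- A square `Φ(f)²` with `f` real is symmetric. -/
theorem inner_field_field {f : 𝒦} (hf : S.conj f = f) {u v : H} {Lu Lv Mu Mv : 𝒦 →L[ℂ] H}
    (hu : S.Reg u Lu) (hu' : S.Reg (Lu f) Mu) (hv : S.Reg v Lv) (hv' : S.Reg (Lv f) Mv) :
    ⟪Mu f, v⟫_ℂ = ⟪u, Mv f⟫_ℂ := by
  have h1 := S.reg_inner v Lv _ Mu hv hu' f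
  have h2 := S.reg_inner _ Mv u Lu hv' hu f
  rw [hf] at h1 h2
  rw [h1, h2]

theorem norm_sum_bilin_le {n : ℕ} (M : 𝒦 →L[ℂ] 𝒦 →L[ℂ] H) (f : Fin n → 𝒦) {b : ℝ}
    (hf : ∀ j, ‖f j‖ ≤ b) : ‖∑ j, M (f j) (f j)‖ ≤ n * (‖M‖ * b * b) := by
  refine (norm_sum_le _ _).trans ((Finset.sum_le_card_nsmul _ _ (‖M‖ * b * b) fun j _ => ?_).trans
    (by simp))
  have hb : 0 ≤ b := (norm_nonneg _).trans (hf j)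
  exact (M.le_opNorm₂ _ _).trans (by gcongr <;> exact hf j)

theorem continuous_adOp (ζ : Fin n → C(ℝ, 𝒦)) : Continuous fun t => S.adOp ζ t :=
  intervalIntegral.continuous_primitive
    (fun a b => (S.continuous_adOp_integrand ζ).intervalIntegrable a b) 0

variable [CompleteSpace H]

/-- The operator `φ` commutes with its semigroup, in the weak sense. -/
theorem inner_phiVec_semigroup (hζ : ∀ j s, S.conj (ζ j s) = ζ j s) (ht : 0 ≤ t) (c : ℝ)
    {w v : H} (hw : w ∈ S.nice) (hv : v ∈ S.nice) {Lw Lv : 𝒦 →L[ℂ] H}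
    {Mw Mv : 𝒦 →L[ℂ] 𝒦 →L[ℂ] H} (hLw : S.Reg w Lw) (hLv : S.Reg v Lv)
    (hMw : ∀ h, S.Reg (Lw h) (Mw h)) (hMv : ∀ h, S.Reg (Lv h) (Mv h)) :
    ⟪phiVec ζ t Mw, S.semigroup ζ t c v⟫_ℂ = ⟪w, S.semigroup ζ t c (phiVec ζ t Mv)⟫_ℂ := by
  have e1 := (S.graphResolvent_nice hζ ht hw hLw hMw).1
  have e2 := (S.graphResolvent_nice hζ ht hv hLv hMv).1
  set μ := w + phiVec ζ t Mw with hμ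
  set ν := v + phiVec ζ t Mv with hν
  have f1 : phiVec ζ t Mw = μ - w := by rw [hμ]; abel
  have f2 : phiVec ζ t Mv = ν - v := by rw [hν]; abel
  have hcomm : ∀ u, S.semigroup ζ t c (graphResolvent (S.graph ζ t) u) =
      graphResolvent (S.graph ζ t) (S.semigroup ζ t c u) := fun u =>
    contractionSemigroup_comm (graphResolvent_isPositive _) c u
  rw [f1, f2, map_sub, inner_sub_left, inner_sub_right]
  congr 1
  rw [← e1, ← e2, inner_graphResolvent_symm, hcomm]

variable [CompleteSpace 𝒦]

/-- The vector `∑ j, Φ(ζ_j(s))² e^{-cφ} v`, in terms of the bilinear map `M h g = Φ(g) Φ(h) v`. -/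
def quadVec (ζ : Fin n → C(ℝ, 𝒦)) (t : ℝ) (M : 𝒦 →L[ℂ] 𝒦 →L[ℂ] H) (c s : ℝ) : H :=
  S.semigroup ζ t c (∑ j, M (NormedSpace.exp (c • S.adOp ζ t) (ζ j s))
    (NormedSpace.exp (c • S.adOp ζ t) (ζ j s)))

theorem continuous_quadVec (ζ : Fin n → C(ℝ, 𝒦)) (t : ℝ) (M : 𝒦 →L[ℂ] 𝒦 →L[ℂ] H) :
    Continuous fun p : ℝ × ℝ => S.quadVec ζ t M p.1 p.2 := by
  have := continuous_exp_smul (S.adOp ζ t)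
  have h1 : Continuous fun p : ℝ × ℝ => NormedSpace.exp (p.1 • S.adOp ζ t) :=
    this.comp continuous_fst
  exact S.continuous_semigroup_comp ζ t continuous_fst (by fun_prop)

theorem continuous_quadVec_right (ζ : Fin n → C(ℝ, 𝒦)) (t : ℝ) (M : 𝒦 →L[ℂ] 𝒦 →L[ℂ] H) (c : ℝ) :
    Continuous fun s => S.quadVec ζ t M c s :=
  (S.continuous_quadVec ζ t M).comp (by fun_prop : Continuous fun s : ℝ => (c, s))

/-- The defining property of `quadVec`, as the image of `e^{-cφ} v` under the adjoint of `∑ j,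
Φ(ζ_j(s))²`. -/
theorem inner_quadVec (hζ : ∀ j s, S.conj (ζ j s) = ζ j s) (ht : 0 ≤ t) {c : ℝ} (hc : 0 ≤ c)
    {v : H} (hv : v ∈ S.nice) {L : 𝒦 →L[ℂ] H} (hL : S.Reg v L) (hLn : ∀ h, L h ∈ S.nice)
    {M : 𝒦 →L[ℂ] 𝒦 →L[ℂ] H} (hM : ∀ h, S.Reg (L h) (M h)) (s : ℝ) {u : H} {Lu : 𝒦 →L[ℂ] H}
    {Mu : Fin n → 𝒦 →L[ℂ] H} (hu : S.Reg u Lu) (hu' : ∀ j, S.Reg (Lu (ζ j s)) (Mu j)) :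
    ⟪u, S.quadVec ζ t M c s⟫_ℂ = ∑ j, ⟪Mu j (ζ j s), S.semigroup ζ t c v⟫_ℂ := by
  rw [quadVec, map_sum, inner_sum]
  refine Finset.sum_congr rfl fun j _ => ?_
  exact (S.inner_field_field (hζ j s) hu (hu' j) (S.reg_semigroup hζ ht hc hv hL)
    (S.reg_semigroup hζ ht hc (hLn _) (hM _))).symm

/-- The operator `φ` on the vectors `e^{-cφ} v` is given by the integral of the squares of the
fields. -/
theorem semigroup_phiVec (hζ : ∀ j s, S.conj (ζ j s) = ζ j s) (ht : 0 ≤ t) {c : ℝ} (hc : 0 ≤ c)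
    {v : H} (hv : v ∈ S.nice) {L : 𝒦 →L[ℂ] H} (hL : S.Reg v L) (hLn : ∀ h, L h ∈ S.nice)
    {M : 𝒦 →L[ℂ] 𝒦 →L[ℂ] H} (hM : ∀ h, S.Reg (L h) (M h)) :
    S.semigroup ζ t c (phiVec ζ t M) = ∫ s in (0 : ℝ)..t, S.quadVec ζ t M c s := by
  have hcq := S.continuous_quadVec_right ζ t M c
  refine S.eq_of_core_inner fun w hw => ?_
  obtain ⟨Lw, Mw, hLw, hMw⟩ := S.nice_reg w (S.core_le hw)
  rw [← S.inner_phiVec_semigroup hζ ht c (S.core_le hw) hv hLw hL (fun h => (hMw h).2) hM,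
    inner_intervalIntegral _ (hcq.intervalIntegrable _ _), phiVec, intervalIntegral_inner]
  · refine intervalIntegral.integral_congr fun s _ => ?_
    simp only [sum_inner]
    rw [S.inner_quadVec hζ ht hc hv hL hLn hM s hLw fun j => (hMw (ζ j s)).2]
  · exact Continuous.intervalIntegrable (by fun_prop) _ _

/-- Duhamel's formula for the semigroups of `φ = ∫₀ᵗ ∑ j, Φ(ζ_j(s))² ds` for different `t`. -/
theorem inner_semigroup_sub (hζ : ∀ j s, S.conj (ζ j s) = ζ j s) (ht : 0 ≤ t) {t' : ℝ}
    (htt' : t ≤ t') {θ : ℝ} (hθ : 0 ≤ θ) {x y : H} (hx : x ∈ S.nice) (hy : y ∈ S.nice)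
    {L : 𝒦 →L[ℂ] H} (hL : S.Reg y L) (hLn : ∀ h, L h ∈ S.nice)
    {M : 𝒦 →L[ℂ] 𝒦 →L[ℂ] H} (hM : ∀ h, S.Reg (L h) (M h)) :
    ⟪x, S.semigroup ζ t' θ y⟫_ℂ - ⟪x, S.semigroup ζ t θ y⟫_ℂ =
      -∫ c in (0 : ℝ)..θ, ⟪S.semigroup ζ t' (θ - c) x, ∫ s in t..t', S.quadVec ζ t M c s⟫_ℂ := by
  have ht' := ht.trans htt'
  obtain ⟨Lx, Mx, hLx, hMx⟩ := S.nice_reg x hx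
  have hcq := S.continuous_quadVec_right ζ t M
  have e1 := (S.graphResolvent_nice hζ ht' hx hLx fun h => (hMx h).2).1
  have e2 := (S.graphResolvent_nice hζ ht hy hL hM).1
  have hcx := S.continuous_semigroup ζ t'
  have hcx' : ∀ u, Continuous fun r => S.semigroup ζ t' (θ - r) u := fun u =>
    (hcx u).comp (by fun_prop : Continuous fun r : ℝ => θ - r)
  have hint : Continuous fun c => ⟪S.semigroup ζ t' (θ - c) x,
      ∫ s in t..t', S.quadVec ζ t M c s⟫_ℂ :=
    (hcx' x).inner (intervalIntegral.continuous_parametric_intervalIntegral_of_continuous'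
      (S.continuous_quadVec ζ t M) t t')
  -- the derivative of `c ↦ ⟪e^{-(θ-c)φ(t')} x, e^{-cφ(t)} y⟫` is the form of `φ(t') - φ(t)`, the
  -- integral of squares of fields over `[t, t']`
  have hder : ∀ c ∈ Set.Ioo (0 : ℝ) θ, HasDerivAt
      (fun c => ⟪S.semigroup ζ t' (θ - c) x, S.semigroup ζ t c y⟫_ℂ)
      ⟪S.semigroup ζ t' (θ - c) x, ∫ s in t..t', S.quadVec ζ t M c s⟫_ℂ c := by
    intro c hc
    have h1 : HasDerivAt (fun c => S.semigroup ζ t c y)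
        (-S.semigroup ζ t c (phiVec ζ t M)) c := by
      have := hasDerivAt_contractionSemigroup (graphResolvent_isPositive _)
        (graphResolvent_norm_le _) (S.denseRange_resolvent ζ t) hc.1 (y + phiVec ζ t M)
      rw [e2, add_sub_cancel_left] at this
      exact this
    have h2 : HasDerivAt (fun c => S.semigroup ζ t' (θ - c) x)
        (S.semigroup ζ t' (θ - c) (phiVec ζ t' Mx)) c := by
      have := hasDerivAt_contractionSemigroup (graphResolvent_isPositive _)
        (graphResolvent_norm_le _) (S.denseRange_resolvent ζ t') (sub_pos.2 hc.2)
        (x + phiVec ζ t' Mx)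
      rw [e1, add_sub_cancel_left] at this
      refine (this.scomp c ((hasDerivAt_id c).const_sub θ)).congr_deriv ?_
      rw [smul_neg, neg_smul, one_smul, neg_neg]
      rfl
    refine (h2.inner ℂ h1).congr_deriv ?_
    rw [S.semigroup_phiVec hζ ht hc.1.le hy hL hLn hM,
      S.semigroup_phiVec hζ ht' (sub_nonneg.2 hc.2.le) hx hLx (fun h => (hMx h).1)
        fun h => (hMx h).2, inner_neg_right]
    have e3 : ⟪∫ s in (0 : ℝ)..t', S.quadVec ζ t' Mx (θ - c) s, S.semigroup ζ t c y⟫_ℂ =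
        ⟪S.semigroup ζ t' (θ - c) x, ∫ s in (0 : ℝ)..t', S.quadVec ζ t M c s⟫_ℂ := by
      rw [inner_intervalIntegral _ ((hcq c).intervalIntegrable _ _), intervalIntegral_inner]
      · refine intervalIntegral.integral_congr fun s _ => ?_
        have hr := S.reg_semigroup hζ ht' (sub_nonneg.2 hc.2.le) hx hLx
        have hr' := fun h => S.reg_semigroup hζ ht' (sub_nonneg.2 hc.2.le) (hMx h).1 (hMx h).2
        simp only [S.inner_quadVec hζ ht hc.1.le hy hL hLn hM s hr fun j => hr' _]
        rw [quadVec, map_sum, sum_inner]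
        rfl
      · exact (S.continuous_quadVec_right ζ t' Mx (θ - c)).intervalIntegrable _ _
    rw [e3, ← intervalIntegral.integral_add_adjacent_intervals
      ((hcq c).intervalIntegrable (μ := volume) 0 t) ((hcq c).intervalIntegrable t t'),
      inner_add_right]
    ring
  rw [intervalIntegral.integral_eq_sub_of_hasDerivAt_of_le hθ
    ((hcx' x).inner (S.continuous_semigroup ζ t y)).continuousOn hder
    (hint.intervalIntegrable _ _), sub_self, sub_zero, semigroup_zero, semigroup_zero,
    inner_semigroup]
  simp

/-- A bound for `∑ j, Φ(ζ_j(s))² e^{-cφ} v` which is locally uniform in all the parameters. -/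
theorem exists_norm_quadVec_le (ζ : Fin n → C(ℝ, 𝒦)) (M : 𝒦 →L[ℂ] 𝒦 →L[ℂ] H) (T θ : ℝ) :
    ∃ C, 0 ≤ C ∧ ∀ t ∈ Set.Icc 0 T, ∀ c ∈ Set.Icc 0 θ, ∀ s ∈ Set.Icc 0 T,
      ‖S.quadVec ζ t M c s‖ ≤ C := by
  have hexp : Continuous fun p : ℝ × ℝ => NormedSpace.exp (p.2 • S.adOp ζ p.1) := by
    let : NormedAlgebra ℚ (𝒦 →L[ℂ] 𝒦) := NormedAlgebra.restrictScalars ℚ ℝ _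
    have := S.continuous_adOp ζ
    exact NormedSpace.exp_continuous.comp (by fun_prop)
  obtain ⟨e, he⟩ := (isCompact_Icc.prod isCompact_Icc).exists_bound_of_continuousOn
    (hexp.continuousOn (s := Set.Icc 0 T ×ˢ Set.Icc 0 θ))
  have hb : ∀ j, ∃ C, ∀ s ∈ Set.Icc (0 : ℝ) T, ‖ζ j s‖ ≤ C := fun j =>
    isCompact_Icc.exists_bound_of_continuousOn (ζ j).continuous.continuousOn
  choose z hz using hb
  set Z := ∑ j, |z j| with hZ
  set E := |e| with hE
  have hZ0 : 0 ≤ Z := Finset.sum_nonneg fun j _ => abs_nonneg _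
  refine ⟨n * (‖M‖ * (E * Z) * (E * Z)), by positivity, fun t ht c hc s hs => ?_⟩
  refine (S.norm_semigroup_le ζ t c _).trans (norm_sum_bilin_le M _ fun j => ?_)
  have h1 : ‖NormedSpace.exp (c • S.adOp ζ t)‖ ≤ E := (he (t, c) ⟨ht, hc⟩).trans (le_abs_self e)
  refine (ContinuousLinearMap.le_of_opNorm_le_of_le _ h1 (hz j s hs)).trans ?_
  refine mul_le_mul_of_nonneg_left ?_ (abs_nonneg e)
  exact (le_abs_self _).trans (Finset.single_le_sum (f := fun j => |z j|)
    (fun j _ => abs_nonneg _) (Finset.mem_univ j))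

/-- Matrix elements of `e^{-θφ}` between nice vectors are locally Lipschitz in `t`. -/
theorem norm_inner_semigroup_sub_le (hζ : ∀ j s, S.conj (ζ j s) = ζ j s) (T : ℝ) {θ : ℝ}
    (hθ : 0 ≤ θ) {x y : H} (hx : x ∈ S.nice) (hy : y ∈ S.nice) :
    ∃ C, ∀ t ∈ Set.Icc 0 T, ∀ t' ∈ Set.Icc 0 T, t ≤ t' →
      ‖⟪x, S.semigroup ζ t' θ y⟫_ℂ - ⟪x, S.semigroup ζ t θ y⟫_ℂ‖ ≤ C * |t' - t| := by
  obtain ⟨L, M, hL, hM⟩ := S.nice_reg y hy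
  obtain ⟨C, hC, hq⟩ := S.exists_norm_quadVec_le ζ M T θ
  refine ⟨‖x‖ * C * θ, fun t ht t' ht' htt' => ?_⟩
  rw [S.inner_semigroup_sub hζ ht.1 htt' hθ hx hy hL (fun h => (hM h).1) fun h => (hM h).2,
    norm_neg]
  refine (intervalIntegral.norm_integral_le_of_norm_le_const (C := ‖x‖ * (C * |t' - t|))
    fun c hc => ?_).trans (le_of_eq ?_)
  · rw [Set.uIoc_of_le hθ] at hc
    refine (norm_inner_le_norm _ _).trans (mul_le_mul (S.norm_semigroup_le ζ t' _ x) ?_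
      (norm_nonneg _) (norm_nonneg _))
    refine intervalIntegral.norm_integral_le_of_norm_le_const fun s hs => ?_
    rw [Set.uIoc_of_le htt'] at hs
    exact hq t ht c ⟨hc.1.le, hc.2⟩ s ⟨ht.1.trans hs.1.le, hs.2.trans ht'.2⟩
  · rw [sub_zero, abs_of_nonneg hθ]; ring

theorem continuousOn_inner_semigroup_of_nice (hζ : ∀ j s, S.conj (ζ j s) = ζ j s) {θ : ℝ}
    (hθ : 0 ≤ θ) {x y : H} (hx : x ∈ S.nice) (hy : y ∈ S.nice) :
    ContinuousOn (fun t => ⟪x, S.semigroup ζ t θ y⟫_ℂ) (Set.Ici 0) := by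
  intro t₀ ht₀
  obtain ⟨C, hC⟩ := S.norm_inner_semigroup_sub_le hζ (t₀ + 1) hθ hx hy
  have hC' : ∀ t ∈ Set.Icc 0 (t₀ + 1),
      ‖⟪x, S.semigroup ζ t θ y⟫_ℂ - ⟪x, S.semigroup ζ t₀ θ y⟫_ℂ‖ ≤ C * |t - t₀| := by
    intro t ht
    have h0 : t₀ ∈ Set.Icc 0 (t₀ + 1) := ⟨ht₀, by linarith⟩
    rcases le_total t₀ t with h | h
    · exact hC t₀ h0 t ht h
    · rw [norm_sub_rev, abs_sub_comm]; exact hC t ht t₀ h0 h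
  refine tendsto_iff_norm_sub_tendsto_zero.2 (squeeze_zero' (Eventually.of_forall fun _ =>
    norm_nonneg _) (g := fun t => C * |t - t₀|) ?_ ?_)
  · filter_upwards [self_mem_nhdsWithin, mem_nhdsWithin_of_mem_nhds (Iio_mem_nhds
      (lt_add_one t₀))] with t h1 h2
    exact hC' t ⟨h1, le_of_lt h2⟩
  · have : Continuous fun t => C * |t - t₀| := by fun_prop
    simpa using (this.tendsto t₀).mono_left nhdsWithin_le_nhds

theorem continuousOn_inner_semigroup (hζ : ∀ j s, S.conj (ζ j s) = ζ j s) {θ : ℝ} (hθ : 0 ≤ θ)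
    (x y : H) : ContinuousOn (fun t => ⟪x, S.semigroup ζ t θ y⟫_ℂ) (Set.Ici 0) := by
  have approx : ∀ u : H, ∀ δ > 0, ∃ v ∈ S.core, ‖u - v‖ < δ := fun u δ hδ => by
    obtain ⟨v, hv, h⟩ := Metric.mem_closure_iff.1 (S.core_dense u) δ hδ
    exact ⟨v, hv, by rwa [← dist_eq_norm]⟩
  have step : ∀ y ∈ S.nice, ∀ x, ContinuousOn (fun t => ⟪x, S.semigroup ζ t θ y⟫_ℂ)
      (Set.Ici 0) := by
    intro y hy x
    refine continuousOn_of_uniform_approx_of_continuousOn fun U hU => ?_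
    obtain ⟨ε, hε, hU⟩ := Metric.mem_uniformity_dist.1 hU
    obtain ⟨v, hv, h⟩ := approx x (ε / (‖y‖ + 1)) (by positivity)
    refine ⟨_, S.continuousOn_inner_semigroup_of_nice hζ hθ (S.core_le hv) hy,
      fun t _ => hU ?_⟩
    rw [dist_eq_norm, ← inner_sub_left]
    calc _ ≤ ‖x - v‖ * ‖y‖ := (norm_inner_le_norm _ _).trans
          (mul_le_mul_of_nonneg_left (S.norm_semigroup_le ζ t θ y) (norm_nonneg _))
      _ ≤ ‖x - v‖ * (‖y‖ + 1) := by gcongr; linarith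
      _ < ε := (lt_div_iff₀ (by positivity)).1 h
  refine continuousOn_of_uniform_approx_of_continuousOn fun U hU => ?_
  obtain ⟨ε, hε, hU⟩ := Metric.mem_uniformity_dist.1 hU
  obtain ⟨v, hv, h⟩ := approx y (ε / (‖x‖ + 1)) (by positivity)
  refine ⟨_, step v (S.core_le hv) x, fun t _ => hU ?_⟩
  rw [dist_eq_norm, ← inner_sub_right, ← map_sub]
  calc _ ≤ ‖x‖ * ‖y - v‖ := (norm_inner_le_norm _ _).trans
        (mul_le_mul_of_nonneg_left (S.norm_semigroup_le ζ t θ _) (norm_nonneg _))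
    _ ≤ (‖x‖ + 1) * ‖y - v‖ := by gcongr; linarith
    _ < ε := by rw [mul_comm]; exact (lt_div_iff₀ (by positivity)).1 h

/-- The derivative of `⟪x, e^{-θφ} y⟫` with respect to the length of the interval in
`φ = ∫₀ᵗ ∑ j, Φ(ζ_j(s))² ds`. -/
theorem hasDerivWithinAt_inner_semigroup (hζ : ∀ j s, S.conj (ζ j s) = ζ j s) (ht : 0 ≤ t)
    {θ : ℝ} (hθ : 0 ≤ θ) {x y : H} (hx : x ∈ S.nice) (hy : y ∈ S.nice)
    {L : 𝒦 →L[ℂ] H} (hL : S.Reg y L) (hLn : ∀ h, L h ∈ S.nice)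
    {M : 𝒦 →L[ℂ] 𝒦 →L[ℂ] H} (hM : ∀ h, S.Reg (L h) (M h)) :
    HasDerivWithinAt (fun τ => ⟪x, S.semigroup ζ τ θ y⟫_ℂ)
      (-⟪x, S.semigroup ζ t θ (∫ c in (0 : ℝ)..θ, ∑ j,
        M (NormedSpace.exp (c • S.adOp ζ t) (ζ j t))
          (NormedSpace.exp (c • S.adOp ζ t) (ζ j t)))⟫_ℂ) (Set.Ici t) t := by
  have hcq := S.continuous_quadVec_right ζ t M
  have hexp := continuous_exp_smul (S.adOp ζ t)
  have e0 : ⟪x, S.semigroup ζ t θ (∫ c in (0 : ℝ)..θ, ∑ j,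
        M (NormedSpace.exp (c • S.adOp ζ t) (ζ j t))
          (NormedSpace.exp (c • S.adOp ζ t) (ζ j t)))⟫_ℂ =
      ∫ c in (0 : ℝ)..θ, ⟪S.semigroup ζ t (θ - c) x, S.quadVec ζ t M c t⟫_ℂ := by
    rw [← inner_semigroup, inner_intervalIntegral _ (Continuous.intervalIntegrable (by fun_prop) _ _)]
    refine intervalIntegral.integral_congr fun c hc => ?_
    rw [Set.uIcc_of_le hθ] at hc
    simp only [quadVec, S.inner_semigroup]
    rw [S.semigroup_add ζ t (sub_nonneg.2 hc.2) hc.1, sub_add_cancel]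
  rw [e0, ← hasDerivWithinAt_Ioi_iff_Ici, hasDerivWithinAt_iff_tendsto_slope' Set.self_notMem_Ioi]
  obtain ⟨C, hC, hq⟩ := S.exists_norm_quadVec_le ζ M (t + 1) θ
  have hnear : ∀ᶠ τ in 𝓝[>] t, t < τ ∧ τ < t + 1 := by
    filter_upwards [self_mem_nhdsWithin, mem_nhdsWithin_of_mem_nhds (Iio_mem_nhds
      (lt_add_one t))] with τ h1 h2
    exact ⟨h1, h2⟩
  -- Duhamel's formula turns the slope into an integral over `[0, θ]`, to which dominated
  -- convergence applies
  have hslope : ∀ᶠ τ in 𝓝[>] t,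
      -∫ c in (0 : ℝ)..θ, ⟪S.semigroup ζ τ (θ - c) x,
        (τ - t)⁻¹ • ∫ s in t..τ, S.quadVec ζ t M c s⟫_ℂ =
      slope (fun τ => ⟪x, S.semigroup ζ τ θ y⟫_ℂ) t τ := by
    filter_upwards [hnear] with τ hτ
    rw [slope_def_module, S.inner_semigroup_sub hζ ht hτ.1.le hθ hx hy hL hLn hM, smul_neg,
      ← intervalIntegral.integral_smul]
    congr 1
    refine intervalIntegral.integral_congr fun c _ => ?_
    simp only [inner_smul_right_eq_smul]
  refine Tendsto.congr' hslope (Tendsto.neg ?_)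
  refine intervalIntegral.tendsto_integral_filter_of_dominated_convergence
      (fun _ => ‖x‖ * C) ?_ ?_ intervalIntegrable_const ?_
  · refine Eventually.of_forall fun τ => Continuous.aestronglyMeasurable ?_
    exact ((S.continuous_semigroup ζ τ x).comp (by fun_prop : Continuous fun c : ℝ => θ - c)).inner
      ((intervalIntegral.continuous_parametric_intervalIntegral_of_continuous'
      (S.continuous_quadVec ζ t M) t τ).const_smul _)
  · filter_upwards [hnear] with τ hτ
    refine Eventually.of_forall fun c hc => ?_
    rw [Set.uIoc_of_le hθ] at hc
    refine (norm_inner_le_norm _ _).trans (mul_le_mul (S.norm_semigroup_le ζ τ _ x) ?_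
      (norm_nonneg _) (norm_nonneg _))
    have hpos : 0 < τ - t := sub_pos.2 hτ.1
    rw [norm_smul, norm_inv, Real.norm_of_nonneg hpos.le, inv_mul_le_iff₀ hpos, mul_comm]
    refine (intervalIntegral.norm_integral_le_of_norm_le_const (C := C) fun s hs => ?_).trans
      (by rw [abs_of_pos hpos])
    rw [Set.uIoc_of_le hτ.1.le] at hs
    exact hq t ⟨ht, by linarith⟩ c ⟨hc.1.le, hc.2⟩ s ⟨ht.trans hs.1.le, hs.2.trans hτ.2.le⟩
  · refine Eventually.of_forall fun c hc => ?_
    rw [Set.uIoc_of_le hθ] at hc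
    have l1 : Tendsto (fun τ => (τ - t)⁻¹ • ∫ s in t..τ, S.quadVec ζ t M c s) (𝓝[>] t)
        (𝓝 (S.quadVec ζ t M c t)) := by
      have := ((hcq c).integral_hasStrictDerivAt t t).hasDerivAt.hasDerivWithinAt (s := Set.Ioi t)
      rw [hasDerivWithinAt_iff_tendsto_slope' Set.self_notMem_Ioi] at this
      refine this.congr fun τ => ?_
      rw [slope_def_module, intervalIntegral.integral_same, sub_zero]
    -- the semigroup depends on the time weakly continuously, which suffices, as it acts on a
    -- convergent vector
    have l2 := (((S.continuousOn_inner_semigroup hζ (sub_nonneg.2 hc.2) x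
      (S.quadVec ζ t M c t)) t ht).mono_left (nhdsWithin_mono t
        (fun τ (hτ : t < τ) => (ht.trans hτ.le : (0 : ℝ) ≤ τ))))
    have l3 : Tendsto (fun τ => ⟪S.semigroup ζ τ (θ - c) x,
        (τ - t)⁻¹ • (∫ s in t..τ, S.quadVec ζ t M c s) - S.quadVec ζ t M c t⟫_ℂ) (𝓝[>] t)
        (𝓝 0) := by
      refine squeeze_zero_norm (fun τ => (norm_inner_le_norm _ _).trans
        (mul_le_mul_of_nonneg_right (S.norm_semigroup_le ζ τ _ x) (norm_nonneg _))) ?_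
      simpa using ((l1.sub_const (S.quadVec ζ t M c t)).norm).const_mul ‖x‖
    have l4 := l3.add l2
    rw [zero_add] at l4
    rw [S.inner_semigroup]
    refine l4.congr fun τ => ?_
    rw [inner_sub_right, S.inner_semigroup ζ τ (θ - c) x (S.quadVec ζ t M c t), sub_add_cancel]

end FieldSystem

/-! ### Power series for bilinear expressions in one-parameter groups -/

section Bilinear

variable {H 𝒦 : Type*} [NormedAddCommGroup H] [NormedSpace ℂ H]
  [NormedAddCommGroup 𝒦] [NormedSpace ℂ 𝒦]

theorem norm_pow_apply_le (D : 𝒦 →L[ℂ] 𝒦) (k : ℕ) (z : 𝒦) : ‖(D ^ k) z‖ ≤ ‖D‖ ^ k * ‖z‖ := by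
  induction k with
  | zero => simp
  | succ k ih =>
    rw [pow_succ', pow_succ', mul_assoc]
    exact (D.le_opNorm _).trans (mul_le_mul_of_nonneg_left ih (norm_nonneg _))

/-- The coefficients of the Taylor series of `s ↦ N (e^{sD} z) (e^{sD} z)`, up to factorials. -/
def bilinCoeff (N : 𝒦 →L[ℂ] 𝒦 →L[ℂ] H) (D : 𝒦 →L[ℂ] 𝒦) (z : 𝒦) (m : ℕ) : H :=
  ∑ p ∈ Finset.HasAntidiagonal.antidiagonal m, (m.choose p.1 : ℝ) • N ((D ^ p.1) z) ((D ^ p.2) z)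

theorem norm_bilinCoeff_le (N : 𝒦 →L[ℂ] 𝒦 →L[ℂ] H) (D : 𝒦 →L[ℂ] 𝒦) (z : 𝒦) (m : ℕ) :
    ‖bilinCoeff N D z m‖ ≤ (2 * ‖D‖) ^ m * (‖N‖ * ‖z‖ * ‖z‖) := by
  refine (norm_sum_le_of_le (f := fun p : ℕ × ℕ => (m.choose p.1 : ℝ) •
    N ((D ^ p.1) z) ((D ^ p.2) z)) (n := fun p => (m.choose p.1 : ℝ) *
    (‖D‖ ^ m * (‖N‖ * ‖z‖ * ‖z‖))) _ fun p hp => ?_).trans (le_of_eq ?_)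
  · obtain rfl := Finset.HasAntidiagonal.mem_antidiagonal.1 hp
    rw [norm_smul, Real.norm_natCast]
    refine mul_le_mul_of_nonneg_left ((N.le_opNorm₂ _ _).trans ?_) (Nat.cast_nonneg _)
    calc _ ≤ ‖N‖ * (‖D‖ ^ p.1 * ‖z‖) * (‖D‖ ^ p.2 * ‖z‖) := by
          gcongr <;> exact norm_pow_apply_le D _ z
      _ = _ := by ring
  · rw [← Finset.sum_mul, Finset.Nat.sum_antidiagonal_eq_sum_range_succ_mk]
    have : (∑ k ∈ Finset.range m.succ, (m.choose k : ℝ)) = 2 ^ m := by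
      exact_mod_cast Nat.sum_range_choose m
    simp only
    rw [this]
    ring

variable [CompleteSpace H]

/-- The Cauchy product formula for a bounded bilinear map. -/
theorem hasSum_bilin_antidiagonal (N : 𝒦 →L[ℂ] 𝒦 →L[ℂ] H) {x : ℕ → 𝒦} {a : 𝒦}
    (hx : HasSum x a) (hn : Summable fun k => ‖x k‖) :
    HasSum (fun m => ∑ p ∈ Finset.HasAntidiagonal.antidiagonal m, N (x p.1) (x p.2)) (N a a) := by
  have hs : Summable fun p : ℕ × ℕ => N (x p.1) (x p.2) := by
    refine Summable.of_norm_bounded (g := fun p : ℕ × ℕ => ‖N‖ * (‖x p.1‖ * ‖x p.2‖))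
      ((hn.mul_of_nonneg hn (fun _ => norm_nonneg _) fun _ => norm_nonneg _).mul_left _) fun p => ?_
    rw [← mul_assoc]
    exact N.le_opNorm₂ _ _
  have h1 : HasSum (fun i => N (x i) a) (∑' p : ℕ × ℕ, N (x p.1) (x p.2)) :=
    hs.hasSum.prod_fiberwise fun i => hx.mapL (N (x i))
  have h2 : HasSum (fun i => N (x i) a) (N a a) := hx.mapL (N.flip a)
  rw [h2.unique h1]
  have h3 := (Finset.HasAntidiagonal.sigmaAntidiagonalEquivProd (A := ℕ)).hasSum_iff.2 hs.hasSum
  refine h3.sigma fun m => ?_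
  have h4 := hasSum_fintype fun p : Finset.HasAntidiagonal.antidiagonal m => N (x p.1.1) (x p.1.2)
  rw [Finset.sum_coe_sort (Finset.HasAntidiagonal.antidiagonal m) fun p => N (x p.1) (x p.2)] at h4
  exact h4

variable [CompleteSpace 𝒦]

theorem hasSum_exp_smul_apply (D : 𝒦 →L[ℂ] 𝒦) (s : ℝ) (z : 𝒦) :
    HasSum (fun k : ℕ => (s ^ k / k.factorial) • (D ^ k) z) (NormedSpace.exp (s • D) z) := by
  have h := NormedSpace.exp_series_hasSum_exp' (𝕂 := ℝ) (s • D)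
  have h2 := h.mapL ((ContinuousLinearMap.apply ℂ 𝒦 z).restrictScalars ℝ)
  refine h2.congr_fun fun k => ?_
  change _ = ((k.factorial : ℝ)⁻¹ • (s • D) ^ k) z
  rw [smul_pow, smul_smul, _root_.smul_apply, div_eq_inv_mul]

theorem hasSum_bilin_exp (N : 𝒦 →L[ℂ] 𝒦 →L[ℂ] H) (D : 𝒦 →L[ℂ] 𝒦) (z : 𝒦) (s : ℝ) :
    HasSum (fun m : ℕ => (s ^ m / m.factorial) • bilinCoeff N D z m)
      (N (NormedSpace.exp (s • D) z) (NormedSpace.exp (s • D) z)) := by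
  have hn : Summable fun k : ℕ => ‖(s ^ k / k.factorial) • (D ^ k) z‖ := by
    refine Summable.of_nonneg_of_le (fun _ => norm_nonneg _) (fun k => ?_)
      ((Real.summable_pow_div_factorial (|s| * ‖D‖)).mul_right ‖z‖)
    rw [norm_smul, norm_div, norm_pow, Real.norm_eq_abs, Real.norm_natCast, mul_pow,
      mul_div_right_comm, mul_assoc]
    exact mul_le_mul_of_nonneg_left (norm_pow_apply_le D k z) (by positivity)
  refine (hasSum_bilin_antidiagonal N (hasSum_exp_smul_apply D s z) hn).congr_fun fun m => ?_
  rw [bilinCoeff, Finset.smul_sum]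
  refine Finset.sum_congr rfl fun p hp => ?_
  obtain rfl := Finset.HasAntidiagonal.mem_antidiagonal.1 hp
  have hre : ∀ (r : ℝ) (h : 𝒦), N (r • h) = r • N h := fun r h => by
    rw [← Complex.coe_smul, ← Complex.coe_smul, map_smul]
  have hre' : ∀ (r : ℝ) (h g : 𝒦), N h (r • g) = r • N h g := fun r h g => by
    rw [← Complex.coe_smul, ← Complex.coe_smul, map_smul]
  rw [hre, _root_.smul_apply, hre', smul_smul, smul_smul, Nat.choose_symm_add, Nat.add_choose, pow_add,
    Nat.cast_div (Nat.factorial_mul_factorial_dvd_factorial_add _ _) (by positivity)]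
  congr 1
  push_cast
  have := Nat.factorial_pos (p.1 + p.2)
  field_simp

/-- `∫_{-a}^a N(e^{sD} z, e^{sD} z) ds` as a series over the even Taylor coefficients. -/
theorem hasSum_integral_bilin_exp (N : 𝒦 →L[ℂ] 𝒦 →L[ℂ] H) (D : 𝒦 →L[ℂ] 𝒦) (z : 𝒦) {a : ℝ}
    (ha : 0 ≤ a) :
    HasSum (fun k : ℕ => (2 * a ^ (2 * k + 1) / (2 * k + 1).factorial) • bilinCoeff N D z (2 * k))
      (∫ s in (-a)..a, N (NormedSpace.exp (s • D) z) (NormedSpace.exp (s • D) z)) := by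
  set b := ‖N‖ * ‖z‖ * ‖z‖
  have hsum : Summable fun m : ℕ => (a * (2 * ‖D‖)) ^ m / m.factorial * b :=
    (Real.summable_pow_div_factorial _).mul_right b
  have h := intervalIntegral.hasSum_integral_of_dominated_convergence (a := -a) (b := a)
    (μ := volume) (F := fun (m : ℕ) (s : ℝ) => (s ^ m / m.factorial) • bilinCoeff N D z m)
    (fun m _ => (a * (2 * ‖D‖)) ^ m / m.factorial * b)
    (fun m => Continuous.aestronglyMeasurable (by fun_prop))
    (fun m => Eventually.of_forall fun s hs => by
      rw [Set.uIoc_of_le (by linarith)] at hs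
      have hs' : |s| ≤ a := abs_le.2 ⟨hs.1.le, hs.2⟩
      rw [norm_smul, norm_div, norm_pow, Real.norm_eq_abs, Real.norm_natCast, mul_pow,
        mul_div_right_comm, mul_assoc]
      gcongr
      exact norm_bilinCoeff_le N D z m)
    (Eventually.of_forall fun s _ => hsum) intervalIntegrable_const
    (Eventually.of_forall fun s _ => hasSum_bilin_exp N D z s)
  have e : ∀ m : ℕ, ∫ s in (-a)..a, (s ^ m / m.factorial) • bilinCoeff N D z m =
      ((a ^ (m + 1) - (-a) ^ (m + 1)) / (m + 1).factorial) • bilinCoeff N D z m := by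
    intro m
    rw [intervalIntegral.integral_smul_const, intervalIntegral.integral_div, integral_pow,
      Nat.factorial_succ]
    congr 1
    push_cast
    field_simp
  simp only [e] at h
  rw [← Function.Injective.hasSum_iff (g := fun k : ℕ => 2 * k) (fun i j hij => by simpa using hij)]
    at h
  · refine h.congr_fun fun k => ?_
    simp only [Function.comp_apply]
    congr 2
    rw [Odd.neg_pow ⟨k, rfl⟩]
    ring
  · intro m hm
    have : Odd m := by
      by_contra h'
      obtain ⟨k, hk⟩ := Nat.not_odd_iff_even.1 h'
      exact hm ⟨k, by simp only; omega⟩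
    rw [Even.neg_pow (Odd.add_odd this odd_one), sub_self, zero_div, zero_smul]

end Bilinear

/-! ### The kernels of the iterated commutators -/

namespace OQHO

variable {n d : ℕ} {ι : Type*} {H₀ : Type*} [NormedAddCommGroup H₀] [InnerProductSpace ℂ H₀]
variable (O : OQHO n d ι H₀) (P : Matrix (Fin n) (Fin n) ℝ)

theorem continuous_exp_smul_matrix (A : Matrix (Fin n) (Fin n) ℝ) :
    Continuous fun t : ℝ => NormedSpace.exp (t • A) := by
  let : NormedRing (Matrix (Fin n) (Fin n) ℝ) := Matrix.linftyOpNormedRing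
  let : NormedAlgebra ℝ (Matrix (Fin n) (Fin n) ℝ) := Matrix.linftyOpNormedAlgebra
  exact continuous_iff_continuousAt.2 fun r =>
    (hasDerivAt_exp_smul_const (𝕂 := ℝ) A r).continuousAt

theorem continuous_Lam : Continuous O.Lam := by
  have h1 := continuous_exp_smul_matrix O.A
  have h2 := continuous_exp_smul_matrix O.A.transpose
  refine Continuous.if_le (f := fun _ : ℝ => (0 : ℝ)) (g := id) ?_ ?_ continuous_const continuous_id
    ?_
  · exact h1.mul continuous_const
  · exact continuous_const.mul (h2.comp continuous_neg)
  · rintro τ (rfl : 0 = τ)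
    simp

theorem continuous_adKernel (t : ℝ) (k : ℕ) :
    Continuous fun p : ℝ × ℝ => O.adKernel P t k p.1 p.2 := by
  have h := O.continuous_Lam
  induction k with
  | zero =>
    change Continuous fun p : ℝ × ℝ => O.Lam (p.1 - p.2) * P
    fun_prop
  | succ k ih =>
    refine continuous_matrix fun a b => ?_
    refine intervalIntegral.continuous_parametric_intervalIntegral_of_continuous'
      (f := fun (p : ℝ × ℝ) r => ((O.Lam (p.1 - r) * P) * O.adKernel P t k r p.2) a b) ?_ 0 t
    have h3 : Continuous fun q : (ℝ × ℝ) × ℝ => O.adKernel P t k q.2 q.1.2 :=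
      ih.comp (by fun_prop : Continuous fun q : (ℝ × ℝ) × ℝ => (q.2, q.1.2))
    have h4 : Continuous fun q : (ℝ × ℝ) × ℝ => O.Lam (q.1.1 - q.2) * P := by fun_prop
    exact (h4.matrix_mul h3).matrix_elem a b

theorem continuous_adKernel_right (t : ℝ) (k : ℕ) (s : ℝ) (a b : Fin n) :
    Continuous fun σ : ℝ => O.adKernel P t k s σ a b :=
  ((O.continuous_adKernel P t k).comp (by fun_prop : Continuous fun σ : ℝ => (s, σ))).matrix_elem
    a b

/-- The kernel `L_{k+1}` has a geometric bound, uniformly on `[0, t]²`. -/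
theorem exists_abs_adKernel_le {t : ℝ} (ht : 0 ≤ t) :
    ∃ b c, 0 ≤ b ∧ 1 ≤ c ∧ ∀ k, ∀ s ∈ Set.Icc 0 t, ∀ σ ∈ Set.Icc 0 t, ∀ i j,
      |O.adKernel P t k s σ i j| ≤ b * c ^ k := by
  have hb : ∀ i j, ∃ C, ∀ p ∈ Set.Icc 0 t ×ˢ Set.Icc 0 t, ‖O.adKernel P t 0 p.1 p.2 i j‖ ≤ C :=
    fun i j => (isCompact_Icc.prod isCompact_Icc).exists_bound_of_continuousOn
      ((O.continuous_adKernel P t 0).matrix_elem i j).continuousOn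
  choose C hC using hb
  set b := ∑ i, ∑ j, |C i j| with hbdef
  have hb0 : 0 ≤ b := by positivity
  have h0 : ∀ s ∈ Set.Icc 0 t, ∀ σ ∈ Set.Icc 0 t, ∀ i j, |O.adKernel P t 0 s σ i j| ≤ b := by
    intro s hs σ hσ i j
    refine (hC i j (s, σ) ⟨hs, hσ⟩).trans ((le_abs_self _).trans ?_)
    refine (Finset.single_le_sum (f := fun j => |C i j|) (fun _ _ => abs_nonneg _)
      (Finset.mem_univ j)).trans ?_
    exact Finset.single_le_sum (f := fun i => ∑ j, |C i j|) (fun _ _ => by positivity)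
      (Finset.mem_univ i)
  refine ⟨b, n * b * t + 1, hb0, le_add_of_nonneg_left (by positivity), fun k => ?_⟩
  induction k with
  | zero => simpa using h0
  | succ k ih =>
    intro s hs σ hσ i j
    change |∫ r in (0 : ℝ)..t, ((O.Lam (s - r) * P) * O.adKernel P t k r σ) i j| ≤ _
    rw [← Real.norm_eq_abs]
    refine (intervalIntegral.norm_integral_le_of_norm_le_const
      (C := n * (b * (b * (n * b * t + 1) ^ k))) fun r hr => ?_).trans ?_
    · rw [Set.uIoc_of_le ht] at hr
      have hr' : r ∈ Set.Icc 0 t := ⟨hr.1.le, hr.2⟩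
      rw [Matrix.mul_apply, Real.norm_eq_abs]
      refine (Finset.abs_sum_le_sum_abs _ _).trans ((Finset.sum_le_card_nsmul _ _
        (b * (b * (n * b * t + 1) ^ k)) fun l _ => ?_).trans (by simp))
      rw [abs_mul]
      exact mul_le_mul (h0 s hs r hr' i l) (ih r hr' σ hσ l j) (abs_nonneg _) hb0
    · rw [sub_zero, abs_of_nonneg ht, pow_succ]
      have : 0 ≤ b * (n * b * t + 1) ^ k := by positivity
      nlinarith

end OQHO

/-! ### The operator `Ψ` as an average of the conjugations with the semigroup -/

section Integrals

variable {E : Type*} [NormedAddCommGroup E] [NormedSpace ℝ E]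

theorem intervalIntegral_swap_of_continuous {G : ℝ × ℝ → E} (hG : Continuous G) {t : ℝ}
    (ht : 0 ≤ t) :
    ∫ r in (0 : ℝ)..t, ∫ σ in (0 : ℝ)..t, G (r, σ) =
      ∫ σ in (0 : ℝ)..t, ∫ r in (0 : ℝ)..t, G (r, σ) := by
  have hi : Integrable (Function.uncurry fun r σ => G (r, σ))
      ((volume.restrict (Set.uIoc 0 t)).prod (volume.restrict (Set.Ioc 0 t))) := by
    rw [Measure.prod_restrict, Set.uIoc_of_le ht]
    exact (hG.continuousOn.integrableOn_compact
      (isCompact_Icc.prod isCompact_Icc)).mono_set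
      (Set.prod_mono Set.Ioc_subset_Icc_self Set.Ioc_subset_Icc_self)
  have := intervalIntegral_integral_swap (a := 0) (b := t) hi
  simp only [intervalIntegral.integral_of_le ht] at this ⊢
  exact this

theorem intervalIntegral_sum_smul_swap {n : ℕ} {𝒦 : Type*} [NormedAddCommGroup 𝒦]
    [NormedSpace ℂ 𝒦] [CompleteSpace 𝒦] {F : Fin n → ℝ × ℝ → ℝ} (hF : ∀ c, Continuous (F c))
    (f : Fin n → C(ℝ, 𝒦))
    {t : ℝ} (ht : 0 ≤ t) :
    ∫ r in (0 : ℝ)..t, ∫ σ in (0 : ℝ)..t, ∑ c, ((F c (r, σ) : ℝ) : ℂ) • f c σ =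
      ∫ σ in (0 : ℝ)..t, ∑ c, ((∫ r in (0 : ℝ)..t, F c (r, σ) : ℝ) : ℂ) • f c σ := by
  rw [intervalIntegral_swap_of_continuous (G := fun p => ∑ c, ((F c p : ℝ) : ℂ) • f c p.2)
    (by fun_prop) ht]
  refine intervalIntegral.integral_congr fun σ _ => ?_
  simp only
  rw [intervalIntegral.integral_finsetSum]
  · refine Finset.sum_congr rfl fun c _ => ?_
    rw [← intervalIntegral.integral_ofReal, intervalIntegral.integral_smul_const]
  · intro c _
    have := hF c
    exact Continuous.intervalIntegrable (by fun_prop) _ _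

/-- Termwise integration of a uniformly summable series of coefficients. -/
theorem hasSum_setIntegral_smul {X : Type*} [TopologicalSpace X] [MeasurableSpace X]
    [OpensMeasurableSpace X] [T2Space X] [SecondCountableTopology X]
    (μ : Measure X) [IsFiniteMeasureOnCompacts μ] {s : Set X} (hs : IsCompact s)
    {a : ℕ → X → ℝ} (ha : ∀ k, Continuous (a k)) {b : ℕ → ℝ} (hb : Summable b)
    (hab : ∀ k, ∀ x ∈ s, |a k x| ≤ b k) {g : X → E} (hg : Continuous g) :
    IntegrableOn (fun x => (∑' k, a k x) • g x) s μ ∧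
      HasSum (fun k => ∫ x in s, a k x • g x ∂μ) (∫ x in s, (∑' k, a k x) • g x ∂μ) := by
  have hm : MeasurableSet s := hs.measurableSet
  have hc : ContinuousOn (fun x => ∑' k, a k x) s :=
    continuousOn_tsum (fun k => (ha k).continuousOn) hb fun k x hx => hab k x hx
  obtain ⟨C, hC⟩ := hs.exists_bound_of_continuousOn hg.continuousOn
  have hfin : IsFiniteMeasure (μ.restrict s) := ⟨by
    rw [Measure.restrict_apply_univ]; exact hs.measure_lt_top⟩
  refine ⟨(hc.smul hg.continuousOn).integrableOn_compact hs, ?_⟩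
  refine hasSum_integral_of_dominated_convergence (F := fun k x => a k x • g x)
    (fun k _ => b k * |C|) (fun k => ?_) (fun k => ?_)
    (Eventually.of_forall fun x => hb.mul_right _) (integrable_const _) ?_
  · have hk : Continuous fun x => a k x • g x := (ha k).smul hg
    exact hk.aestronglyMeasurable
  · refine (ae_restrict_iff' hm).2 (Eventually.of_forall fun x hx => ?_)
    rw [norm_smul]
    exact mul_le_mul (hab k x hx) ((hC x hx).trans (le_abs_self C)) (norm_nonneg _)
      ((abs_nonneg _).trans (hab k x hx))
  · refine (ae_restrict_iff' hm).2 (Eventually.of_forall fun x hx => ?_)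
    have hsum : Summable fun k => a k x := Summable.of_norm_bounded hb fun k => by
      rw [Real.norm_eq_abs]; exact hab k x hx
    exact hsum.hasSum.smul_const (g x)

theorem bilin_setIntegral {H 𝒦 : Type*} [NormedAddCommGroup H] [NormedSpace ℂ H] [CompleteSpace H]
    [NormedAddCommGroup 𝒦] [NormedSpace ℂ 𝒦] [CompleteSpace 𝒦] (N : 𝒦 →L[ℂ] 𝒦 →L[ℂ] H)
    {u w : ℝ → 𝒦} (hu : Continuous u) (hw : Continuous w) (t : ℝ) :
    N (∫ τ in Set.Icc 0 t, u τ) (∫ σ in Set.Icc 0 t, w σ) =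
      ∫ p in Set.Icc 0 t ×ˢ Set.Icc 0 t, N (u p.2) (w p.1) := by
  have hc : Continuous fun p : ℝ × ℝ => N (u p.2) (w p.1) := by fun_prop
  rw [Measure.volume_eq_prod, setIntegral_prod _ (by
    rw [← Measure.volume_eq_prod]
    exact hc.continuousOn.integrableOn_compact (isCompact_Icc.prod isCompact_Icc))]
  have h1 : ∀ σ, ∫ τ in Set.Icc 0 t, N (u τ) (w σ) = N (∫ τ in Set.Icc 0 t, u τ) (w σ) :=
    fun σ => (N.flip (w σ)).integral_comp_comm (hu.continuousOn.integrableOn_compact isCompact_Icc)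
  simp only [h1]
  exact ((N (∫ τ in Set.Icc 0 t, u τ)).integral_comp_comm
    (hw.continuousOn.integrableOn_compact isCompact_Icc)).symm

end Integrals

section Sqrt

variable {n : ℕ} {P : Matrix (Fin n) (Fin n) ℝ}

/-- The entries of the identity `(√P)ᵀ √P = P`. -/
theorem sum_sqrt_mul_sqrt (hP : P.PosSemidef) (l m : Fin n) :
    ∑ j, cfc Real.sqrt P j l * cfc Real.sqrt P j m = P l m := by
  have hsa : IsSelfAdjoint P := hP.isHermitian
  have h0 : ∀ x ∈ spectrum ℝ P, 0 ≤ x := by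
    intro x hx
    rw [hP.isHermitian.spectrum_real_eq_range_eigenvalues] at hx
    obtain ⟨i, rfl⟩ := hx
    exact hP.eigenvalues_nonneg i
  have h1 : cfc Real.sqrt P * cfc Real.sqrt P = P := by
    rw [← cfc_mul Real.sqrt Real.sqrt P Real.continuous_sqrt.continuousOn
      Real.continuous_sqrt.continuousOn]
    conv_rhs => rw [← cfc_id ℝ P hsa]
    exact cfc_congr fun x hx => Real.mul_self_sqrt (h0 x hx)
  have h2 : (cfc Real.sqrt P).transpose = cfc Real.sqrt P := by
    have : IsSelfAdjoint (cfc Real.sqrt P) := cfc_predicate Real.sqrt P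
    rw [IsSelfAdjoint, Matrix.star_eq_conjTranspose, Matrix.conjTranspose_eq_transpose_of_trivial]
      at this
    exact this
  have h3 := congrFun (congrFun h1 l) m
  rw [Matrix.mul_apply] at h3
  rw [← h3]
  refine Finset.sum_congr rfl fun j _ => ?_
  congr 1
  exact congrFun (congrFun h2 l) j

theorem sum_sqrt_bilin {𝒦 E : Type*} [NormedAddCommGroup 𝒦] [NormedSpace ℂ 𝒦]
    [NormedAddCommGroup E] [NormedSpace ℂ E] (hP : P.PosSemidef) (N : 𝒦 →L[ℂ] 𝒦 →L[ℂ] E)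
    (u w : Fin n → 𝒦) :
    ∑ j, N (∑ l, ((cfc Real.sqrt P j l : ℝ) : ℂ) • u l)
      (∑ m, ((cfc Real.sqrt P j m : ℝ) : ℂ) • w m) =
      ∑ l, ∑ m, ((P l m : ℝ) : ℂ) • N (u l) (w m) := by
  simp only [map_sum, map_smul, _root_.sum_apply, _root_.smul_apply, Finset.smul_sum, smul_smul]
  rw [Finset.sum_comm]
  refine (Finset.sum_congr rfl fun m _ => Finset.sum_comm).trans ?_
  rw [Finset.sum_comm]
  refine Finset.sum_congr rfl fun l _ => Finset.sum_congr rfl fun m _ => ?_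
  rw [← Finset.sum_smul, ← sum_sqrt_mul_sqrt hP l m]
  push_cast
  congr 1
  exact Finset.sum_congr rfl fun j _ => mul_comm _ _

end Sqrt

namespace OQHO

variable {n d : ℕ} {ι : Type*} {H₀ : Type*} [NormedAddCommGroup H₀] [InnerProductSpace ℂ H₀]
variable (O : OQHO n d ι H₀) {P : Matrix (Fin n) (Fin n) ℝ}

/-- The two-point commutators are antisymmetric. -/
theorem Lam_neg (τ : ℝ) : O.Lam (-τ) = -(O.Lam τ).transpose := by
  have key : ∀ τ : ℝ, 0 ≤ τ → O.Lam (-τ) = -(O.Lam τ).transpose := by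
    intro τ hτ
    rcases hτ.eq_or_lt with rfl | hτ
    · simp [Lam, O.antisymm]
    · rw [Lam, if_neg (by linarith), Lam, if_pos hτ.le, Matrix.transpose_mul, O.antisymm, neg_neg,
        ← Matrix.exp_transpose, Matrix.transpose_smul]
      simp
  rcases le_total 0 τ with h | h
  · exact key τ h
  · have := key (-τ) (by linarith)
    rw [neg_neg] at this
    rw [this]
    simp

end OQHO

/-- The curves `ζ_j = ∑ l, (√P)_{jl} f_l`. -/
def sqrtCurve {n : ℕ} {𝒦 : Type*} [NormedAddCommGroup 𝒦] [NormedSpace ℂ 𝒦]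
    (P : Matrix (Fin n) (Fin n) ℝ) (f : Fin n → C(ℝ, 𝒦)) (j : Fin n) : C(ℝ, 𝒦) :=
  ∑ l, ((cfc Real.sqrt P j l : ℝ) : ℂ) • f l

theorem sqrtCurve_apply {n : ℕ} {𝒦 : Type*} [NormedAddCommGroup 𝒦] [NormedSpace ℂ 𝒦]
    (P : Matrix (Fin n) (Fin n) ℝ) (f : Fin n → C(ℝ, 𝒦)) (j : Fin n) (s : ℝ) :
    sqrtCurve P f j s = ∑ l, ((cfc Real.sqrt P j l : ℝ) : ℂ) • f l s := by
  simp [sqrtCurve]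

theorem FieldSystem.conj_sqrtCurve {n : ℕ} {H 𝒦 : Type*} [NormedAddCommGroup H]
    [InnerProductSpace ℂ H] [NormedAddCommGroup 𝒦] [NormedSpace ℂ 𝒦] (S : FieldSystem H 𝒦)
    {f : Fin n → C(ℝ, 𝒦)} (hc : ∀ j s, S.conj (f j s) = f j s)
    (P : Matrix (Fin n) (Fin n) ℝ) (j : Fin n) (s : ℝ) :
    S.conj (sqrtCurve P f j s) = sqrtCurve P f j s := by
  rw [sqrtCurve_apply, map_sum]
  refine Finset.sum_congr rfl fun l _ => ?_
  rw [map_smulₛₗ, hc, Complex.conj_ofReal]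

namespace OQHO

variable {n d : ℕ} {ι : Type*} {H₀ : Type*} [NormedAddCommGroup H₀] [InnerProductSpace ℂ H₀]
variable (O : OQHO n d ι H₀) {P : Matrix (Fin n) (Fin n) ℝ}
variable {H 𝒦 : Type*} [NormedAddCommGroup H] [InnerProductSpace ℂ H]
  [NormedAddCommGroup 𝒦] [NormedSpace ℂ 𝒦] [CompleteSpace 𝒦] (S : FieldSystem H 𝒦)
  {f : Fin n → C(ℝ, 𝒦)}

/-- The one-particle curves have the two-point commutators of the system variables. -/
def HasLamComm (f : Fin n → C(ℝ, 𝒦)) : Prop :=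
  ∀ j k : Fin n, ∀ s σ : ℝ, 0 ≤ s → 0 ≤ σ →
    S.comm (f j s) (f k σ) = 2 * Complex.I * ((O.Lam (s - σ) j k : ℝ) : ℂ)

/-- The operator `D` acts on the one-particle curves of the system variables as an integral
operator with the kernel `L_1`: it is the commutator `[φ, X(s)] = -4i ∫ L_1(s, r) X(r) dr`. -/
theorem adOp_curve (hP : P.PosSemidef) (hf : O.HasLamComm S f) {t : ℝ} (ht : 0 ≤ t) {s : ℝ}
    (hs : 0 ≤ s) (a : Fin n) :
    S.adOp (sqrtCurve P f) t (f a s) =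
      (-4 * Complex.I) • ∫ r in (0 : ℝ)..t, ∑ b, ((O.adKernel P t 0 s r a b : ℝ) : ℂ) • f b r := by
  rw [S.adOp_apply, ← intervalIntegral.integral_smul]
  refine intervalIntegral.integral_congr fun r hr => ?_
  rw [Set.uIcc_of_le ht] at hr
  have h := sum_sqrt_bilin hP ((ContinuousLinearMap.lsmul ℂ ℂ : ℂ →L[ℂ] 𝒦 →L[ℂ] 𝒦) ∘L
    S.comm.flip (f a s)) (fun l => f l r) fun l => f l r
  simp only [← sqrtCurve_apply, ContinuousLinearMap.comp_apply, ContinuousLinearMap.lsmul_apply,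
    ContinuousLinearMap.flip_apply] at h
  simp only [mul_smul (2 : ℂ), ← Finset.smul_sum]
  rw [h]
  rw [Finset.sum_comm, Finset.smul_sum, Finset.smul_sum]
  refine Finset.sum_congr rfl fun b _ => ?_
  simp only [smul_smul]
  rw [← Finset.sum_smul (R := ℂ) (M := 𝒦), smul_smul]
  congr 1
  have e : O.adKernel P t 0 s r a b = ∑ l, O.Lam (s - r) a l * P l b := Matrix.mul_apply
  rw [e]
  push_cast
  rw [Finset.mul_sum, Finset.mul_sum]
  refine Finset.sum_congr rfl fun l _ => ?_
  rw [hf l a r s hr.1 hs, ← neg_sub s r, O.Lam_neg, Matrix.neg_apply, Matrix.transpose_apply]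
  push_cast
  ring

/-- Powers of `D` act on the one-particle curves through the iterated kernels `L_{k+1}`, of which
`adKernel` with the index `k` is the zero-based version. -/
theorem adOp_pow_curve (hP : P.PosSemidef) (hf : O.HasLamComm S f) {t : ℝ} (ht : 0 ≤ t) (k : ℕ)
    {s : ℝ} (hs : 0 ≤ s) (a : Fin n) :
    (S.adOp (sqrtCurve P f) t ^ (k + 1)) (f a s) = (-4 * Complex.I) ^ (k + 1) •
      ∫ r in (0 : ℝ)..t, ∑ b, ((O.adKernel P t k s r a b : ℝ) : ℂ) • f b r := by
  induction k generalizing s a with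
  | zero => simpa using O.adOp_curve S hP hf ht hs a
  | succ k ih =>
    have hc : ∀ k b, Continuous fun p : ℝ × ℝ => O.adKernel P t k p.1 p.2 a b := fun k b =>
      (O.continuous_adKernel P t k).matrix_elem a b
    have hc0 : ∀ b, Continuous fun r : ℝ => O.adKernel P t 0 s r a b := fun b =>
      O.continuous_adKernel_right P t 0 s a b
    have e1 : (S.adOp (sqrtCurve P f) t ^ (k + 1 + 1)) (f a s) =
        (S.adOp (sqrtCurve P f) t ^ (k + 1)) (S.adOp (sqrtCurve P f) t (f a s)) := by
      rw [pow_succ _ (k + 1)]; rfl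
    rw [e1, O.adOp_curve S hP hf ht hs, map_smul, ← ContinuousLinearMap.intervalIntegral_comp_comm _
      (Continuous.intervalIntegrable (by fun_prop) _ _), pow_succ' _ (k + 1), mul_smul (-4 * Complex.I)]
    congr 1
    simp only [map_sum, map_smul]
    have e2 : ∫ r in (0 : ℝ)..t, ∑ b, ((O.adKernel P t 0 s r a b : ℝ) : ℂ) •
        (S.adOp (sqrtCurve P f) t ^ (k + 1)) (f b r) = (-4 * Complex.I) ^ (k + 1) •
        ∫ r in (0 : ℝ)..t, ∫ σ in (0 : ℝ)..t, ∑ c,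
          ((((O.Lam (s - r) * P) * O.adKernel P t k r σ) a c : ℝ) : ℂ) • f c σ := by
      rw [← intervalIntegral.integral_smul]
      refine intervalIntegral.integral_congr fun r hr => ?_
      rw [Set.uIcc_of_le ht] at hr
      simp only [ih hr.1]
      simp only [smul_comm _ ((-4 * Complex.I) ^ (k + 1)), ← Finset.smul_sum]
      congr 1
      have e3 : ∀ b, ((O.adKernel P t 0 s r a b : ℝ) : ℂ) • (∫ σ in (0 : ℝ)..t, ∑ c,
          ((O.adKernel P t k r σ b c : ℝ) : ℂ) • f c σ) =
          ∫ σ in (0 : ℝ)..t, ((O.adKernel P t 0 s r a b : ℝ) : ℂ) • ∑ c,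
          ((O.adKernel P t k r σ b c : ℝ) : ℂ) • f c σ := fun b =>
        (intervalIntegral.integral_smul _ _).symm
      simp only [e3]
      rw [← intervalIntegral.integral_finsetSum]
      · refine intervalIntegral.integral_congr fun σ _ => ?_
        simp only [Finset.smul_sum]
        rw [Finset.sum_comm]
        refine Finset.sum_congr rfl fun c _ => ?_
        rw [Matrix.mul_apply]
        push_cast
        rw [Finset.sum_smul]
        simp only [smul_smul]
        rfl
      · intro b _
        have := fun c => O.continuous_adKernel_right P t k r b c
        exact Continuous.intervalIntegrable (by fun_prop) _ _
    rw [e2]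
    congr 1
    have hc1 : ∀ c, Continuous fun p : ℝ × ℝ =>
        ((O.Lam (s - p.1) * P) * O.adKernel P t k p.1 p.2) a c := by
      intro c
      have h3 := O.continuous_adKernel P t k
      have h4 := O.continuous_Lam
      have h5 : Continuous fun p : ℝ × ℝ => O.Lam (s - p.1) * P := by fun_prop
      exact (h5.matrix_mul h3).matrix_elem a c
    exact intervalIntegral_sum_smul_swap (F := fun c p =>
      ((O.Lam (s - p.1) * P) * O.adKernel P t k p.1 p.2) a c) hc1 f ht

end OQHO

namespace OQHO

variable {n d : ℕ} {ι : Type*} {H₀ : Type*} [NormedAddCommGroup H₀] [InnerProductSpace ℂ H₀]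
variable (O : OQHO n d ι H₀) (P : Matrix (Fin n) (Fin n) ℝ)

/-! ### The functions `α` and `β` -/

/-- The scalar coefficients of the series for `α` and `β`. -/
def serCoeff (θ : ℝ) (k : ℕ) : ℝ :=
  (-1) ^ (k + 1) * (2 * θ) ^ (2 * k + 1) / (Nat.factorial (2 * k + 3))

/-- The terms of the series for `β`, without the scalar coefficients. -/
def betaKernel (t : ℝ) (k : ℕ) (σ τ : ℝ) : Matrix (Fin n) (Fin n) ℝ :=
  ∑ j ∈ Finset.range (2 * k + 1), (Nat.choose (2 * k + 2) (j + 1) : ℝ) •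
      ((O.adKernel P t j t σ).transpose * P * O.adKernel P t (2 * k - j) t τ)

theorem abs_serCoeff_mul_le (θ : ℝ) {c : ℝ} (hc : 0 ≤ c) (k : ℕ) :
    |serCoeff θ k| * c ^ (2 * k + 1) ≤ (2 * |θ| * c) ^ (2 * k + 1) / (2 * k + 1).factorial := by
  have h : ((2 * k + 1).factorial : ℝ) ≤ (2 * k + 3).factorial := by
    exact_mod_cast Nat.factorial_le (by omega)
  rw [serCoeff, abs_div, abs_mul, abs_pow, abs_pow, abs_neg, abs_one, one_pow, one_mul, abs_mul,
    abs_two, Nat.abs_cast, mul_pow (2 * |θ|), div_mul_eq_mul_div]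
  gcongr

theorem summable_serBound (x : ℝ) :
    Summable fun k : ℕ => x ^ (2 * k + 1) / (2 * k + 1).factorial :=
  (Real.summable_pow_div_factorial x).comp_injective (i := fun k : ℕ => 2 * k + 1)
    fun i j h => by simpa using h

/-- A summable bound for the terms of the series of `α`, uniform on `[0, t]`. -/
theorem exists_alpha_bound (θ : ℝ) {t : ℝ} (ht : 0 ≤ t) :
    ∃ b : ℕ → ℝ, Summable b ∧ ∀ k, ∀ σ ∈ Set.Icc 0 t, ∀ i j,
      |serCoeff θ k * (P * O.adKernel P t (2 * k + 1) t σ) i j| ≤ b k := by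
  obtain ⟨b, c, hb, hc, h⟩ := O.exists_abs_adKernel_le P ht
  have hc0 : 0 ≤ c := zero_le_one.trans hc
  set p := ∑ i, ∑ j, |P i j|
  refine ⟨fun k => p * b * ((2 * |θ| * c) ^ (2 * k + 1) / (2 * k + 1).factorial),
    (summable_serBound _).mul_left _, fun k σ hσ i j => ?_⟩
  have h1 : |(P * O.adKernel P t (2 * k + 1) t σ) i j| ≤ p * (b * c ^ (2 * k + 1)) := by
    rw [Matrix.mul_apply]
    refine (Finset.abs_sum_le_sum_abs _ _).trans ?_
    refine (Finset.sum_le_sum (g := fun l => |P i l| * (b * c ^ (2 * k + 1))) fun l _ => ?_).trans ?_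
    · rw [abs_mul]
      exact mul_le_mul_of_nonneg_left (h _ t ⟨ht, le_rfl⟩ σ hσ l j) (abs_nonneg _)
    · rw [← Finset.sum_mul]
      refine mul_le_mul_of_nonneg_right ?_ (by positivity)
      exact Finset.single_le_sum (f := fun i => ∑ j, |P i j|) (fun _ _ => by positivity)
        (Finset.mem_univ i)
  rw [abs_mul]
  calc _ ≤ |serCoeff θ k| * (p * (b * c ^ (2 * k + 1))) :=
        mul_le_mul_of_nonneg_left h1 (abs_nonneg _)
    _ = p * b * (|serCoeff θ k| * c ^ (2 * k + 1)) := by ring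
    _ ≤ _ := mul_le_mul_of_nonneg_left (abs_serCoeff_mul_le θ hc0 k) (by positivity)

/-- A summable bound for the terms of the series of `β`, uniform on `[0, t]²`. -/
theorem exists_beta_bound (θ : ℝ) {t : ℝ} (ht : 0 ≤ t) :
    ∃ b : ℕ → ℝ, Summable b ∧ ∀ k, ∀ σ ∈ Set.Icc 0 t, ∀ τ ∈ Set.Icc 0 t, ∀ i j,
      |serCoeff θ k * O.betaKernel P t k σ τ i j| ≤ b k := by
  obtain ⟨b, c, hb, hc, h⟩ := O.exists_abs_adKernel_le P ht
  have hc0 : 0 ≤ c := zero_le_one.trans hc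
  set p := ∑ i, ∑ j, |P i j|
  have hp : ∀ k, ∀ σ ∈ Set.Icc 0 t, ∀ τ ∈ Set.Icc 0 t, ∀ i j, ∀ l ∈ Finset.range (2 * k + 1),
      |((O.adKernel P t l t σ).transpose * P * O.adKernel P t (2 * k - l) t τ) i j| ≤
        p * b ^ 2 * c ^ (2 * k) := by
    intro k σ hσ τ hτ i j l hl
    have e : p * b ^ 2 * c ^ (2 * k) =
        ∑ x, ∑ y, (b * c ^ l) * |P y x| * (b * c ^ (2 * k - l)) := by
      rw [Finset.sum_comm]
      simp only [← Finset.sum_mul, ← Finset.mul_sum]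
      have : c ^ (2 * k) = c ^ l * c ^ (2 * k - l) := by
        rw [← pow_add]; congr 1; have := Finset.mem_range.1 hl; omega
      rw [this]; ring
    rw [e, Matrix.mul_apply]
    refine (Finset.abs_sum_le_sum_abs _ _).trans (Finset.sum_le_sum fun x _ => ?_)
    rw [Matrix.mul_apply, abs_mul, ← Finset.sum_mul]
    refine mul_le_mul ?_ (h _ t ⟨ht, le_rfl⟩ τ hτ x j) (abs_nonneg _) (by positivity)
    refine (Finset.abs_sum_le_sum_abs _ _).trans (Finset.sum_le_sum fun y _ => ?_)
    rw [abs_mul]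
    exact mul_le_mul_of_nonneg_right (h _ t ⟨ht, le_rfl⟩ σ hσ y i) (abs_nonneg _)
  refine ⟨fun k => 2 * p * b ^ 2 * ((2 * |θ| * (2 * c)) ^ (2 * k + 1) / (2 * k + 1).factorial),
    (summable_serBound _).mul_left _, fun k σ hσ τ hτ i j => ?_⟩
  have h1 : |O.betaKernel P t k σ τ i j| ≤ 2 * p * b ^ 2 * (2 * c) ^ (2 * k + 1) := by
    rw [betaKernel, Matrix.sum_apply]
    refine (Finset.abs_sum_le_sum_abs _ _).trans ?_
    refine (Finset.sum_le_sum (g := fun l => ((2 * k + 2).choose (l + 1) : ℝ) *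
      (p * b ^ 2 * c ^ (2 * k))) fun l hl => ?_).trans ?_
    · rw [Matrix.smul_apply, smul_eq_mul, abs_mul, Nat.abs_cast]
      exact mul_le_mul_of_nonneg_left (hp k σ hσ τ hτ i j l hl) (Nat.cast_nonneg _)
    · rw [← Finset.sum_mul]
      have h2 : (∑ l ∈ Finset.range (2 * k + 1), ((2 * k + 2).choose (l + 1) : ℝ)) ≤
          2 ^ (2 * k + 2) := by
        have := Nat.sum_range_choose (2 * k + 2)
        rw [Finset.sum_range_succ, Finset.sum_range_succ'] at this
        have h3 : (∑ l ∈ Finset.range (2 * k + 1), (2 * k + 2).choose (l + 1)) ≤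
          2 ^ (2 * k + 2) := by omega
        exact_mod_cast h3
      calc _ ≤ 2 ^ (2 * k + 2) * (p * b ^ 2 * c ^ (2 * k + 1)) := by
            gcongr
            omega
        _ = _ := by ring
  rw [abs_mul]
  calc _ ≤ |serCoeff θ k| * (2 * p * b ^ 2 * (2 * c) ^ (2 * k + 1)) :=
        mul_le_mul_of_nonneg_left h1 (abs_nonneg _)
    _ = 2 * p * b ^ 2 * (|serCoeff θ k| * (2 * c) ^ (2 * k + 1)) := by ring
    _ ≤ _ := mul_le_mul_of_nonneg_left (abs_serCoeff_mul_le θ (by positivity) k) (by positivity)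

theorem matrix_tsum_apply {M : ℕ → Matrix (Fin n) (Fin n) ℝ}
    (h : ∀ i j, Summable fun k => M k i j) (i j : Fin n) : (∑' k, M k) i j = ∑' k, M k i j := by
  have : HasSum M (Matrix.of fun i j => ∑' k, M k i j) :=
    Pi.hasSum.2 fun i => Pi.hasSum.2 fun j => (h i j).hasSum
  rw [this.tsum_eq]
  rfl

theorem alpha_apply (θ : ℝ) {t : ℝ} (ht : 0 ≤ t) {σ : ℝ} (hσ : σ ∈ Set.Icc 0 t) (i j : Fin n) :
    O.alpha P θ t σ i j =
      8 * ∑' k, serCoeff θ k * (P * O.adKernel P t (2 * k + 1) t σ) i j := by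
  obtain ⟨b, hb, h⟩ := O.exists_alpha_bound P θ ht
  rw [alpha, Matrix.smul_apply, smul_eq_mul, matrix_tsum_apply]
  · rfl
  · exact fun i j => Summable.of_norm_bounded hb fun k => h k σ hσ i j

theorem beta_apply (θ : ℝ) {t : ℝ} (ht : 0 ≤ t) {σ : ℝ} (hσ : σ ∈ Set.Icc 0 t) {τ : ℝ}
    (hτ : τ ∈ Set.Icc 0 t) (i j : Fin n) :
    O.beta P θ t σ τ i j = 4 * ∑' k, serCoeff θ k * O.betaKernel P t k σ τ i j := by
  obtain ⟨b, hb, h⟩ := O.exists_beta_bound P θ ht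
  rw [beta, Matrix.smul_apply, smul_eq_mul, matrix_tsum_apply]
  · rfl
  · exact fun i j => Summable.of_norm_bounded hb fun k => h k σ hσ τ hτ i j

theorem continuous_betaKernel (t : ℝ) (k : ℕ) :
    Continuous fun p : ℝ × ℝ => O.betaKernel P t k p.1 p.2 := by
  refine continuous_finsetSum _ fun j _ => ?_
  have h : ∀ k, Continuous fun s : ℝ => O.adKernel P t k t s := fun k =>
    (O.continuous_adKernel P t k).comp (by fun_prop : Continuous fun s : ℝ => (t, s))
  have h1 := (h j).comp (continuous_fst (X := ℝ) (Y := ℝ))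
  have h2 := (h (2 * k - j)).comp (continuous_snd (X := ℝ) (Y := ℝ))
  exact Continuous.const_smul ((h1.matrix_transpose.matrix_mul (continuous_const (y := P))).matrix_mul
    h2) ((2 * k + 2).choose (j + 1) : ℝ)

/-! ### The series of commutators as an average over the semigroup -/

variable {P}
variable {H 𝒦 : Type*} [NormedAddCommGroup H] [InnerProductSpace ℂ H]
  [NormedAddCommGroup 𝒦] [NormedSpace ℂ 𝒦] (S : FieldSystem H 𝒦)
  {f : Fin n → C(ℝ, 𝒦)} (N : 𝒦 →L[ℂ] 𝒦 →L[ℂ] H)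

theorem sum_bilinCoeff (hP : P.PosSemidef) (D : 𝒦 →L[ℂ] 𝒦) (t : ℝ) (m : ℕ) :
    ∑ j, bilinCoeff N D (sqrtCurve P f j t) m =
      ∑ p ∈ Finset.HasAntidiagonal.antidiagonal m, (m.choose p.1 : ℝ) •
        ∑ a, ∑ b, ((P a b : ℝ) : ℂ) • N ((D ^ p.1) (f a t)) ((D ^ p.2) (f b t)) := by
  simp only [bilinCoeff]
  rw [Finset.sum_comm]
  refine Finset.sum_congr rfl fun p _ => ?_
  rw [← Finset.smul_sum, ← sum_sqrt_bilin hP]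
  simp only [sqrtCurve_apply, map_sum, map_smul]

theorem continuous_adKernel_sum (t : ℝ) (k : ℕ) (a : Fin n) :
    Continuous fun r => ∑ b, ((O.adKernel P t k t r a b : ℝ) : ℂ) • f b r :=
  continuous_finsetSum _ fun b _ => (Complex.continuous_ofReal.comp
    (O.continuous_adKernel_right P t k t a b)).smul (f b).continuous

theorem continuous_mul_adKernel (t : ℝ) (k : ℕ) (a b : Fin n) :
    Continuous fun r => (P * O.adKernel P t k t r) a b := by
  have h : Continuous fun s : ℝ => O.adKernel P t k t s :=
    (O.continuous_adKernel P t k).comp (by fun_prop : Continuous fun s : ℝ => (t, s))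
  exact ((continuous_const (y := P)).matrix_mul h).matrix_elem a b

theorem sum_antidiagonal_even (g : ℕ → ℕ → H) (k : ℕ) :
    ∑ p ∈ Finset.HasAntidiagonal.antidiagonal (2 * (k + 1)), (((2 * (k + 1)).choose p.1 : ℕ) : ℝ) •
        g p.1 p.2 =
      g (2 * k + 1 + 1) 0 + g 0 (2 * k + 1 + 1) +
        ∑ j ∈ Finset.range (2 * k + 1), ((2 * k + 2).choose (j + 1) : ℝ) •
          g (2 * k - j + 1) (j + 1) := by
  rw [← Finset.Nat.sum_antidiagonal_swap]
  rw [Finset.Nat.sum_antidiagonal_eq_sum_range_succ_mk]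
  simp only [Prod.swap_prod_mk]
  rw [Nat.succ_eq_add_one, Finset.sum_range_succ, show 2 * (k + 1) = 2 * k + 1 + 1 by ring,
    Finset.sum_range_succ']
  simp only [Nat.sub_self, Nat.choose_zero_right, Nat.choose_self, Nat.sub_zero, Nat.cast_one,
    one_smul]
  have : ∀ j ∈ Finset.range (2 * k + 1), (((2 * k + 1 + 1).choose (2 * k + 1 + 1 - (j + 1)) : ℕ) : ℝ) •
      g (2 * k + 1 + 1 - (j + 1)) (j + 1) =
      ((2 * k + 2).choose (j + 1) : ℝ) • g (2 * k - j + 1) (j + 1) := by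
    intro j hj
    have hj' := Finset.mem_range.1 hj
    rw [Nat.choose_symm (by omega), show 2 * k + 1 + 1 - (j + 1) = 2 * k - j + 1 by omega]
  rw [Finset.sum_congr rfl this]
  abel

/-- The value of `Ψ` in terms of the products `N (f_k(τ)) (f_j(σ))` of the system variables. -/
def psiValue (P : Matrix (Fin n) (Fin n) ℝ) (θ t : ℝ) (f : Fin n → C(ℝ, 𝒦))
    (N : 𝒦 →L[ℂ] 𝒦 →L[ℂ] H) : H :=
  (∑ j, ∑ k, ((P j k : ℝ) : ℂ) • N (f k t) (f j t)) +
      ((θ / 2 : ℝ) : ℂ) • ((∑ j, ∑ k, (∫ σ in Set.Icc 0 t, ((O.alpha P θ t σ j k / 2 : ℝ) : ℂ) •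
          (N (f k σ) (f j t) + N (f j t) (f k σ)))) +
        ∑ j, ∑ k, (∫ q in Set.Icc 0 t ×ˢ Set.Icc 0 t, ((O.beta P θ t q.1 q.2 j k : ℝ) : ℂ) •
          N (f k q.2) (f j q.1)))

/-- Termwise integration of the series of `α`. -/
theorem alphaIntegral (P : Matrix (Fin n) (Fin n) ℝ) (θ : ℝ) {t : ℝ} (ht : 0 ≤ t) (j k : Fin n)
    {g : ℝ → H} (hg : Continuous g) :
    IntegrableOn (fun σ => ((O.alpha P θ t σ j k / 2 : ℝ) : ℂ) • g σ) (Set.Icc 0 t) ∧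
    HasSum (fun κ => (4 * serCoeff θ κ) • ∫ σ in Set.Icc 0 t,
        (P * O.adKernel P t (2 * κ + 1) t σ) j k • g σ)
      (∫ σ in Set.Icc 0 t, ((O.alpha P θ t σ j k / 2 : ℝ) : ℂ) • g σ) := by
  obtain ⟨b, hb, h⟩ := O.exists_alpha_bound P θ ht
  obtain ⟨h1, h2⟩ := hasSum_setIntegral_smul volume (isCompact_Icc (a := (0 : ℝ)) (b := t))
    (a := fun κ σ => serCoeff θ κ * (P * O.adKernel P t (2 * κ + 1) t σ) j k)
    (fun κ => continuous_const.mul (O.continuous_mul_adKernel t _ j k)) hb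
    (fun κ σ hσ => h κ σ hσ j k) hg
  have e : Set.EqOn (fun σ => ((O.alpha P θ t σ j k / 2 : ℝ) : ℂ) • g σ)
      (fun σ => (4 : ℝ) • ((∑' κ, serCoeff θ κ * (P * O.adKernel P t (2 * κ + 1) t σ) j k) • g σ))
      (Set.Icc 0 t) := by
    intro σ hσ
    simp only
    rw [O.alpha_apply P θ ht hσ, Complex.coe_smul, smul_smul]
    congr 1
    ring
  refine ⟨(integrableOn_congr_fun e measurableSet_Icc).2 (h1.smul 4), ?_⟩
  rw [setIntegral_congr_fun measurableSet_Icc e, integral_smul]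
  refine (h2.const_smul (4 : ℝ)).congr_fun fun κ => ?_
  rw [mul_smul]
  congr 1
  rw [← integral_smul]
  simp only [smul_smul]

/-- Termwise integration of the series of `β`. -/
theorem betaIntegral (P : Matrix (Fin n) (Fin n) ℝ) (θ : ℝ) {t : ℝ} (ht : 0 ≤ t) (j k : Fin n)
    {g : ℝ × ℝ → H} (hg : Continuous g) :
    IntegrableOn (fun q : ℝ × ℝ => ((O.beta P θ t q.1 q.2 j k : ℝ) : ℂ) • g q)
      (Set.Icc 0 t ×ˢ Set.Icc 0 t) ∧
    HasSum (fun κ => (4 * serCoeff θ κ) • ∫ q in Set.Icc 0 t ×ˢ Set.Icc 0 t,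
        O.betaKernel P t κ q.1 q.2 j k • g q)
      (∫ q in Set.Icc 0 t ×ˢ Set.Icc 0 t, ((O.beta P θ t q.1 q.2 j k : ℝ) : ℂ) • g q) := by
  have hm : MeasurableSet (Set.Icc 0 t ×ˢ Set.Icc 0 t : Set (ℝ × ℝ)) :=
    measurableSet_Icc.prod measurableSet_Icc
  obtain ⟨b, hb, h⟩ := O.exists_beta_bound P θ ht
  obtain ⟨h1, h2⟩ := hasSum_setIntegral_smul volume ((isCompact_Icc (a := (0 : ℝ)) (b := t)).prod
    (isCompact_Icc (a := (0 : ℝ)) (b := t)))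
    (a := fun κ q => serCoeff θ κ * O.betaKernel P t κ q.1 q.2 j k)
    (fun κ => continuous_const.mul ((O.continuous_betaKernel P t κ).matrix_elem j k)) hb
    (fun κ q hq => h κ q.1 hq.1 q.2 hq.2 j k) hg
  have e : Set.EqOn (fun q : ℝ × ℝ => ((O.beta P θ t q.1 q.2 j k : ℝ) : ℂ) • g q)
      (fun q => (4 : ℝ) • ((∑' κ, serCoeff θ κ * O.betaKernel P t κ q.1 q.2 j k) • g q))
      (Set.Icc 0 t ×ˢ Set.Icc 0 t) := by
    intro q hq
    simp only
    rw [O.beta_apply P θ ht hq.1 hq.2, Complex.coe_smul, smul_smul]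
  refine ⟨(integrableOn_congr_fun e hm).2 (h1.smul 4), ?_⟩
  rw [setIntegral_congr_fun hm e, integral_smul]
  refine (h2.const_smul (4 : ℝ)).congr_fun fun κ => ?_
  rw [mul_smul]
  congr 1
  rw [← integral_smul]
  simp only [smul_smul]

variable [CompleteSpace 𝒦]

theorem adOp_pow_curve_eq_setIntegral (hP : P.PosSemidef) (hf : O.HasLamComm S f) {t : ℝ}
    (ht : 0 ≤ t) (k : ℕ) (a : Fin n) :
    (S.adOp (sqrtCurve P f) t ^ (k + 1)) (f a t) = (-4 * Complex.I) ^ (k + 1) •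
      ∫ r in Set.Icc 0 t, ∑ b, ((O.adKernel P t k t r a b : ℝ) : ℂ) • f b r := by
  rw [O.adOp_pow_curve S hP hf ht k ht, intervalIntegral.integral_of_le ht,
    ← integral_Icc_eq_integral_Ioc]

variable [CompleteSpace H]

/-- The terms where all the commutators fall on one of the factors. -/
theorem sum_adOp_pow_one (hP : P.PosSemidef) (hf : O.HasLamComm S f) {t : ℝ} (ht : 0 ≤ t) (k : ℕ)
    (φ : Fin n → 𝒦 →L[ℂ] H) :
    ∑ a, ∑ b, ((P a b : ℝ) : ℂ) • φ b ((S.adOp (sqrtCurve P f) t ^ (k + 1)) (f a t)) =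
      (-4 * Complex.I) ^ (k + 1) • ∑ a, ∑ b, ∫ σ in Set.Icc 0 t,
        (P * O.adKernel P t k t σ) a b • φ a (f b σ) := by
  have hsymm : ∀ a b, P a b = P b a := fun a b => by
    have := congrFun (congrFun hP.isHermitian a) b
    simpa using this.symm
  have h1 : ∀ a b, φ b ((S.adOp (sqrtCurve P f) t ^ (k + 1)) (f a t)) =
      (-4 * Complex.I) ^ (k + 1) • ∑ c, ∫ r in Set.Icc 0 t,
        ((O.adKernel P t k t r a c : ℝ) : ℂ) • φ b (f c r) := by
    intro a b
    rw [O.adOp_pow_curve_eq_setIntegral S hP hf ht, map_smul, ← integral_finsetSum,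
      ← ContinuousLinearMap.integral_comp_comm]
    · simp only [map_sum, map_smul]
    · exact (O.continuous_adKernel_sum t k a).continuousOn.integrableOn_compact isCompact_Icc
    · intro c _
      have h2 := O.continuous_adKernel_right P t k t a c
      exact (show Continuous fun r => ((O.adKernel P t k t r a c : ℝ) : ℂ) • φ b (f c r) from
        (Complex.continuous_ofReal.comp h2).smul (by fun_prop)).continuousOn.integrableOn_compact
          isCompact_Icc
  have h2 : ∀ a b, ∫ σ in Set.Icc 0 t, (P * O.adKernel P t k t σ) a b • φ a (f b σ) =
      ∑ c, ((P c a : ℝ) : ℂ) • ∫ r in Set.Icc 0 t,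
        ((O.adKernel P t k t r c b : ℝ) : ℂ) • φ a (f b r) := by
    intro a b
    simp only [← integral_smul]
    rw [← integral_finsetSum]
    · refine integral_congr_ae (Eventually.of_forall fun r => ?_)
      simp only
      rw [Matrix.mul_apply, Finset.sum_smul]
      refine Finset.sum_congr rfl fun c _ => ?_
      rw [smul_smul, ← Complex.ofReal_mul, Complex.coe_smul, hsymm]
    · intro c _
      have h2 := O.continuous_adKernel_right P t k t c b
      exact (show Continuous fun r => ((P c a : ℝ) : ℂ) • ((O.adKernel P t k t r c b : ℝ) : ℂ) •
        φ a (f b r) from ((Complex.continuous_ofReal.comp h2).smul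
          (by fun_prop)).const_smul _).continuousOn.integrableOn_compact isCompact_Icc
  simp only [h1, h2, smul_comm _ ((-4 * Complex.I) ^ (k + 1)), ← Finset.smul_sum]
  congr 1
  rw [Finset.sum_comm]
  refine Finset.sum_congr rfl fun a _ => ?_
  simp only [Finset.smul_sum]
  rw [Finset.sum_comm]

/-- The terms where the commutators fall on both factors. -/
theorem sum_adOp_pow_two (hP : P.PosSemidef) (hf : O.HasLamComm S f) {t : ℝ} (ht : 0 ≤ t)
    (k l : ℕ) :
    ∑ a, ∑ b, ((P a b : ℝ) : ℂ) • N ((S.adOp (sqrtCurve P f) t ^ (k + 1)) (f a t))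
        ((S.adOp (sqrtCurve P f) t ^ (l + 1)) (f b t)) =
      (-4 * Complex.I) ^ (k + 1 + (l + 1)) • ∑ a, ∑ b, ∫ p in Set.Icc 0 t ×ˢ Set.Icc 0 t,
        ((O.adKernel P t l t p.1).transpose * P * O.adKernel P t k t p.2) a b •
          N (f b p.2) (f a p.1) := by
  have hsymm : ∀ a b, P a b = P b a := fun a b => by
    have := congrFun (congrFun hP.isHermitian a) b
    simpa using this.symm
  have hA : ∀ k a b, Continuous fun σ => O.adKernel P t k t σ a b := fun k a b =>
    O.continuous_adKernel_right P t k t a b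
  have hcomp : IsCompact (Set.Icc 0 t ×ˢ Set.Icc 0 t : Set (ℝ × ℝ)) :=
    isCompact_Icc.prod isCompact_Icc
  have h1 : ∀ a b, N ((S.adOp (sqrtCurve P f) t ^ (k + 1)) (f a t))
        ((S.adOp (sqrtCurve P f) t ^ (l + 1)) (f b t)) =
      (-4 * Complex.I) ^ (k + 1 + (l + 1)) • ∫ p in Set.Icc 0 t ×ˢ Set.Icc 0 t,
        N (∑ c, ((O.adKernel P t k t p.2 a c : ℝ) : ℂ) • f c p.2)
          (∑ e, ((O.adKernel P t l t p.1 b e : ℝ) : ℂ) • f e p.1) := by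
    intro a b
    rw [O.adOp_pow_curve_eq_setIntegral S hP hf ht, O.adOp_pow_curve_eq_setIntegral S hP hf ht,
      map_smul, map_smul, _root_.smul_apply, smul_smul, bilin_setIntegral N
        (O.continuous_adKernel_sum t k a) (O.continuous_adKernel_sum t l b), mul_comm, ← pow_add]
  simp only [h1, smul_comm _ ((-4 * Complex.I) ^ (k + 1 + (l + 1))), ← Finset.smul_sum]
  congr 1
  simp only [← integral_smul]
  have i1 : ∀ a b, IntegrableOn (fun p : ℝ × ℝ => ((P a b : ℝ) : ℂ) •
      N (∑ c, ((O.adKernel P t k t p.2 a c : ℝ) : ℂ) • f c p.2)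
          (∑ e, ((O.adKernel P t l t p.1 b e : ℝ) : ℂ) • f e p.1))
          (Set.Icc 0 t ×ˢ Set.Icc 0 t) := by
    intro a b
    have c1 := (O.continuous_adKernel_sum (P := P) (f := f) t k a).comp
      (continuous_snd (X := ℝ) (Y := ℝ))
    have c2 := (O.continuous_adKernel_sum (P := P) (f := f) t l b).comp
      (continuous_fst (X := ℝ) (Y := ℝ))
    exact (((N.continuous.comp c1).clm_apply c2).const_smul
      ((P a b : ℝ) : ℂ)).continuousOn.integrableOn_compact hcomp
  have hA' : ∀ k, Continuous fun σ => O.adKernel P t k t σ := fun k =>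
    (O.continuous_adKernel P t k).comp (by fun_prop : Continuous fun s : ℝ => (t, s))
  have i2 : ∀ a b, IntegrableOn (fun p : ℝ × ℝ =>
      ((O.adKernel P t l t p.1).transpose * P * O.adKernel P t k t p.2) a b •
          N (f b p.2) (f a p.1)) (Set.Icc 0 t ×ˢ Set.Icc 0 t) := by
    intro a b
    have c1 := (hA' k).comp (continuous_snd (X := ℝ) (Y := ℝ))
    have c2 := (hA' l).comp (continuous_fst (X := ℝ) (Y := ℝ))
    have c3 := ((c2.matrix_transpose.matrix_mul (continuous_const (y := P))).matrix_mul
      c1).matrix_elem a b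
    exact (c3.smul (by fun_prop : Continuous fun p : ℝ × ℝ =>
      N (f b p.2) (f a p.1))).continuousOn.integrableOn_compact hcomp
  simp only [← integral_finsetSum _ fun b _ => i1 _ b, ← integral_finsetSum _ fun b _ => i2 _ b]
  rw [← integral_finsetSum _ fun a _ => integrable_finsetSum _ fun b _ => i1 a b,
    ← integral_finsetSum _ fun a _ => integrable_finsetSum _ fun b _ => i2 a b]
  refine integral_congr_ae (Eventually.of_forall fun p => ?_)
  simp only [map_sum, map_smul, _root_.sum_apply, _root_.smul_apply, Finset.smul_sum, smul_smul,
    Matrix.mul_apply, Matrix.transpose_apply, Finset.sum_smul, Finset.sum_mul]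
  refine (Finset.sum_congr rfl fun a _ => Finset.sum_comm.trans
    (Finset.sum_congr rfl fun e _ => Finset.sum_comm)).trans (Finset.sum_comm.trans ?_)
  refine Finset.sum_congr rfl fun e _ => Finset.sum_comm.trans ?_
  refine Finset.sum_congr rfl fun c _ => Finset.sum_congr rfl fun a _ =>
    Finset.sum_congr rfl fun b _ => ?_
  rw [← Complex.coe_smul, hsymm a b]
  congr 1
  push_cast
  ring

/-- The series of the terms of `θ Ψ` with at least two commutators. Each `ad_φ^{2k}` is expanded
by the Leibniz rule over the two factors of `ψ`. -/
theorem hasSum_psiValue (hP : P.PosSemidef) (hf : O.HasLamComm S f) {t : ℝ} (ht : 0 ≤ t) (θ : ℝ) :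
    HasSum (fun k : ℕ => (2 * (θ / 2) ^ (2 * (k + 1) + 1) / (2 * (k + 1) + 1).factorial : ℝ) •
        ∑ j, bilinCoeff N (S.adOp (sqrtCurve P f) t) (sqrtCurve P f j t) (2 * (k + 1)))
      (θ • O.psiValue P θ t f N - θ • ∑ j, ∑ k, ((P j k : ℝ) : ℂ) • N (f k t) (f j t)) := by
  have hα := fun j k => (O.alphaIntegral P θ ht j k
    (g := fun σ => N (f k σ) (f j t) + N (f j t) (f k σ)) (by fun_prop)).2
  have hβ := fun j k => (O.betaIntegral P θ ht j k
    (g := fun q => N (f k q.2) (f j q.1)) (by fun_prop)).2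
  have h := ((hasSum_sum (s := Finset.univ) fun j _ => hasSum_sum (s := Finset.univ) fun k _ =>
    hα j k).add (hasSum_sum (s := Finset.univ) fun j _ => hasSum_sum (s := Finset.univ) fun k _ =>
    hβ j k)).const_smul (θ * (θ / 2))
  have e : θ • O.psiValue P θ t f N - θ • ∑ j, ∑ k, ((P j k : ℝ) : ℂ) • N (f k t) (f j t) =
    (θ * (θ / 2)) • ((∑ j, ∑ k, (∫ σ in Set.Icc 0 t, ((O.alpha P θ t σ j k / 2 : ℝ) : ℂ) •
          (N (f k σ) (f j t) + N (f j t) (f k σ)))) +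
        ∑ j, ∑ k, (∫ q in Set.Icc 0 t ×ˢ Set.Icc 0 t, ((O.beta P θ t q.1 q.2 j k : ℝ) : ℂ) •
          N (f k q.2) (f j q.1))) := by
    rw [psiValue, smul_add, add_sub_cancel_left, Complex.coe_smul, smul_smul]
  rw [e]
  refine h.congr_fun fun k => ?_
  set D := S.adOp (sqrtCurve P f) t with hD
  rw [sum_bilinCoeff N hP, sum_antidiagonal_even (fun i l => ∑ a, ∑ b, ((P a b : ℝ) : ℂ) •
    N ((D ^ i) (f a t)) ((D ^ l) (f b t)))]
  -- an even number of commutators contributes a real factor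
  have hI : (-4 * Complex.I) ^ (2 * k + 1 + 1) = (((-16) ^ (k + 1) : ℝ) : ℂ) := by
    rw [show 2 * k + 1 + 1 = 2 * (k + 1) by ring, pow_mul, mul_pow, Complex.I_sq]
    push_cast
    norm_num
  have hsymm : ∀ a b, P a b = P b a := fun a b => by
    have := congrFun (congrFun hP.isHermitian a) b
    simpa using this.symm
  -- all the commutators on the first factor: this and the next case give `α`
  have t1 : ∑ a, ∑ b, ((P a b : ℝ) : ℂ) • N ((D ^ (2 * k + 1 + 1)) (f a t)) ((D ^ 0) (f b t)) =
      ((-16) ^ (k + 1) : ℝ) • ∑ a, ∑ b, ∫ σ in Set.Icc 0 t,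
        (P * O.adKernel P t (2 * k + 1) t σ) a b • N (f b σ) (f a t) := by
    rw [← Complex.coe_smul, ← hI]
    exact O.sum_adOp_pow_one S hP hf ht (2 * k + 1) fun b => N.flip (f b t)
  have t2 : ∑ a, ∑ b, ((P a b : ℝ) : ℂ) • N ((D ^ 0) (f a t)) ((D ^ (2 * k + 1 + 1)) (f b t)) =
      ((-16) ^ (k + 1) : ℝ) • ∑ a, ∑ b, ∫ σ in Set.Icc 0 t,
        (P * O.adKernel P t (2 * k + 1) t σ) a b • N (f a t) (f b σ) := by
    rw [← Complex.coe_smul, ← hI, ← O.sum_adOp_pow_one S hP hf ht (2 * k + 1) fun b => N (f b t),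
      Finset.sum_comm]
    refine Finset.sum_congr rfl fun a _ => Finset.sum_congr rfl fun b _ => ?_
    rw [hsymm]
    rfl
  -- commutators on both factors: this case gives `β`
  have t3 : ∀ j ∈ Finset.range (2 * k + 1), ((2 * k + 2).choose (j + 1) : ℝ) •
      ∑ a, ∑ b, ((P a b : ℝ) : ℂ) • N ((D ^ (2 * k - j + 1)) (f a t)) ((D ^ (j + 1)) (f b t)) =
      ((-16) ^ (k + 1) : ℝ) • ((2 * k + 2).choose (j + 1) : ℝ) • ∑ a, ∑ b,
        ∫ p in Set.Icc 0 t ×ˢ Set.Icc 0 t,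
        ((O.adKernel P t j t p.1).transpose * P * O.adKernel P t (2 * k - j) t p.2) a b •
          N (f b p.2) (f a p.1) := by
    intro j hj
    rw [smul_comm (((-16) ^ (k + 1) : ℝ)), ← Complex.coe_smul ((-16) ^ (k + 1) : ℝ), ← hI,
      O.sum_adOp_pow_two S N hP hf ht]
    have : 2 * k - j + 1 + (j + 1) = 2 * k + 1 + 1 := by
      have := Finset.mem_range.1 hj; omega
    rw [this]
  rw [t1, t2, Finset.sum_congr rfl t3, ← Finset.smul_sum, ← smul_add, ← smul_add, smul_smul]
  have e1 : ∀ a b, ∫ σ in Set.Icc 0 t, (P * O.adKernel P t (2 * k + 1) t σ) a b •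
      (N (f b σ) (f a t) + N (f a t) (f b σ)) =
      (∫ σ in Set.Icc 0 t, (P * O.adKernel P t (2 * k + 1) t σ) a b • N (f b σ) (f a t)) +
      ∫ σ in Set.Icc 0 t, (P * O.adKernel P t (2 * k + 1) t σ) a b • N (f a t) (f b σ) := by
    intro a b
    have hc := O.continuous_mul_adKernel (P := P) t (2 * k + 1) a b
    rw [← integral_add]
    · simp only [smul_add]
    · exact (hc.smul (by fun_prop : Continuous fun σ =>
        N (f b σ) (f a t))).continuousOn.integrableOn_compact isCompact_Icc
    · exact (hc.smul (by fun_prop : Continuous fun σ =>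
        N (f a t) (f b σ))).continuousOn.integrableOn_compact isCompact_Icc
  have e2 : ∀ a b, ∫ q in Set.Icc 0 t ×ˢ Set.Icc 0 t, O.betaKernel P t k q.1 q.2 a b •
      N (f b q.2) (f a q.1) = ∑ j ∈ Finset.range (2 * k + 1), ((2 * k + 2).choose (j + 1) : ℝ) •
        ∫ p in Set.Icc 0 t ×ˢ Set.Icc 0 t,
        ((O.adKernel P t j t p.1).transpose * P * O.adKernel P t (2 * k - j) t p.2) a b •
          N (f b p.2) (f a p.1) := by
    intro a b
    have hA' : ∀ k, Continuous fun σ => O.adKernel P t k t σ := fun k =>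
      (O.continuous_adKernel P t k).comp (by fun_prop : Continuous fun s : ℝ => (t, s))
    simp only [← integral_smul]
    rw [← integral_finsetSum]
    · refine integral_congr_ae (Eventually.of_forall fun p => ?_)
      simp only [betaKernel, Matrix.sum_apply, Finset.sum_smul, Matrix.smul_apply, smul_smul,
        smul_eq_mul]
    · intro j _
      have c1 := (hA' (2 * k - j)).comp (continuous_snd (X := ℝ) (Y := ℝ))
      have c2 := (hA' j).comp (continuous_fst (X := ℝ) (Y := ℝ))
      have c3 := ((c2.matrix_transpose.matrix_mul (continuous_const (y := P))).matrix_mul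
        c1).matrix_elem a b
      exact ((c3.smul (by fun_prop : Continuous fun p : ℝ × ℝ =>
        N (f b p.2) (f a p.1))).const_smul ((2 * k + 2).choose (j + 1) : ℝ)).continuousOn.integrableOn_compact
          (isCompact_Icc.prod isCompact_Icc)
  simp only [e1, e2, ← Finset.smul_sum, ← smul_add, smul_smul, Finset.sum_add_distrib]
  have e3 : ∀ g : Fin n → Fin n → ℕ → H, ∑ a, ∑ b, ∑ j ∈ Finset.range (2 * k + 1), g a b j =
      ∑ j ∈ Finset.range (2 * k + 1), ∑ a, ∑ b, g a b j := fun g =>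
    (Finset.sum_congr rfl fun a _ => Finset.sum_comm).trans Finset.sum_comm
  rw [e3]
  simp only [← Finset.smul_sum]
  congr 1
  rw [serCoeff, show 2 * (k + 1) + 1 = 2 * k + 3 by ring]
  have h16 : ((-16 : ℝ)) ^ (k + 1) = (-1) ^ (k + 1) * 2 ^ (4 * k + 4) := by
    rw [show 4 * k + 4 = 4 * (k + 1) by ring, pow_mul, ← mul_pow]; norm_num
  rw [h16, div_pow, mul_pow]
  field_simp
  ring

/-- The operator `Ψ_θ(t)` is the average over `s ∈ [-θ/2, θ/2]` of `ψ(t)` conjugated with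
`e^{sφ(t)}`. -/
theorem integral_exp_eq_psiValue (hP : P.PosSemidef) (hf : O.HasLamComm S f) {t : ℝ} (ht : 0 ≤ t)
    {θ : ℝ} (hθ : 0 ≤ θ) :
    ∫ s in (-(θ / 2))..(θ / 2), ∑ j,
      N (NormedSpace.exp (s • S.adOp (sqrtCurve P f) t) (sqrtCurve P f j t))
        (NormedSpace.exp (s • S.adOp (sqrtCurve P f) t) (sqrtCurve P f j t)) =
      θ • O.psiValue P θ t f N := by
  have hexp := FieldSystem.continuous_exp_smul (S.adOp (sqrtCurve P f) t)
  rw [intervalIntegral.integral_finsetSum fun j _ =>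
    Continuous.intervalIntegrable (by fun_prop) _ _]
  have h := hasSum_sum (s := Finset.univ) fun j _ => hasSum_integral_bilin_exp N
    (S.adOp (sqrtCurve P f) t) (sqrtCurve P f j t) (div_nonneg hθ zero_le_two)
  simp only [← Finset.smul_sum] at h
  have h1 := (hasSum_nat_add_iff' 1).2 h
  have h2 := h1.unique (O.hasSum_psiValue S N hP hf ht θ)
  rw [Finset.sum_range_one, sum_bilinCoeff N hP] at h2
  simp only [mul_zero, zero_add, pow_one, Finset.Nat.antidiagonal_zero, Finset.sum_singleton,
    Nat.factorial_one, Nat.choose_self, Nat.cast_one, one_smul, pow_zero,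
    div_one] at h2
  have e1 : ∑ a, ∑ b, ((P a b : ℝ) : ℂ) • N ((1 : 𝒦 →L[ℂ] 𝒦) (f a t))
      ((1 : 𝒦 →L[ℂ] 𝒦) (f b t)) = ∑ j, ∑ k, ((P j k : ℝ) : ℂ) • N (f k t) (f j t) := by
    rw [Finset.sum_comm]
    refine Finset.sum_congr rfl fun a _ => Finset.sum_congr rfl fun b _ => ?_
    have := congrFun (congrFun hP.isHermitian a) b
    rw [← this]
    rfl
  rw [e1, show 2 * (θ / 2) = θ by ring, sub_left_inj] at h2
  exact h2

end OQHO

/-! ### The derivative of the semigroup in terms of `Ψ` -/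

namespace OQHO

variable {n d : ℕ} {ι : Type*} {H₀ : Type*} [NormedAddCommGroup H₀] [InnerProductSpace ℂ H₀]
variable (O : OQHO n d ι H₀) {P : Matrix (Fin n) (Fin n) ℝ}
variable {H 𝒦 : Type*} [NormedAddCommGroup H] [InnerProductSpace ℂ H] [CompleteSpace H]
  [NormedAddCommGroup 𝒦] [NormedSpace ℂ 𝒦] (S : FieldSystem H 𝒦)
  {f : Fin n → C(ℝ, 𝒦)}

/-- The bilinear map `(h, g) ↦ Φ(g) Φ(h) e^{-cφ} v`, in terms of `M h g = Φ(g) Φ(h) v`. -/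
def semigroupBilin (ζ : Fin n → C(ℝ, 𝒦)) (t c : ℝ) (M : 𝒦 →L[ℂ] 𝒦 →L[ℂ] H) :
    𝒦 →L[ℂ] 𝒦 →L[ℂ] H :=
  (ContinuousLinearMap.compL ℂ 𝒦 𝒦 H).flip (NormedSpace.exp (c • S.adOp ζ t)) ∘L
    (ContinuousLinearMap.compL ℂ 𝒦 H H (S.semigroup ζ t c) ∘L
      (M ∘L NormedSpace.exp (c • S.adOp ζ t)))

theorem semigroupBilin_apply (ζ : Fin n → C(ℝ, 𝒦)) (t c : ℝ) (M : 𝒦 →L[ℂ] 𝒦 →L[ℂ] H) (h : 𝒦) :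
    semigroupBilin S ζ t c M h = S.semigroup ζ t c ∘L
      (M (NormedSpace.exp (c • S.adOp ζ t) h) ∘L NormedSpace.exp (c • S.adOp ζ t)) := rfl

variable [CompleteSpace 𝒦]

/-- The derivative of `⟪x, e^{-θφ(t)} y⟫` in `t` is `-θ ⟪e^{-θφ/2} x, Ψ e^{-θφ/2} y⟫`. -/
theorem hasDerivWithinAt_inner_semigroup_psi (hP : P.PosSemidef) (hf : O.HasLamComm S f)
    (hc : ∀ j s, S.conj (f j s) = f j s) {t : ℝ} (ht : 0 ≤ t) {θ : ℝ} (hθ : 0 ≤ θ) {x y : H}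
    (hx : x ∈ S.nice) (hy : y ∈ S.nice) {L : 𝒦 →L[ℂ] H} (hL : S.Reg y L)
    (hLn : ∀ h, L h ∈ S.nice) {M : 𝒦 →L[ℂ] 𝒦 →L[ℂ] H} (hM : ∀ h, S.Reg (L h) (M h)) :
    HasDerivWithinAt (fun τ => ⟪x, S.semigroup (sqrtCurve P f) τ θ y⟫_ℂ)
      (-(θ * ⟪S.semigroup (sqrtCurve P f) t (θ / 2) x,
        O.psiValue P θ t f (semigroupBilin S (sqrtCurve P f) t (θ / 2) M)⟫_ℂ)) (Set.Ici t) t := by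
  have hζ := S.conj_sqrtCurve hc P
  refine (S.hasDerivWithinAt_inner_semigroup hζ ht hθ hx hy hL hLn hM).congr_deriv ?_
  set ζ := sqrtCurve P f with hζdef
  set D := S.adOp ζ t with hD
  have hexp := FieldSystem.continuous_exp_smul D
  have h := O.integral_exp_eq_psiValue S (semigroupBilin S ζ t (θ / 2) M) hP hf ht hθ
  rw [← hζdef, ← hD] at h
  -- shift the interval `[0, θ]` of the integration to `[-θ/2, θ/2]`
  have h2 : ∫ c in (0 : ℝ)..θ, S.semigroup ζ t (θ / 2) (∑ j, M (NormedSpace.exp (c • D) (ζ j t))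
      (NormedSpace.exp (c • D) (ζ j t))) = θ • O.psiValue P θ t f
        (semigroupBilin S ζ t (θ / 2) M) := by
    have hs := intervalIntegral.integral_comp_sub_right (a := 0) (b := θ) (fun s => ∑ j,
        semigroupBilin S ζ t (θ / 2) M (NormedSpace.exp (s • D) (ζ j t))
          (NormedSpace.exp (s • D) (ζ j t))) (θ / 2)
    rw [zero_sub, sub_half] at hs
    rw [← h, ← hs]
    refine intervalIntegral.integral_congr fun c _ => ?_
    simp only [map_sum]
    refine Finset.sum_congr rfl fun j _ => ?_
    have e : NormedSpace.exp (c • D) = NormedSpace.exp ((θ / 2) • D) *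
        NormedSpace.exp ((c - θ / 2) • D) := by
      let : NormedAlgebra ℚ (𝒦 →L[ℂ] 𝒦) := NormedAlgebra.restrictScalars ℚ ℝ _
      rw [← NormedSpace.exp_add_of_commute (((Commute.refl D).smul_left _).smul_right _),
        ← add_smul]
      congr 2
      ring
    rw [semigroupBilin_apply, e]
    rfl
  have h3 : S.semigroup ζ t θ (∫ c in (0 : ℝ)..θ, ∑ j, M (NormedSpace.exp (c • D) (ζ j t))
      (NormedSpace.exp (c • D) (ζ j t))) = S.semigroup ζ t (θ / 2) (θ • O.psiValue P θ t f
        (semigroupBilin S ζ t (θ / 2) M)) := by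
    rw [← h2, ContinuousLinearMap.intervalIntegral_comp_comm _
      (Continuous.intervalIntegrable (by fun_prop) _ _), S.semigroup_add ζ t (by positivity)
        (by positivity), add_halves]
  rw [h3, ← S.inner_semigroup, ← Complex.coe_smul, inner_smul_right]

end OQHO

/-! ### Smooth vectors of the Weyl representation -/

namespace OQHO

variable {n d : ℕ} {ι : Type*} {H₀ : Type*} [NormedAddCommGroup H₀] [InnerProductSpace ℂ H₀]
variable (O : OQHO n d ι H₀)

/-- The symplectic form `uᵀ Θ v`. -/
def symp (u v : Fin n → ℝ) : ℝ := u ⬝ᵥ O.Θ.mulVec v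

theorem symp_add_right (u v w : Fin n → ℝ) : O.symp u (v + w) = O.symp u v + O.symp u w := by
  simp [symp, Matrix.mulVec_add, dotProduct_add]

theorem symp_smul_left (a : ℝ) (u v : Fin n → ℝ) : O.symp (a • u) v = a * O.symp u v := by
  simp [symp]

theorem symp_smul_right (a : ℝ) (u v : Fin n → ℝ) : O.symp u (a • v) = a * O.symp u v := by
  simp [symp, Matrix.mulVec_smul]

theorem symp_swap (u v : Fin n → ℝ) : O.symp v u = -O.symp u v := by
  have h : O.symp v u = u ⬝ᵥ O.Θ.transpose.mulVec v := by
    rw [symp, Matrix.mulVec_transpose, dotProduct_comm u, ← Matrix.dotProduct_mulVec]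
  rw [h, O.antisymm, Matrix.neg_mulVec, dotProduct_neg]
  rfl

theorem symp_self (u : Fin n → ℝ) : O.symp u u = 0 := by
  have := O.symp_swap u u
  linarith

theorem contDiff_symp {E : Type*} [NormedAddCommGroup E] [NormedSpace ℝ E]
    {f g : E → Fin n → ℝ} (hf : ContDiff ℝ ∞ f) (hg : ContDiff ℝ ∞ g) :
    ContDiff ℝ ∞ fun x => O.symp (f x) (g x) := by
  unfold symp dotProduct Matrix.mulVec dotProduct
  have h1 := contDiff_pi.1 hf
  have h2 := contDiff_pi.1 hg
  exact ContDiff.sum fun i _ => (h1 i).mul (ContDiff.sum fun j _ => contDiff_const.mul (h2 j))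

theorem weyl_mul (u v : Fin n → ℝ) (x : H₀) : O.weyl u (O.weyl v x) =
    Complex.exp (-(Complex.I * ((O.symp u v : ℝ) : ℂ))) • O.weyl (u + v) x :=
  O.weyl_rel u v x

theorem weyl_zero (x : H₀) : O.weyl 0 x = x := by
  have h := O.weyl_mul 0 0 x
  simp only [O.symp_self, Complex.ofReal_zero, mul_zero, neg_zero, Complex.exp_zero, one_smul,
    add_zero] at h
  exact (O.weyl 0).injective h

/-- The smooth vectors of the Weyl representation. -/
def smooth : Submodule ℂ H₀ where
  carrier := {x | ContDiff ℝ ∞ fun u : Fin n → ℝ => O.weyl u x}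
  zero_mem' := by simpa using contDiff_const
  add_mem' := fun {x y} hx hy => by
    simp only [Set.mem_ofPred_eq, map_add] at *
    exact hx.add hy
  smul_mem' := fun c x hx => by
    simp only [Set.mem_ofPred_eq, map_smul] at *
    exact hx.const_smul c

theorem weyl_mem_smooth {x : H₀} (hx : x ∈ O.smooth) (v : Fin n → ℝ) :
    O.weyl v x ∈ O.smooth := by
  change ContDiff ℝ ∞ fun u => O.weyl u (O.weyl v x)
  simp only [weyl_mul]
  have h1 : ContDiff ℝ ∞ fun u => O.weyl u x := hx
  have h2 : ContDiff ℝ ∞ fun u => O.symp u v := O.contDiff_symp contDiff_id contDiff_const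
  have h3 : ContDiff ℝ ∞ fun u => Complex.exp (-(Complex.I * ((O.symp u v : ℝ) : ℂ))) :=
    (contDiff_const.mul (Complex.ofRealCLM.contDiff.comp h2)).neg.cexp
  exact h3.smul (h1.comp (contDiff_id.add contDiff_const))

/-- Averages `∫ φ(u) W(u) x du` of a vector over the Weyl representation, with smooth compactly
supported `φ`, are smooth vectors. -/
theorem integral_weyl_mem_smooth [CompleteSpace H₀] (φ : ContDiffBump (0 : Fin n → ℝ)) (x : H₀) :
    ∫ t, φ.normed volume t • O.weyl t x ∈ O.smooth := by
  set f : (Fin n → ℝ) → H₀ := fun t => O.weyl t x with hf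
  have hfc : Continuous f := O.weyl_cont x
  -- by the Weyl relations, `W(v) ∫ φ(u) W(u) x du` is a convolution in `v`, with a phase which
  -- depends on `v` as a parameter
  set g : (Fin n → ℝ) → (Fin n → ℝ) → ℂ := fun p y =>
    ((φ.normed volume (-y) : ℝ) : ℂ) * Complex.exp (Complex.I * ((O.symp p y : ℝ) : ℂ)) with hg
  have h := contDiffOn_convolution_right_with_param (n := ⊤) (f := f) (g := g) (μ := volume)
    (s := Set.univ) (k := Metric.closedBall 0 φ.rOut)
    ((ContinuousLinearMap.lsmul ℝ ℂ : ℂ →L[ℝ] H₀ →L[ℝ] H₀).flip) isOpen_univ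
    (isCompact_closedBall _ _) (fun p y _ hy => by
      have : φ.normed volume (-y) = 0 := by
        rw [← Function.notMem_support, φ.support_normed_eq]
        intro h
        rw [Metric.mem_ball, dist_zero_right, norm_neg] at h
        rw [Metric.mem_closedBall, dist_zero_right] at hy
        exact hy h.le
      simp [hg, this]) hfc.locallyIntegrable (by
      refine ContDiff.contDiffOn ?_
      have h1 : ContDiff ℝ ∞ fun q : (Fin n → ℝ) × (Fin n → ℝ) => φ.normed volume (-q.2) :=
        φ.contDiff_normed.comp contDiff_snd.neg
      have h2 : ContDiff ℝ ∞ fun q : (Fin n → ℝ) × (Fin n → ℝ) => O.symp q.1 q.2 :=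
        O.contDiff_symp contDiff_fst contDiff_snd
      exact (Complex.ofRealCLM.contDiff.comp h1).mul
        (contDiff_const.mul (Complex.ofRealCLM.contDiff.comp h2)).cexp)
  rw [Set.univ_prod_univ, contDiffOn_univ] at h
  have h2 := h.comp (contDiff_id.prodMk contDiff_id : ContDiff ℝ ∞ fun v : Fin n → ℝ => (v, v))
  change ContDiff ℝ ∞ fun v => O.weyl v (∫ t, φ.normed volume t • O.weyl t x)
  convert h2 using 1
  funext v
  have hint : Integrable fun t => φ.normed volume t • O.weyl t x :=
    (φ.continuous_normed.smul hfc).integrable_of_hasCompactSupport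
      (φ.hasCompactSupport_normed.smul_right)
  change O.weyl v (∫ t, φ.normed volume t • O.weyl t x) = ∫ t, g v (v - t) • f t
  have e1 := ((O.weyl v).toContinuousLinearEquiv.toContinuousLinearMap).integral_comp_comm hint
  refine e1.symm.trans ?_
  rw [← integral_sub_right_eq_self _ v]
  refine integral_congr_ae (Eventually.of_forall fun t => ?_)
  have e2 : O.symp v (t - v) = O.symp v t := by
    have := O.symp_add_right v (t - v) v
    rw [sub_add_cancel, O.symp_self, add_zero] at this
    exact this.symm
  have e3 : O.symp v (v - t) = -O.symp v t := by
    have := O.symp_smul_right (-1) v (t - v)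
    rwa [neg_one_smul, neg_sub, e2, neg_one_mul] at this
  change O.weyl v (φ.normed volume (t - v) • O.weyl (t - v) x) = _
  rw [← Complex.coe_smul, map_smul, weyl_mul, e2, add_sub_cancel, smul_smul]
  simp only [hg, hf, neg_sub, e3]
  congr 2
  push_cast
  ring_nf

/-- Gårding's theorem: smooth vectors are dense. -/
theorem dense_smooth [CompleteSpace H₀] : Dense (O.smooth : Set H₀) := by
  intro x
  refine Metric.mem_closure_iff.2 fun ε hε => ?_
  have hc : Continuous fun u : Fin n → ℝ => O.weyl (-u) x := (O.weyl_cont x).comp continuous_neg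
  obtain ⟨δ, hδ, h⟩ := Metric.continuousAt_iff.1 (hc.continuousAt (x := 0)) (ε / 2)
    (half_pos hε)
  let φ : ContDiffBump (0 : Fin n → ℝ) := ⟨δ / 2, δ, half_pos hδ, half_lt_self hδ⟩
  refine ⟨_, O.integral_weyl_mem_smooth φ x, ?_⟩
  have h2 := φ.dist_normed_convolution_le (μ := volume) (x₀ := (0 : Fin n → ℝ)) (ε := ε / 2)
    (g := fun u => O.weyl (-u) x) hc.aestronglyMeasurable fun u hu => (h hu).le
  rw [dist_comm] at h2
  simp only [neg_zero, weyl_zero] at h2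
  have e : convolution (φ.normed volume) (fun u => O.weyl (-u) x) (ContinuousLinearMap.lsmul ℝ ℝ)
      volume 0 = ∫ t, φ.normed volume t • O.weyl t x := by
    rw [convolution]
    simp
  rw [e] at h2
  linarith

end OQHO

/-! ### Weighted shifts of square summable functions -/

section

variable {α E : Type*} [NormedAddCommGroup E]

theorem lp_norm_sq (v : lp (fun _ : α => E) 2) : ‖v‖ ^ 2 = ∑' N, ‖v N‖ ^ 2 := by
  have := lp.norm_rpow_eq_tsum (p := 2) (by norm_num) v
  simpa using this

theorem lp_summable_sq (v : lp (fun _ : α => E) 2) : Summable fun N => ‖v N‖ ^ 2 := by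
  have := (memℓp_gen_iff (p := 2) (by norm_num)).1 (lp.memℓp v)
  simpa using this

theorem memlp_two_of_summable {f : α → E} (h : Summable fun N => ‖f N‖ ^ 2) :
    Memℓp (E := fun _ : α => E) f 2 :=
  (memℓp_gen_iff (p := 2) (by norm_num)).2 (by simpa using h)

/-- Dominated convergence for square summable functions. -/
theorem tendsto_lp_of_dominated {x : ℕ → lp (fun _ : α => E) 2} {w : lp (fun _ : α => E) 2}
    {b : α → ℝ} (hb : Summable b) (hx : ∀ m N, ‖x m N‖ ^ 2 ≤ b N)
    (h : ∀ N, Tendsto (fun m => x m N) atTop (𝓝 (w N))) : Tendsto x atTop (𝓝 w) := by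
  have hw : ∀ N, ‖w N‖ ^ 2 ≤ b N := fun N =>
    le_of_tendsto (((h N).norm).pow 2) (Eventually.of_forall fun m => hx m N)
  have h2 : Tendsto (fun m => ∑' N, ‖(x m - w) N‖ ^ 2) atTop (𝓝 (∑' N : α, (0 : ℝ))) := by
    refine tendsto_tsum_of_dominated_convergence (bound := fun N => 4 * b N) (hb.mul_left 4)
      (fun N => ?_) (Eventually.of_forall fun m N => ?_)
    · have := ((h N).sub_const (w N)).norm.pow 2
      simpa using this
    · rw [Real.norm_of_nonneg (sq_nonneg _)]
      have h3 : ‖(x m - w) N‖ ≤ ‖x m N‖ + ‖w N‖ := norm_sub_le _ _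
      have h4 := hx m N
      have h5 := hw N
      nlinarith [norm_nonneg (x m N), norm_nonneg (w N), norm_nonneg ((x m - w) N),
        sq_nonneg (‖x m N‖ - ‖w N‖)]
  rw [tsum_zero] at h2
  simp only [← lp_norm_sq] at h2
  rw [tendsto_iff_norm_sub_tendsto_zero]
  have h3 := (Real.continuous_sqrt.tendsto 0).comp h2
  simpa [Function.comp_def, Real.sqrt_sq (norm_nonneg _)] using h3

/-- Reindexing of a sum along maps which are inverse to each other on the supports of the terms. -/
theorem tsum_eq_tsum_shift {f g : α → ℂ} (φ ψ : α → α)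
    (hf : ∀ N, f N ≠ 0 → ψ (φ N) = N ∧ g (φ N) = f N)
    (hg : ∀ N, g N ≠ 0 → φ (ψ N) = N ∧ f (ψ N) = g N) : ∑' N, f N = ∑' N, g N := by
  refine tsum_eq_tsum_of_ne_zero_bij (fun N : Function.support g => ψ N) (fun N N' h => ?_)
    (fun N hN => ?_) fun N => (hg N N.2).2
  · have := congrArg φ h
    simp only [(hg N N.2).1, (hg N' N'.2).1] at this
    exact Subtype.ext this
  · obtain ⟨h1, h2⟩ := hf N hN
    exact ⟨⟨φ N, by rw [Function.mem_support, h2]; exact hN⟩, h1⟩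

end

/-- Bounded weights `T N` together with a shift `φ` of the index set, which is injective where the
weights do not vanish. -/
structure WeightedShift (α E : Type*) [NormedAddCommGroup E] [InnerProductSpace ℂ E] where
  φ : α → α
  T : α → E →L[ℂ] E
  C : ℝ
  bound : ∀ N, ‖T N‖ ≤ C
  inj : ∀ N N', T N ≠ 0 → T N' ≠ 0 → φ N = φ N' → N = N'

namespace WeightedShift

variable {α E : Type*} [NormedAddCommGroup E] [InnerProductSpace ℂ E]

variable (A : WeightedShift α E)

theorem summable_aux (v : lp (fun _ : α => E) 2) :
    (Summable fun N : {N // A.T N ≠ 0} => ‖v (A.φ N)‖ ^ 2) ∧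
      ∑' N : {N // A.T N ≠ 0}, ‖v (A.φ N)‖ ^ 2 ≤ ‖v‖ ^ 2 := by
  have hinj : Function.Injective fun N : {N // A.T N ≠ 0} => A.φ N := fun N N' h =>
    Subtype.ext (A.inj _ _ N.2 N'.2 h)
  have hs := (lp_summable_sq v).comp_injective hinj
  refine ⟨hs, ?_⟩
  rw [lp_norm_sq]
  exact tsum_comp_le_tsum_of_inj (lp_summable_sq v) (fun _ => sq_nonneg _) hinj

theorem summable_indicator (v : lp (fun _ : α => E) 2) :
    Summable fun N => Set.indicator {N | A.T N ≠ 0} (fun N => ‖v (A.φ N)‖ ^ 2) N :=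
  summable_subtype_iff_indicator.1 (A.summable_aux v).1

theorem norm_sq_apply_le (v : lp (fun _ : α => E) 2) (N : α) :
    ‖A.T N (v (A.φ N))‖ ^ 2 ≤
      A.C ^ 2 * Set.indicator {N | A.T N ≠ 0} (fun N => ‖v (A.φ N)‖ ^ 2) N := by
  by_cases h : A.T N = 0
  · simp [h]
  · rw [Set.indicator_of_mem (show N ∈ {N | A.T N ≠ 0} from h), ← mul_pow]
    exact pow_le_pow_left₀ (norm_nonneg _) ((A.T N).le_of_opNorm_le (A.bound N) _) 2

theorem memlp (v : lp (fun _ : α => E) 2) :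
    Memℓp (E := fun _ : α => E) (fun N => A.T N (v (A.φ N))) 2 :=
  memlp_two_of_summable (Summable.of_nonneg_of_le (fun _ => sq_nonneg _) (A.norm_sq_apply_le v)
    ((A.summable_indicator v).mul_left _))

/-- The bounded operator `(op v)(N) = T N (v (φ N))`. -/
def op : lp (fun _ : α => E) 2 →L[ℂ] lp (fun _ : α => E) 2 :=
  LinearMap.mkContinuous
    { toFun := fun v => ⟨fun N => A.T N (v (A.φ N)), A.memlp v⟩
      map_add' := fun v w => by ext N; exact map_add _ _ _
      map_smul' := fun c v => by ext N; exact map_smul _ _ _ }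
    |A.C| (fun v => by
      rw [← sq_le_sq₀ (norm_nonneg _) (by positivity), lp_norm_sq, mul_pow, sq_abs]
      calc _ ≤ ∑' N, A.C ^ 2 * Set.indicator {N | A.T N ≠ 0} (fun N => ‖v (A.φ N)‖ ^ 2) N :=
            (Summable.of_nonneg_of_le (fun _ => sq_nonneg _) (A.norm_sq_apply_le v)
              ((A.summable_indicator v).mul_left _)).tsum_le_tsum (A.norm_sq_apply_le v)
              ((A.summable_indicator v).mul_left _)
        _ ≤ _ := by
          rw [tsum_mul_left]
          refine mul_le_mul_of_nonneg_left ?_ (sq_nonneg _)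
          rw [← tsum_subtype]
          exact (A.summable_aux v).2)

theorem op_apply (v : lp (fun _ : α => E) 2) (N : α) : A.op v N = A.T N (v (A.φ N)) := rfl

theorem norm_op_le : ‖A.op‖ ≤ |A.C| := LinearMap.mkContinuous_norm_le _ (abs_nonneg _) _

/-- Strong convergence of weighted shifts with dominated converging weights. -/
theorem tendsto_op {B : ℕ → WeightedShift α E} (hφ : ∀ m, (B m).φ = A.φ)
    (hT : ∀ m N, ‖(B m).T N‖ ≤ ‖A.T N‖) {v w : lp (fun _ : α => E) 2}
    (h : ∀ N, Tendsto (fun m => (B m).op v N) atTop (𝓝 (w N))) :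
    Tendsto (fun m => (B m).op v) atTop (𝓝 w) := by
  refine tendsto_lp_of_dominated ((A.summable_indicator v).mul_left (A.C ^ 2)) (fun m N => ?_) h
  rw [op_apply, hφ]
  by_cases h0 : A.T N = 0
  · have h1 := hT m N
    rw [h0, norm_zero] at h1
    rw [norm_le_zero_iff.1 h1]
    simp [h0]
  · rw [Set.indicator_of_mem (show N ∈ {N | A.T N ≠ 0} from h0), ← mul_pow]
    exact pow_le_pow_left₀ (norm_nonneg _)
      (((B m).T N).le_of_opNorm_le ((hT m N).trans (A.bound N)) _) 2

theorem inner_op {A A' : WeightedShift α E}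
    (h : ∀ N, A.T N ≠ 0 → A'.φ (A.φ N) = N ∧ ∀ x y, ⟪x, A.T N y⟫_ℂ = ⟪A'.T (A.φ N) x, y⟫_ℂ)
    (h' : ∀ N, A'.T N ≠ 0 → A.φ (A'.φ N) = N ∧ ∀ x y, ⟪A'.T N x, y⟫_ℂ = ⟪x, A.T (A'.φ N) y⟫_ℂ)
    (v w : lp (fun _ : α => E) 2) : ⟪A'.op w, v⟫_ℂ = ⟪w, A.op v⟫_ℂ := by
  rw [lp.inner_eq_tsum, lp.inner_eq_tsum]
  simp only [op_apply]
  refine tsum_eq_tsum_shift A'.φ A.φ (fun N hN => ?_) fun N hN => ?_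
  · have h0 : A'.T N ≠ 0 := fun h0 => hN (by simp [h0])
    obtain ⟨h1, h2⟩ := h' N h0
    exact ⟨h1, by rw [h1, h2]⟩
  · have h0 : A.T N ≠ 0 := fun h0 => hN (by simp [h0])
    obtain ⟨h1, h2⟩ := h N h0
    exact ⟨h1, by rw [h1, h2]⟩

end WeightedShift

/-! ### Creation and annihilation operators with a number cutoff -/

section Creation

variable {m E : Type*} [NormedAddCommGroup E] [InnerProductSpace ℂ E]

/-- The values of the creation operator `a†(c)` on the functions of the occupation numbers,
cut off to the particle numbers not exceeding `K`. -/
def creationFun (K : ℕ) (c : m → ℂ) (v : (m →₀ ℕ) → E) (N : m →₀ ℕ) : E :=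
  if N.degree ≤ K then
    ∑ κ ∈ N.support, (c κ * ((√(N κ : ℝ) : ℝ) : ℂ)) • v (N - Finsupp.single κ 1) else 0

theorem creationFun_add_left (K : ℕ) (c c' : m → ℂ) (v : (m →₀ ℕ) → E) (N : m →₀ ℕ) :
    creationFun K (c + c') v N = creationFun K c v N + creationFun K c' v N := by
  unfold creationFun
  split_ifs
  · simp [add_mul, add_smul, Finset.sum_add_distrib]
  · simp

theorem creationFun_smul_left (K : ℕ) (a : ℂ) (c : m → ℂ) (v : (m →₀ ℕ) → E) (N : m →₀ ℕ) :
    creationFun K (a • c) v N = a • creationFun K c v N := by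
  unfold creationFun
  split_ifs
  · simp [Finset.smul_sum, smul_smul, mul_assoc]
  · simp

theorem creationFun_add_right (K : ℕ) (c : m → ℂ) (v w : (m →₀ ℕ) → E) (N : m →₀ ℕ) :
    creationFun K c (v + w) N = creationFun K c v N + creationFun K c w N := by
  unfold creationFun
  split_ifs
  · simp [smul_add, Finset.sum_add_distrib]
  · simp

theorem creationFun_smul_right (K : ℕ) (a : ℂ) (c : m → ℂ) (v : (m →₀ ℕ) → E) (N : m →₀ ℕ) :
    creationFun K c (a • v) N = a • creationFun K c v N := by
  unfold creationFun
  split_ifs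
  · simp [Finset.smul_sum, smul_comm a]
  · simp

theorem norm_creationFun_sq_le (K : ℕ) (c : m → ℂ) (v : (m →₀ ℕ) → E) (N : m →₀ ℕ) :
    ‖creationFun K c v N‖ ^ 2 ≤
      K * ∑ κ ∈ N.support, ‖c κ‖ ^ 2 * ‖v (N - Finsupp.single κ 1)‖ ^ 2 := by
  unfold creationFun
  split_ifs with h
  · have h1 : ‖∑ κ ∈ N.support, (c κ * ((√(N κ : ℝ) : ℝ) : ℂ)) • v (N - Finsupp.single κ 1)‖ ≤
        ∑ κ ∈ N.support, √(N κ : ℝ) * (‖c κ‖ * ‖v (N - Finsupp.single κ 1)‖) := by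
      refine (norm_sum_le _ _).trans (Finset.sum_le_sum fun κ _ => le_of_eq ?_)
      rw [norm_smul, norm_mul, Complex.norm_real, Real.norm_of_nonneg (Real.sqrt_nonneg _)]
      ring
    refine (pow_le_pow_left₀ (norm_nonneg _) h1 2).trans
      ((Finset.sum_mul_sq_le_sq_mul_sq _ _ _).trans ?_)
    simp only [mul_pow]
    refine mul_le_mul_of_nonneg_right ?_ (by positivity)
    have h2 : ∑ κ ∈ N.support, √(N κ : ℝ) ^ 2 = ((N.degree : ℕ) : ℝ) := by
      rw [Finsupp.degree_apply, Nat.cast_sum]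
      exact Finset.sum_congr rfl fun κ _ => Real.sq_sqrt (Nat.cast_nonneg _)
    rw [h2]
    exact_mod_cast h
  · rw [norm_zero, zero_pow two_ne_zero]
    positivity

/-- The bound `‖a†(c) v‖² ≤ K ‖c‖² ‖v‖²` for the creation operator with values cut off at `K`
particles. -/
theorem tsum_creation_le (K : ℕ) (c : lp (fun _ : m => ℂ) 2) (v : lp (fun _ : m →₀ ℕ => E) 2) :
    ∑' N, ENNReal.ofReal (‖creationFun K c v N‖ ^ 2) ≤ ENNReal.ofReal (K * (‖c‖ ^ 2 * ‖v‖ ^ 2)) := by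
  classical
  calc ∑' N, ENNReal.ofReal (‖creationFun K c v N‖ ^ 2)
      ≤ ∑' N : m →₀ ℕ, ENNReal.ofReal K * ∑' κ : m, ENNReal.ofReal (‖c κ‖ ^ 2) *
          if κ ∈ N.support then ENNReal.ofReal (‖v (N - Finsupp.single κ 1)‖ ^ 2) else 0 := by
        refine ENNReal.tsum_le_tsum fun N => ?_
        refine (ENNReal.ofReal_le_ofReal (norm_creationFun_sq_le K c v N)).trans ?_
        rw [ENNReal.ofReal_mul (Nat.cast_nonneg K), ENNReal.ofReal_sum_of_nonneg fun κ _ => by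
          positivity]
        gcongr
        rw [tsum_eq_sum (s := N.support) fun κ hκ => by rw [if_neg hκ, mul_zero]]
        refine Finset.sum_le_sum fun κ hκ => ?_
        rw [if_pos hκ, ENNReal.ofReal_mul (sq_nonneg _)]
    _ = ENNReal.ofReal K * ∑' κ : m, ENNReal.ofReal (‖c κ‖ ^ 2) * ∑' N : m →₀ ℕ,
          if κ ∈ N.support then ENNReal.ofReal (‖v (N - Finsupp.single κ 1)‖ ^ 2) else 0 := by
        rw [ENNReal.tsum_mul_left, ENNReal.tsum_comm]
        simp only [ENNReal.tsum_mul_left]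
    _ ≤ ENNReal.ofReal K * ∑' κ : m, ENNReal.ofReal (‖c κ‖ ^ 2) * ∑' N : m →₀ ℕ,
          ENNReal.ofReal (‖v N‖ ^ 2) := by
        refine mul_le_mul_right (ENNReal.tsum_le_tsum fun κ => mul_le_mul_right ?_ _) _
        have hinj : Function.Injective fun N : {N : m →₀ ℕ // κ ∈ N.support} =>
            (N : m →₀ ℕ) - Finsupp.single κ 1 := by
          intro N N' h
          have hle : ∀ N : {N : m →₀ ℕ // κ ∈ N.support}, Finsupp.single κ 1 ≤ (N : m →₀ ℕ) :=
            fun N => Finsupp.single_le_iff.2 (Nat.one_le_iff_ne_zero.2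
              (Finsupp.mem_support_iff.1 N.2))
          refine Subtype.ext ?_
          rw [← tsub_add_cancel_of_le (hle N), ← tsub_add_cancel_of_le (hle N')]
          exact congrArg (· + Finsupp.single κ 1) h
        refine le_trans (le_of_eq ?_) (ENNReal.tsum_comp_le_tsum_of_injective hinj
          fun N => ENNReal.ofReal (‖v N‖ ^ 2))
        rw [← tsum_subtype_eq_of_support_subset (s := {N : m →₀ ℕ | κ ∈ N.support})]
        · refine tsum_congr fun N => ?_
          exact if_pos N.2
        · intro N hN
          by_contra h
          exact hN (if_neg h)
    _ = _ := by
        rw [ENNReal.tsum_mul_right, ← ENNReal.ofReal_tsum_of_nonneg (fun _ => sq_nonneg _)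
          (lp_summable_sq c), ← ENNReal.ofReal_tsum_of_nonneg (fun _ => sq_nonneg _)
          (lp_summable_sq v), ← lp_norm_sq, ← lp_norm_sq, ENNReal.ofReal_mul (Nat.cast_nonneg K),
          ENNReal.ofReal_mul (sq_nonneg _)]

theorem summable_creationFun (K : ℕ) (c : lp (fun _ : m => ℂ) 2)
    (v : lp (fun _ : m →₀ ℕ => E) 2) : Summable fun N => ‖creationFun K c v N‖ ^ 2 := by
  have h := ENNReal.summable_toReal ((tsum_creation_le K c v).trans_lt ENNReal.ofReal_lt_top).ne
  simpa only [ENNReal.toReal_ofReal (sq_nonneg _)] using h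

/-- The creation operators `a†(c)` cut off to the particle numbers not exceeding `K`. -/
def creation (K : ℕ) : lp (fun _ : m => ℂ) 2 →L[ℂ]
    lp (fun _ : m →₀ ℕ => E) 2 →L[ℂ] lp (fun _ : m →₀ ℕ => E) 2 :=
  LinearMap.mkContinuous₂ (LinearMap.mk₂ ℂ
    (fun c v => ⟨creationFun K c v, memlp_two_of_summable (summable_creationFun K c v)⟩)
    (fun c c' v => by ext N; exact creationFun_add_left K _ _ _ _)
    (fun a c v => by ext N; exact creationFun_smul_left K _ _ _ _)
    (fun c v w => by ext N; exact creationFun_add_right K _ _ _ _)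
    (fun a c v => by ext N; exact creationFun_smul_right K _ _ _ _)) √K (fun c v => by
      rw [← sq_le_sq₀ (norm_nonneg _) (by positivity), lp_norm_sq, mul_pow, mul_pow,
        Real.sq_sqrt (Nat.cast_nonneg K), mul_assoc]
      have h := tsum_creation_le K c v
      rw [← ENNReal.ofReal_tsum_of_nonneg (fun _ => sq_nonneg _) (summable_creationFun K c v)] at h
      exact (ENNReal.ofReal_le_ofReal_iff (by positivity)).1 h)

theorem creation_apply (K : ℕ) (c : lp (fun _ : m => ℂ) 2) (v : lp (fun _ : m →₀ ℕ => E) 2)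
    (N : m →₀ ℕ) : creation K c v N = if N.degree ≤ K then
      ∑ κ ∈ N.support, (c κ * ((√(N κ : ℝ) : ℝ) : ℂ)) • v (N - Finsupp.single κ 1) else 0 := rfl

open Classical in
/-- The basis vectors of the one-particle space. -/
def modeVec (κ : m) : lp (fun _ : m => ℂ) 2 := lp.single 2 κ (1 : ℂ)

theorem modeVec_apply_self (κ : m) : modeVec κ κ = 1 := by
  simp [modeVec]

theorem modeVec_apply_of_ne {κ κ' : m} (h : κ' ≠ κ) : modeVec κ κ' = 0 := by
  classical
  simp [modeVec, h]

theorem hasSum_modeVec (c : lp (fun _ : m => ℂ) 2) : HasSum (fun κ => c κ • modeVec κ) c := by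
  classical
  convert lp.hasSum_single (p := 2) (by norm_num) c using 2 with κ
  rw [modeVec, ← lp.single_smul, smul_eq_mul, mul_one]

theorem star_modeVec (κ : m) : star (modeVec κ) = modeVec κ := by
  ext κ'
  rw [lp.star_apply]
  by_cases h : κ' = κ
  · rw [h, modeVec_apply_self, star_one]
  · rw [modeVec_apply_of_ne h, star_zero]

theorem creation_modeVec (K : ℕ) (κ : m) (v : lp (fun _ : m →₀ ℕ => E) 2) (N : m →₀ ℕ) :
    creation K (modeVec κ) v N =
      if N.degree ≤ K then ((√(N κ : ℝ) : ℝ) : ℂ) • v (N - Finsupp.single κ 1) else 0 := by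
  rw [creation_apply]
  refine if_congr Iff.rfl ?_ rfl
  by_cases h : κ ∈ N.support
  · rw [Finset.sum_eq_single_of_mem κ h fun κ' _ hκ' => by simp [modeVec_apply_of_ne hκ'],
      modeVec_apply_self, one_mul]
  · rw [Finset.sum_eq_zero fun κ' hκ' => by
      rw [modeVec_apply_of_ne fun h0 : κ' = κ => h (h0 ▸ hκ'), zero_mul, zero_smul]]
    simp [Finsupp.notMem_support_iff.1 h]

theorem sqrt_smul_single_sub [DecidableEq (m →₀ ℕ)] (κ : m) (N N' : m →₀ ℕ) (x : E) :
    ((√(N' κ : ℝ) : ℝ) : ℂ) •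
        (lp.single 2 N x : lp (fun _ : m →₀ ℕ => E) 2) (N' - Finsupp.single κ 1) =
      (lp.single 2 (N + Finsupp.single κ 1) (((√((N κ : ℝ) + 1) : ℝ) : ℂ) • x) :
        lp (fun _ : m →₀ ℕ => E) 2) N' := by
  by_cases hN : N' = N + Finsupp.single κ 1
  · subst hN
    simp
  · rw [lp.single_apply_ne _ _ _ hN]
    by_cases hk : N' κ = 0
    · simp [hk]
    · rw [lp.single_apply_ne, smul_zero]
      intro h
      exact hN (by rw [← h, tsub_add_cancel_of_le (Finsupp.single_le_iff.2
        (Nat.one_le_iff_ne_zero.2 hk))])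

theorem sqrt_smul_single_add [DecidableEq (m →₀ ℕ)] (κ : m) (N N' : m →₀ ℕ) (x : E) :
    ((√((N' κ : ℝ) + 1) : ℝ) : ℂ) •
        (lp.single 2 N x : lp (fun _ : m →₀ ℕ => E) 2) (N' + Finsupp.single κ 1) =
      (lp.single 2 (N - Finsupp.single κ 1) (((√(N κ : ℝ) : ℝ) : ℂ) • x) :
        lp (fun _ : m →₀ ℕ => E) 2) N' := by
  by_cases hN : N = N' + Finsupp.single κ 1
  · subst hN
    simp
  · rw [lp.single_apply_ne _ _ _ (Ne.symm hN), smul_zero]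
    by_cases hk : N κ = 0
    · simp [hk]
    · rw [lp.single_apply_ne]
      intro h
      exact hN (by rw [h, tsub_add_cancel_of_le (Finsupp.single_le_iff.2
        (Nat.one_le_iff_ne_zero.2 hk))])

variable [CompleteSpace E]

/-- The annihilation operators `∑ κ, c κ a_κ`, restricted to the particle numbers not exceeding
`K`. -/
def annihilation (K : ℕ) : lp (fun _ : m => ℂ) 2 →L[ℂ]
    lp (fun _ : m →₀ ℕ => E) 2 →L[ℂ] lp (fun _ : m →₀ ℕ => E) 2 :=
  (ContinuousLinearMap.adjoint (𝕜 := ℂ) (E := lp (fun _ : m →₀ ℕ => E) 2)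
      (F := lp (fun _ : m →₀ ℕ => E) 2)).toContinuousLinearEquiv.toContinuousLinearMap.comp
    ((creation K).comp (starL ℂ : lp (fun _ : m => ℂ) 2 ≃L⋆[ℂ] _).toContinuousLinearMap)

theorem annihilation_eq (K : ℕ) (c : lp (fun _ : m => ℂ) 2) :
    (annihilation K c : lp (fun _ : m →₀ ℕ => E) 2 →L[ℂ] _) =
      ContinuousLinearMap.adjoint (creation K (star c)) := rfl

theorem annihilation_modeVec (K : ℕ) (κ : m) (v : lp (fun _ : m →₀ ℕ => E) 2) (N : m →₀ ℕ) :
    annihilation K (modeVec κ) v N =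
      if N.degree + 1 ≤ K then ((√((N κ : ℝ) + 1) : ℝ) : ℂ) • v (N + Finsupp.single κ 1)
        else 0 := by
  classical
  have h0 : ∀ x : E, (creation K (modeVec κ) (lp.single 2 N x) : lp (fun _ : m →₀ ℕ => E) 2) =
      if N.degree + 1 ≤ K then lp.single 2 (N + Finsupp.single κ 1)
        (((√((N κ : ℝ) + 1) : ℝ) : ℂ) • x) else 0 := by
    intro x
    ext N'
    rw [creation_modeVec, sqrt_smul_single_sub]
    by_cases hN : N' = N + Finsupp.single κ 1
    · subst hN
      have e : (N + Finsupp.single κ 1).degree = N.degree + 1 := by simp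
      rw [e]
      split_ifs <;> simp
    · rw [lp.single_apply_ne _ _ _ hN, ite_self]
      split_ifs
      · rw [lp.single_apply_ne _ _ _ hN]
      · rfl
  refine ext_inner_left ℂ fun x => ?_
  refine (lp.inner_single_left (𝕜 := ℂ) N x (annihilation K (modeVec κ) v)).symm.trans ?_
  rw [annihilation_eq, star_modeVec, ContinuousLinearMap.adjoint_inner_right, h0]
  split_ifs
  · rw [lp.inner_single_left, inner_smul_left, inner_smul_right, Complex.conj_ofReal]
  · rw [inner_zero_left, inner_zero_right]

end Creation

theorem HasDerivAt.clm_map {E F : Type*} [NormedAddCommGroup E] [NormedSpace ℂ E]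
    [NormedAddCommGroup F] [NormedSpace ℂ F] {f : ℝ → E} {f' : E} {x : ℝ} (h : HasDerivAt f f' x)
    (A : E →L[ℂ] F) : HasDerivAt (fun t => A (f t)) (A f') x :=
  (A.restrictScalars ℝ).hasFDerivAt.comp_hasDerivAt x h

/-! ### The one-particle space -/

/-- The one-particle space: `(u, c, c')` stands for the operator
`∑ j, u_j X_j + ∑ κ, c_κ a_κ + ∑ κ, c'_κ a_κ†`. -/
abbrev OneParticle (n : ℕ) (m : Type*) : Type _ :=
  (Fin n → ℂ) × (lp (fun _ : m => ℂ) 2 × lp (fun _ : m => ℂ) 2)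

namespace OneParticle

variable {n : ℕ} {m : Type*}

/-- The vector of `uᵀX`, for a real vector `u`. -/
def ofReal (u : Fin n → ℝ) : OneParticle n m := (fun j => (u j : ℂ), 0, 0)

/-- The vector of the annihilation operator `a_κ`. -/
def ann (κ : m) : OneParticle n m := (0, modeVec κ, 0)

/-- The vector of the creation operator `a_κ†`. -/
def cre (κ : m) : OneParticle n m := (0, 0, modeVec κ)

/-- The coefficient of `X_j`. -/
def sysCLM (j : Fin n) : OneParticle n m →L[ℂ] ℂ :=
  (ContinuousLinearMap.proj (R := ℂ) (φ := fun _ : Fin n => ℂ) j).comp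
    (ContinuousLinearMap.fst ℂ (Fin n → ℂ) (lp (fun _ : m => ℂ) 2 × lp (fun _ : m => ℂ) 2))

/-- The coefficients of the annihilation operators. -/
def annCLM : OneParticle n m →L[ℂ] lp (fun _ : m => ℂ) 2 :=
  (ContinuousLinearMap.fst ℂ (lp (fun _ : m => ℂ) 2) (lp (fun _ : m => ℂ) 2)).comp
    (ContinuousLinearMap.snd ℂ (Fin n → ℂ) (lp (fun _ : m => ℂ) 2 × lp (fun _ : m => ℂ) 2))

/-- The coefficients of the creation operators. -/
def creCLM : OneParticle n m →L[ℂ] lp (fun _ : m => ℂ) 2 :=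
  (ContinuousLinearMap.snd ℂ (lp (fun _ : m => ℂ) 2) (lp (fun _ : m => ℂ) 2)).comp
    (ContinuousLinearMap.snd ℂ (Fin n → ℂ) (lp (fun _ : m => ℂ) 2 × lp (fun _ : m => ℂ) 2))

theorem ofReal_smul (a : ℝ) (u : Fin n → ℝ) :
    (ofReal (a • u) : OneParticle n m) = (a : ℂ) • ofReal u := by
  ext <;> simp [ofReal]

/-- The conjugation which corresponds to the adjoint of operators. -/
def conj : OneParticle n m →SL[starRingEnd ℂ] OneParticle n m where
  toFun g := (star g.1, star g.2.2, star g.2.1)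
  map_add' g h := by simp
  map_smul' a g := by ext <;> simp
  cont := by fun_prop

theorem conj_apply (g : OneParticle n m) : conj g = (star g.1, star g.2.2, star g.2.1) := rfl

theorem conj_ofReal (u : Fin n → ℝ) : conj (ofReal u : OneParticle n m) = ofReal u := by
  refine Prod.ext ?_ (by simp [conj_apply, ofReal])
  funext j
  simp [conj_apply, ofReal]

theorem conj_ann (κ : m) : conj (ann κ : OneParticle n m) = cre κ := by
  simp [conj_apply, ann, cre, star_modeVec]

theorem conj_cre (κ : m) : conj (cre κ : OneParticle n m) = ann κ := by
  simp [conj_apply, ann, cre, star_modeVec]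

/-- The vectors of the operators `X_j`, `a_κ` and `a_κ†` are total. -/
theorem eq_top_of_generators {U : Submodule ℂ (OneParticle n m)}
    (hU : IsClosed (U : Set (OneParticle n m)))
    (hX : ∀ j, ofReal (Pi.single j 1) ∈ U) (ha : ∀ κ, ann κ ∈ U) (hc : ∀ κ, cre κ ∈ U) :
    U = ⊤ := by
  refine Submodule.eq_top_iff'.2 fun g => ?_
  have h1 : ((g.1, 0, 0) : OneParticle n m) ∈ U := by
    have e : ((g.1, 0, 0) : OneParticle n m) = ∑ j, g.1 j • ofReal (Pi.single j 1) := by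
      refine Prod.ext ?_ (Prod.ext ?_ ?_)
      · funext k
        simp [ofReal, Prod.fst_sum, Pi.single_apply, apply_ite]
      · simp [ofReal, Prod.snd_sum]
      · simp [ofReal, Prod.snd_sum]
    rw [e]
    exact Submodule.sum_mem _ fun j _ => U.smul_mem _ (hX j)
  have h2 : ((0, g.2.1, 0) : OneParticle n m) ∈ U := by
    refine hU.mem_of_tendsto ((((ContinuousLinearMap.inr ℂ (Fin n → ℂ) _).comp
      (ContinuousLinearMap.inl ℂ _ _)).hasSum (hasSum_modeVec g.2.1)))
      (Eventually.of_forall fun s => Submodule.sum_mem _ fun κ _ => ?_)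
    rw [map_smul]
    exact U.smul_mem _ (ha κ)
  have h3 : ((0, 0, g.2.2) : OneParticle n m) ∈ U := by
    refine hU.mem_of_tendsto ((((ContinuousLinearMap.inr ℂ (Fin n → ℂ) _).comp
      (ContinuousLinearMap.inr ℂ _ _)).hasSum (hasSum_modeVec g.2.2)))
      (Eventually.of_forall fun s => Submodule.sum_mem _ fun κ _ => ?_)
    rw [map_smul]
    exact U.smul_mem _ (hc κ)
  have e : g = (g.1, 0, 0) + ((0, g.2.1, 0) + (0, 0, g.2.2)) :=
    Prod.ext (by simp) (Prod.ext (by simp) (by simp))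
  rw [e]
  exact U.add_mem h1 (U.add_mem h2 h3)

end OneParticle

/-- The bilinear form `∑ κ, c_κ e_κ`. -/
def modePairing {m : Type*} : lp (fun _ : m => ℂ) 2 →L[ℂ] lp (fun _ : m => ℂ) 2 →L[ℂ] ℂ :=
  (innerSL ℂ).comp (starL ℂ : lp (fun _ : m => ℂ) 2 ≃L⋆[ℂ] _).toContinuousLinearMap

theorem modePairing_apply {m : Type*} (c e : lp (fun _ : m => ℂ) 2) :
    modePairing c e = ⟪star c, e⟫_ℂ := rfl

theorem hasSum_modePairing {m : Type*} (c e : lp (fun _ : m => ℂ) 2) :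
    HasSum (fun κ => c κ * e κ) (modePairing c e) := by
  rw [modePairing_apply]
  refine (lp.hasSum_inner (star c) e).congr_fun fun κ => ?_
  simp [lp.star_apply, mul_comm]

theorem modePairing_modeVec {m : Type*} (c : lp (fun _ : m => ℂ) 2) (κ : m) :
    modePairing c (modeVec κ) = c κ := by
  refine (hasSum_modePairing c (modeVec κ)).unique ?_
  convert hasSum_single κ fun κ' h => ?_ using 1
  · rw [modeVec_apply_self, mul_one]
  · rw [modeVec_apply_of_ne h, mul_zero]

theorem modePairing_star {m : Type*} (c e : lp (fun _ : m => ℂ) 2) :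
    modePairing (star c) (star e) = starRingEnd ℂ (modePairing c e) := by
  refine (hasSum_modePairing _ _).unique ?_
  refine ((hasSum_modePairing c e).map (starRingEnd ℂ) Complex.continuous_conj).congr_fun
    fun κ => ?_
  simp [lp.star_apply]

/-! ### The field operators of the oscillator -/

namespace OQHO

variable {n d : ℕ} {ι : Type*} {H₀ : Type*} [NormedAddCommGroup H₀] [InnerProductSpace ℂ H₀]
variable (O : OQHO n d ι H₀)

/-- The scalar commutators `[Φ(f), Φ(g)]`. -/
def comm : OneParticle n (FieldMode d ι) →L[ℂ] OneParticle n (FieldMode d ι) →L[ℂ] ℂ :=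
  (∑ j, ∑ k, (2 * Complex.I * ((O.Θ j k : ℝ) : ℂ)) •
    (ContinuousLinearMap.mul ℂ ℂ).bilinearComp (OneParticle.sysCLM j) (OneParticle.sysCLM k)) +
  (modePairing.bilinearComp OneParticle.annCLM OneParticle.creCLM -
    modePairing.bilinearComp OneParticle.creCLM OneParticle.annCLM)

theorem comm_apply (f g : OneParticle n (FieldMode d ι)) :
    O.comm f g = (∑ j, ∑ k, (2 * Complex.I * ((O.Θ j k : ℝ) : ℂ)) * (f.1 j * g.1 k)) +
      (modePairing f.2.1 g.2.2 - modePairing f.2.2 g.2.1) := by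
  simp [comm, _root_.sum_apply, OneParticle.sysCLM, OneParticle.annCLM, OneParticle.creCLM]

theorem comm_conj (f g : OneParticle n (FieldMode d ι)) :
    O.comm (OneParticle.conj f) (OneParticle.conj g) = -starRingEnd ℂ (O.comm f g) := by
  simp only [comm_apply, OneParticle.conj_apply, modePairing_star, map_add, map_sub, map_sum,
    map_mul, Complex.conj_I, Complex.conj_ofReal, Pi.star_apply, RCLike.star_def, map_ofNat,
    neg_add, ← Finset.sum_neg_distrib]
  congr 1
  · refine Finset.sum_congr rfl fun j _ => Finset.sum_congr rfl fun k _ => ?_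
    ring
  · ring

theorem comm_ofReal (u v : Fin n → ℝ) :
    O.comm (OneParticle.ofReal u) (OneParticle.ofReal v) = 2 * Complex.I * (O.symp u v : ℝ) := by
  simp only [comm_apply, OneParticle.ofReal, symp, dotProduct, Matrix.mulVec]
  push_cast
  simp only [Finset.mul_sum, map_zero, sub_zero, add_zero]
  refine Finset.sum_congr rfl fun j _ => Finset.sum_congr rfl fun k _ => ?_
  ring

theorem comm_ann (f : OneParticle n (FieldMode d ι)) (κ : FieldMode d ι) :
    O.comm f (OneParticle.ann κ) = -f.2.2 κ := by
  simp [comm_apply, OneParticle.ann, modePairing_modeVec]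

theorem comm_cre (f : OneParticle n (FieldMode d ι)) (κ : FieldMode d ι) :
    O.comm f (OneParticle.cre κ) = f.2.1 κ := by
  simp [comm_apply, OneParticle.cre, modePairing_modeVec]

/-- The Weyl operators acting on the system-field space. -/
def weylShift (u : Fin n → ℝ) : WeightedShift (FieldMode d ι →₀ ℕ) H₀ where
  φ := id
  T _ := (O.weyl u).toContinuousLinearEquiv.toContinuousLinearMap
  C := 1
  bound _ := (O.weyl u).toLinearIsometry.norm_toContinuousLinearMap_le
  inj _ _ _ _ h := h

/-- The Weyl operators `exp (i uᵀX(0)) ⊗ I` on the system-field space. -/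
def W (u : Fin n → ℝ) : SystemField d ι H₀ →L[ℂ] SystemField d ι H₀ := (O.weylShift u).op

theorem W_apply (u : Fin n → ℝ) (v : SystemField d ι H₀) (N : FieldMode d ι →₀ ℕ) :
    O.W u v N = O.weyl u (v N) := rfl

theorem W_zero (v : SystemField d ι H₀) : O.W 0 v = v := by
  ext N
  rw [W_apply, weyl_zero]

theorem W_mul (u w : Fin n → ℝ) (v : SystemField d ι H₀) : O.W u (O.W w v) =
    Complex.exp (-(Complex.I * ((O.symp u w : ℝ) : ℂ))) • O.W (u + w) v := by
  ext N
  simp only [W_apply, weyl_mul, lp.coeFn_smul, Pi.smul_apply]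

theorem W_neg_W (u : Fin n → ℝ) (v : SystemField d ι H₀) : O.W (-u) (O.W u v) = v := by
  have h := O.symp_smul_left (-1) u u
  rw [neg_one_smul, O.symp_self, mul_zero] at h
  rw [W_mul, h, neg_add_cancel, W_zero]
  simp

theorem inner_W (u : Fin n → ℝ) (v w : SystemField d ι H₀) :
    ⟪O.W u v, w⟫_ℂ = ⟪v, O.W (-u) w⟫_ℂ := by
  rw [lp.inner_eq_tsum, lp.inner_eq_tsum]
  refine tsum_congr fun N => ?_
  have h : w N = O.weyl u (O.weyl (-u) (w N)) := by
    have := O.W_neg_W (-u) w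
    rw [neg_neg] at this
    exact (congrArg (fun x : SystemField d ι H₀ => x N) this).symm
  rw [W_apply, W_apply]
  conv_lhs => rw [h]
  exact (O.weyl u).inner_map_map _ _

theorem norm_W (u : Fin n → ℝ) (v : SystemField d ι H₀) : ‖O.W u v‖ = ‖v‖ := by
  rw [← sq_eq_sq₀ (norm_nonneg _) (norm_nonneg _), lp_norm_sq, lp_norm_sq]
  simp only [W_apply, LinearIsometryEquiv.norm_map]

theorem continuous_W (v : SystemField d ι H₀) : Continuous fun u => O.W u v := by
  refine continuous_iff_continuousAt.2 fun u => tendsto_nhds_iff_seq_tendsto.2 fun s hs => ?_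
  refine tendsto_lp_of_dominated (lp_summable_sq v) (fun m N => ?_) fun N => ?_
  · change ‖O.weyl (s m) (v N)‖ ^ 2 ≤ _
    rw [LinearIsometryEquiv.norm_map]
  · exact ((O.weyl_cont (v N)).tendsto u).comp hs

theorem W_comm_op {A : WeightedShift (FieldMode d ι →₀ ℕ) H₀}
    (hA : ∀ N u x, A.T N (O.weyl u x) = O.weyl u (A.T N x)) (u : Fin n → ℝ)
    (v : SystemField d ι H₀) : O.W u (A.op v) = A.op (O.W u v) := by
  ext N
  rw [W_apply, WeightedShift.op_apply, WeightedShift.op_apply, W_apply, hA]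

theorem W_creation (u : Fin n → ℝ) (K : ℕ) (c : lp (fun _ : FieldMode d ι => ℂ) 2)
    (v : SystemField d ι H₀) : O.W u (creation K c v) = creation K c (O.W u v) := by
  ext N
  rw [W_apply, creation_apply, creation_apply]
  split_ifs
  · simp [W_apply]
  · simp

/-- The vector `v` belongs to the domains of all the fields, and `L g = Φ(g) v` depends
continuously on `g`. -/
structure FieldReg (v : SystemField d ι H₀)
    (L : OneParticle n (FieldMode d ι) →L[ℂ] SystemField d ι H₀) : Prop where
  ann : ∀ κ (N : FieldMode d ι →₀ ℕ), L (OneParticle.ann κ) N =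
    ((√((N κ : ℝ) + 1) : ℝ) : ℂ) • v (N + Finsupp.single κ 1)
  deriv : ∀ u : Fin n → ℝ,
    HasDerivAt (fun τ : ℝ => O.W (τ • u) v) (Complex.I • L (OneParticle.ofReal u)) 0
  cre : ∀ κ (N : FieldMode d ι →₀ ℕ), L (OneParticle.cre κ) N =
    ((√(N κ : ℝ) : ℝ) : ℂ) • v (N - Finsupp.single κ 1)

variable {O}

theorem FieldReg.add {v v' : SystemField d ι H₀}
    {L L' : OneParticle n (FieldMode d ι) →L[ℂ] SystemField d ι H₀} (h : O.FieldReg v L)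
    (h' : O.FieldReg v' L') : O.FieldReg (v + v') (L + L') where
  deriv u := by
    simp only [map_add, _root_.add_apply, smul_add]
    exact (h.deriv u).add (h'.deriv u)
  ann κ N := by simp [h.ann, h'.ann]
  cre κ N := by simp [h.cre, h'.cre]

theorem FieldReg.smul {v : SystemField d ι H₀}
    {L : OneParticle n (FieldMode d ι) →L[ℂ] SystemField d ι H₀} (a : ℂ) (h : O.FieldReg v L) :
    O.FieldReg (a • v) (a • L) where
  deriv u := by
    simp only [map_smul, _root_.smul_apply, smul_comm Complex.I a]
    exact (h.deriv u).const_smul a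
  ann κ N := by simp [h.ann, smul_comm a]
  cre κ N := by simp [h.cre, smul_comm a]

theorem FieldReg.unique {v : SystemField d ι H₀}
    {L L' : OneParticle n (FieldMode d ι) →L[ℂ] SystemField d ι H₀} (h : O.FieldReg v L)
    (h' : O.FieldReg v L') : L = L' := by
  have hU := OneParticle.eq_top_of_generators (U := (L - L').ker)
    (ContinuousLinearMap.isClosed_ker _) (fun j => ?_) (fun κ => ?_) fun κ => ?_
  · refine ContinuousLinearMap.ext fun g => sub_eq_zero.1 ?_
    have : g ∈ (L - L').ker := hU ▸ Submodule.mem_top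
    exact this
  · have := (h.deriv (Pi.single j 1)).unique (h'.deriv (Pi.single j 1))
    exact sub_eq_zero.2 (smul_right_injective _ Complex.I_ne_zero this)
  · refine sub_eq_zero.2 ?_
    ext N
    exact (h.ann κ N).trans (h'.ann κ N).symm
  · refine sub_eq_zero.2 ?_
    ext N
    exact (h.cre κ N).trans (h'.cre κ N).symm

/-- Weyl operators shift the field operators: `[Φ(h), W(u)] = i [Φ(h), uᵀX] W(u)`. -/
theorem FieldReg.weyl {v : SystemField d ι H₀}
    {L : OneParticle n (FieldMode d ι) →L[ℂ] SystemField d ι H₀} (h : O.FieldReg v L)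
    (u : Fin n → ℝ) : O.FieldReg (O.W u v) (O.W u ∘L L +
      ContinuousLinearMap.smulRight (O.comm.flip (OneParticle.ofReal u))
        (Complex.I • O.W u v)) where
  deriv w := by
    have h1 : ∀ τ : ℝ, O.W (τ • w) (O.W u v) =
        Complex.exp (-(Complex.I * ((2 * (τ * O.symp w u) : ℝ) : ℂ))) •
          O.W u (O.W (τ • w) v) := by
      intro τ
      rw [W_mul, W_mul, smul_smul, ← Complex.exp_add, add_comm u, O.symp_smul_left,
        O.symp_smul_right, O.symp_swap w u]
      congr 2
      push_cast
      ring
    have h2 : HasDerivAt (fun τ : ℝ => Complex.exp (-(Complex.I *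
        ((2 * (τ * O.symp w u) : ℝ) : ℂ)))) (-(Complex.I * ((2 * O.symp w u : ℝ) : ℂ))) 0 := by
      have h3 : HasDerivAt (fun τ : ℝ => 2 * (τ * O.symp w u)) (2 * O.symp w u) 0 := by
        simpa using ((hasDerivAt_id (0 : ℝ)).mul_const (O.symp w u)).const_mul 2
      have h4 := ((h3.ofReal_comp).const_mul Complex.I).neg.cexp
      simpa using h4
    have h3 := h2.smul ((h.deriv w).clm_map (O.W u))
    refine (h3.congr_of_eventuallyEq (Eventually.of_forall h1)).congr_deriv ?_
    simp only [_root_.add_apply, ContinuousLinearMap.smulRight_apply, ContinuousLinearMap.flip_apply,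
      comm_ofReal, ContinuousLinearMap.comp_apply, zero_smul, W_zero, zero_mul, mul_zero,
      Complex.ofReal_zero, neg_zero, Complex.exp_zero, map_smul, smul_add, smul_smul]
    congr 2
    · ring
    · push_cast
      linear_combination (-2 * Complex.I * (O.symp w u : ℂ)) * Complex.I_mul_I
  ann κ N := by
    have e : (O.comm (OneParticle.ann κ)) (OneParticle.ofReal u) = 0 := by
      simp [comm_apply, OneParticle.ann, OneParticle.ofReal]
    simp only [_root_.add_apply, ContinuousLinearMap.smulRight_apply, ContinuousLinearMap.flip_apply,
      e, zero_smul, add_zero, ContinuousLinearMap.comp_apply, W_apply, h.ann, map_smul]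
  cre κ N := by
    have e : (O.comm (OneParticle.cre κ)) (OneParticle.ofReal u) = 0 := by
      simp [comm_apply, OneParticle.cre, OneParticle.ofReal]
    simp only [_root_.add_apply, ContinuousLinearMap.smulRight_apply, ContinuousLinearMap.flip_apply,
      e, zero_smul, add_zero, ContinuousLinearMap.comp_apply, W_apply, h.cre, map_smul]

theorem FieldReg.hasDerivAt_W {v : SystemField d ι H₀}
    {L : OneParticle n (FieldMode d ι) →L[ℂ] SystemField d ι H₀} (h : O.FieldReg v L)
    (u : Fin n → ℝ) (s : ℝ) : HasDerivAt (fun τ : ℝ => O.W (τ • u) v)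
      (Complex.I • O.W (s • u) (L (OneParticle.ofReal u))) s := by
  have h1 : HasDerivAt (fun τ : ℝ => O.W ((τ - s) • u) v)
      (Complex.I • L (OneParticle.ofReal u)) s := by
    have := h.deriv u
    rw [← sub_self s] at this
    exact (HasDerivAt.scomp (h := fun τ : ℝ => τ - s) s this
      ((hasDerivAt_id s).sub_const s)).congr_deriv (one_smul _ _)
  have h2 := h1.clm_map (O.W (s • u))
  rw [map_smul] at h2
  refine h2.congr_of_eventuallyEq (Eventually.of_forall fun τ => ?_)
  change _ = O.W (s • u) (O.W ((τ - s) • u) v)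
  rw [W_mul, O.symp_smul_left, O.symp_smul_right, O.symp_self, ← add_smul, add_sub_cancel]
  simp

end OQHO

namespace OQHO

/-! ### Regular vectors of the field operators -/

variable {n d : ℕ} {ι : Type*} {H₀ : Type*} [NormedAddCommGroup H₀]

/-- The particle number in the state `v` does not exceed `K`. -/
def NumberLE (K : ℕ) (v : SystemField d ι H₀) : Prop :=
  ∀ N : FieldMode d ι →₀ ℕ, K < N.degree → v N = 0

theorem NumberLE.mono {K K' : ℕ} (h : K ≤ K') {v : SystemField d ι H₀} (hv : NumberLE K v) :
    NumberLE K' v := fun N hN => hv N (h.trans_lt hN)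

variable [InnerProductSpace ℂ H₀]

theorem NumberLE.creation {K : ℕ} (c : lp (fun _ : FieldMode d ι => ℂ) 2)
    (v : SystemField d ι H₀) : NumberLE K (creation K c v) := fun N hN => by
  rw [creation_apply, if_neg (not_le.2 hN)]

variable (O : OQHO n d ι H₀)

/-- The vectors `X_j v`, for a smooth vector `v`. -/
def sysVar (v : SystemField d ι H₀) (j : Fin n) : SystemField d ι H₀ :=
  -Complex.I • fderiv ℝ (fun u => O.W u v) 0 (Pi.single j 1)

variable {O}

theorem hasDerivAt_sysVar {v : SystemField d ι H₀} (hv : ContDiff ℝ ∞ fun u => O.W u v)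
    (u : Fin n → ℝ) : HasDerivAt (fun τ : ℝ => O.W (τ • u) v)
      (Complex.I • ∑ j, (u j : ℂ) • O.sysVar v j) 0 := by
  have h1 := ((hv.differentiable (by simp)) ((0 : ℝ) • u)).hasFDerivAt
  have h2 : HasDerivAt (fun τ : ℝ => τ • u) u 0 := by
    simpa using (hasDerivAt_id (0 : ℝ)).smul_const u
  refine (h1.comp_hasDerivAt (0 : ℝ) h2).congr_deriv ?_
  rw [zero_smul]
  conv_lhs => rw [pi_eq_sum_univ' u, map_sum]
  rw [Finset.smul_sum]
  refine Finset.sum_congr rfl fun j _ => ?_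
  have hI : Complex.I * (u j : ℂ) * -Complex.I = (u j : ℂ) := by
    linear_combination -(u j : ℂ) * Complex.I_mul_I
  rw [map_smul, sysVar, smul_smul, smul_smul, hI, Complex.coe_smul]
  rfl

/-- The system variables preserve smooth vectors: Weyl operators shift them by scalars. -/
theorem contDiff_W_sysVar {v : SystemField d ι H₀} (hv : ContDiff ℝ ∞ fun u => O.W u v)
    (j : Fin n) : ContDiff ℝ ∞ fun u => O.W u (O.sysVar v j) := by
  set e : Fin n → ℝ := Pi.single j 1
  have key : ∀ u, O.W u (fderiv ℝ (fun u => O.W u v) 0 e) =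
      -(Complex.I * ((O.symp u e : ℝ) : ℂ)) • O.W u v + fderiv ℝ (fun u => O.W u v) u e := by
    intro u
    have h0 : HasDerivAt (fun τ : ℝ => τ • e) e 0 := by
      simpa using (hasDerivAt_id (0 : ℝ)).smul_const e
    have h1 : HasDerivAt (fun τ : ℝ => O.W (τ • e) v) (fderiv ℝ (fun u => O.W u v) 0 e) 0 := by
      have := ((hv.differentiable (by simp)) ((0 : ℝ) • e)).hasFDerivAt.comp_hasDerivAt (0 : ℝ) h0
      rwa [zero_smul] at this
    have h2 : HasDerivAt (fun τ : ℝ => O.W (u + τ • e) v) (fderiv ℝ (fun u => O.W u v) u e) 0 := by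
      have := ((hv.differentiable (by simp)) (u + (0 : ℝ) • e)).hasFDerivAt.comp_hasDerivAt (0 : ℝ)
        (h0.const_add u)
      rwa [zero_smul, add_zero] at this
    have h3 : HasDerivAt (fun τ : ℝ => Complex.exp (-(Complex.I *
        ((τ * O.symp u e : ℝ) : ℂ)))) (-(Complex.I * ((O.symp u e : ℝ) : ℂ))) 0 := by
      have h4 : HasDerivAt (fun τ : ℝ => τ * O.symp u e) (O.symp u e) 0 := by
        simpa using (hasDerivAt_id (0 : ℝ)).mul_const (O.symp u e)
      simpa using ((h4.ofReal_comp).const_mul Complex.I).neg.cexp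
    have h5 := (h3.smul h2).congr_of_eventuallyEq (f₁ := fun τ : ℝ => O.W u (O.W (τ • e) v))
      (Eventually.of_forall fun τ => by
        simp only [Pi.smul_apply']
        rw [W_mul, O.symp_smul_right])
    have h6 := (h1.clm_map (O.W u)).unique h5
    rw [h6]
    simp [add_comm]
  have h1 : ContDiff ℝ ∞ fun u => fderiv ℝ (fun u => O.W u v) u e :=
    (hv.fderiv_right (by simp)).clm_apply contDiff_const
  have h2 : ContDiff ℝ ∞ fun u => -(Complex.I * ((O.symp u e : ℝ) : ℂ)) :=
    (contDiff_const.mul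
      (Complex.ofRealCLM.contDiff.comp (O.contDiff_symp contDiff_id contDiff_const))).neg
  change ContDiff ℝ ∞ fun u => O.W u (-Complex.I • fderiv ℝ (fun u => O.W u v) 0 e)
  simp only [map_smul, key]
  exact ContDiff.const_smul (-Complex.I) ((ContDiff.smul (𝕜' := ℂ) h2 hv).add h1)

theorem NumberLE.sysVar {K : ℕ} {v : SystemField d ι H₀} (hK : NumberLE K v)
    (hv : ContDiff ℝ ∞ fun u => O.W u v) (j : Fin n) : NumberLE K (O.sysVar v j) := by
  intro N hN
  have h := (hasDerivAt_sysVar hv (Pi.single j 1)).clm_map (lp.evalCLM ℂ (fun _ => H₀) 2 N)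
  have h2 : HasDerivAt (fun τ : ℝ => (O.W (τ • Pi.single j 1) v : SystemField d ι H₀) N)
      (0 : H₀) 0 := by
    simp only [W_apply, hK N hN, map_zero]
    exact hasDerivAt_const _ _
  have h3 := h.unique h2
  have h4 : ∑ k, ((Pi.single j 1 : Fin n → ℝ) k : ℂ) • O.sysVar v k = O.sysVar v j := by
    rw [Finset.sum_eq_single j (fun k _ hk => by simp [Pi.single_eq_of_ne hk]) (by simp)]
    simp
  rw [h4, map_smul] at h3
  exact (smul_eq_zero.1 h3).resolve_left Complex.I_ne_zero

variable [CompleteSpace H₀]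

theorem NumberLE.annihilation {K : ℕ} (c : lp (fun _ : FieldMode d ι => ℂ) 2)
    (v : SystemField d ι H₀) : NumberLE K (annihilation K c v) := by
  intro N hN
  have h := (((lp.evalCLM ℂ (fun _ : FieldMode d ι →₀ ℕ => H₀) 2 N).comp
    ((_root_.annihilation K).flip v)).hasSum (hasSum_modeVec c))
  refine h.unique (hasSum_zero.congr_fun fun κ => ?_)
  rw [map_smul]
  change c κ • (_root_.annihilation K (modeVec κ) v : SystemField d ι H₀) N = 0
  rw [annihilation_modeVec, if_neg (by omega), smul_zero]

theorem W_annihilation (u : Fin n → ℝ) (K : ℕ) (c : lp (fun _ : FieldMode d ι => ℂ) 2)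
    (v : SystemField d ι H₀) : O.W u (annihilation K c v) = annihilation K c (O.W u v) := by
  refine ext_inner_left ℂ fun x => ?_
  have h : ∀ y z : SystemField d ι H₀, ⟪y, O.W u z⟫_ℂ = ⟪O.W (-u) y, z⟫_ℂ := fun y z => by
    rw [inner_W, neg_neg]
  rw [h, annihilation_eq, ContinuousLinearMap.adjoint_inner_right,
    ContinuousLinearMap.adjoint_inner_right, h, W_creation]

/-- The map `(v, X) ↦ ((u, c, c') ↦ ∑ j, u_j X_j + (∑ κ, c_κ a_κ + ∑ κ, c'_κ a_κ†) v)`, with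
the particle number cut off. -/
def fieldMap (K : ℕ) : (SystemField d ι H₀ × (Fin n → SystemField d ι H₀)) →L[ℂ]
    OneParticle n (FieldMode d ι) →L[ℂ] SystemField d ι H₀ :=
  (∑ j, ((ContinuousLinearMap.smulRightL ℂ (OneParticle n (FieldMode d ι)) (SystemField d ι H₀)
      (OneParticle.sysCLM j)).comp (ContinuousLinearMap.proj (R := ℂ)
        (φ := fun _ : Fin n => SystemField d ι H₀) j)).comp
      (ContinuousLinearMap.snd ℂ (SystemField d ι H₀) (Fin n → SystemField d ι H₀))) +
  ((((ContinuousLinearMap.compL ℂ (OneParticle n (FieldMode d ι)) _ (SystemField d ι H₀)).flip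
      OneParticle.annCLM).comp (annihilation K).flip) +
    (((ContinuousLinearMap.compL ℂ (OneParticle n (FieldMode d ι)) _ (SystemField d ι H₀)).flip
      OneParticle.creCLM).comp (creation K).flip)).comp
    (ContinuousLinearMap.fst ℂ (SystemField d ι H₀) (Fin n → SystemField d ι H₀))

theorem fieldMap_apply (K : ℕ) (v : SystemField d ι H₀) (X : Fin n → SystemField d ι H₀)
    (g : OneParticle n (FieldMode d ι)) : fieldMap K (v, X) g =
      (∑ j, g.1 j • X j) + (annihilation K g.2.1 v + creation K g.2.2 v) := by
  simp [fieldMap, _root_.sum_apply, OneParticle.sysCLM, OneParticle.annCLM, OneParticle.creCLM]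

theorem W_fieldMap (u : Fin n → ℝ) (K : ℕ) (v : SystemField d ι H₀)
    (X : Fin n → SystemField d ι H₀) (g : OneParticle n (FieldMode d ι)) :
    O.W u (fieldMap K (v, X) g) = fieldMap K (O.W u v, fun j => O.W u (X j)) g := by
  simp only [fieldMap_apply, map_add, map_sum, map_smul, W_annihilation, W_creation]

/-- Vectors with bounded particle numbers, differentiable along the Weyl operators, are in the
domains of all the fields. The cutoff at `K + 1` is immaterial, since a field creates at most one
particle. -/
theorem fieldReg_fieldMap {K : ℕ} {v : SystemField d ι H₀} (hK : NumberLE K v)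
    {X : Fin n → SystemField d ι H₀} (hX : ∀ u : Fin n → ℝ,
      HasDerivAt (fun τ : ℝ => O.W (τ • u) v) (Complex.I • ∑ j, (u j : ℂ) • X j) 0) :
    O.FieldReg v (fieldMap (K + 1) (v, X)) where
  deriv u := by
    refine (hX u).congr_deriv ?_
    simp [fieldMap_apply, OneParticle.ofReal]
  ann κ N := by
    have e : fieldMap (K + 1) (v, X) (OneParticle.ann κ) =
        annihilation (K + 1) (modeVec κ) v := by
      simp [fieldMap_apply, OneParticle.ann]
    rw [e, annihilation_modeVec]
    split_ifs with h
    · rfl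
    · rw [hK, smul_zero]
      rw [map_add, Finsupp.degree_single]
      omega
  cre κ N := by
    have e : fieldMap (K + 1) (v, X) (OneParticle.cre κ) = creation (K + 1) (modeVec κ) v := by
      simp [fieldMap_apply, OneParticle.cre]
    rw [e, creation_modeVec]
    split_ifs with h
    · rfl
    · by_cases h0 : N κ = 0
      · simp [h0]
      · rw [hK, smul_zero]
        have h1 : Finsupp.single κ 1 ≤ N :=
          Finsupp.single_le_iff.2 (Nat.one_le_iff_ne_zero.2 h0)
        have h2 : (N - Finsupp.single κ 1).degree + 1 = N.degree := by
          conv_rhs => rw [← tsub_add_cancel_of_le h1, map_add, Finsupp.degree_single]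
        omega

variable (O)

/-- The smooth vectors with bounded particle numbers. -/
def nice : Submodule ℂ (SystemField d ι H₀) where
  carrier := {v | (∃ K, NumberLE K v) ∧ ContDiff ℝ ∞ fun u => O.W u v}
  zero_mem' := ⟨⟨0, fun _ _ => rfl⟩, by simpa using contDiff_const⟩
  add_mem' := by
    rintro v w ⟨⟨K, hv⟩, hv'⟩ ⟨⟨K', hw⟩, hw'⟩
    refine ⟨⟨max K K', fun N hN => ?_⟩, by simpa using hv'.add hw'⟩
    rw [lp.coeFn_add, Pi.add_apply, hv N ((le_max_left _ _).trans_lt hN),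
      hw N ((le_max_right _ _).trans_lt hN), add_zero]
  smul_mem' := by
    rintro a v ⟨⟨K, hv⟩, hv'⟩
    refine ⟨⟨K, fun N hN => ?_⟩, by simpa using hv'.const_smul a⟩
    rw [lp.coeFn_smul, Pi.smul_apply, hv N hN, smul_zero]

variable {O}

/-- The fields preserve the smooth vectors with bounded particle numbers. -/
theorem exists_fieldReg_of_nice {v : SystemField d ι H₀} (hv : v ∈ O.nice) :
    ∃ (L : OneParticle n (FieldMode d ι) →L[ℂ] SystemField d ι H₀)
      (M : OneParticle n (FieldMode d ι) →L[ℂ] OneParticle n (FieldMode d ι) →L[ℂ]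
        SystemField d ι H₀), O.FieldReg v L ∧ ∀ h, L h ∈ O.nice ∧ O.FieldReg (L h) (M h) := by
  obtain ⟨⟨K, hK⟩, hv⟩ := hv
  have hX := fun j => contDiff_W_sysVar hv j
  refine ⟨fieldMap (K + 1) (v, O.sysVar v), (fieldMap (K + 2)).comp
    ((fieldMap (K + 1) (v, O.sysVar v)).prod (ContinuousLinearMap.pi fun k =>
      fieldMap (K + 1) (O.sysVar v k, fun j => O.sysVar (O.sysVar v j) k))),
    fieldReg_fieldMap hK (hasDerivAt_sysVar hv), fun h => ?_⟩
  have hL : NumberLE (K + 1) (fieldMap (K + 1) (v, O.sysVar v) h) := by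
    intro N hN
    rw [fieldMap_apply]
    have h1 : (∑ j, h.1 j • O.sysVar v j : SystemField d ι H₀) N = 0 := by
      rw [lp.coeFn_sum, Finset.sum_apply]
      refine Finset.sum_eq_zero fun j _ => ?_
      rw [lp.coeFn_smul, Pi.smul_apply, (hK.mono (Nat.le_succ K)).sysVar hv j N hN, smul_zero]
    rw [lp.coeFn_add, lp.coeFn_add, Pi.add_apply, Pi.add_apply, h1,
      NumberLE.annihilation _ _ N hN, NumberLE.creation _ _ N hN, add_zero, add_zero]
  have hc : ∀ u, O.W u (fieldMap (K + 1) (v, O.sysVar v) h) =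
      fieldMap (K + 1) (O.W u v, fun j => O.W u (O.sysVar v j)) h := fun u =>
    W_fieldMap u _ _ _ _
  refine ⟨⟨⟨K + 1, hL⟩, ?_⟩, fieldReg_fieldMap hL fun u => ?_⟩
  · simp only [hc]
    exact (((ContinuousLinearMap.apply ℂ _ h).comp (fieldMap (K + 1))).restrictScalars ℝ).contDiff.comp
      (hv.prodMk (contDiff_pi.2 hX))
  · simp only [hc]
    have h1 := ((hasDerivAt_sysVar hv u).prodMk (hasDerivAt_pi.2 fun j =>
      hasDerivAt_sysVar (hX j) u)).clm_map ((ContinuousLinearMap.apply ℂ _ h).comp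
        (fieldMap (K + 1)))
    refine h1.congr_deriv ?_
    have e : ((Complex.I • ∑ k, (u k : ℂ) • O.sysVar v k, fun j =>
        Complex.I • ∑ k, (u k : ℂ) • O.sysVar (O.sysVar v j) k) :
          SystemField d ι H₀ × (Fin n → SystemField d ι H₀)) =
        Complex.I • ∑ k, (u k : ℂ) • (O.sysVar v k, fun j => O.sysVar (O.sysVar v j) k) := by
      refine Prod.ext ?_ (funext fun j => ?_)
      · simp [Prod.fst_sum]
      · simp only [Prod.smul_snd, Prod.snd_sum, Pi.smul_apply, Finset.sum_apply]
    rw [e, map_smul, map_sum]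
    simp only [map_smul]
    rfl

end OQHO

namespace OQHO

variable {n d : ℕ} {ι : Type*} {H₀ : Type*} [NormedAddCommGroup H₀] [InnerProductSpace ℂ H₀]
variable (O : OQHO n d ι H₀)

/-! ### The core and its approximation properties -/

theorem mem_core {v : SystemField d ι H₀} :
    v ∈ O.core ↔ (Function.support fun N => v N).Finite ∧ ∀ N, v N ∈ O.smooth := Iff.rfl

/-- The vectors of `O.core` form a subspace. -/
def coreSubmodule : Submodule ℂ (SystemField d ι H₀) where
  carrier := O.core
  zero_mem' := O.mem_core.2 ⟨by simp, fun N => O.smooth.zero_mem⟩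
  add_mem' {v w} hv hw := O.mem_core.2 ⟨(hv.1.union hw.1).subset (Function.support_add _ _),
    fun N => O.smooth.add_mem (hv.2 N) (hw.2 N)⟩
  smul_mem' a v hv := O.mem_core.2 ⟨hv.1.subset (Function.support_const_smul_subset a _),
    fun N => O.smooth.smul_mem a (hv.2 N)⟩

theorem op_mem_core {A : WeightedShift (FieldMode d ι →₀ ℕ) H₀}
    (hA : ∀ N, ∀ x ∈ O.smooth, A.T N x ∈ O.smooth) {v : SystemField d ι H₀} (hv : v ∈ O.core) :
    A.op v ∈ O.core := by
  refine O.mem_core.2 ⟨?_, fun N => hA N _ (hv.2 _)⟩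
  have h0 : ∀ N, A.op v N ≠ 0 → A.T N ≠ 0 ∧ v (A.φ N) ≠ 0 := by
    refine fun N hN => ⟨fun h => hN ?_, fun h => hN ?_⟩
    · rw [WeightedShift.op_apply, h, _root_.zero_apply]
    · rw [WeightedShift.op_apply, h, map_zero]
  exact Set.Finite.of_injOn (fun N hN => (h0 N hN).2)
    (fun N hN N' hN' h => A.inj _ _ (h0 N hN).1 (h0 N' hN').1 h) hv.1

/-- The restriction of states to a finite set of occupation numbers. -/
def truncShift (F : Finset (FieldMode d ι →₀ ℕ)) : WeightedShift (FieldMode d ι →₀ ℕ) H₀ where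
  φ := id
  T N := open Classical in if N ∈ F then 1 else 0
  C := 1
  bound N := by
    split_ifs
    · exact ContinuousLinearMap.norm_id_le
    · simp
  inj _ _ _ _ h := h

theorem truncShift_op_apply (F : Finset (FieldMode d ι →₀ ℕ)) (v : SystemField d ι H₀)
    (N : FieldMode d ι →₀ ℕ) :
    (truncShift F).op v N = open Classical in if N ∈ F then v N else 0 := by
  rw [WeightedShift.op_apply]
  simp only [truncShift]
  split_ifs <;> rfl

theorem truncShift_op_eq_sum [DecidableEq (FieldMode d ι →₀ ℕ)]
    (F : Finset (FieldMode d ι →₀ ℕ)) (v : SystemField d ι H₀) :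
    (truncShift F).op v = ∑ N ∈ F, lp.single 2 N (v N) := by
  ext N
  rw [truncShift_op_apply, lp.coeFn_sum, Finset.sum_apply]
  by_cases h : N ∈ F
  · rw [if_pos h, Finset.sum_eq_single_of_mem N h fun N' _ hN' => lp.single_apply_ne _ _ _ hN'.symm,
      lp.single_apply_self]
  · rw [if_neg h, Finset.sum_eq_zero fun N' hN' => lp.single_apply_ne _ _ _
      fun e : N = N' => h (e ▸ hN')]

theorem tendsto_truncShift (v : SystemField d ι H₀) :
    Tendsto (fun F => (truncShift F).op v) atTop (𝓝 v) := by
  classical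
  simp only [truncShift_op_eq_sum]
  exact lp.hasSum_single (by norm_num) v

theorem single_mem_core [DecidableEq (FieldMode d ι →₀ ℕ)] (N : FieldMode d ι →₀ ℕ) {x : H₀}
    (hx : x ∈ O.smooth) : (lp.single 2 N x : SystemField d ι H₀) ∈ O.core := by
  refine O.mem_core.2 ⟨(Set.finite_singleton N).subset fun N' hN' => ?_, fun N' => ?_⟩
  · by_contra h
    exact hN' (lp.single_apply_ne _ _ _ h)
  · by_cases h : N' = N
    · subst h
      rwa [lp.single_apply_self]
    · rw [lp.single_apply_ne _ _ _ h]
      exact O.smooth.zero_mem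

theorem truncShift_op_mem_core (F : Finset (FieldMode d ι →₀ ℕ)) {v : SystemField d ι H₀}
    (hv : ∀ N, v N ∈ O.smooth) : (truncShift F).op v ∈ O.core := by
  classical
  rw [truncShift_op_eq_sum]
  exact O.coreSubmodule.sum_mem fun N _ => O.single_mem_core N (hv N)

theorem core_le_nice : O.coreSubmodule ≤ O.nice := by
  classical
  intro v hv
  refine ⟨⟨hv.1.toFinset.sup Finsupp.degree, fun N hN => ?_⟩, ?_⟩
  · by_contra h
    exact absurd (Finset.le_sup (f := Finsupp.degree) (hv.1.mem_toFinset.2 h)) (not_le.2 hN)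
  · have e : v = (truncShift hv.1.toFinset).op v := by
      ext N
      rw [truncShift_op_apply]
      split_ifs with h
      · rfl
      · by_contra h0
        exact h (hv.1.mem_toFinset.2 h0)
    have h1 : ∀ u, O.W u v = ∑ N ∈ hv.1.toFinset,
        lp.singleContinuousLinearMap ℂ (fun _ => H₀) 2 N (O.weyl u (v N)) := fun u => by
      conv_lhs => rw [e, O.W_comm_op (fun N u x => by simp only [truncShift]; split_ifs <;> simp),
        truncShift_op_eq_sum]
      rfl
    simp only [h1]
    exact ContDiff.sum fun N _ => ((lp.singleContinuousLinearMap ℂ (fun _ => H₀) 2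
      N).restrictScalars ℝ).contDiff.comp (hv.2 N)

variable {O}

/-- Creation and annihilation operators are adjoint to each other. -/
theorem FieldReg.inner_cre {v w : SystemField d ι H₀}
    {L L' : OneParticle n (FieldMode d ι) →L[ℂ] SystemField d ι H₀} (hv : O.FieldReg v L)
    (hw : O.FieldReg w L') (κ : FieldMode d ι) :
    ⟪L' (OneParticle.cre κ), v⟫_ℂ = ⟪w, L (OneParticle.ann κ)⟫_ℂ := by
  rw [lp.inner_eq_tsum, lp.inner_eq_tsum]
  simp only [hv.ann, hw.cre]
  refine tsum_eq_tsum_shift (fun N => N - Finsupp.single κ 1) (fun N => N + Finsupp.single κ 1)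
    (fun N hN => ?_) fun N _ => ?_
  · have h0 : N κ ≠ 0 := fun h => hN (by simp [h])
    have h1 : N - Finsupp.single κ 1 + Finsupp.single κ 1 = N :=
      tsub_add_cancel_of_le (Finsupp.single_le_iff.2 (Nat.one_le_iff_ne_zero.2 h0))
    refine ⟨h1, ?_⟩
    have h2 : (((N - Finsupp.single κ 1 : FieldMode d ι →₀ ℕ) κ : ℕ) : ℝ) + 1 = N κ := by
      rw [Finsupp.tsub_apply, Finsupp.single_eq_same]
      exact_mod_cast Nat.sub_add_cancel (Nat.one_le_iff_ne_zero.2 h0)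
    simp only [h1, h2, inner_smul_left, inner_smul_right, Complex.conj_ofReal]
  · refine ⟨add_tsub_cancel_right _ _, ?_⟩
    have h2 : (((N + Finsupp.single κ 1 : FieldMode d ι →₀ ℕ) κ : ℕ) : ℝ) = N κ + 1 := by simp
    simp only [add_tsub_cancel_right, h2, inner_smul_left, inner_smul_right, Complex.conj_ofReal]

/-- The adjoint relation of the fields, checked on the generators of the one-particle space. For
the initial variables it is the derivative of the unitarity of the Weyl operators. -/
theorem FieldReg.inner_conj {v w : SystemField d ι H₀}
    {L L' : OneParticle n (FieldMode d ι) →L[ℂ] SystemField d ι H₀} (hv : O.FieldReg v L)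
    (hw : O.FieldReg w L') (g : OneParticle n (FieldMode d ι)) :
    ⟪L' (OneParticle.conj g), v⟫_ℂ = ⟪w, L g⟫_ℂ := by
  let U : Submodule ℂ (OneParticle n (FieldMode d ι)) :=
    { carrier := {g | ⟪L' (OneParticle.conj g), v⟫_ℂ = ⟪w, L g⟫_ℂ}
      zero_mem' := by simp
      add_mem' := fun {a b} ha hb => by
        rw [Set.mem_ofPred_eq] at *
        simp only [map_add, inner_add_left, inner_add_right, ha, hb]
      smul_mem' := fun a b hb => by
        rw [Set.mem_ofPred_eq] at *
        rw [map_smulₛₗ, map_smul, map_smul, inner_smul_left, inner_smul_right, hb,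
          Complex.conj_conj] }
  have hU : U = ⊤ := by
    refine OneParticle.eq_top_of_generators ?_ (fun j => ?_) (fun κ => ?_) fun κ => ?_
    · exact isClosed_eq (by fun_prop) (by fun_prop)
    · change ⟪L' (OneParticle.conj (OneParticle.ofReal _)), v⟫_ℂ = _
      rw [OneParticle.conj_ofReal]
      set e : Fin n → ℝ := Pi.single j 1
      have h1 : HasDerivAt (fun τ : ℝ => ⟪w, O.W (τ • e) v⟫_ℂ) _ 0 :=
        (hasDerivAt_const (0 : ℝ) w).inner ℂ (hv.deriv e)
      have h2 : HasDerivAt (fun τ : ℝ => O.W ((-τ) • e) w)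
          (-(Complex.I • L' (OneParticle.ofReal e))) 0 := by
        have h3 := hw.deriv e
        rw [← neg_zero] at h3
        exact (HasDerivAt.scomp (h := fun τ : ℝ => -τ) 0 h3 (hasDerivAt_neg 0)).congr_deriv
          (neg_one_smul _ _)
      have h3 : HasDerivAt (fun τ : ℝ => ⟪O.W ((-τ) • e) w, v⟫_ℂ) _ 0 :=
        h2.inner ℂ (hasDerivAt_const (0 : ℝ) v)
      have h4 := h1.unique (h3.congr_of_eventuallyEq (Eventually.of_forall fun τ => by
        dsimp only
        rw [neg_smul, inner_W, neg_neg]))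
      simp only [neg_zero, zero_smul, W_zero, inner_zero_left, inner_zero_right, add_zero,
        zero_add, inner_smul_right, inner_neg_left, inner_smul_left, Complex.conj_I, neg_mul,
        neg_neg] at h4
      exact (mul_left_cancel₀ Complex.I_ne_zero h4).symm
    · change ⟪L' (OneParticle.conj (OneParticle.ann κ)), v⟫_ℂ = _
      rw [OneParticle.conj_ann]
      exact hv.inner_cre hw κ
    · change ⟪L' (OneParticle.conj (OneParticle.cre κ)), v⟫_ℂ = _
      rw [OneParticle.conj_cre, ← inner_conj_symm, ← hw.inner_cre hv κ, inner_conj_symm]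
  have h : g ∈ U := hU ▸ Submodule.mem_top
  exact h

theorem smooth_apply_of_nice {v : SystemField d ι H₀} (hv : v ∈ O.nice)
    (N : FieldMode d ι →₀ ℕ) : v N ∈ O.smooth :=
  ((lp.evalCLM ℂ (fun _ => H₀) 2 N).restrictScalars ℝ).contDiff.comp hv.2

variable (O) [CompleteSpace H₀]

/-- By truncation and by the density of smooth vectors. -/
theorem core_dense : Dense (O.core : Set (SystemField d ι H₀)) := by
  classical
  intro v
  have h1 : ∀ N (x : H₀), lp.singleContinuousLinearMap ℂ (fun _ => H₀) 2 N x ∈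
      O.coreSubmodule.topologicalClosure := fun N x =>
    map_mem_closure (lp.singleContinuousLinearMap ℂ (fun _ : FieldMode d ι →₀ ℕ => H₀) 2 N).continuous
      (O.dense_smooth x) fun y hy => O.single_mem_core N hy
  refine O.coreSubmodule.isClosed_topologicalClosure.mem_of_tendsto
    (tendsto_truncShift v) (Eventually.of_forall fun F => ?_)
  rw [truncShift_op_eq_sum]
  exact Submodule.sum_mem _ fun N _ => h1 N _

variable {O}

/-- A smooth vector with bounded particle numbers is approximated by its restrictions to finite
sets of occupation numbers, together with the values of the fields. -/
theorem mem_closure_of_nice {v : SystemField d ι H₀} (hv : v ∈ O.nice)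
    {L : OneParticle n (FieldMode d ι) →L[ℂ] SystemField d ι H₀} (hL : O.FieldReg v L) :
    (v, L) ∈ closure {p : SystemField d ι H₀ ×
      (OneParticle n (FieldMode d ι) →L[ℂ] SystemField d ι H₀) |
        p.1 ∈ O.coreSubmodule ∧ O.FieldReg p.1 p.2} := by
  obtain ⟨⟨K, hK⟩, hs⟩ := id hv
  rw [hL.unique (fieldReg_fieldMap hK (hasDerivAt_sysVar hs))]
  have hc : ∀ F u (w : SystemField d ι H₀), O.W u ((truncShift F).op w) =
      (truncShift F).op (O.W u w) := fun F u w =>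
    O.W_comm_op (fun N u x => by simp only [truncShift]; split_ifs <;> simp) u w
  have h1 : Tendsto (fun F => ((truncShift F).op v, fun j => (truncShift F).op (O.sysVar v j)))
      atTop (𝓝 (v, O.sysVar v)) :=
    (tendsto_truncShift v).prodMk_nhds (tendsto_pi_nhds.2 fun j => tendsto_truncShift _)
  refine mem_closure_of_tendsto ((tendsto_truncShift v).prodMk_nhds
    (((fieldMap (K + 1)).continuous.tendsto _).comp h1)) (Eventually.of_forall fun F => ?_)
  refine ⟨O.truncShift_op_mem_core F (smooth_apply_of_nice hv),
    fieldReg_fieldMap (fun N hN => ?_) fun u => ?_⟩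
  · rw [truncShift_op_apply]
    split_ifs
    · exact hK N hN
    · rfl
  · simp only [hc]
    refine ((hasDerivAt_sysVar hs u).clm_map (truncShift F).op).congr_deriv ?_
    simp only [map_smul, map_sum]

/-- The field operators are the adjoints of their restrictions to the core. -/
theorem fieldReg_of_weak {v : SystemField d ι H₀}
    {L : OneParticle n (FieldMode d ι) →L[ℂ] SystemField d ι H₀}
    (h : ∀ w ∈ O.coreSubmodule, ∀ L', O.FieldReg w L' →
      ∀ g, ⟪L' (OneParticle.conj g), v⟫_ℂ = ⟪w, L g⟫_ℂ) : O.FieldReg v L where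
  ann κ N := by
    classical
    refine O.dense_smooth.eq_of_inner_right ℂ fun x hx => ?_
    have hc := O.single_mem_core N hx
    obtain ⟨L', -, hL', -⟩ := exists_fieldReg_of_nice (O.core_le_nice hc)
    have h1 := h _ hc L' hL' (OneParticle.ann κ)
    have h2 : L' (OneParticle.cre κ) = lp.single 2 (N + Finsupp.single κ 1)
        (((√((N κ : ℝ) + 1) : ℝ) : ℂ) • x) := by
      ext N'
      rw [hL'.cre, sqrt_smul_single_sub]
    rw [OneParticle.conj_ann, h2, lp.inner_single_left, lp.inner_single_left, inner_smul_left,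
      Complex.conj_ofReal] at h1
    rw [inner_smul_right]
    exact h1.symm
  cre κ N := by
    classical
    refine O.dense_smooth.eq_of_inner_right ℂ fun x hx => ?_
    have hc := O.single_mem_core N hx
    obtain ⟨L', -, hL', -⟩ := exists_fieldReg_of_nice (O.core_le_nice hc)
    have h1 := h _ hc L' hL' (OneParticle.cre κ)
    have h2 : L' (OneParticle.ann κ) = lp.single 2 (N - Finsupp.single κ 1)
        (((√(N κ : ℝ) : ℝ) : ℂ) • x) := by
      ext N'
      rw [hL'.ann, sqrt_smul_single_add]
    rw [OneParticle.conj_cre, h2, lp.inner_single_left, lp.inner_single_left, inner_smul_left,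
      Complex.conj_ofReal] at h1
    rw [inner_smul_right]
    exact h1.symm
  deriv u := by
    set g : OneParticle n (FieldMode d ι) := OneParticle.ofReal u
    have hcont : Continuous fun s : ℝ => O.W (s • u) (Complex.I • L g) :=
      (O.continuous_W _).comp (continuous_id.smul continuous_const)
    -- The weak form of the group law, integrated: `W(τu) v = v + ∫ W(su) (i L g) ds`.
    have key : ∀ τ : ℝ, O.W (τ • u) v = v + ∫ s in (0 : ℝ)..τ, O.W (s • u) (Complex.I • L g) := by
      intro τ
      refine O.core_dense.eq_of_inner_right ℂ fun w hw => ?_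
      obtain ⟨L', -, hL', -⟩ := exists_fieldReg_of_nice (O.core_le_nice hw)
      have hd : ∀ s : ℝ, HasDerivAt (fun s : ℝ => ⟪w, O.W (s • u) v⟫_ℂ)
          ⟪w, O.W (s • u) (Complex.I • L g)⟫_ℂ s := by
        intro s
        have h1 : HasDerivAt (fun τ : ℝ => O.W ((-τ) • u) w)
            (-(Complex.I • O.W ((-s) • u) (L' g))) s :=
          (HasDerivAt.scomp (h := fun τ : ℝ => -τ) s (hL'.hasDerivAt_W u (-s))
            (hasDerivAt_neg s)).congr_deriv (neg_one_smul _ _)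
        have h2 : HasDerivAt (fun τ : ℝ => ⟪O.W ((-τ) • u) w, v⟫_ℂ) _ s :=
          h1.inner ℂ (hasDerivAt_const s v)
        have h3 := h _ (show O.W ((-s) • u) w ∈ O.coreSubmodule from
          O.op_mem_core (fun N x hx => O.weyl_mem_smooth hx _) hw) _ (hL'.weyl ((-s) • u)) g
        have h4 : O.comm g (OneParticle.ofReal ((-s) • u)) = 0 := by
          rw [OneParticle.ofReal_smul, map_smul, O.comm_ofReal, O.symp_self]
          simp
        rw [OneParticle.conj_ofReal] at h3
        simp only [_root_.add_apply, ContinuousLinearMap.comp_apply,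
          ContinuousLinearMap.smulRight_apply, ContinuousLinearMap.flip_apply] at h3
        rw [h4, zero_smul, add_zero] at h3
        refine (h2.congr_of_eventuallyEq (Eventually.of_forall fun τ => ?_)).congr_deriv ?_
        · dsimp only
          rw [neg_smul, inner_W, neg_neg]
        · rw [inner_zero_right, zero_add, inner_neg_left, inner_smul_left, Complex.conj_I, h3,
            map_smul, inner_smul_right, neg_smul, inner_W, neg_neg]
          ring
      have h5 := intervalIntegral.integral_eq_sub_of_hasDerivAt (a := 0) (b := τ)
        (fun s _ => hd s) ((continuous_const.inner hcont).intervalIntegrable _ _)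
      have h6 : ⟪w, ∫ s in (0 : ℝ)..τ, O.W (s • u) (Complex.I • L g)⟫_ℂ = _ :=
        (inner_intervalIntegral w (hcont.intervalIntegrable _ _)).trans h5
      rw [inner_add_right, h6, zero_smul, W_zero]
      ring
    have h1 := intervalIntegral.integral_hasDerivAt_right (a := 0) (b := 0)
      (hcont.intervalIntegrable _ _) (hcont.stronglyMeasurableAtFilter _ _) hcont.continuousAt
    have h2 := h1.const_add v
    simp only [zero_smul, W_zero] at h2
    exact h2.congr_of_eventuallyEq (Eventually.of_forall key)

end OQHO

/-! ### Bounded approximations of the creation and annihilation operators -/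

/-- Weighted shifts with scalar weights. -/
def scalarShift {α : Type*} (E : Type*) [NormedAddCommGroup E] [InnerProductSpace ℂ E] (φ : α → α)
    (w : α → ℝ) (C : ℝ) (hw : ∀ N, |w N| ≤ C)
    (hφ : ∀ N N', w N ≠ 0 → w N' ≠ 0 → φ N = φ N' → N = N') : WeightedShift α E where
  φ := φ
  T N := ((w N : ℝ) : ℂ) • ContinuousLinearMap.id ℂ E
  C := C
  bound N := by
    rw [norm_smul, Complex.norm_real, Real.norm_eq_abs]
    exact (mul_le_of_le_one_right (abs_nonneg _) ContinuousLinearMap.norm_id_le).trans (hw N)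
  inj N N' h h' := hφ N N' (fun h0 => h (by simp [h0])) fun h0 => h' (by simp [h0])

section Ladder

variable {m E : Type*} [NormedAddCommGroup E] [InnerProductSpace ℂ E]

variable (E) in
/-- The operator `(B v)(N) = w (N κ) v(N + r e_κ)`. -/
def upShift (κ : m) (r : ℕ) (w : ℕ → ℝ) (C : ℝ) (hw : ∀ k, |w k| ≤ C) :
    WeightedShift (m →₀ ℕ) E :=
  scalarShift E (fun N => N + Finsupp.single κ r) (fun N => w (N κ)) C (fun N => hw (N κ))
    fun _ _ _ _ h => add_left_injective _ h

variable (E) in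
/-- The operator `(B v)(N) = w (N κ) v(N - r e_κ)`, with `w k = 0` for `k < r`. -/
def downShift (κ : m) (r : ℕ) (w : ℕ → ℝ) (C : ℝ) (hw : ∀ k, |w k| ≤ C)
    (h0 : ∀ k < r, w k = 0) : WeightedShift (m →₀ ℕ) E :=
  scalarShift E (fun N => N - Finsupp.single κ r) (fun N => w (N κ)) C (fun N => hw (N κ))
    fun N N' h h' e => by
      have hle : ∀ N : m →₀ ℕ, w (N κ) ≠ 0 → Finsupp.single κ r ≤ N := fun N hN =>
        Finsupp.single_le_iff.2 (not_lt.1 fun hlt => hN (h0 _ hlt))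
      rw [← tsub_add_cancel_of_le (hle N h), ← tsub_add_cancel_of_le (hle N' h')]
      exact congrArg (· + Finsupp.single κ r) e

theorem upShift_op_apply (κ : m) (r : ℕ) {w : ℕ → ℝ} {C : ℝ} (hw : ∀ k, |w k| ≤ C)
    (v : lp (fun _ : m →₀ ℕ => E) 2) (N : m →₀ ℕ) :
    (upShift E κ r w C hw).op v N = ((w (N κ) : ℝ) : ℂ) • v (N + Finsupp.single κ r) := rfl

theorem downShift_op_apply (κ : m) (r : ℕ) {w : ℕ → ℝ} {C : ℝ} (hw : ∀ k, |w k| ≤ C)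
    (h0 : ∀ k < r, w k = 0) (v : lp (fun _ : m →₀ ℕ => E) 2) (N : m →₀ ℕ) :
    (downShift E κ r w C hw h0).op v N = ((w (N κ) : ℝ) : ℂ) • v (N - Finsupp.single κ r) := rfl

theorem norm_scalar_le {a b : ℝ} (h : |a| ≤ |b|) :
    ‖((a : ℝ) : ℂ) • ContinuousLinearMap.id ℂ E‖ ≤ ‖((b : ℝ) : ℂ) • ContinuousLinearMap.id ℂ E‖ := by
  rw [norm_smul, norm_smul, Complex.norm_real, Complex.norm_real]
  exact mul_le_mul_of_nonneg_right h (norm_nonneg _)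

theorem tendsto_upShift (κ : m) (r : ℕ) {w : ℕ → ℕ → ℝ} (hw : ∀ i k, |w i k| ≤ 1)
    {v x : lp (fun _ : m →₀ ℕ => E) 2} {l : ℝ} (hl : ∀ k, Tendsto (fun i => w i k) atTop (𝓝 l))
    (hx : ∀ N, ((l : ℝ) : ℂ) • v (N + Finsupp.single κ r) = x N) :
    Tendsto (fun i => (upShift E κ r (w i) 1 (hw i)).op v) atTop (𝓝 x) := by
  have h1 : ∀ k : ℕ, |(fun _ => 1 : ℕ → ℝ) k| ≤ 1 := fun k => by simp
  refine WeightedShift.tendsto_op (B := fun i => upShift E κ r (w i) 1 (hw i))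
    (upShift E κ r (fun _ => 1) 1 h1) (fun _ => rfl) (fun i N => norm_scalar_le ?_) fun N => ?_
  · simpa using hw i (N κ)
  · simp only [upShift_op_apply, ← hx N]
    exact ((Complex.continuous_ofReal.tendsto l).comp (hl (N κ))).smul_const _

theorem tendsto_downShift_zero (κ : m) (r : ℕ) {w : ℕ → ℕ → ℝ} (hw : ∀ i k, |w i k| ≤ 1)
    (h0 : ∀ i, ∀ k < r, w i k = 0) (v : lp (fun _ : m →₀ ℕ => E) 2)
    (hl : ∀ k, Tendsto (fun i => w i k) atTop (𝓝 0)) :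
    Tendsto (fun i => (downShift E κ r (w i) 1 (hw i) (h0 i)).op v) atTop (𝓝 0) := by
  have h1 : ∀ k : ℕ, |(fun k => if k < r then 0 else 1 : ℕ → ℝ) k| ≤ 1 := fun k => by
    dsimp only
    split_ifs <;> simp
  refine WeightedShift.tendsto_op (B := fun i => downShift E κ r (w i) 1 (hw i) (h0 i))
    (downShift E κ r _ 1 h1 fun k hk => if_pos hk) (fun _ => rfl)
    (fun i N => norm_scalar_le ?_) fun N => ?_
  · dsimp only
    split_ifs with h
    · rw [h0 i _ h]
    · simpa using hw i (N κ)
  · simp only [downShift_op_apply]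
    have := ((Complex.continuous_ofReal.tendsto 0).comp (hl (N κ))).smul_const
      (v (N - Finsupp.single κ r))
    simpa using this

end Ladder

/-- The cutoff functions `x ↦ μ / (μ + x)`, `μ = i + 1`, which tend to `1`. -/
def numCut (i : ℕ) (x : ℝ) : ℝ := ((i : ℝ) + 1) / ((i : ℝ) + 1 + x)

theorem numCut_nonneg (i : ℕ) {x : ℝ} (hx : 0 ≤ x) : 0 ≤ numCut i x := by
  unfold numCut
  positivity

theorem numCut_le_one (i : ℕ) {x : ℝ} (hx : 0 ≤ x) : numCut i x ≤ 1 := by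
  unfold numCut
  rw [div_le_one (by positivity)]
  linarith

theorem tendsto_numCut (x : ℝ) : Tendsto (fun i => numCut i x) atTop (𝓝 1) := by
  unfold numCut
  have h1 : Tendsto (fun i : ℕ => (i : ℝ) + 1) atTop atTop :=
    tendsto_atTop_add_const_right _ _ tendsto_natCast_atTop_atTop
  have h2 : Tendsto (fun i : ℕ => x / ((i : ℝ) + 1)) atTop (𝓝 0) := h1.const_div_atTop x
  have h3 : Tendsto (fun i : ℕ => (1 + x / ((i : ℝ) + 1))⁻¹) atTop (𝓝 1) := by
    have := (h2.const_add 1).inv₀ (by norm_num)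
    simpa using this
  refine h3.congr fun i => ?_
  have h4 : (i : ℝ) + 1 ≠ 0 := by positivity
  rw [← inv_div ((i : ℝ) + 1 + x), add_div _ x, div_self h4]

/-- The weights of the bounded approximations of `a_κ†`. -/
def creWeight (i k : ℕ) : ℝ := √(k : ℝ) * numCut i k

theorem abs_creWeight_le (i k : ℕ) : |creWeight i k| ≤ (i : ℝ) + 1 := by
  have h1 : (√(k : ℝ)) ≤ (i : ℝ) + 1 + k := by
    rw [Real.sqrt_le_left (by positivity)]
    nlinarith [Nat.cast_nonneg (α := ℝ) k, Nat.cast_nonneg (α := ℝ) i]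
  rw [creWeight, abs_of_nonneg (mul_nonneg (Real.sqrt_nonneg _) (numCut_nonneg i (by positivity))),
    numCut, ← mul_div_assoc, div_le_iff₀ (by positivity), mul_comm]
  exact mul_le_mul_of_nonneg_left h1 (by positivity)

/-- The weights of the commutator of `a_κ†` with the approximation of itself, up to the sign:
they vanish in the limit. -/
def pairWeight (i k : ℕ) : ℝ :=
  √((k : ℝ) + 1) * √((k : ℝ) + 1 + 1) * (numCut i ((k : ℝ) + 1 + 1) - numCut i ((k : ℝ) + 1))

theorem abs_pairWeight_le (i k : ℕ) : |pairWeight i k| ≤ 1 := by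
  have hi : (0 : ℝ) ≤ i := Nat.cast_nonneg i
  have hk : (0 : ℝ) ≤ k := Nat.cast_nonneg k
  have e : numCut i ((k : ℝ) + 1 + 1) - numCut i ((k : ℝ) + 1) =
      -(((i : ℝ) + 1) / (((i : ℝ) + 1 + (k + 1)) * ((i : ℝ) + 1 + (k + 1 + 1)))) := by
    unfold numCut
    field_simp
    ring
  have h1 : √((k : ℝ) + 1) * √((k : ℝ) + 1 + 1) ≤ k + 1 + 1 := by
    have : √((k : ℝ) + 1) ≤ √((k : ℝ) + 1 + 1) := Real.sqrt_le_sqrt (by linarith)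
    calc _ ≤ √((k : ℝ) + 1 + 1) * √((k : ℝ) + 1 + 1) :=
          mul_le_mul_of_nonneg_right this (Real.sqrt_nonneg _)
      _ = _ := Real.mul_self_sqrt (by positivity)
  rw [pairWeight, e, mul_neg, abs_neg, abs_of_nonneg (by positivity), ← mul_div_assoc,
    div_le_one (by positivity)]
  calc _ ≤ ((k : ℝ) + 1 + 1) * ((i : ℝ) + 1) := mul_le_mul_of_nonneg_right h1 (by positivity)
    _ ≤ _ := by nlinarith

theorem tendsto_pairWeight (k : ℕ) : Tendsto (fun i => pairWeight i k) atTop (𝓝 0) := by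
  unfold pairWeight
  have := ((tendsto_numCut ((k : ℝ) + 1 + 1)).sub (tendsto_numCut ((k : ℝ) + 1))).const_mul
    (√((k : ℝ) + 1) * √((k : ℝ) + 1 + 1))
  simpa using this

/-- The weights of the commutator of `a_κ` with the approximation of `a_κ†`. -/
def numWeight (i k : ℕ) : ℝ := ((k : ℝ) + 1) * numCut i ((k : ℝ) + 1) - k * numCut i k

theorem abs_numWeight_le (i k : ℕ) : |numWeight i k| ≤ 1 := by
  have hi : (0 : ℝ) ≤ i := Nat.cast_nonneg i
  have hk : (0 : ℝ) ≤ k := Nat.cast_nonneg k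
  have e : numWeight i k =
      ((i : ℝ) + 1) * ((i : ℝ) + 1) / (((i : ℝ) + 1 + (k + 1)) * ((i : ℝ) + 1 + k)) := by
    unfold numWeight numCut
    field_simp
    ring
  rw [e, abs_of_nonneg (by positivity), div_le_one (by positivity)]
  nlinarith

theorem tendsto_numWeight (k : ℕ) : Tendsto (fun i => numWeight i k) atTop (𝓝 1) := by
  unfold numWeight
  have := ((tendsto_numCut ((k : ℝ) + 1)).const_mul ((k : ℝ) + 1)).sub
    ((tendsto_numCut (k : ℝ)).const_mul (k : ℝ))
  simpa using this

/-- The weights `- pairWeight`, moved by two units. -/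
def pairWeightDown (i : ℕ) : ℕ → ℝ
  | 0 => 0
  | 1 => 0
  | k + 2 => -pairWeight i k

theorem abs_pairWeightDown_le (i : ℕ) : ∀ k, |pairWeightDown i k| ≤ 1
  | 0 => by simp [pairWeightDown]
  | 1 => by simp [pairWeightDown]
  | k + 2 => by simpa [pairWeightDown] using abs_pairWeight_le i k

theorem pairWeightDown_of_lt (i : ℕ) : ∀ k < 2, pairWeightDown i k = 0
  | 0, _ => rfl
  | 1, _ => rfl
  | k + 2, h => by omega

theorem tendsto_pairWeightDown : ∀ k, Tendsto (fun i => pairWeightDown i k) atTop (𝓝 0)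
  | 0 => tendsto_const_nhds
  | 1 => tendsto_const_nhds
  | k + 2 => by simpa [pairWeightDown] using (tendsto_pairWeight k).neg

/-- The bounded linear map `p ↦ (g ↦ φ(g) S p + ψ(g) T p)`. -/
def smulRightPair {H 𝒦 : Type*} [NormedAddCommGroup H] [NormedSpace ℂ H] [NormedAddCommGroup 𝒦]
    [NormedSpace ℂ 𝒦] (φ ψ : 𝒦 →L[ℂ] ℂ) (S T : H →L[ℂ] H) : H →L[ℂ] 𝒦 →L[ℂ] H :=
  (ContinuousLinearMap.smulRightL ℂ 𝒦 H φ).comp S + (ContinuousLinearMap.smulRightL ℂ 𝒦 H ψ).comp T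

section

variable {H 𝒦 : Type*} [NormedAddCommGroup H] [NormedSpace ℂ H] [NormedAddCommGroup 𝒦]
    [NormedSpace ℂ 𝒦] (φ ψ : 𝒦 →L[ℂ] ℂ)

theorem smulRightPair_apply (S T : H →L[ℂ] H) (p : H) (g : 𝒦) :
    smulRightPair φ ψ S T p g = φ g • S p + ψ g • T p := rfl

theorem norm_smulRightPair_le : ∃ C, ∀ S T : H →L[ℂ] H, ‖S‖ ≤ 1 → ‖T‖ ≤ 1 →
    ‖smulRightPair φ ψ S T‖ ≤ C := by
  refine ⟨‖ContinuousLinearMap.smulRightL ℂ 𝒦 H φ‖ * 1 + ‖ContinuousLinearMap.smulRightL ℂ 𝒦 H ψ‖ * 1,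
    fun S T hS hT => ?_⟩
  refine (ContinuousLinearMap.opNorm_add_le _ _).trans (add_le_add ?_ ?_)
  · exact (ContinuousLinearMap.opNorm_comp_le _ _).trans
      (mul_le_mul_of_nonneg_left hS (norm_nonneg _))
  · exact (ContinuousLinearMap.opNorm_comp_le _ _).trans
      (mul_le_mul_of_nonneg_left hT (norm_nonneg _))

theorem tendsto_smulRightPair {S T : ℕ → H →L[ℂ] H} {p s t : H}
    (hS : Tendsto (fun i => S i p) atTop (𝓝 s)) (hT : Tendsto (fun i => T i p) atTop (𝓝 t))
    {L : 𝒦 →L[ℂ] H} (hL : ∀ g, φ g • s + ψ g • t = L g) :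
    Tendsto (fun i => smulRightPair φ ψ (S i) (T i) p) atTop (𝓝 L) := by
  have h := (((ContinuousLinearMap.smulRightL ℂ 𝒦 H φ).continuous.tendsto s).comp hS).add
    (((ContinuousLinearMap.smulRightL ℂ 𝒦 H ψ).continuous.tendsto t).comp hT)
  have e : ContinuousLinearMap.smulRightL ℂ 𝒦 H φ s + ContinuousLinearMap.smulRightL ℂ 𝒦 H ψ t = L :=
    ContinuousLinearMap.ext hL
  rwa [e] at h

end

namespace OneParticle

variable {n : ℕ} {m : Type*}

/-- The coefficient of `a_κ`. -/
def annCoeff (κ : m) : OneParticle n m →L[ℂ] ℂ := (lp.evalCLM ℂ (fun _ => ℂ) 2 κ).comp annCLM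

/-- The coefficient of `a_κ†`. -/
def creCoeff (κ : m) : OneParticle n m →L[ℂ] ℂ := (lp.evalCLM ℂ (fun _ => ℂ) 2 κ).comp creCLM

theorem annCoeff_apply (κ : m) (g : OneParticle n m) : annCoeff κ g = g.2.1 κ := rfl

theorem creCoeff_apply (κ : m) (g : OneParticle n m) : creCoeff κ g = g.2.2 κ := rfl

end OneParticle

namespace OQHO

open OneParticle

variable {n d : ℕ} {ι : Type*} {H₀ : Type*} [NormedAddCommGroup H₀] [InnerProductSpace ℂ H₀]
variable {O : OQHO n d ι H₀}

theorem scalar_weyl (w : ℂ) (u : Fin n → ℝ) (x : H₀) :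
    (w • ContinuousLinearMap.id ℂ H₀) (O.weyl u x) =
      O.weyl u ((w • ContinuousLinearMap.id ℂ H₀) x) := by
  simp

/-- The bounded approximations of the annihilation operator `a_κ`. -/
def annApprox (H₀ : Type*) [NormedAddCommGroup H₀] [InnerProductSpace ℂ H₀] (κ : FieldMode d ι)
    (i : ℕ) : SystemField d ι H₀ →L[ℂ] SystemField d ι H₀ :=
  (upShift H₀ κ 1 (fun k => creWeight i (k + 1)) (i + 1) fun k => abs_creWeight_le i (k + 1)).op

/-- The bounded approximations of the creation operator `a_κ†`. -/
def creApprox (H₀ : Type*) [NormedAddCommGroup H₀] [InnerProductSpace ℂ H₀] (κ : FieldMode d ι)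
    (i : ℕ) : SystemField d ι H₀ →L[ℂ] SystemField d ι H₀ :=
  (downShift H₀ κ 1 (creWeight i) (i + 1) (abs_creWeight_le i) fun k hk => by
    rw [Nat.lt_one_iff.1 hk]; simp [creWeight]).op

theorem annApprox_apply (κ : FieldMode d ι) (i : ℕ) (v : SystemField d ι H₀)
    (N : FieldMode d ι →₀ ℕ) : annApprox H₀ κ i v N =
      ((creWeight i (N κ + 1) : ℝ) : ℂ) • v (N + Finsupp.single κ 1) := rfl

theorem creApprox_apply (κ : FieldMode d ι) (i : ℕ) (v : SystemField d ι H₀)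
    (N : FieldMode d ι →₀ ℕ) : creApprox H₀ κ i v N =
      ((creWeight i (N κ) : ℝ) : ℂ) • v (N - Finsupp.single κ 1) := rfl

theorem inner_annApprox (κ : FieldMode d ι) (i : ℕ) (x y : SystemField d ι H₀) :
    ⟪creApprox H₀ κ i x, y⟫_ℂ = ⟪x, annApprox H₀ κ i y⟫_ℂ := by
  refine WeightedShift.inner_op (fun N _ => ⟨add_tsub_cancel_right N _, fun x y => ?_⟩)
    (fun N hN => ?_) y x
  · have e : (N + Finsupp.single κ 1 : FieldMode d ι →₀ ℕ) κ = N κ + 1 := by simp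
    change ⟪x, ((creWeight i (N κ + 1) : ℝ) : ℂ) • y⟫_ℂ =
      ⟪((creWeight i ((N + Finsupp.single κ 1 : FieldMode d ι →₀ ℕ) κ) : ℝ) : ℂ) • x, y⟫_ℂ
    rw [e, inner_smul_left, inner_smul_right, Complex.conj_ofReal]
  · have h0 : N κ ≠ 0 := fun h0 => hN (by
      change ((creWeight i (N κ) : ℝ) : ℂ) • ContinuousLinearMap.id ℂ H₀ = 0
      rw [h0]
      simp [creWeight])
    refine ⟨tsub_add_cancel_of_le (Finsupp.single_le_iff.2 (Nat.one_le_iff_ne_zero.2 h0)),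
      fun x y => ?_⟩
    have e : (N - Finsupp.single κ 1 : FieldMode d ι →₀ ℕ) κ + 1 = N κ := by
      rw [Finsupp.tsub_apply, Finsupp.single_eq_same]
      exact Nat.sub_add_cancel (Nat.one_le_iff_ne_zero.2 h0)
    change ⟪((creWeight i (N κ) : ℝ) : ℂ) • x, y⟫_ℂ =
      ⟪x, ((creWeight i ((N - Finsupp.single κ 1 : FieldMode d ι →₀ ℕ) κ + 1) : ℝ) : ℂ) • y⟫_ℂ
    rw [e, inner_smul_left, inner_smul_right, Complex.conj_ofReal]

/-- The commutators of the fields with the bounded approximations of `a_κ` are weighted shifts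
with bounded weights. -/
theorem FieldReg.annApprox {p : SystemField d ι H₀}
    {L : OneParticle n (FieldMode d ι) →L[ℂ] SystemField d ι H₀} (h : O.FieldReg p L)
    (κ : FieldMode d ι) (i : ℕ) : O.FieldReg (annApprox H₀ κ i p) (annApprox H₀ κ i ∘L L +
      smulRightPair (annCoeff κ) (creCoeff κ) (upShift H₀ κ 2 (pairWeight i) 1 (abs_pairWeight_le i)).op
        (upShift H₀ κ 0 (fun k => -numWeight i k) 1
          fun k => by rw [abs_neg]; exact abs_numWeight_le i k).op p) where
  deriv u := by
    have h1 := (h.deriv u).clm_map (OQHO.annApprox H₀ κ i)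
    have hc : ∀ u, O.W u (OQHO.annApprox H₀ κ i p) = OQHO.annApprox H₀ κ i (O.W u p) := fun u =>
      O.W_comm_op (fun _ u x => scalar_weyl _ u x) u p
    simp only [hc]
    refine h1.congr_deriv ?_
    rw [_root_.add_apply, smulRightPair_apply]
    simp [annCoeff_apply, creCoeff_apply, OneParticle.ofReal]
  ann κ' N := by
    rw [_root_.add_apply, smulRightPair_apply, lp.coeFn_add, Pi.add_apply, ContinuousLinearMap.comp_apply,
      annApprox_apply, annApprox_apply, h.ann, creCoeff_apply, annCoeff_apply]
    by_cases hκ : κ' = κ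
    · subst hκ
      have e : N + Finsupp.single κ' 2 = N + Finsupp.single κ' 1 + Finsupp.single κ' 1 := by
        rw [add_assoc, ← Finsupp.single_add]
      simp only [OneParticle.ann, modeVec_apply_self, one_smul, lp.coeFn_zero, Pi.zero_apply,
        zero_smul, add_zero, upShift_op_apply, e, smul_smul, ← add_smul, Finsupp.add_apply,
        Finsupp.single_eq_same]
      congr 1
      rw [creWeight, creWeight, pairWeight]
      push_cast
      ring
    · have e1 : (N + Finsupp.single κ 1 : FieldMode d ι →₀ ℕ) κ' = N κ' := by
        simp [Ne.symm hκ]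
      have e2 : (N + Finsupp.single κ' 1 : FieldMode d ι →₀ ℕ) κ = N κ := by
        simp [hκ]
      simp only [OneParticle.ann, modeVec_apply_of_ne (Ne.symm hκ), zero_smul, lp.coeFn_zero,
        Pi.zero_apply, add_zero, e1, e2, add_right_comm N (Finsupp.single κ 1)]
      exact smul_comm _ _ _
  cre κ' N := by
    rw [_root_.add_apply, smulRightPair_apply, lp.coeFn_add, Pi.add_apply, ContinuousLinearMap.comp_apply,
      annApprox_apply, annApprox_apply, h.cre, creCoeff_apply, annCoeff_apply]
    by_cases hκ : κ' = κ
    · subst hκ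
      simp only [OneParticle.cre, modeVec_apply_self, one_smul, lp.coeFn_zero, Pi.zero_apply,
        zero_smul, zero_add, upShift_op_apply, add_tsub_cancel_right, Finsupp.single_zero, add_zero,
        smul_smul, ← add_smul, Finsupp.add_apply, Finsupp.single_eq_same]
      by_cases h0 : N κ' = 0
      · have : (((creWeight i (N κ' + 1) : ℝ) : ℂ) * ((√(((N κ' + 1 : ℕ) : ℝ)) : ℝ) : ℂ) +
            ((-numWeight i (N κ') : ℝ) : ℂ)) = 0 := by
          rw [h0]
          simp [creWeight, numWeight]
        rw [this, h0]
        simp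
      · obtain ⟨k, hk⟩ := Nat.exists_eq_succ_of_ne_zero h0
        have e1 : (N - Finsupp.single κ' 1 : FieldMode d ι →₀ ℕ) κ' = k := by simp [hk]
        have e2 : N - Finsupp.single κ' 1 + Finsupp.single κ' 1 = N :=
          tsub_add_cancel_of_le (Finsupp.single_le_iff.2 (Nat.one_le_iff_ne_zero.2 h0))
        rw [e1, e2, hk]
        congr 1
        norm_cast
        rw [creWeight, creWeight, numWeight]
        push_cast
        have s1 := Real.mul_self_sqrt (show (0 : ℝ) ≤ (k : ℝ) + 1 by positivity)
        have s2 := Real.mul_self_sqrt (show (0 : ℝ) ≤ (k : ℝ) + 1 + 1 by positivity)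
        linear_combination numCut i ((k : ℝ) + 1 + 1) * s2 - numCut i ((k : ℝ) + 1) * s1
    · have e1 : (N + Finsupp.single κ 1 : FieldMode d ι →₀ ℕ) κ' = N κ' := by
        simp [Ne.symm hκ]
      have e2 : (N - Finsupp.single κ' 1 : FieldMode d ι →₀ ℕ) κ = N κ := by
        simp [hκ]
      simp only [OneParticle.cre, modeVec_apply_of_ne (Ne.symm hκ), zero_smul, lp.coeFn_zero,
        Pi.zero_apply, add_zero, e1, e2]
      by_cases h0 : N κ' = 0
      · simp [h0]
      · rw [tsub_add_eq_add_tsub (Finsupp.single_le_iff.2 (Nat.one_le_iff_ne_zero.2 h0))]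
        exact smul_comm _ _ _

/-- The commutators of the fields with the bounded approximations of `a_κ†` are weighted shifts
with bounded weights. -/
theorem FieldReg.creApprox {p : SystemField d ι H₀}
    {L : OneParticle n (FieldMode d ι) →L[ℂ] SystemField d ι H₀} (h : O.FieldReg p L)
    (κ : FieldMode d ι) (i : ℕ) : O.FieldReg (creApprox H₀ κ i p) (creApprox H₀ κ i ∘L L +
      smulRightPair (annCoeff κ) (creCoeff κ) (upShift H₀ κ 0 (numWeight i) 1 (abs_numWeight_le i)).op
        (downShift H₀ κ 2 (pairWeightDown i) 1 (abs_pairWeightDown_le i)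
          (pairWeightDown_of_lt i)).op p) where
  deriv u := by
    have h1 := (h.deriv u).clm_map (OQHO.creApprox H₀ κ i)
    have hc : ∀ u, O.W u (OQHO.creApprox H₀ κ i p) = OQHO.creApprox H₀ κ i (O.W u p) := fun u =>
      O.W_comm_op (fun _ u x => scalar_weyl _ u x) u p
    simp only [hc]
    refine h1.congr_deriv ?_
    rw [_root_.add_apply, smulRightPair_apply]
    simp [annCoeff_apply, creCoeff_apply, OneParticle.ofReal]
  ann κ' N := by
    rw [_root_.add_apply, smulRightPair_apply, lp.coeFn_add, Pi.add_apply, ContinuousLinearMap.comp_apply,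
      creApprox_apply, creApprox_apply, h.ann, creCoeff_apply, annCoeff_apply]
    by_cases hκ : κ' = κ
    · subst hκ
      simp only [OneParticle.ann, modeVec_apply_self, one_smul, lp.coeFn_zero, Pi.zero_apply,
        zero_smul, upShift_op_apply, add_tsub_cancel_right, Finsupp.single_zero, add_zero,
        smul_smul, Finsupp.add_apply, Finsupp.single_eq_same]
      by_cases h0 : N κ' = 0
      · rw [h0]
        simp [creWeight, numWeight]
      · obtain ⟨k, hk⟩ := Nat.exists_eq_succ_of_ne_zero h0
        have e1 : (N - Finsupp.single κ' 1 : FieldMode d ι →₀ ℕ) κ' = k := by simp [hk]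
        have e2 : N - Finsupp.single κ' 1 + Finsupp.single κ' 1 = N :=
          tsub_add_cancel_of_le (Finsupp.single_le_iff.2 (Nat.one_le_iff_ne_zero.2 h0))
        rw [e1, e2, hk, ← add_smul]
        congr 1
        norm_cast
        rw [creWeight, creWeight, numWeight]
        push_cast
        have s1 := Real.mul_self_sqrt (show (0 : ℝ) ≤ (k : ℝ) + 1 by positivity)
        have s2 := Real.mul_self_sqrt (show (0 : ℝ) ≤ (k : ℝ) + 1 + 1 by positivity)
        linear_combination numCut i ((k : ℝ) + 1) * s1 - numCut i ((k : ℝ) + 1 + 1) * s2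
    · have e1 : (N - Finsupp.single κ 1 : FieldMode d ι →₀ ℕ) κ' = N κ' := by
        simp [Ne.symm hκ]
      have e2 : (N + Finsupp.single κ' 1 : FieldMode d ι →₀ ℕ) κ = N κ := by
        simp [hκ]
      simp only [OneParticle.ann, modeVec_apply_of_ne (Ne.symm hκ), zero_smul, lp.coeFn_zero,
        Pi.zero_apply, add_zero, e1, e2]
      by_cases h0 : N κ = 0
      · simp [h0, creWeight]
      · rw [tsub_add_eq_add_tsub (Finsupp.single_le_iff.2 (Nat.one_le_iff_ne_zero.2 h0))]
        exact smul_comm _ _ _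
  cre κ' N := by
    rw [_root_.add_apply, smulRightPair_apply, lp.coeFn_add, Pi.add_apply, ContinuousLinearMap.comp_apply,
      creApprox_apply, creApprox_apply, h.cre, creCoeff_apply, annCoeff_apply]
    by_cases hκ : κ' = κ
    · subst hκ
      have e : N - Finsupp.single κ' 2 = N - Finsupp.single κ' 1 - Finsupp.single κ' 1 := by
        rw [tsub_tsub, ← Finsupp.single_add]
      have e1 : (N - Finsupp.single κ' 1 : FieldMode d ι →₀ ℕ) κ' = N κ' - 1 := by simp
      simp only [OneParticle.cre, modeVec_apply_self, one_smul, lp.coeFn_zero, Pi.zero_apply,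
        zero_smul, zero_add, downShift_op_apply, e, e1, smul_smul, ← add_smul]
      congr 1
      norm_cast
      generalize N κ' = k
      match k with
      | 0 => simp [creWeight, pairWeightDown]
      | 1 => simp [creWeight, pairWeightDown]
      | k + 2 =>
        have e2 : k + 2 - 1 = k + 1 := rfl
        rw [e2, creWeight, creWeight, pairWeightDown, pairWeight]
        push_cast
        rw [show (k : ℝ) + 2 = k + 1 + 1 by ring]
        ring
    · have e1 : (N - Finsupp.single κ 1 : FieldMode d ι →₀ ℕ) κ' = N κ' := by
        simp [Ne.symm hκ]
      have e2 : (N - Finsupp.single κ' 1 : FieldMode d ι →₀ ℕ) κ = N κ := by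
        simp [hκ]
      simp only [OneParticle.cre, modeVec_apply_of_ne (Ne.symm hκ), zero_smul, lp.coeFn_zero,
        Pi.zero_apply, add_zero, e1, e2, tsub_right_comm (a := N) (b := Finsupp.single κ 1)]
      exact smul_comm _ _ _

theorem norm_scalarOp_le {α : Type*} {A : WeightedShift α H₀} (hA : A.C = 1) : ‖A.op‖ ≤ 1 := by
  have := A.norm_op_le
  rwa [hA, abs_one] at this

variable (O)

theorem isFieldApprox_ann (κ : FieldMode d ι) : IsFieldApprox O.FieldReg O.coreSubmodule O.comm
    (OneParticle.ann κ) (annApprox H₀ κ) (fun i =>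
      smulRightPair (annCoeff κ) (creCoeff κ) (upShift H₀ κ 2 (pairWeight i) 1 (abs_pairWeight_le i)).op
        (upShift H₀ κ 0 (fun k => -numWeight i k) 1
          fun k => by rw [abs_neg]; exact abs_numWeight_le i k).op) where
  map_core i p hp := O.op_mem_core (fun N x hx => O.smooth.smul_mem _ hx) hp
  map_reg i p L h := h.annApprox κ i
  bound := by
    obtain ⟨C, hC⟩ := norm_smulRightPair_le (H := SystemField d ι H₀)
      (annCoeff (n := n) κ) (creCoeff κ)
    exact ⟨C, fun i => hC _ _ (norm_scalarOp_le rfl) (norm_scalarOp_le rfl)⟩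
  tendsto_comm p := by
    refine tendsto_smulRightPair _ _ (s := 0) (t := -p)
      (tendsto_upShift κ 2 (l := 0) abs_pairWeight_le tendsto_pairWeight fun N => by simp)
      (tendsto_upShift κ 0 (l := -1)
        (fun i k => by rw [abs_neg]; exact abs_numWeight_le i k)
        (fun k => (tendsto_numWeight k).neg) fun N => by simp) fun g => ?_
    rw [ContinuousLinearMap.smulRight_apply, ContinuousLinearMap.flip_apply, comm_ann, smul_zero,
      zero_add, smul_neg, neg_smul]
    rfl
  tendsto_field v L h := by
    refine tendsto_lp_of_dominated (lp_summable_sq (L (OneParticle.ann κ))) (fun i N => ?_)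
      fun N => ?_
    all_goals
      have e : ∀ i, annApprox H₀ κ i v N = ((numCut i ((N κ : ℝ) + 1) : ℝ) : ℂ) •
          L (OneParticle.ann κ) N := fun i => by
        rw [annApprox_apply, h.ann, smul_smul, creWeight]
        push_cast
        rw [mul_comm]
    · rw [e, norm_smul, Complex.norm_real, Real.norm_of_nonneg (numCut_nonneg i (by positivity))]
      exact pow_le_pow_left₀ (by have := numCut_nonneg i (x := (N κ : ℝ) + 1) (by positivity); positivity)
        (mul_le_of_le_one_left (norm_nonneg _) (numCut_le_one i (by positivity))) 2
    · simp only [e]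
      have := ((Complex.continuous_ofReal.tendsto 1).comp
        (tendsto_numCut ((N κ : ℝ) + 1))).smul_const (L (OneParticle.ann κ) N)
      simpa using this

theorem isFieldApprox_cre (κ : FieldMode d ι) : IsFieldApprox O.FieldReg O.coreSubmodule O.comm
    (OneParticle.cre κ) (creApprox H₀ κ) (fun i =>
      smulRightPair (annCoeff κ) (creCoeff κ) (upShift H₀ κ 0 (numWeight i) 1 (abs_numWeight_le i)).op
        (downShift H₀ κ 2 (pairWeightDown i) 1 (abs_pairWeightDown_le i)
          (pairWeightDown_of_lt i)).op) where
  map_core i p hp := O.op_mem_core (fun N x hx => O.smooth.smul_mem _ hx) hp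
  map_reg i p L h := h.creApprox κ i
  bound := by
    obtain ⟨C, hC⟩ := norm_smulRightPair_le (H := SystemField d ι H₀)
      (annCoeff (n := n) κ) (creCoeff κ)
    exact ⟨C, fun i => hC _ _ (norm_scalarOp_le rfl) (norm_scalarOp_le rfl)⟩
  tendsto_comm p := by
    refine tendsto_smulRightPair _ _ (s := p) (t := 0)
      (tendsto_upShift κ 0 (l := 1) abs_numWeight_le tendsto_numWeight fun N => by simp)
      (tendsto_downShift_zero κ 2 abs_pairWeightDown_le pairWeightDown_of_lt p
        tendsto_pairWeightDown) fun g => ?_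
    rw [ContinuousLinearMap.smulRight_apply, ContinuousLinearMap.flip_apply, comm_cre, smul_zero,
      add_zero]
    rfl
  tendsto_field v L h := by
    refine tendsto_lp_of_dominated (lp_summable_sq (L (OneParticle.cre κ))) (fun i N => ?_)
      fun N => ?_
    all_goals
      have e : ∀ i, creApprox H₀ κ i v N = ((numCut i (N κ : ℝ) : ℝ) : ℂ) •
          L (OneParticle.cre κ) N := fun i => by
        rw [creApprox_apply, h.cre, smul_smul, creWeight]
        push_cast
        rw [mul_comm]
    · rw [e, norm_smul, Complex.norm_real, Real.norm_of_nonneg (numCut_nonneg i (by positivity))]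
      exact pow_le_pow_left₀ (by have := numCut_nonneg i (x := (N κ : ℝ)) (by positivity); positivity)
        (mul_le_of_le_one_left (norm_nonneg _) (numCut_le_one i (by positivity))) 2
    · simp only [e]
      have := ((Complex.continuous_ofReal.tendsto 1).comp
        (tendsto_numCut (N κ : ℝ))).smul_const (L (OneParticle.cre κ) N)
      simpa using this

end OQHO

/-! ### Bounded approximations of the initial system variables -/

namespace OQHO

variable {n d : ℕ} {ι : Type*} {H₀ : Type*} [NormedAddCommGroup H₀] [InnerProductSpace ℂ H₀]
variable (O : OQHO n d ι H₀)

/-- The step `ε = 1 / (i + 1)` of the difference quotients. -/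
def weylStep (i : ℕ) : ℝ := 1 / ((i : ℝ) + 1)

theorem weylStep_pos (i : ℕ) : 0 < weylStep i := by
  unfold weylStep
  positivity

theorem tendsto_weylStep : Tendsto weylStep atTop (𝓝 0) := tendsto_one_div_add_atTop_nhds_zero_nat

/-- The bounded approximations `sin (ε uᵀX) / ε` of the operator `uᵀX`. -/
def weylApprox (u : Fin n → ℝ) (i : ℕ) : SystemField d ι H₀ →L[ℂ] SystemField d ι H₀ :=
  (1 / (2 * Complex.I * (weylStep i : ℂ))) • (O.W (weylStep i • u) - O.W (-weylStep i • u))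

/-- The operators `cos (ε uᵀX)`. -/
def weylCos (u : Fin n → ℝ) (i : ℕ) : SystemField d ι H₀ →L[ℂ] SystemField d ι H₀ :=
  (1 / 2 : ℂ) • (O.W (weylStep i • u) + O.W (-weylStep i • u))

theorem inner_weylApprox (u : Fin n → ℝ) (i : ℕ) (x y : SystemField d ι H₀) :
    ⟪O.weylApprox u i x, y⟫_ℂ = ⟪x, O.weylApprox u i y⟫_ℂ := by
  have h : ∀ s : ℝ, ⟪O.W (s • u) x, y⟫_ℂ = ⟪x, O.W (-s • u) y⟫_ℂ := fun s => by
    rw [inner_W, neg_smul]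
  simp only [weylApprox, _root_.smul_apply, _root_.sub_apply, inner_smul_left, inner_smul_right,
    inner_sub_left, inner_sub_right, h, neg_neg, map_div₀, map_mul, map_one, Complex.conj_I,
    Complex.conj_ofReal, map_ofNat]
  ring

theorem norm_weylCos_le (u : Fin n → ℝ) (i : ℕ) :
    ‖(O.weylCos u i : SystemField d ι H₀ →L[ℂ] SystemField d ι H₀)‖ ≤ 1 := by
  refine ContinuousLinearMap.opNorm_le_bound _ zero_le_one fun v => ?_
  rw [weylCos, _root_.smul_apply, _root_.add_apply, norm_smul, one_mul]
  have h := norm_add_le (O.W (weylStep i • u) v) (O.W (-weylStep i • u) v)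
  rw [norm_W, norm_W] at h
  rw [show ‖(1 / 2 : ℂ)‖ = 1 / 2 by norm_num]
  linarith

theorem tendsto_W_step (u : Fin n → ℝ) (v : SystemField d ι H₀) {s : ℕ → ℝ}
    (hs : Tendsto s atTop (𝓝 0)) : Tendsto (fun i => O.W (s i • u) v) atTop (𝓝 v) := by
  have h := ((O.continuous_W v).tendsto ((0 : ℝ) • u)).comp (hs.smul_const u)
  rwa [zero_smul, W_zero] at h

theorem tendsto_weylCos (u : Fin n → ℝ) (v : SystemField d ι H₀) :
    Tendsto (fun i => O.weylCos u i v) atTop (𝓝 v) := by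
  have h2 := tendsto_weylStep.neg
  rw [neg_zero] at h2
  have h := ((O.tendsto_W_step u v tendsto_weylStep).add (O.tendsto_W_step u v h2)).const_smul
    (1 / 2 : ℂ)
  have e : (1 / 2 : ℂ) • (v + v) = v := by
    rw [← two_smul ℂ v, smul_smul]
    norm_num
  rwa [e] at h

variable {O}

/-- The commutators of the fields with `sin (ε uᵀX) / ε` are scalar multiples of `cos (ε uᵀX)`. -/
theorem FieldReg.weylApprox {p : SystemField d ι H₀}
    {L : OneParticle n (FieldMode d ι) →L[ℂ] SystemField d ι H₀} (h : O.FieldReg p L)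
    (u : Fin n → ℝ) (i : ℕ) : O.FieldReg (O.weylApprox u i p) (O.weylApprox u i ∘L L +
      ContinuousLinearMap.smulRight (O.comm.flip (OneParticle.ofReal u)) (O.weylCos u i p)) := by
  have h1 := ((h.weyl (weylStep i • u)).add ((h.weyl (-weylStep i • u)).smul (-1))).smul
    (1 / (2 * Complex.I * (weylStep i : ℂ)))
  convert h1 using 1
  · simp [OQHO.weylApprox, sub_eq_add_neg]
  · refine ContinuousLinearMap.ext fun g => ?_
    have h0 : (weylStep i : ℂ) ≠ 0 := Complex.ofReal_ne_zero.2 (weylStep_pos i).ne'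
    have hc : (1 / (2 * Complex.I * (weylStep i : ℂ))) * ((weylStep i : ℂ) * Complex.I) = 1 / 2 := by
      field_simp
    simp only [_root_.add_apply, _root_.smul_apply, ContinuousLinearMap.comp_apply, _root_.sub_apply,
      ContinuousLinearMap.smulRight_apply, ContinuousLinearMap.flip_apply, OneParticle.ofReal_smul,
      OQHO.weylApprox, weylCos, map_smul, smul_eq_mul, Complex.ofReal_neg]
    linear_combination (norm := module) (-(O.comm g (OneParticle.ofReal u)) * hc) • (O.W (weylStep i • u) p) +
      (-(O.comm g (OneParticle.ofReal u)) * hc) • (O.W (-weylStep i • u) p)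

theorem FieldReg.tendsto_weylApprox {v : SystemField d ι H₀}
    {L : OneParticle n (FieldMode d ι) →L[ℂ] SystemField d ι H₀} (h : O.FieldReg v L)
    (u : Fin n → ℝ) :
    Tendsto (fun i => O.weylApprox u i v) atTop (𝓝 (L (OneParticle.ofReal u))) := by
  have h1 := hasDerivAt_iff_tendsto_slope_zero.1 (h.deriv u)
  have hs : Tendsto weylStep atTop (𝓝[≠] 0) := tendsto_nhdsWithin_iff.2
    ⟨tendsto_weylStep, Eventually.of_forall fun i => (weylStep_pos i).ne'⟩
  have hs' : Tendsto (fun i => -weylStep i) atTop (𝓝[≠] 0) := tendsto_nhdsWithin_iff.2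
    ⟨by simpa using tendsto_weylStep.neg, Eventually.of_forall fun i =>
      neg_ne_zero.2 (weylStep_pos i).ne'⟩
  have h2 := ((h1.comp hs).add (h1.comp hs')).const_smul (1 / (2 * Complex.I))
  have e : (1 / (2 * Complex.I)) • (Complex.I • L (OneParticle.ofReal u) +
      Complex.I • L (OneParticle.ofReal u)) = L (OneParticle.ofReal u) := by
    have : 1 / (2 * Complex.I) * Complex.I * 2 = 1 := by field_simp
    rw [← smul_add, smul_smul, ← two_smul ℂ (L _), smul_smul, this, one_smul]
  rw [e] at h2
  refine h2.congr fun i => ?_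
  have h0 : (weylStep i : ℂ) ≠ 0 := Complex.ofReal_ne_zero.2 (weylStep_pos i).ne'
  have hr : ∀ (a : ℝ) (x : SystemField d ι H₀), a • x = (a : ℂ) • x := fun a x =>
    (Complex.coe_smul a x).symm
  simp only [Function.comp_apply, zero_add, hr, OQHO.weylApprox,
    _root_.smul_apply, _root_.sub_apply]
  push_cast
  (match_scalars <;> field_simp); ring

variable (O)

theorem isFieldApprox_weyl (u : Fin n → ℝ) : IsFieldApprox O.FieldReg O.coreSubmodule O.comm
    (OneParticle.ofReal u) (O.weylApprox u) (fun i =>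
      (ContinuousLinearMap.smulRightL ℂ (OneParticle n (FieldMode d ι)) (SystemField d ι H₀)
        (O.comm.flip (OneParticle.ofReal u))).comp (O.weylCos u i)) where
  map_core i p hp := by
    have h : ∀ u, O.W u p ∈ O.coreSubmodule := fun u =>
      O.op_mem_core (fun N x hx => O.weyl_mem_smooth hx _) hp
    exact O.coreSubmodule.smul_mem _ (O.coreSubmodule.sub_mem (h _) (h _))
  map_reg i p L h := h.weylApprox u i
  bound := ⟨‖ContinuousLinearMap.smulRightL ℂ (OneParticle n (FieldMode d ι)) (SystemField d ι H₀)
      (O.comm.flip (OneParticle.ofReal u))‖ * 1, fun i =>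
    (ContinuousLinearMap.opNorm_comp_le _ _).trans
      (mul_le_mul_of_nonneg_left (O.norm_weylCos_le u i) (norm_nonneg _))⟩
  tendsto_comm p := ((ContinuousLinearMap.smulRightL ℂ (OneParticle n (FieldMode d ι))
    (SystemField d ι H₀) (O.comm.flip (OneParticle.ofReal u))).continuous.tendsto p).comp
      (O.tendsto_weylCos u p)
  tendsto_field v L h := h.tendsto_weylApprox u

/-- The field operators of an open quantum harmonic oscillator. -/
def fieldSystem [CompleteSpace H₀] :
    FieldSystem (SystemField d ι H₀) (OneParticle n (FieldMode d ι)) where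
  conj := OneParticle.conj
  comm := O.comm
  Reg := O.FieldReg
  core := O.coreSubmodule
  nice := O.nice
  comm_conj := O.comm_conj
  core_dense := O.core_dense
  core_le := O.core_le_nice
  nice_reg _ hv := exists_fieldReg_of_nice hv
  nice_approx _ hv _ hL := mem_closure_of_nice hv hL
  reg_inner _ _ _ _ hv hw := hv.inner_conj hw
  reg_of_weak _ _ h := fieldReg_of_weak h
  approx U hU h := OneParticle.eq_top_of_generators hU
    (fun j => by
      have h1 := O.isFieldApprox_weyl (ι := ι) (Pi.single j 1)
      exact h _ _ _ _ _ h1 (by rw [OneParticle.conj_ofReal]; exact h1) (O.inner_weylApprox _))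
    (fun κ => h _ _ _ _ _ (O.isFieldApprox_ann κ)
      (by rw [OneParticle.conj_ann]; exact O.isFieldApprox_cre κ) (inner_annApprox κ))
    fun κ => h _ _ _ _ _ (O.isFieldApprox_cre κ)
      (by rw [OneParticle.conj_cre]; exact O.isFieldApprox_ann κ) fun i x y => by
        rw [← inner_conj_symm, ← inner_annApprox, inner_conj_symm]

end OQHO

/-! ### The system variables as fields -/

theorem opApply_toLinearPMap {H : Type*} [NormedAddCommGroup H] [InnerProductSpace ℂ H]
    {Γ : Submodule ℂ (H × H)} (hΓ : ∀ p ∈ Γ, p.1 = 0 → p.2 = 0) {v w : H} (h : (v, w) ∈ Γ) :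
    v ∈ Γ.toLinearPMap.domain ∧ opApply Γ.toLinearPMap v = w := by
  have h1 : (v, w) ∈ Γ.toLinearPMap.graph := by
    rwa [Submodule.toLinearPMap_graph_eq Γ fun p hp => hΓ p hp]
  obtain ⟨y, hy, rfl⟩ := (LinearPMap.mem_graph_iff _).1 h1
  simp only at hy
  subst hy
  exact ⟨y.2, opApply_of_mem _ y.2⟩

/-- The vector of the operator `uᵀX + a(c) + a†(c)`. -/
def OneParticle.field {n : ℕ} {m : Type*} (u : Fin n → ℝ) (c : lp (fun _ : m => ℂ) 2) :
    OneParticle n m := (fun j => (u j : ℂ), star c, c)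

theorem OneParticle.conj_field {n : ℕ} {m : Type*} (u : Fin n → ℝ) (c : lp (fun _ : m => ℂ) 2) :
    OneParticle.conj (OneParticle.field u c) = OneParticle.field u c := by
  refine Prod.ext ?_ (Prod.ext ?_ ?_)
  · funext j
    simp [OneParticle.conj_apply, OneParticle.field]
  · simp [OneParticle.conj_apply, OneParticle.field]
  · simp [OneParticle.conj_apply, OneParticle.field]

namespace OQHO

variable {n d : ℕ} {ι : Type*} {H₀ : Type*} [NormedAddCommGroup H₀] [InnerProductSpace ℂ H₀]
variable (O : OQHO n d ι H₀)

/-- The commutators of self-adjoint fields are imaginary. -/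
theorem comm_field (u u' : Fin n → ℝ) (c c' : lp (fun _ : FieldMode d ι => ℂ) 2) :
    O.comm (OneParticle.field u c) (OneParticle.field u' c') =
      2 * Complex.I * ((O.symp u u' + (⟪c, c'⟫_ℂ).im : ℝ) : ℂ) := by
  have h1 : modePairing (star c) c' = ⟪c, c'⟫_ℂ := by rw [modePairing_apply, star_star]
  have h2 : modePairing c (star c') = starRingEnd ℂ ⟪c, c'⟫_ℂ := by
    rw [← h1, ← modePairing_star, star_star]
  have h3 := O.comm_ofReal (ι := ι) u u'
  simp only [comm_apply, OneParticle.ofReal, map_zero, sub_zero, add_zero] at h3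
  simp only [comm_apply, OneParticle.field]
  rw [h3, h1, h2, Complex.sub_conj]
  push_cast
  ring

variable {O}

/-- The images of a regular vector agree componentwise with the series which define the field
operator. -/
theorem FieldReg.mem_fieldGraph {v : SystemField d ι H₀}
    {L : OneParticle n (FieldMode d ι) →L[ℂ] SystemField d ι H₀} (h : O.FieldReg v L)
    (u : Fin n → ℝ) (c : lp (fun _ : FieldMode d ι => ℂ) 2) :
    (v, L (OneParticle.field u c)) ∈ O.fieldGraph u (fun κ => c κ) := by
  intro N
  let ev : SystemField d ι H₀ →L[ℂ] H₀ := lp.evalCLM ℂ (fun _ => H₀) 2 N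
  have hev : ∀ w : SystemField d ι H₀, ev w = w N := fun _ => rfl
  have hc1 := (hasSum_modeVec (star c)).mapL (ev ∘L (L ∘L ((ContinuousLinearMap.inr ℂ
    (Fin n → ℂ) _).comp (ContinuousLinearMap.inl ℂ (lp (fun _ : FieldMode d ι => ℂ) 2)
      (lp (fun _ : FieldMode d ι => ℂ) 2)))))
  have hc2 := (hasSum_modeVec c).mapL (ev ∘L (L ∘L ((ContinuousLinearMap.inr ℂ
    (Fin n → ℂ) _).comp (ContinuousLinearMap.inr ℂ (lp (fun _ : FieldMode d ι => ℂ) 2)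
      (lp (fun _ : FieldMode d ι => ℂ) 2)))))
  refine ⟨ev (L (OneParticle.ofReal u)), ev (L (0, star c, 0)), (h.deriv u).clm_map ev, ?_, ?_⟩
  · refine hc1.congr_fun fun κ => ?_
    rw [map_smul]
    change _ = star (c κ) • (L (OneParticle.ann κ) N)
    rw [h.ann, smul_smul]
    rfl
  · have h2 : ev (L (0, 0, c)) = ∑ κ ∈ N.support,
        (c κ * ((√(N κ : ℝ) : ℝ) : ℂ)) • v (N - Finsupp.single κ 1) := by
      refine hc2.unique ?_
      have e : ∀ κ, (ev ∘L (L ∘L ((ContinuousLinearMap.inr ℂ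
          (Fin n → ℂ) _).comp (ContinuousLinearMap.inr ℂ (lp (fun _ : FieldMode d ι => ℂ) 2)
          (lp (fun _ : FieldMode d ι => ℂ) 2))))) (c κ • modeVec κ) =
          (c κ * ((√(N κ : ℝ) : ℝ) : ℂ)) • v (N - Finsupp.single κ 1) := fun κ => by
        rw [map_smul]
        change c κ • (L (OneParticle.cre κ) N) = _
        rw [h.cre, smul_smul]
      simp only [e]
      refine hasSum_sum_of_ne_finset_zero fun κ hκ => ?_
      simp [Finsupp.notMem_support_iff.1 hκ]
    have e : OneParticle.field u c =
        OneParticle.ofReal u + ((0, star c, 0) + (0, 0, c)) := by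
      refine Prod.ext ?_ (Prod.ext ?_ ?_) <;> simp [OneParticle.field, OneParticle.ofReal]
    change ev (L (OneParticle.field u c)) = _
    rw [e, map_add, map_add, map_add, map_add, h2, add_assoc]

/-- The operator `uᵀX + a(c) + a†(c)` is applicable to all the regular vectors. -/
theorem FieldReg.field {v : SystemField d ι H₀}
    {L : OneParticle n (FieldMode d ι) →L[ℂ] SystemField d ι H₀} (h : O.FieldReg v L)
    (u : Fin n → ℝ) (c : lp (fun _ : FieldMode d ι => ℂ) 2) :
    v ∈ (O.field u fun κ => c κ).domain ∧
      opApply (O.field u fun κ => c κ) v = L (OneParticle.field u c) :=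
  opApply_toLinearPMap (O.fieldGraph_functional u _) (h.mem_fieldGraph u c)

end OQHO

/-! ### The one-particle curves of the system variables -/

theorem hasSum_prod_of_fintype {α β E : Type*} [Fintype α] [DecidableEq α] [AddCommMonoid E]
    [TopologicalSpace E] [ContinuousAdd E] {f : α × β → E} {s : α → E}
    (h : ∀ a, HasSum (fun b => f (a, b)) (s a)) : HasSum f (∑ a, s a) := by
  have h1 : ∀ a, HasSum (fun p : α × β => if p.1 = a then f p else 0) (s a) := fun a => by
    have hi : Function.Injective fun b : β => (a, b) := fun b b' h => (Prod.mk.inj h).2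
    rw [← hi.hasSum_iff]
    · simpa [Function.comp_def] using h a
    · rintro ⟨a', b⟩ hb
      refine if_neg fun h => hb ⟨b, ?_⟩
      simp only at h
      rw [h]
  refine (hasSum_sum fun a _ => h1 a).congr_fun fun p => ?_
  simp

theorem memLp_indicator_Ioc (s : ℝ) (g : C(ℝ, ℝ)) :
    MemLp (Set.indicator (Set.Ioc 0 s) g) 2 (volume.restrict (Set.Ici (0 : ℝ))) := by
  rw [memLp_indicator_iff_restrict measurableSet_Ioc, Measure.restrict_restrict measurableSet_Ioc]
  obtain ⟨C, hC⟩ := isCompact_Icc.exists_bound_of_continuousOn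
    (g.continuous.continuousOn (s := Set.Icc 0 s))
  refine MemLp.mono_measure (Measure.restrict_mono
    (Set.inter_subset_left.trans Set.Ioc_subset_Icc_self) le_rfl) ?_
  exact MemLp.of_bound (g.continuous.continuousOn.aestronglyMeasurable_of_isCompact
    isCompact_Icc measurableSet_Icc) C
    ((ae_restrict_iff' measurableSet_Icc).2 (Eventually.of_forall hC))

/-- The truncation of a continuous function to the interval `(0, s]`. -/
def modeInd (s : ℝ) : C(ℝ, ℝ) →ₗ[ℝ] HalfLineL2 where
  toFun g := (memLp_indicator_Ioc s g).toLp _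
  map_add' g h := by
    rw [← MemLp.toLp_add]
    congr 1
    exact Set.indicator_add _ _ _
  map_smul' a g := by
    rw [RingHom.id_apply, ← MemLp.toLp_const_smul]
    congr 1
    exact Set.indicator_const_smul (Set.Ioc 0 s) a g

theorem modeInd_coeFn (s : ℝ) (g : C(ℝ, ℝ)) :
    modeInd s g =ᵐ[volume.restrict (Set.Ici (0 : ℝ))] Set.indicator (Set.Ioc 0 s) g :=
  MemLp.coeFn_toLp (memLp_indicator_Ioc s g)

theorem inner_modeInd {s : ℝ} (hs : 0 ≤ s) (x : HalfLineL2) (g : C(ℝ, ℝ)) :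
    ⟪x, modeInd s g⟫_ℝ = ∫ r in (0 : ℝ)..s, g r * x r := by
  rw [L2.inner_def, intervalIntegral.integral_of_le hs]
  have h : (fun r => ⟪x r, modeInd s g r⟫_ℝ) =ᵐ[volume.restrict (Set.Ici (0 : ℝ))]
      Set.indicator (Set.Ioc 0 s) fun r => g r * x r := by
    filter_upwards [modeInd_coeFn s g] with r hr
    rw [hr]
    by_cases h : r ∈ Set.Ioc 0 s <;> simp [h, mul_comm]
  rw [integral_congr_ae h, integral_indicator measurableSet_Ioc,
    Measure.restrict_restrict measurableSet_Ioc, Set.inter_eq_left.2 fun r hr => hr.1.le]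

theorem inner_modeInd_modeInd (s σ : ℝ) (g h : C(ℝ, ℝ)) :
    ⟪modeInd s g, modeInd σ h⟫_ℝ = ∫ r in Set.Ioc 0 (min s σ), g r * h r := by
  rw [L2.inner_def]
  have h : (fun r => ⟪modeInd s g r, modeInd σ h r⟫_ℝ) =ᵐ[volume.restrict (Set.Ici (0 : ℝ))]
      Set.indicator (Set.Ioc 0 (min s σ)) fun r => g r * h r := by
    filter_upwards [modeInd_coeFn s g, modeInd_coeFn σ h] with r hr hr'
    rw [hr, hr']
    by_cases h1 : 0 < r <;> by_cases h2 : r ≤ s <;> by_cases h3 : r ≤ σ <;>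
      simp [h1, h2, h3, mul_comm]
  rw [integral_congr_ae h, integral_indicator measurableSet_Ioc,
    Measure.restrict_restrict measurableSet_Ioc, Set.inter_eq_left.2 fun r hr => hr.1.le]

theorem continuous_modeInd (g : C(ℝ, ℝ)) : Continuous fun s => modeInd s g := by
  refine continuous_iff_continuousAt.2 fun s => ?_
  have hG : Continuous fun s : ℝ => ∫ r in Set.Ioc 0 s, g r * g r := by
    have e : (fun s : ℝ => ∫ r in Set.Ioc 0 s, g r * g r) =
        fun s => ∫ r in (0 : ℝ)..(max 0 s), g r * g r := by
      funext s
      rcases le_total 0 s with h | h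
      · rw [max_eq_right h, intervalIntegral.integral_of_le h]
      · rw [max_eq_left h, Set.Ioc_eq_empty (not_lt.2 h)]
        simp
    rw [e]
    have h1 : Continuous fun s : ℝ => ∫ r in (0 : ℝ)..s, g r * g r :=
      intervalIntegral.continuous_primitive (fun a b =>
        Continuous.intervalIntegrable (by fun_prop) a b) 0
    exact h1.comp (continuous_const.max continuous_id)
  -- the squared norm of a difference, through integrals over intervals with varying endpoints
  have hn : ∀ σ, ‖modeInd σ g - modeInd s g‖ ^ 2 =
      (∫ r in Set.Ioc 0 σ, g r * g r) - 2 * (∫ r in Set.Ioc 0 (min σ s), g r * g r) +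
        ∫ r in Set.Ioc 0 s, g r * g r := fun σ => by
    rw [norm_sub_sq_real, ← real_inner_self_eq_norm_sq, ← real_inner_self_eq_norm_sq,
      inner_modeInd_modeInd, inner_modeInd_modeInd, inner_modeInd_modeInd, min_self, min_self]
  have h2 : Tendsto (fun σ => ‖modeInd σ g - modeInd s g‖ ^ 2) (𝓝 s) (𝓝 0) := by
    simp only [hn]
    have hc : Continuous fun σ => (∫ r in Set.Ioc 0 σ, g r * g r) -
        2 * (∫ r in Set.Ioc 0 (min σ s), g r * g r) + ∫ r in Set.Ioc 0 s, g r * g r :=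
      (hG.sub (continuous_const.mul (hG.comp (continuous_id.min continuous_const)))).add
        continuous_const
    have := hc.tendsto s
    rwa [min_self, show ∀ x : ℝ, x - 2 * x + x = 0 from fun x => by ring] at this
  refine tendsto_iff_norm_sub_tendsto_zero.2 ?_
  have h3 := (Real.continuous_sqrt.tendsto 0).comp h2
  simpa [Function.comp_def, Real.sqrt_sq] using h3

section Modes

variable {d : ℕ} {ι : Type*} (b : HilbertBasis ι ℝ HalfLineL2)

/-- Parseval's identity for the complex mode coefficients, the inner product being split into its
real and imaginary parts. -/
theorem hasSum_modeCoeff (u w : Fin d ⊕ Fin d → HalfLineL2) :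
    HasSum (fun κ : FieldMode d ι =>
      starRingEnd ℂ ((b.repr (u (Sum.inl κ.1)) κ.2 : ℂ) + Complex.I * (b.repr (u (Sum.inr κ.1)) κ.2 : ℂ)) *
        ((b.repr (w (Sum.inl κ.1)) κ.2 : ℂ) + Complex.I * (b.repr (w (Sum.inr κ.1)) κ.2 : ℂ)))
      (∑ j : Fin d, (((⟪u (Sum.inl j), w (Sum.inl j)⟫_ℝ + ⟪u (Sum.inr j), w (Sum.inr j)⟫_ℝ : ℝ) : ℂ) +
        ((⟪u (Sum.inl j), w (Sum.inr j)⟫_ℝ - ⟪u (Sum.inr j), w (Sum.inl j)⟫_ℝ : ℝ) : ℂ) *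
          Complex.I)) := by
  classical
  refine hasSum_prod_of_fintype fun j => ?_
  have h : ∀ x y : HalfLineL2, HasSum (fun i => ((b.repr x i * b.repr y i : ℝ) : ℂ))
      ((⟪x, y⟫_ℝ : ℝ) : ℂ) := fun x y => by
    have h1 := lp.hasSum_inner (𝕜 := ℝ) (b.repr x) (b.repr y)
    rw [b.repr.inner_map_map] at h1
    refine (Complex.hasSum_ofReal.2 h1).congr_fun fun i => ?_
    simp [mul_comm]
  have h2 := ((h (u (Sum.inl j)) (w (Sum.inl j))).add (h (u (Sum.inr j)) (w (Sum.inr j)))).add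
    (((h (u (Sum.inl j)) (w (Sum.inr j))).sub (h (u (Sum.inr j)) (w (Sum.inl j)))).mul_right
      Complex.I)
  convert h2 using 1
  · funext i
    simp only [map_add, map_mul, Complex.conj_ofReal, Complex.conj_I, Complex.ofReal_mul]
    linear_combination (-(b.repr (u (Sum.inr j)) i : ℂ) * (b.repr (w (Sum.inr j)) i : ℂ)) *
      Complex.I_mul_I
  · push_cast
    rfl

/-- The complex mode coefficients of the functions `u_1, …, u_{2d}`, with the channels `j` and
`j + d` as the real and imaginary parts. -/
def modeCoeff : (Fin d ⊕ Fin d → HalfLineL2) →L[ℝ] lp (fun _ : FieldMode d ι => ℂ) 2 :=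
  LinearMap.mkContinuous
    { toFun := fun u => ⟨fun κ => (b.repr (u (Sum.inl κ.1)) κ.2 : ℂ) +
        Complex.I * (b.repr (u (Sum.inr κ.1)) κ.2 : ℂ), memℓp_gen (by
          refine (hasSum_modeCoeff b u u).summable.norm.congr fun κ => ?_
          rw [norm_mul, RCLike.norm_conj, ← sq]
          norm_num)⟩
      map_add' := fun u w => by
        ext κ
        change ((b.repr ((u + w) (Sum.inl κ.1)) κ.2 : ℝ) : ℂ) + Complex.I * (b.repr ((u + w) (Sum.inr κ.1)) κ.2 : ℝ) =
          ((b.repr (u (Sum.inl κ.1)) κ.2 : ℂ) + Complex.I * (b.repr (u (Sum.inr κ.1)) κ.2 : ℂ)) +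
          ((b.repr (w (Sum.inl κ.1)) κ.2 : ℂ) + Complex.I * (b.repr (w (Sum.inr κ.1)) κ.2 : ℂ))
        simp
        ring
      map_smul' := fun a u => by
        ext κ
        change ((b.repr ((a • u) (Sum.inl κ.1)) κ.2 : ℝ) : ℂ) + Complex.I * (b.repr ((a • u) (Sum.inr κ.1)) κ.2 : ℝ) =
          a • ((b.repr (u (Sum.inl κ.1)) κ.2 : ℂ) + Complex.I * (b.repr (u (Sum.inr κ.1)) κ.2 : ℂ))
        simp
        ring }
    (√(2 * d)) (fun u => by
      set x : lp (fun _ : FieldMode d ι => ℂ) 2 := ⟨fun κ => (b.repr (u (Sum.inl κ.1)) κ.2 : ℂ) +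
        Complex.I * (b.repr (u (Sum.inr κ.1)) κ.2 : ℂ), _⟩
      change ‖x‖ ≤ _
      have h := (lp.hasSum_inner (𝕜 := ℂ) x x).unique ((hasSum_modeCoeff b u u).congr_fun fun κ =>
        mul_comm _ _)
      have h1 : ‖x‖ ^ 2 = ∑ j : Fin d, (‖u (Sum.inl j)‖ ^ 2 + ‖u (Sum.inr j)‖ ^ 2) := by
        rw [inner_self_eq_norm_sq_to_K] at h
        have h2 := congrArg Complex.re h
        simp only [Complex.re_sum, Complex.add_re, Complex.ofReal_re, Complex.mul_re, Complex.I_re,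
          Complex.ofReal_im, mul_zero, zero_mul, sub_zero, add_zero, real_inner_self_eq_norm_sq]
          at h2
        rw [← h2]
        exact_mod_cast rfl
      have h2 : ‖x‖ ^ 2 ≤ (√(2 * d) * ‖u‖) ^ 2 := by
        rw [h1, mul_pow, Real.sq_sqrt (by positivity)]
        refine (Finset.sum_le_card_nsmul _ _ (‖u‖ ^ 2 + ‖u‖ ^ 2) fun j _ => ?_).trans (le_of_eq ?_)
        · gcongr <;> exact norm_le_pi_norm u _
        · rw [Finset.card_univ, Fintype.card_fin, nsmul_eq_mul]
          ring
      exact (pow_le_pow_iff_left₀ (norm_nonneg _) (by positivity) two_ne_zero).1 h2)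

theorem modeCoeff_apply (u : Fin d ⊕ Fin d → HalfLineL2) (κ : FieldMode d ι) :
    modeCoeff b u κ = (b.repr (u (Sum.inl κ.1)) κ.2 : ℂ) +
      Complex.I * (b.repr (u (Sum.inr κ.1)) κ.2 : ℂ) := rfl

/-- The imaginary part of the inner product of mode coefficients is the symplectic form of the
matrix `J`. -/
theorem im_inner_modeCoeff (u w : Fin d ⊕ Fin d → HalfLineL2) :
    (⟪modeCoeff b u, modeCoeff b w⟫_ℂ).im =
      ∑ j : Fin d, (⟪u (Sum.inl j), w (Sum.inr j)⟫_ℝ - ⟪u (Sum.inr j), w (Sum.inl j)⟫_ℝ) := by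
  have h := (lp.hasSum_inner (modeCoeff b u) (modeCoeff b w)).unique
    ((hasSum_modeCoeff b u w).congr_fun fun κ => ?_)
  · rw [h, Complex.im_sum]
    refine Finset.sum_congr rfl fun j _ => ?_
    simp
  · rw [modeCoeff_apply, modeCoeff_apply]
    simp [mul_comm]

end Modes

/-! ### The commutators of the system variables -/

namespace OQHO

variable {n d : ℕ} {ι : Type*} {H₀ : Type*} [NormedAddCommGroup H₀] [InnerProductSpace ℂ H₀]
variable (O : OQHO n d ι H₀)

theorem exp_add_smul_matrix (A : Matrix (Fin n) (Fin n) ℝ) (s t : ℝ) :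
    NormedSpace.exp ((s + t) • A) = NormedSpace.exp (s • A) * NormedSpace.exp (t • A) := by
  rw [add_smul]
  exact Matrix.exp_add_of_commute _ _ (((Commute.refl A).smul_left s).smul_right t)

/-- The algebraic relation between the drift and the coupling which preserves the CCRs. -/
theorem drift_relation : O.A * O.Θ + O.Θ * O.A.transpose =
    -(O.B * matJ d * O.B.transpose) := by
  have hJ : (matJ d).transpose = -matJ d := by
    simp [matJ, Matrix.fromBlocks_transpose, Matrix.fromBlocks_neg]
  simp only [A, B, Matrix.transpose_smul, Matrix.transpose_mul, Matrix.transpose_add, O.antisymm,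
    O.symm.eq, hJ, Matrix.transpose_transpose, Matrix.mul_add, Matrix.add_mul, Matrix.smul_mul,
    Matrix.mul_smul,
    Matrix.mul_neg, Matrix.neg_mul, Matrix.mul_assoc, smul_add, smul_neg, smul_smul, neg_neg]
  module

/-- Row `k` of `e^{(s-r)A} B`, as a function of `r`, in the column `a`. -/
def rowCurve (k : Fin n) (a : Fin d ⊕ Fin d) (s : ℝ) : C(ℝ, ℝ) where
  toFun r := (NormedSpace.exp ((s - r) • O.A) * O.B) k a
  continuous_toFun := by
    have h : Continuous fun r : ℝ => NormedSpace.exp ((s - r) • O.A) :=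
      (continuous_exp_smul_matrix O.A).comp (continuous_const.sub continuous_id)
    exact (h.matrix_mul continuous_const).matrix_elem k a

theorem rowCurve_eq_sum (k : Fin n) (a : Fin d ⊕ Fin d) (s : ℝ) :
    O.rowCurve k a s = ∑ b, NormedSpace.exp (s • O.A) k b • O.rowCurve b a 0 := by
  ext r
  have h : NormedSpace.exp ((s - r) • O.A) * O.B =
      NormedSpace.exp (s • O.A) * (NormedSpace.exp ((0 - r) • O.A) * O.B) := by
    rw [← Matrix.mul_assoc, ← exp_add_smul_matrix, zero_sub, sub_eq_add_neg]
  have h2 := congrFun (congrFun h k) a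
  rw [Matrix.mul_apply (M := NormedSpace.exp (s • O.A))] at h2
  simpa [rowCurve] using h2

theorem continuous_modeInd_rowCurve (k : Fin n) (a : Fin d ⊕ Fin d) :
    Continuous fun s => modeInd s (O.rowCurve k a s) := by
  have e : ∀ s, modeInd s (O.rowCurve k a s) =
      ∑ b, NormedSpace.exp (s • O.A) k b • modeInd s (O.rowCurve b a 0) := fun s => by
    rw [rowCurve_eq_sum, map_sum]
    simp only [map_smul]
  simp only [e]
  refine continuous_finsetSum _ fun b _ => ?_
  exact ((continuous_exp_smul_matrix O.A).matrix_elem k b).smul (continuous_modeInd _)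

/-- The coefficients of the creation operators in `X_k(s)`. -/
def modeCurve (k : Fin n) (s : ℝ) : lp (fun _ : FieldMode d ι => ℂ) 2 :=
  modeCoeff O.basis fun a => modeInd s (O.rowCurve k a s)

theorem modeCurve_apply (k : Fin n) {s : ℝ} (hs : 0 ≤ s) (κ : FieldMode d ι) :
    O.modeCurve k s κ =
      O.fieldCoeff s (fun r => (NormedSpace.exp ((s - r) • O.A) * O.B) k) κ := by
  simp only [modeCurve, modeCoeff_apply, HilbertBasis.repr_apply_apply, inner_modeInd hs]
  rfl

/-- The one-particle curve of the system variable `X_k(s)`. -/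
def sysCurve (k : Fin n) : C(ℝ, OneParticle n (FieldMode d ι)) where
  toFun s := OneParticle.field (NormedSpace.exp (s • O.A) k) (O.modeCurve k s)
  continuous_toFun := by
    have h1 : Continuous fun s => O.modeCurve k s :=
      (modeCoeff O.basis).continuous.comp
        (continuous_pi fun a => O.continuous_modeInd_rowCurve k a)
    have h2 : Continuous fun s : ℝ => fun j => ((NormedSpace.exp (s • O.A) k j : ℝ) : ℂ) :=
      continuous_pi fun j => Complex.continuous_ofReal.comp
        ((continuous_exp_smul_matrix O.A).matrix_elem k j)
    exact h2.prodMk (h1.star.prodMk h1)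

theorem sysCurve_apply (k : Fin n) (s : ℝ) :
    O.sysCurve k s = OneParticle.field (NormedSpace.exp (s • O.A) k) (O.modeCurve k s) := rfl

theorem conj_sysCurve (k : Fin n) (s : ℝ) : OneParticle.conj (O.sysCurve k s) = O.sysCurve k s :=
  OneParticle.conj_field _ _

/-- The field contribution to the commutators is an exact integral: by `drift_relation`, the
integrand is the derivative of `e^{(s-r)A} Θ e^{(σ-r)Aᵀ}`. -/
theorem integral_coupling (s σ μ : ℝ) (j k : Fin n) :
    ∫ r in (0 : ℝ)..μ, (NormedSpace.exp ((s - r) • O.A) * (O.B * matJ d * O.B.transpose) *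
      (NormedSpace.exp ((σ - r) • O.A)).transpose) j k =
    (NormedSpace.exp ((s - μ) • O.A) * O.Θ * (NormedSpace.exp ((σ - μ) • O.A)).transpose) j k -
      (NormedSpace.exp (s • O.A) * O.Θ * (NormedSpace.exp (σ • O.A)).transpose) j k := by
  let : NormedRing (Matrix (Fin n) (Fin n) ℝ) := Matrix.linftyOpNormedRing
  let : NormedAlgebra ℝ (Matrix (Fin n) (Fin n) ℝ) := Matrix.linftyOpNormedAlgebra
  have h1 : ∀ (A : Matrix (Fin n) (Fin n) ℝ) (s r : ℝ),
      HasDerivAt (fun r : ℝ => NormedSpace.exp ((s - r) • A))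
        (-(NormedSpace.exp ((s - r) • A) * A)) r := fun A s r => by
    have h := HasDerivAt.scomp (h := fun r : ℝ => s - r) r
      (hasDerivAt_exp_smul_const (𝕂 := ℝ) A (s - r)) ((hasDerivAt_id r).const_sub s)
    exact h.congr_deriv (neg_one_smul _ _)
  have h1' : ∀ (A : Matrix (Fin n) (Fin n) ℝ) (s r : ℝ),
      HasDerivAt (fun r : ℝ => NormedSpace.exp ((s - r) • A))
        (-(A * NormedSpace.exp ((s - r) • A))) r := fun A s r => by
    have h := HasDerivAt.scomp (h := fun r : ℝ => s - r) r
      (hasDerivAt_exp_smul_const' (𝕂 := ℝ) A (s - r)) ((hasDerivAt_id r).const_sub s)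
    exact h.congr_deriv (neg_one_smul _ _)
  have h2 : ∀ r, HasDerivAt (fun r : ℝ => (NormedSpace.exp ((s - r) • O.A) * O.Θ) *
      NormedSpace.exp ((σ - r) • O.A.transpose)) (NormedSpace.exp ((s - r) • O.A) *
        (O.B * matJ d * O.B.transpose) * NormedSpace.exp ((σ - r) • O.A.transpose)) r := by
    intro r
    refine (((h1 O.A s r).mul_const O.Θ).mul (h1' O.A.transpose σ r)).congr_deriv ?_
    have h3 : O.B * matJ d * O.B.transpose = -(O.A * O.Θ + O.Θ * O.A.transpose) := by
      rw [drift_relation, neg_neg]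
    rw [h3]
    noncomm_ring
  have h3 : ∀ r, HasDerivAt (fun r : ℝ => ((NormedSpace.exp ((s - r) • O.A) * O.Θ) *
      NormedSpace.exp ((σ - r) • O.A.transpose)) j k) ((NormedSpace.exp ((s - r) • O.A) *
        (O.B * matJ d * O.B.transpose) * NormedSpace.exp ((σ - r) • O.A.transpose)) j k) r :=
    fun r => hasDerivAt_pi.1 (hasDerivAt_pi.1 (h2 r) j) k
  have e : ∀ r : ℝ, (NormedSpace.exp (r • O.A)).transpose = NormedSpace.exp (r • O.A.transpose) :=
    fun r => by rw [← Matrix.exp_transpose, Matrix.transpose_smul]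
  have hc := fun s (A : Matrix (Fin n) (Fin n) ℝ) =>
    (continuous_exp_smul_matrix A).comp (continuous_const.sub continuous_id : Continuous fun r : ℝ => s - r)
  simp only [e]
  rw [intervalIntegral.integral_eq_sub_of_hasDerivAt (fun r _ => h3 r)
    (Continuous.intervalIntegrable (((hc s O.A).mul continuous_const).mul
      (hc σ O.A.transpose) |>.matrix_elem j k) _ _)]
  simp only [sub_zero]

theorem Lam_eq {s σ : ℝ} : NormedSpace.exp ((s - min s σ) • O.A) * O.Θ *
    (NormedSpace.exp ((σ - min s σ) • O.A)).transpose = O.Lam (s - σ) := by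
  rcases le_or_gt σ s with h | h
  · rw [min_eq_right h, Lam, if_pos (sub_nonneg.2 h)]
    simp
  · rw [min_eq_left h.le, Lam, if_neg (by linarith), ← Matrix.exp_transpose]
    simp

theorem im_inner_modeCurve {s σ : ℝ} (hs : 0 ≤ s) (hσ : 0 ≤ σ) (j k : Fin n) :
    (⟪O.modeCurve j s, O.modeCurve k σ⟫_ℂ).im =
      ∫ r in (0 : ℝ)..(min s σ), (NormedSpace.exp ((s - r) • O.A) * (O.B * matJ d * O.B.transpose) *
        (NormedSpace.exp ((σ - r) • O.A)).transpose) j k := by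
  have hμ : 0 ≤ min s σ := le_min hs hσ
  simp only [modeCurve, im_inner_modeCoeff, inner_modeInd_modeInd,
    ← intervalIntegral.integral_of_le hμ]
  have hi : ∀ g h : C(ℝ, ℝ), IntervalIntegrable (fun r => g r * h r) volume 0 (min s σ) :=
    fun g h => Continuous.intervalIntegrable (by fun_prop) _ _
  simp only [← intervalIntegral.integral_sub (hi _ _) (hi _ _)]
  rw [← intervalIntegral.integral_finsetSum fun i _ => (hi _ _).sub (hi _ _)]
  refine intervalIntegral.integral_congr fun r _ => ?_
  have e : NormedSpace.exp ((s - r) • O.A) * (O.B * matJ d * O.B.transpose) *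
      (NormedSpace.exp ((σ - r) • O.A)).transpose = (NormedSpace.exp ((s - r) • O.A) * O.B) * matJ d *
        (NormedSpace.exp ((σ - r) • O.A) * O.B).transpose := by
    simp only [Matrix.transpose_mul, Matrix.mul_assoc]
  simp only [e, rowCurve, ContinuousMap.coe_mk]
  generalize NormedSpace.exp ((s - r) • O.A) * O.B = Y
  generalize NormedSpace.exp ((σ - r) • O.A) * O.B = Z
  simp only [Matrix.mul_apply, Matrix.transpose_apply, Fintype.sum_sum_type, matJ,
    Matrix.fromBlocks_apply₁₁, Matrix.fromBlocks_apply₁₂, Matrix.fromBlocks_apply₂₁,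
    Matrix.fromBlocks_apply₂₂, Matrix.neg_apply, Matrix.zero_apply, Matrix.one_apply]
  simp
  ring

variable [CompleteSpace H₀]

/-- The system variables satisfy `[X(s), X(σ)ᵀ] = 2iΛ(s - σ)`. The contributions of the initial
variables and of the field add up to a telescoping sum. -/
theorem hasLamComm_sysCurve : O.HasLamComm O.fieldSystem (O.sysCurve (ι := ι)) := by
  intro j k s σ hs hσ
  change O.comm (O.sysCurve j s) (O.sysCurve k σ) = _
  rw [sysCurve_apply, sysCurve_apply, comm_field, O.im_inner_modeCurve hs hσ, integral_coupling,
    Lam_eq]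
  congr 2
  have e : O.symp (NormedSpace.exp (s • O.A) j) (NormedSpace.exp (σ • O.A) k) =
      (NormedSpace.exp (s • O.A) * O.Θ * (NormedSpace.exp (σ • O.A)).transpose) j k := by
    simp only [symp, dotProduct, Matrix.mulVec, Matrix.mul_apply, Matrix.transpose_apply,
      Finset.mul_sum, Finset.sum_mul]
    rw [Finset.sum_comm]
    refine Finset.sum_congr rfl fun a _ => Finset.sum_congr rfl fun b _ => ?_
    ring
  rw [e]
  ring

end OQHO

/-! ### The operators `e^{-cφ}` and `Ψ` of the oscillator -/

namespace OQHO

variable {n d : ℕ} {ι : Type*} {H₀ : Type*} [NormedAddCommGroup H₀] [InnerProductSpace ℂ H₀]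
variable {O : OQHO n d ι H₀}

/-- On a regular vector the system variable `X_k(s)` is the field of its one-particle curve. -/
theorem FieldReg.X {v : SystemField d ι H₀}
    {L : OneParticle n (FieldMode d ι) →L[ℂ] SystemField d ι H₀} (h : O.FieldReg v L)
    (k : Fin n) {s : ℝ} (hs : 0 ≤ s) :
    v ∈ (O.X k s).domain ∧ opApply (O.X k s) v = L (O.sysCurve k s) := by
  have h1 := h.field (NormedSpace.exp (s • O.A) k) (O.modeCurve k s)
  have e : (fun κ => O.modeCurve k s κ) =
      O.fieldCoeff s (fun r => (NormedSpace.exp ((s - r) • O.A) * O.B) k) :=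
    funext fun κ => O.modeCurve_apply k hs κ
  rw [e] at h1
  exact h1

theorem FieldReg.XX {v : SystemField d ι H₀}
    {L : OneParticle n (FieldMode d ι) →L[ℂ] SystemField d ι H₀} (h : O.FieldReg v L)
    {N : OneParticle n (FieldMode d ι) → OneParticle n (FieldMode d ι) →L[ℂ] SystemField d ι H₀}
    (hN : ∀ g, O.FieldReg (L g) (N g)) (j k : Fin n) {σ τ : ℝ} (hσ : 0 ≤ σ) (hτ : 0 ≤ τ) :
    v ∈ (O.XX j k σ τ).domain ∧
      opApply (O.XX j k σ τ) v = N (O.sysCurve k τ) (O.sysCurve j σ) := by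
  obtain ⟨h1, h2⟩ := h.X k hτ
  obtain ⟨h3, h4⟩ := (hN (O.sysCurve k τ)).X j hσ
  rw [← h2] at h3 h4
  refine ⟨⟨h1, h3⟩, ?_⟩
  rw [opApply_of_mem _ (show v ∈ (O.XX j k σ τ).domain from ⟨h1, h3⟩)]
  rw [← h4]
  rfl

variable (O)

theorem PsiGraph_functional (P : Matrix (Fin n) (Fin n) ℝ) (θ t : ℝ) :
    ∀ p ∈ O.PsiGraph P θ t (ι := ι), p.1 = 0 → p.2 = 0 := by
  rintro ⟨v, w⟩ ⟨-, -, -, h⟩ (rfl : v = 0)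
  simpa [alphaTerm, betaTerm, opApply_zero] using h

variable {O}

/-- The operator `Ψ` is applicable to a vector whose images under the fields are regular again,
and has the value `psiValue` on it. -/
theorem FieldReg.Psi {v : SystemField d ι H₀}
    {L : OneParticle n (FieldMode d ι) →L[ℂ] SystemField d ι H₀} (h : O.FieldReg v L)
    {N : OneParticle n (FieldMode d ι) →L[ℂ] OneParticle n (FieldMode d ι) →L[ℂ]
      SystemField d ι H₀}
    (hN : ∀ g, O.FieldReg (L g) (N g)) [CompleteSpace H₀] (P : Matrix (Fin n) (Fin n) ℝ)
    (θ : ℝ) {t : ℝ} (ht : 0 ≤ t) :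
    v ∈ (O.Psi P θ t).domain ∧ opApply (O.Psi P θ t) v = O.psiValue P θ t O.sysCurve N := by
  have hXX := fun j k {σ τ : ℝ} (hσ : 0 ≤ σ) (hτ : 0 ≤ τ) => h.XX hN j k hσ hτ
  have hm : MeasurableSet (Set.Icc 0 t ×ˢ Set.Icc 0 t) := measurableSet_Icc.prod measurableSet_Icc
  have ha : ∀ j k, Set.EqOn (O.alphaTerm P θ t j k v) (fun σ =>
      ((O.alpha P θ t σ j k / 2 : ℝ) : ℂ) • (N (O.sysCurve k σ) (O.sysCurve j t) +
        N (O.sysCurve j t) (O.sysCurve k σ))) (Set.Icc 0 t) := fun j k σ hσ => by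
    rw [alphaTerm, (hXX j k ht hσ.1).2, (hXX k j hσ.1 ht).2]
  have hb : ∀ j k, Set.EqOn (O.betaTerm P θ t j k v) (fun q =>
      ((O.beta P θ t q.1 q.2 j k : ℝ) : ℂ) • N (O.sysCurve k q.2) (O.sysCurve j q.1))
      (Set.Icc 0 t ×ˢ Set.Icc 0 t) := fun j k q hq => by
    rw [betaTerm, (hXX j k hq.1.1 hq.2.1).2]
  refine opApply_toLinearPMap (O.PsiGraph_functional P θ t) ⟨?_, fun j k => ?_, fun j k => ?_, ?_⟩
  · simp only [quadDomain, Submodule.mem_iInf]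
    rintro j k ⟨σ, hσ⟩ ⟨τ, hτ⟩
    rw [Set.uIcc_of_le ht] at hσ hτ
    exact (hXX j k hσ.1 hτ.1).1
  · refine (integrableOn_congr_fun (ha j k) measurableSet_Icc).2 ?_
    exact (O.alphaIntegral P θ ht j k (g := fun σ => N (O.sysCurve k σ) (O.sysCurve j t) +
        N (O.sysCurve j t) (O.sysCurve k σ)) (by fun_prop)).1
  · refine (integrableOn_congr_fun (hb j k) hm).2 ?_
    exact (O.betaIntegral P θ ht j k (g := fun q => N (O.sysCurve k q.2) (O.sysCurve j q.1))
      (by fun_prop)).1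
  · have h1 : ∀ j k, opApply (O.XX j k t t) v = N (O.sysCurve k t) (O.sysCurve j t) :=
      fun j k => (hXX j k ht ht).2
    have h2 : ∀ j k, (∫ σ in Set.Icc 0 t, O.alphaTerm P θ t j k v σ) = _ := fun j k =>
      setIntegral_congr_fun measurableSet_Icc (ha j k)
    have h3 : ∀ j k, (∫ q in Set.Icc 0 t ×ˢ Set.Icc 0 t, O.betaTerm P θ t j k v q) = _ :=
      fun j k => setIntegral_congr_fun hm (hb j k)
    simp only [h1, h2, h3]
    rfl

variable [CompleteSpace H₀] (O)

/-- The form of `φ` is that of the fields along the curves `∑ l, (√P)_{jl} f_l`. -/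
theorem zetaGraph_eq (P : Matrix (Fin n) (Fin n) ℝ) (t : ℝ) :
    O.zetaGraph P t (ι := ι) = O.fieldSystem.preGraph (sqrtCurve P O.sysCurve) t := by
  unfold zetaGraph FieldSystem.preGraph
  congr 1
  ext p
  refine and_congr_right fun hp => ?_
  obtain ⟨L, hL⟩ := O.fieldSystem.core_reg hp
  have hval : ∀ s ∈ Set.Icc 0 t, ∀ k, ∑ l, ((cfc Real.sqrt P k l : ℝ) : ℂ) •
      opApply (O.X l s) p.fst = L (sqrtCurve P O.sysCurve k s) := fun s hs k => by
    rw [sqrtCurve_apply, map_sum]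
    refine Finset.sum_congr rfl fun l _ => ?_
    rw [map_smul, (FieldReg.X hL l hs.1).2]
  have hc := curveMap_coeFn (sqrtCurve P O.sysCurve) t L
  have hmem : ∀ᵐ s ∂(volume.restrict (Set.Icc 0 t)), s ∈ Set.Icc 0 t :=
    ae_restrict_mem measurableSet_Icc
  constructor
  · intro h
    refine ⟨L, hL, Lp.ext ?_⟩
    filter_upwards [hc, hmem, ae_all_iff.2 h] with s h1 h2 h3
    rw [h1]
    ext k
    rw [h3 k, hval s h2 k]
  · rintro ⟨L', hL', h⟩ k
    obtain rfl := O.fieldSystem.reg_unique hL hL'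
    filter_upwards [hc, hmem] with s h1 h2
    rw [h, h1, hval s h2 k]

theorem expNegPhi_eq (P : Matrix (Fin n) (Fin n) ℝ) {c : ℝ} (hc : 0 ≤ c) (t : ℝ) :
    O.expNegPhi P c t (ι := ι) = O.fieldSystem.semigroup (sqrtCurve P O.sysCurve) t c := by
  unfold expNegPhi phiResolvent FieldSystem.semigroup contractionSemigroup FieldSystem.graph
  simp only [zetaGraph_eq]
  rw [max_eq_left hc]

end OQHO

/-! ### Operators with bounded inverses -/

section BoundedInverse

variable {H : Type*} [NormedAddCommGroup H] [InnerProductSpace ℂ H]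

theorem mem_graph_iff_opApply (A : H →ₗ.[ℂ] H) {p : H × H} :
    p ∈ A.graph ↔ p.1 ∈ A.domain ∧ opApply A p.1 = p.2 := by
  rw [LinearPMap.mem_graph_iff]
  constructor
  · rintro ⟨y, hy, h⟩
    rw [← hy]
    exact ⟨y.2, (opApply_of_mem A y.2).trans h⟩
  · rintro ⟨h1, h2⟩
    exact ⟨⟨p.1, h1⟩, rfl, (opApply_of_mem A h1).symm.trans h2⟩

theorem mem_graph_opBdd (T : H →L[ℂ] H) {p : H × H} : p ∈ (opBdd T).graph ↔ p.2 = T p.1 := by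
  rw [LinearPMap.mem_graph_iff]
  constructor
  · rintro ⟨y, hy, h⟩
    rw [← h, ← hy]
    rfl
  · intro h
    exact ⟨⟨p.1, Submodule.mem_top⟩, rfl, h.symm⟩

theorem mem_graph_inverse {A : H →ₗ.[ℂ] H} (hA : ∀ p ∈ A.graph, p.2 = 0 → p.1 = 0) {p : H × H} :
    p ∈ A.inverse.graph ↔ (p.2, p.1) ∈ A.graph := by
  have hker : A.toFun.ker = ⊥ := by
    refine LinearMap.ker_eq_bot'.2 fun x hx => Subtype.ext ?_
    exact hA _ (A.mem_graph x) hx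
  rw [LinearPMap.inverse_graph hker, Submodule.mem_map]
  constructor
  · rintro ⟨q, hq, rfl⟩
    exact hq
  · intro h
    exact ⟨(p.2, p.1), h, rfl⟩

theorem mem_graph_opBdd_inverse {T : H →L[ℂ] H} (hT : ∀ x, T x = 0 → x = 0) {p : H × H} :
    p ∈ (opBdd T).inverse.graph ↔ p.1 = T p.2 := by
  rw [mem_graph_inverse, mem_graph_opBdd]
  intro p hp h
  exact hT _ (by rw [← (mem_graph_opBdd T).1 hp, h])

/-- The inverse of the inverse of an injective bounded operator. -/
theorem inverse_inverse_opBdd {T : H →L[ℂ] H} (hT : ∀ x, T x = 0 → x = 0) :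
    (opBdd T).inverse.inverse = opBdd T := by
  refine LinearPMap.eq_of_eq_graph (Submodule.ext fun p => ?_)
  rw [mem_graph_inverse, mem_graph_opBdd_inverse hT, mem_graph_opBdd]
  intro p hp h
  rw [(mem_graph_opBdd_inverse hT).1 hp, h, map_zero]

theorem IsBddInverse.mem_graph_iff {A : H →ₗ.[ℂ] H} {Q : H →L[ℂ] H} (h : IsBddInverse A Q)
    {p : H × H} : p ∈ A.graph ↔ p.1 = Q p.2 := by
  rw [LinearPMap.mem_graph_iff]
  constructor
  · rintro ⟨y, hy, hp⟩
    rw [← hy, ← hp, h.2]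
  · intro hp
    obtain ⟨hd, hx⟩ := h.1 p.2
    exact ⟨⟨Q p.2, hd⟩, hp.symm, hx⟩

theorem IsBddInverse.injective {A : H →ₗ.[ℂ] H} {Q : H →L[ℂ] H} (h : IsBddInverse A Q) :
    Function.Injective Q := by
  intro x y hxy
  obtain ⟨hx, ex⟩ := h.1 x
  obtain ⟨hy, ey⟩ := h.1 y
  rw [← ex, ← ey]
  congr 1
  exact Subtype.ext hxy

theorem mem_graph_opMul {A B : H →ₗ.[ℂ] H} {p : H × H} :
    p ∈ (opMul A B).graph ↔ ∃ y, (p.1, y) ∈ B.graph ∧ (y, p.2) ∈ A.graph := by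
  simp only [mem_graph_iff_opApply]
  constructor
  · rintro ⟨h, h'⟩
    refine ⟨opApply B p.1, ⟨h.1, rfl⟩, h.2, ?_⟩
    rw [opApply_of_mem _ h] at h'
    exact h'
  · rintro ⟨y, ⟨h1, rfl⟩, h2, h3⟩
    exact ⟨⟨h1, h2⟩, (opApply_of_mem (opMul A B) (show p.1 ∈ (opMul A B).domain from ⟨h1, h2⟩)).trans h3⟩

variable [CompleteSpace H]

theorem mem_graph_adjoint {A : H →ₗ.[ℂ] H} (hA : Dense (A.domain : Set H)) {p : H × H} :
    p ∈ A.adjoint.graph ↔ ∀ q ∈ A.graph, ⟪p.2, q.1⟫_ℂ = ⟪p.1, q.2⟫_ℂ := by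
  rw [LinearPMap.mem_graph_iff]
  constructor
  · rintro ⟨y, hy, hp⟩ q hq
    obtain ⟨x, hx, hq⟩ := (LinearPMap.mem_graph_iff _).1 hq
    rw [← hy, ← hp, ← hx, ← hq]
    exact LinearPMap.adjoint_isFormalAdjoint hA y x
  · intro h
    have h' : ∀ x : A.domain, ⟪p.2, (x : H)⟫_ℂ = ⟪p.1, A x⟫_ℂ := fun x => h _ (A.mem_graph x)
    have hd := LinearPMap.mem_adjoint_domain_of_exists (T := A) p.1 ⟨p.2, h'⟩
    exact ⟨⟨p.1, hd⟩, rfl, LinearPMap.adjoint_apply_eq hA ⟨p.1, hd⟩ h'⟩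

/-- If `A` has the bounded inverse `Q` then `A†` has the inverse `Q†`. -/
theorem IsBddInverse.mem_graph_adjoint_iff {A : H →ₗ.[ℂ] H} {Q : H →L[ℂ] H} (h : IsBddInverse A Q)
    (hA : Dense (A.domain : Set H)) {p : H × H} :
    p ∈ A.adjoint.graph ↔ p.1 = ContinuousLinearMap.adjoint Q p.2 := by
  rw [mem_graph_adjoint hA]
  constructor
  · refine fun h1 => ext_inner_right ℂ fun x => ?_
    rw [ContinuousLinearMap.adjoint_inner_left]
    exact (h1 (Q x, x) (h.mem_graph_iff.2 rfl)).symm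
  · intro h1 q hq
    rw [h1, ContinuousLinearMap.adjoint_inner_left, ← h.mem_graph_iff.1 hq]

/-- If `R` has the bounded inverse `Q` then `R†R` is the inverse of `Q Q†`. -/
theorem IsBddInverse.opMul_adjoint_self {R : H →ₗ.[ℂ] H} {Q T : H →L[ℂ] H} (h : IsBddInverse R Q)
    (hR : Dense (R.domain : Set H)) (hT : ∀ x, T x = 0 → x = 0)
    (hQ : ∀ x, Q (ContinuousLinearMap.adjoint Q x) = T x) :
    opMul R.adjoint R = (opBdd T).inverse := by
  refine LinearPMap.eq_of_eq_graph (Submodule.ext fun p => ?_)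
  rw [mem_graph_opMul, mem_graph_opBdd_inverse hT, ← hQ]
  simp only [h.mem_graph_iff, h.mem_graph_adjoint_iff hR]
  constructor
  · rintro ⟨y, h1, h2⟩
    rw [h1, h2]
  · exact fun h1 => ⟨_, h1, rfl⟩

theorem denseRange_of_inner {A : H →L[ℂ] H} (h : ∀ y, (∀ x, ⟪A x, y⟫_ℂ = 0) → y = 0) :
    DenseRange A := by
  have h1 : Dense ((A.range : Submodule ℂ H) : Set H) := by
    rw [Submodule.dense_iff_topologicalClosure_eq_top, Submodule.topologicalClosure_eq_top_iff,
      Submodule.eq_bot_iff]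
    exact fun y hy => h y fun x => hy (A x) ⟨x, rfl⟩
  exact h1

/-- Operators with the same inner products and dense ranges differ by a unitary factor. -/
theorem exists_unitary_of_inner_eq {S T : H →L[ℂ] H} (h : ∀ x y, ⟪S x, S y⟫_ℂ = ⟪T x, T y⟫_ℂ)
    (hS : DenseRange S) (hT : DenseRange T) : ∃ U ∈ unitary (H →L[ℂ] H), ∀ x, U (T x) = S x := by
  have hn : ∀ x, ‖S x‖ = ‖T x‖ := fun x => by
    rw [← sq_eq_sq₀ (norm_nonneg _) (norm_nonneg _)]
    have := h x x
    rw [inner_self_eq_norm_sq_to_K, inner_self_eq_norm_sq_to_K] at this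
    exact_mod_cast this
  set U : H →L[ℂ] H := S.toLinearMap.extendOfNorm T.toLinearMap
  have hU : ∀ x, U (T x) = S x := LinearMap.extendOfNorm_eq hT ⟨1, fun x => by
    simpa using (hn x).le⟩
  have h1 : ContinuousLinearMap.adjoint U * U = 1 := by
    refine ContinuousLinearMap.ext_on (s := Set.range T) (hT.mono Submodule.subset_span) ?_
    rintro _ ⟨x, rfl⟩
    refine hT.eq_of_inner_right (𝕜 := ℂ) fun y => ?_
    change ⟪T y, ContinuousLinearMap.adjoint U (U (T x))⟫_ℂ = ⟪T y, T x⟫_ℂ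
    rw [ContinuousLinearMap.adjoint_inner_right, hU, hU, h]
  have h2 : U * ContinuousLinearMap.adjoint U = 1 := by
    refine ContinuousLinearMap.ext_on (s := Set.range S) (hS.mono Submodule.subset_span) ?_
    rintro _ ⟨x, rfl⟩
    have h3 : ContinuousLinearMap.adjoint U (U (T x)) = T x := congrArg (fun A => A (T x)) h1
    change U (ContinuousLinearMap.adjoint U (S x)) = S x
    rw [← hU, h3]
  exact ⟨U, Unitary.mem_iff.2 ⟨h1, h2⟩, hU⟩

/-- A polar decomposition: if `R` has the bounded inverse `Q` with `Q Q† = T²` then `R T` is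
unitary. -/
theorem IsBddInverse.isUnitaryOp {R : H →ₗ.[ℂ] H} {Q T : H →L[ℂ] H} (h : IsBddInverse R Q)
    (hT : ∀ x, T x = 0 → x = 0) (hTs : ∀ x y, ⟪T x, y⟫_ℂ = ⟪x, T y⟫_ℂ)
    (hQ : ∀ x, Q (ContinuousLinearMap.adjoint Q x) = T (T x)) :
    IsUnitaryOp (opMul R (opBdd T)) := by
  have hS : DenseRange (ContinuousLinearMap.adjoint Q) := denseRange_of_inner fun y hy => by
    refine h.injective ?_
    rw [map_zero]
    refine ext_inner_left ℂ fun x => ?_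
    rw [inner_zero_right, ← ContinuousLinearMap.adjoint_inner_left, hy]
  have hTd : DenseRange T := denseRange_of_inner fun y hy => by
    refine hT y (ext_inner_left ℂ fun x => ?_)
    rw [inner_zero_right, ← hTs, hy]
  obtain ⟨U, hU, hUT⟩ := exists_unitary_of_inner_eq (fun x y => by
    rw [ContinuousLinearMap.adjoint_inner_left, hQ, hTs]) hS hTd
  -- `U T = Q†` gives `Q U = T`, so that `U = R T`
  have h1 : ∀ v, Q (U v) = T v := fun v => by
    refine ext_inner_left ℂ fun x => ?_
    rw [← ContinuousLinearMap.adjoint_inner_left, ← hUT, ← hTs]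
    exact ContinuousLinearMap.inner_map_map_of_mem_unitary hU _ _
  refine ⟨U, hU, LinearPMap.eq_of_eq_graph (Submodule.ext fun p => ?_)⟩
  rw [mem_graph_opMul, mem_graph_opBdd]
  simp only [h.mem_graph_iff, mem_graph_opBdd]
  constructor
  · rintro ⟨y, h2, h3⟩
    refine h.injective ?_
    rw [← h3, h1, h2]
  · exact fun h2 => ⟨_, rfl, by rw [h2, h1]⟩

end BoundedInverse

/-! ### The exponentials `e^{-cφ}` as functions of time -/

section Initial

variable {n : ℕ} {H 𝒦 : Type*} [NormedAddCommGroup H] [InnerProductSpace ℂ H] [CompleteSpace H]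
  [NormedAddCommGroup 𝒦] [NormedSpace ℂ 𝒦] (S : FieldSystem H 𝒦)

/-- The operator `φ` vanishes on an interval of zero length. -/
theorem FieldSystem.semigroup_time_zero (ζ : Fin n → C(ℝ, 𝒦)) (c : ℝ) :
    S.semigroup ζ 0 c = 1 := by
  have hz : volume.restrict (Set.Icc (0 : ℝ) 0) = 0 := by simp
  have h0 : ∀ q : CurveL2 n H 0, q = 0 := fun q => Lp.ext <| by
    rw [EventuallyEq, ae_eq_bot.2 hz]
    exact eventually_bot
  have hmem : ∀ u : H, (WithLp.toLp 2 (u, 0) : WithLp 2 (H × CurveL2 n H 0)) ∈ S.graph ζ 0 := by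
    intro u
    have hc : Continuous fun u : H => (WithLp.toLp 2 (u, 0) : WithLp 2 (H × CurveL2 n H 0)) :=
      (WithLp.prod_continuous_toLp 2 _ _).comp (by fun_prop)
    have h := map_mem_closure (t := (S.preGraph ζ 0 : Set (WithLp 2 (H × CurveL2 n H 0)))) hc
      (S.core_dense u) fun w hw => ?_
    · exact h
    · obtain ⟨L, hL⟩ := S.core_reg hw
      exact Submodule.subset_span ⟨hw, L, hL, (h0 _).symm⟩
  have h1 : graphResolvent (S.graph ζ 0) = 1 := by
    ext u
    exact (graphResolvent_unique (S.graph ζ 0) (hmem u) fun p _ => by simp).1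
  rw [semigroup, h1, contractionSemigroup, expNegOfResolvent, cfc_apply_one]
  have h2 : (if max c 0 = 0 then 1 else if (1 : ℝ) ≤ 0 then 0
      else Real.exp (-max c 0 * (1 / 1 - 1))) = 1 := by
    split_ifs <;> norm_num at *
  rw [h2, map_one]

end Initial

namespace OQHO

variable {n d : ℕ} {ι : Type*} {H₀ : Type*} [NormedAddCommGroup H₀] [InnerProductSpace ℂ H₀]
  [CompleteSpace H₀] (O : OQHO n d ι H₀) {P : Matrix (Fin n) (Fin n) ℝ}

theorem expNegPhi_injective {c : ℝ} (hc : 0 ≤ c) (t : ℝ) {x : SystemField d ι H₀}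
    (hx : O.expNegPhi P c t x = 0) : x = 0 := by
  rw [expNegPhi_eq O P hc] at hx
  exact contractionSemigroup_injective (graphResolvent_isPositive _) (graphResolvent_norm_le _)
    (O.fieldSystem.denseRange_resolvent _ _) hx

theorem inner_expNegPhi (P : Matrix (Fin n) (Fin n) ℝ) {c : ℝ} (hc : 0 ≤ c) (t : ℝ)
    (x y : SystemField d ι H₀) :
    ⟪O.expNegPhi P c t x, y⟫_ℂ = ⟪x, O.expNegPhi P c t y⟫_ℂ := by
  rw [expNegPhi_eq O P hc]
  exact O.fieldSystem.inner_semigroup _ _ _ _ _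

theorem expNegPhi_half (P : Matrix (Fin n) (Fin n) ℝ) {θ : ℝ} (hθ : 0 ≤ θ) (t : ℝ)
    (x : SystemField d ι H₀) :
    O.expNegPhi P (θ / 2) t (O.expNegPhi P (θ / 2) t x) = O.expNegPhi P θ t x := by
  have h : 0 ≤ θ / 2 := by positivity
  rw [expNegPhi_eq O P hθ, expNegPhi_eq O P h, O.fieldSystem.semigroup_add _ _ h h, add_halves]

theorem expNegPhi_zero (P : Matrix (Fin n) (Fin n) ℝ) {c : ℝ} (hc : 0 ≤ c) :
    O.expNegPhi P c 0 (ι := ι) = 1 := by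
  rw [expNegPhi_eq O P hc, FieldSystem.semigroup_time_zero]

theorem continuousOn_inner_expNegPhi (P : Matrix (Fin n) (Fin n) ℝ) {c : ℝ} (hc : 0 ≤ c)
    (x y : SystemField d ι H₀) :
    ContinuousOn (fun t => ⟪x, O.expNegPhi P c t y⟫_ℂ) (Set.Ici 0) := by
  simp only [expNegPhi_eq O P hc]
  exact O.fieldSystem.continuousOn_inner_semigroup
    (O.fieldSystem.conj_sqrtCurve O.conj_sysCurve P) hc x y

/-- The derivative of `⟪x, e^{-θφ(t)} y⟫` in `t`, by the commutation of `Ψ` through the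
exponentials. -/
theorem hasDerivWithinAt_inner_expNegPhi (hP : P.PosSemidef) {θ : ℝ} (hθ : 0 ≤ θ) {t : ℝ}
    (ht : 0 ≤ t) {x y : SystemField d ι H₀} (hx : x ∈ O.core) (hy : y ∈ O.core) :
    HasDerivWithinAt (fun s => ⟪x, O.expNegPhi P θ s y⟫_ℂ)
      (-(θ * ⟪O.expNegPhi P (θ / 2) t x,
        opApply (O.Psi P θ t) (O.expNegPhi P (θ / 2) t y)⟫_ℂ)) (Set.Ici t) t := by
  have hx' : x ∈ O.fieldSystem.nice := O.core_le_nice hx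
  have hy' : y ∈ O.fieldSystem.nice := O.core_le_nice hy
  have hθ2 : 0 ≤ θ / 2 := by positivity
  have hζ := O.fieldSystem.conj_sqrtCurve (O.conj_sysCurve (ι := ι)) P
  obtain ⟨L, M, hL, hM⟩ := O.fieldSystem.nice_reg y hy'
  have h := O.hasDerivWithinAt_inner_semigroup_psi O.fieldSystem hP O.hasLamComm_sysCurve
    (fun j s => O.conj_sysCurve j s) ht hθ hx' hy' hL (fun g => (hM g).1) fun g => (hM g).2
  have h1 := O.fieldSystem.reg_semigroup hζ ht hθ2 hy' hL
  have h2 : ∀ g, O.FieldReg _ (semigroupBilin O.fieldSystem (sqrtCurve P O.sysCurve) t (θ / 2) M g) :=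
    fun g => O.fieldSystem.reg_semigroup hζ ht hθ2 (hM _).1 (hM _).2
  have h3 := (FieldReg.Psi h1 h2 P θ ht).2
  rw [← h3] at h
  simp only [expNegPhi_eq O P hθ, expNegPhi_eq O P hθ2]
  exact h

/-- The symmetry of `e^{-θφ/2} Ψ e^{-θφ/2}` on the core. -/
theorem inner_expNegPhi_Psi_symm (hP : P.PosSemidef) {θ : ℝ} (hθ : 0 ≤ θ) {t : ℝ}
    (ht : 0 ≤ t) {x y : SystemField d ι H₀} (hx : x ∈ O.core) (hy : y ∈ O.core) :
    (θ : ℂ) * ⟪opApply (O.Psi P θ t) (O.expNegPhi P (θ / 2) t x), O.expNegPhi P (θ / 2) t y⟫_ℂ =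
      θ * ⟪O.expNegPhi P (θ / 2) t x, opApply (O.Psi P θ t) (O.expNegPhi P (θ / 2) t y)⟫_ℂ := by
  -- both sides are the derivative of the same function; the factor `θ`, which may vanish, stays
  have h1 := (O.hasDerivWithinAt_inner_expNegPhi hP hθ ht hy hx).star
  have h2 := O.hasDerivWithinAt_inner_expNegPhi hP hθ ht hx hy
  have e : ∀ s, star ⟪y, O.expNegPhi P θ s x⟫_ℂ = ⟪x, O.expNegPhi P θ s y⟫_ℂ := fun s => by
    rw [← inner_expNegPhi O P hθ]
    exact inner_conj_symm _ _
  simp only [e] at h1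
  have h3 := (uniqueDiffWithinAt_Ici t).eq_deriv _ h1 h2
  rw [RCLike.star_def, map_neg, map_mul, inner_conj_symm, Complex.conj_ofReal] at h3
  exact neg_injective h3

end OQHO

/-! ### The equation for the inverse of the time-ordered exponential -/

namespace OQHO

variable {n d : ℕ} {ι : Type*} {H₀ : Type*} [NormedAddCommGroup H₀] [InnerProductSpace ℂ H₀]
  [CompleteSpace H₀] (O : OQHO n d ι H₀) {P : Matrix (Fin n) (Fin n) ℝ}

/-- By definition `V = R S⁻¹`, where `S = e^{θφ/2}` is itself the inverse of the bounded operator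
`e^{-θφ/2}`. -/
theorem V_eq (P : Matrix (Fin n) (Fin n) ℝ) {θ : ℝ} (hθ : 0 ≤ θ)
    (R : ℝ → (SystemField d ι H₀ →ₗ.[ℂ] SystemField d ι H₀)) (t : ℝ) :
    O.V P θ R t = opMul (R t) (opBdd (O.expNegPhi P (θ / 2) t)) := by
  have h : 0 ≤ θ / 2 := by positivity
  rw [V, S, expPhi, inverse_inverse_opBdd fun x => O.expNegPhi_injective h t]

/-- The operator `V†` is given by `V† Q† = e^{-θφ/2}`, where `Q = R⁻¹`. -/
theorem mem_graph_adjoint_V {θ : ℝ} (hθ : 0 ≤ θ)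
    {R : ℝ → (SystemField d ι H₀ →ₗ.[ℂ] SystemField d ι H₀)} {t : ℝ}
    {Q : SystemField d ι H₀ →L[ℂ] SystemField d ι H₀} (hQ : IsBddInverse (R t) Q)
    (hV : Dense ((O.V P θ R t).domain : Set (SystemField d ι H₀))) (x : SystemField d ι H₀) :
    (ContinuousLinearMap.adjoint Q x, O.expNegPhi P (θ / 2) t x) ∈ (O.V P θ R t).adjoint.graph := by
  have h : 0 ≤ θ / 2 := by positivity
  rw [mem_graph_adjoint hV]
  intro q hq
  rw [V_eq O P hθ, mem_graph_opMul] at hq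
  obtain ⟨y, h1, h2⟩ := hq
  rw [mem_graph_opBdd] at h1
  rw [hQ.mem_graph_iff] at h2
  simp only at h1 h2
  rw [ContinuousLinearMap.adjoint_inner_left, ← h2, h1, inner_expNegPhi O P h]

/-- The equation `C Q† = R e^{-θφ/2} Ψ e^{-θφ/2}`, multiplied by `Q = R⁻¹`. -/
theorem map_time_ordered_generator {θ : ℝ} (hθ : 0 ≤ θ)
    {C R : ℝ → (SystemField d ι H₀ →ₗ.[ℂ] SystemField d ι H₀)} {t : ℝ}
    {Q : SystemField d ι H₀ →L[ℂ] SystemField d ι H₀} (hQ : IsBddInverse (R t) Q)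
    (hV : Dense ((O.V P θ R t).domain : Set (SystemField d ι H₀)))
    (hC : C t = opMul (O.V P θ R t) (opMul (O.Psi P θ t) (O.V P θ R t).adjoint))
    {x : SystemField d ι H₀} (hx : ContinuousLinearMap.adjoint Q x ∈ (C t).domain) :
    Q (C t ⟨ContinuousLinearMap.adjoint Q x, hx⟩) = O.expNegPhi P (θ / 2) t
      (opApply (O.Psi P θ t) (O.expNegPhi P (θ / 2) t x)) := by
  have h : (ContinuousLinearMap.adjoint Q x, C t ⟨ContinuousLinearMap.adjoint Q x, hx⟩) ∈
      (C t).graph := (C t).mem_graph ⟨ContinuousLinearMap.adjoint Q x, hx⟩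
  generalize C t ⟨ContinuousLinearMap.adjoint Q x, hx⟩ = w at h
  rw [hC, mem_graph_opMul] at h
  obtain ⟨y, h1, h2⟩ := h
  obtain ⟨z, h3, h4⟩ := mem_graph_opMul.1 h1
  have hz : z = O.expNegPhi P (θ / 2) t x :=
    LinearPMap.mem_graph_snd_inj _ h3 (O.mem_graph_adjoint_V hθ hQ hV x) rfl
  rw [V_eq O P hθ, mem_graph_opMul] at h2
  obtain ⟨u, h5, h6⟩ := h2
  rw [mem_graph_opBdd] at h5
  rw [hQ.mem_graph_iff] at h6
  simp only at h5 h6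
  rw [← h6, h5, ← hz, ((mem_graph_iff_opApply _).1 h4).2]

/-- The inverse `Q` of the time-ordered exponential satisfies `Q Q† = e^{-θφ}`: the derivatives of
the matrix elements of both sides between vectors of the core coincide. -/
theorem inverse_mul_adjoint (hP : P.PosSemidef) {θ : ℝ} (hθ : 0 ≤ θ)
    {C R : ℝ → (SystemField d ι H₀ →ₗ.[ℂ] SystemField d ι H₀)}
    (hR₀ : R 0 = opBdd (ContinuousLinearMap.id ℂ _))
    (hV : ∀ t : ℝ, 0 ≤ t → Dense ((O.V P θ R t).domain : Set (SystemField d ι H₀)))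
    (hC : ∀ t : ℝ, 0 ≤ t →
      C t = opMul (O.V P θ R t) (opMul (O.Psi P θ t) (O.V P θ R t).adjoint))
    {Q : ℝ → (SystemField d ι H₀ →L[ℂ] SystemField d ι H₀)}
    (hQ : ∀ t : ℝ, 0 ≤ t → IsBddInverse (R t) (Q t))
    (hQd : ∀ x ∈ O.core, ∀ t : ℝ, 0 ≤ t →
      ∃ h : ContinuousLinearMap.adjoint (Q t) x ∈ (C t).domain,
      HasDerivWithinAt (fun s : ℝ => ContinuousLinearMap.adjoint (Q s) x)
        (-((θ / 2 : ℝ) : ℂ) • (C t) ⟨ContinuousLinearMap.adjoint (Q t) x, h⟩) (Set.Ici 0) t)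
    {t : ℝ} (ht : 0 ≤ t) (x : SystemField d ι H₀) :
    Q t (ContinuousLinearMap.adjoint (Q t) x) = O.expNegPhi P θ t x := by
  have hderiv : ∀ x ∈ O.core, ∀ y ∈ O.core, ∀ s : ℝ, 0 ≤ s → HasDerivWithinAt (fun s : ℝ =>
      ⟪ContinuousLinearMap.adjoint (Q s) x, ContinuousLinearMap.adjoint (Q s) y⟫_ℂ)
      (-(θ * ⟪O.expNegPhi P (θ / 2) s x,
        opApply (O.Psi P θ s) (O.expNegPhi P (θ / 2) s y)⟫_ℂ)) (Set.Ici 0) s := by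
    intro x hx y hy s hs
    have h2 : 0 ≤ θ / 2 := by positivity
    obtain ⟨ex, dx⟩ := hQd x hx s hs
    obtain ⟨ey, dy⟩ := hQd y hy s hs
    refine (dx.inner ℂ dy).congr_deriv ?_
    have hsymm := O.inner_expNegPhi_Psi_symm hP hθ hs hx hy
    rw [inner_smul_right, inner_smul_left, ContinuousLinearMap.adjoint_inner_left,
      ContinuousLinearMap.adjoint_inner_right,
      O.map_time_ordered_generator hθ (hQ s hs) (hV s hs) (hC s hs),
      O.map_time_ordered_generator hθ (hQ s hs) (hV s hs) (hC s hs),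
      inner_expNegPhi O P h2, ← inner_expNegPhi O P h2 s x, map_neg, Complex.conj_ofReal]
    push_cast
    linear_combination (-1 / 2 : ℂ) * hsymm
  have hcore : ∀ x ∈ O.core, ∀ y ∈ O.core,
      ⟪x, Q t (ContinuousLinearMap.adjoint (Q t) y)⟫_ℂ = ⟪x, O.expNegPhi P θ t y⟫_ℂ := by
    intro x hx y hy
    have h0 : ∀ x, ContinuousLinearMap.adjoint (Q 0) x = x := fun x => by
      have : Q 0 = 1 := by
        refine ContinuousLinearMap.ext fun v => ?_
        refine ((hQ 0 le_rfl).mem_graph_iff (p := (v, v))).1 ?_ |>.symm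
        rw [hR₀, mem_graph_opBdd]
        rfl
      rw [this]
      exact ext_inner_right ℂ fun w => ContinuousLinearMap.adjoint_inner_left _ _ _
    -- the two matrix elements differ by a constant, which is zero at the time `0`
    have h := constant_of_has_deriv_right_zero (a := 0) (b := t) (f := fun s =>
      ⟪ContinuousLinearMap.adjoint (Q s) x, ContinuousLinearMap.adjoint (Q s) y⟫_ℂ -
        ⟪x, O.expNegPhi P θ s y⟫_ℂ) (fun s hs => ?_) (fun s hs => ?_) t ⟨ht, le_rfl⟩
    · simp only [h0, expNegPhi_zero O P hθ] at h
      rw [← ContinuousLinearMap.adjoint_inner_left]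
      exact sub_eq_zero.1 (h.trans (sub_self _))
    · exact ((hderiv x hx y hy s hs.1).continuousWithinAt.sub
        (O.continuousOn_inner_expNegPhi P hθ x y s hs.1)).mono Set.Icc_subset_Ici_self
    · have h1 := (hderiv x hx y hy s hs.1).mono (Set.Ici_subset_Ici.2 hs.1)
      exact (h1.sub (O.hasDerivWithinAt_inner_expNegPhi hP hθ hs.1 hx hy)).congr_deriv (sub_self _)
  have h : Q t ∘L ContinuousLinearMap.adjoint (Q t) = O.expNegPhi P θ t := by
    refine ContinuousLinearMap.ext_on (s := O.core) (O.core_dense.mono Submodule.subset_span)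
      fun y hy => ?_
    exact O.core_dense.eq_of_inner_right ℂ fun x hx => hcore x hx y hy
  exact congrArg (fun A => A x) h

end OQHO

end

theorem theorem3 {n d : ℕ} {ι H₀ : Type*} [NormedAddCommGroup H₀] [InnerProductSpace ℂ H₀]
    [CompleteSpace H₀] (O : OQHO n d ι H₀)
    (P : Matrix (Fin n) (Fin n) ℝ) (hP : P.PosSemidef)
    (ρ : SystemField d ι H₀ →L[ℂ] SystemField d ι H₀) (hρ : IsDensityOp ρ)
    (θ : ℝ) (hθ : 0 ≤ θ)
    (C R : ℝ → (SystemField d ι H₀ →ₗ.[ℂ] SystemField d ι H₀))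
    (hR : IsTimeOrderedExp O.core θ C R)
    (hV : ∀ t : ℝ, 0 ≤ t → Dense ((O.V P θ R t).domain : Set (SystemField d ι H₀)))
    (hC : ∀ t : ℝ, 0 ≤ t →
      C t = opMul (O.V P θ R t) (opMul (O.Psi P θ t) (O.V P θ R t).adjoint)) :
    (∀ t : ℝ, 0 ≤ t → expectation ρ (opMul (R t).adjoint (R t)) = O.QEF ρ P θ t) ∧
      ∀ t : ℝ, 0 ≤ t → IsUnitaryOp (O.V P θ R t) := by
  obtain ⟨Q, hQ, hQd⟩ := hR.evolution
  have key := fun t (ht : 0 ≤ t) => O.inverse_mul_adjoint hP hθ hR.initial hV hC hQ hQd ht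
  have hθ2 : 0 ≤ θ / 2 := by positivity
  refine ⟨fun t ht => ?_, fun t ht => ?_⟩
  · rw [(hQ t ht).opMul_adjoint_self (hR.dense_domain t ht)
      (fun x => O.expNegPhi_injective hθ t) (key t ht)]
    rfl
  · rw [O.V_eq P hθ]
    refine (hQ t ht).isUnitaryOp (fun x => O.expNegPhi_injective hθ2 t)
      (O.inner_expNegPhi P hθ2 t) fun x => ?_
    rw [key t ht, O.expNegPhi_half P hθ]
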